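/- Let $M\subset\mathbf{R}^n$ be a compact connected embedded isoparametric submanifold, i.e. a smooth submanifold whose normal bundle $\nu M$ is flat and whose principal curvatures (with multiplicities) in the direction of any parallel normal field on a connected open piece of $M$ are constant. Let $\mathcal F$ be its isoparametric foliation, that is, the partition of $\mathbf{R}^n$ into the parallel and focal submanifolds of $M$: the leaf through $x+\xi$ ($x\in M$, $\xi\in\nu_xM$) consists of all $y+\eta$, where $\eta\in\nu_yM$ is obtained from $\xi$ by normal parallel transport along a curve in $M$ from $x$ to $y$. Points on leaves of maximal dimension are called regular, all others singular. A section of $\mathcal F$ is a complete totally geodesic submanifold of $\mathbf{R}^n$ (an affine subspace) $\Sigma$ that passes through some regular point $p$ with $T_p\Sigma=\nu_pL_p$ ($L_p$ being the leaf through $p$), meets every leaf, and is orthogonal to the leaves at all points of intersection. The generalized Weyl group $W=W(\Sigma)$ is the group of isometries of $\Sigma$ generated by the reflections of $\Sigma$ across those hyperplanes of $\Sigma$ that consist of singular points. Then there is a point $c\in\mathbf{R}^n$ such that every leaf of $\mathcal F$ is contained in a sphere (possibly of radius $0$) around $c$. Moreover, for every such $c$ (for instance for $c=0$, if the origin is chosen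 so that the leaves lie in spheres around it) and for every section $\Sigma$ of $\mathcal F$, the fixed point set $\mathrm{Fix}(W)\subset\Sigma$ of $W=W(\Sigma)$ satisfies $$\mathrm{Fix}(W)=I\qquad\text{and}\qquad \mathrm{Fix}(W)=S,$$ where $I$ is the intersection of all sections of $\mathcal F$ through $c$, and $S=\{p\in\mathbf{R}^n:\dim L_p=0\}$ is the stratum of zero-dimensional leaves. -/

import Mathlib

open scoped ContDiff

/-- The Euclidean space `ℝⁿ`. -/
abbrev Euc (n : ℕ) : Type := EuclideanSpace ℝ (Fin n)

/-- `A` is a smooth embedded `d`-dimensional submanifold of `ℝⁿ`: near each of its points a smooth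
diffeomorphism between open subsets of `ℝⁿ` straightens `A` to a `d`-dimensional subspace. -/
def IsSmoothSubmanifold {n : ℕ} (A : Set (Euc n)) (d : ℕ) : Prop :=
  ∀ x ∈ A, ∃ (φ : OpenPartialHomeomorph (Euc n) (Euc n)) (V : Submodule ℝ (Euc n)),
    x ∈ φ.source ∧ ContDiffOn ℝ ∞ φ φ.source ∧ ContDiffOn ℝ ∞ φ.symm φ.target ∧
      Module.finrank ℝ V = d ∧ φ '' (A ∩ φ.source) = φ.target ∩ (V : Set (Euc n))

/-- The tangent space `T_p A`, spanned by the velocities at `p` of the smooth curves in `A`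
through `p`. -/
def tangentSpaceAt {n : ℕ} (A : Set (Euc n)) (p : Euc n) : Submodule ℝ (Euc n) :=
  Submodule.span ℝ
    {X | ∃ c : ℝ → Euc n, ContDiff ℝ ∞ c ∧ (∀ t, c t ∈ A) ∧ c 0 = p ∧ deriv c 0 = X}

/-- The normal space `ν_p A = (T_p A)ᗮ`. -/
noncomputable def normalSpaceAt {n : ℕ} (A : Set (Euc n)) (p : Euc n) : Submodule ℝ (Euc n) :=
  (tangentSpaceAt A p)ᗮ

/-- `v` is a parallel normal field on the open piece `M ∩ U` of `M` (given by a smooth map on the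
open set `U` of `ℝⁿ`): it is normal to `M`, and its derivatives in directions tangent to `M` have
no normal component. -/
def IsParallelNormalField {n : ℕ} (M U : Set (Euc n)) (v : Euc n → Euc n) : Prop :=
  IsOpen U ∧ ContDiffOn ℝ ∞ v U ∧
    ∀ x ∈ M ∩ U, v x ∈ normalSpaceAt M x ∧
      ∀ X ∈ tangentSpaceAt M x, fderiv ℝ v x X ∈ tangentSpaceAt M x

/-- The normal bundle of `M` is flat: every normal vector extends to a parallel normal field on a
neighbourhood of its foot point in `M`. -/
def HasFlatNormalBundle {n : ℕ} (M : Set (Euc n)) : Prop :=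
  ∀ x ∈ M, ∀ ξ ∈ normalSpaceAt M x,
    ∃ (U : Set (Euc n)) (v : Euc n → Euc n), x ∈ U ∧ IsParallelNormalField M U v ∧ v x = ξ

/-- The shape operator `X ↦ -(D_X v)ᵀ` of `M` at `x` in the direction of the normal field `v`. -/
noncomputable def shapeOperator {n : ℕ} (M : Set (Euc n)) (v : Euc n → Euc n) (x : Euc n) :
    tangentSpaceAt M x →ₗ[ℝ] tangentSpaceAt M x :=
  -(((tangentSpaceAt M x).orthogonalProjectionOnto : Euc n →ₗ[ℝ] tangentSpaceAt M x) ∘ₗ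
    (fderiv ℝ v x : Euc n →ₗ[ℝ] Euc n) ∘ₗ (tangentSpaceAt M x).subtype)

/-- `M` is a (connected, embedded) isoparametric submanifold of `ℝⁿ`: its normal bundle is flat,
and the principal curvatures (the eigenvalues of the shape operator, with multiplicities) in the
direction of any parallel normal field on a connected open piece of `M` are constant. -/
structure IsIsoparametricSubmanifold {n : ℕ} (M : Set (Euc n)) : Prop where
  connected : IsConnected M
  submanifold : ∃ d : ℕ, IsSmoothSubmanifold M d
  flat : HasFlatNormalBundle M
  const_principal_curvatures : ∀ (U : Set (Euc n)) (v : Euc n → Euc n),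
    IsParallelNormalField M U v → IsPreconnected (M ∩ U) →
      ∀ x ∈ M ∩ U, ∀ y ∈ M ∩ U, (shapeOperator M v x).charpoly = (shapeOperator M v y).charpoly

/-- `w` is a parallel normal field of `M` along the smooth curve `γ` in `M`. -/
structure IsParallelAlong {n : ℕ} (M : Set (Euc n)) (γ w : ℝ → Euc n) : Prop where
  contDiff_curve : ContDiff ℝ ∞ γ
  contDiff_field : ContDiff ℝ ∞ w
  mem : ∀ t, γ t ∈ M
  normal : ∀ t, w t ∈ normalSpaceAt M (γ t)
  parallel : ∀ t, deriv w t ∈ tangentSpaceAt M (γ t)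

/-- The parallel (or focal) submanifold of `M` through `x + ξ`, where `ξ` is a normal vector of `M`
at `x`: the set of all `y + η`, where `η` is a parallel translate of `ξ` along a curve in `M` from
`x` to `y`. -/
def parallelLeaf {n : ℕ} (M : Set (Euc n)) (x ξ : Euc n) : Set (Euc n) :=
  {q | ∃ γ w : ℝ → Euc n, IsParallelAlong M γ w ∧ γ 0 = x ∧ w 0 = ξ ∧ q = γ 1 + w 1}

/-- The isoparametric foliation of `M`: the set of all parallel and focal submanifolds of `M`. -/
def isoparametricFoliation {n : ℕ} (M : Set (Euc n)) : Set (Set (Euc n)) :=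
  {L | ∃ x ∈ M, ∃ ξ ∈ normalSpaceAt M x, L = parallelLeaf M x ξ}

/-- The leaf `L_p` of the foliation `F` through `p`. (If `F` is a partition then exactly one member
of `F` contains `p`.) -/
def leafAt {n : ℕ} (F : Set (Set (Euc n))) (p : Euc n) : Set (Euc n) :=
  ⋃₀ {L | L ∈ F ∧ p ∈ L}

/-- The dimension of the leaf through `p`. -/
noncomputable def leafDim {n : ℕ} (F : Set (Set (Euc n))) (p : Euc n) : ℕ :=
  Module.finrank ℝ (tangentSpaceAt (leafAt F p) p)

/-- A point is regular if its leaf has maximal dimension. -/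
def IsRegularPoint {n : ℕ} (F : Set (Set (Euc n))) (p : Euc n) : Prop :=
  ∀ q, leafDim F q ≤ leafDim F p

/-- The stratum of zero-dimensional leaves. -/
def zeroStratum {n : ℕ} (F : Set (Set (Euc n))) : Set (Euc n) :=
  {p | leafDim F p = 0}

/-- `P` is a section of `F`: a complete totally geodesic submanifold (in `ℝⁿ`: an affine subspace)
that is the normal space of the leaf at one of its regular points, meets every leaf, and is
orthogonal to the leaves at all points of intersection. -/
structure IsSection {n : ℕ} (F : Set (Set (Euc n))) (P : AffineSubspace ℝ (Euc n)) : Prop where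
  normal : ∃ p ∈ P, IsRegularPoint F p ∧ P.direction = normalSpaceAt (leafAt F p) p
  meets : ∀ L ∈ F, ∃ q ∈ L, q ∈ P
  ortho : ∀ L ∈ F, ∀ q ∈ L, q ∈ P → P.direction ⟂ tangentSpaceAt L q

/-- `H` is a singular hyperplane of the section `P`: a hyperplane of `P` all of whose points are
singular. -/
def IsSingularHyperplane {n : ℕ} (F : Set (Set (Euc n))) (P : AffineSubspace ℝ (Euc n))
    [Nonempty P] (H : AffineSubspace ℝ P) : Prop :=
  Module.finrank ℝ H.direction + 1 = Module.finrank ℝ P.direction ∧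
    ∀ q ∈ H, ¬ IsRegularPoint F (q : Euc n)

/-- The generalized Weyl group acting on the section `P`: the group of isometries of `P` generated
by the reflections across the singular hyperplanes of `P`. -/
noncomputable def generalizedWeylGroup {n : ℕ} (F : Set (Set (Euc n)))
    (P : AffineSubspace ℝ (Euc n)) [Nonempty P] : Subgroup (P ≃ᵃⁱ[ℝ] P) :=
  Subgroup.closure {g | ∃ (H : AffineSubspace ℝ P) (_ : Nonempty H),
    IsSingularHyperplane F P H ∧ g = EuclideanGeometry.reflection H}

/-- The fixed point set `Fix(W)` in `P` of a group `W` of isometries of `P`. -/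
def fixedSet {n : ℕ} (P : AffineSubspace ℝ (Euc n)) [Nonempty P]
    (W : Subgroup (P ≃ᵃⁱ[ℝ] P)) : Set (Euc n) :=
  {p | ∃ h : p ∈ P, ∀ g ∈ W, g ⟨p, h⟩ = ⟨p, h⟩}

/-- The intersection of all sections of `F` through the point `c`. -/
def sectionIntersection {n : ℕ} (F : Set (Set (Euc n))) (c : Euc n) : Set (Euc n) :=
  {p | ∀ P : AffineSubspace ℝ (Euc n), IsSection F P → c ∈ P → p ∈ P}

/-- Every leaf of `F` is contained in a sphere around `c`. -/
def LeavesInSpheresAround {n : ℕ} (F : Set (Set (Euc n))) (c : Euc n) : Prop :=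
  ∀ L ∈ F, ∃ r : ℝ, L ⊆ Metric.sphere c r

/-!
# Fixed points of the generalized Weyl group of an isoparametric foliation

The common value of all three sets is the set of centers of `M`, the points `c` with
`y - c ∈ ν_y M` for all `y ∈ M`. It is computed from the curvature normals of `M` at one point `x`:
the vectors `ν ∈ ν_x M` such that `A_ξ e = ⟪ξ, ν⟫ e` for some unit vector `e`. Parallel normal fields
are handled on charts with a parallel normal frame (`FlatChart`), and simultaneous diagonalization
of the shape operators provides the curvature normals (`PrincipalFrame`).

*A center exists.* Consider the normal vectors `ξ` with `tr A_ζ (1 - A_ξ) = 0` for all normal `ζ`.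
This condition is invariant under parallel translation, and it says that the map `y ↦ y + ξ(y)`
has vanishing Laplacian. If the end point of such a `ξ` is, among those of vectors of the same
length, at maximal distance from the origin, then the maximum principle forces `A_ξ = 1`, so that
`y + ξ(y)` is a constant, which is a center (`exists_inner_nrm_eq_one`, `exists_isCenter`). It
follows that `⟪x - c, ν⟫ = -1` for all curvature normals `ν`, which are therefore nonzero.

*Curvature circles.* The circle through `x` in the plane of `e` and `ν`, with center
`x + ν / ‖ν‖ ^ 2`, lies in `M`, and normal vectors are translated along it explicitly
(`IsCurvatureNormal.isCurvCircleAt`). The slice on which an end point map is constant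
(`exists_kernel_slice`) gives a short arc, and the good angles form a clopen set.

*Leaves are orthogonal to the affine normal spaces.* This is the main difficulty, as nothing is
known in advance about the holonomy of the normal bundle. Let `r` be a normal vector at `y`
with negative principal curvatures. The normal vectors of the same length, with the same principal
curvatures and with the same constant part as `r` form a finite covering of `M` (`normalOrbit`). On
the component of `r`, consider the height function `⟪q, ·⟫` of a nonfocal direction `q`. Its critical
points are nondegenerate with Hessian `-A_ξ A_q`. Passing a critical level could connect two
components of the superlevel sets only at a critical point with one positive direction, but there
the two sides are already joined by the rest of a curvature circle (`height_alternative`). Hence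
there is a single local maximum (`HasNoConnectingPass.eq_of_isStrictLocalMax`). If all principal
curvatures of `q` at `y` are negative, it is `r`. Nonfocal directions being dense, `⟪q, ·⟫` is bounded
by `⟪q, r⟫` whenever `q` lies in the closed chamber at `y` (`IsParallelInvariant.inner_le`). On a
chart any normal field can be brought into the closed chamber by translations composed of antipodal
maps of curvature circles (`FlatChart.exists_translation_chamber`), so the maxima of `⟪q, ·⟫` over the
component are constant along leaves (`IsParallelInvariant.isGreatest`). Thus `⟪· - c, r⟫` is maximal
on the leaf through `q` at the point `q`. As the negative vectors span the normal space, the leaf is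
orthogonal to `x + ν_x M` at its points there (`inner_eq_zero_of_mem_tangentSpaceAt_leafAt`).

*Conclusion.* The sections are exactly the affine normal spaces `x + ν_x M` (`isSection_mk'`,
`IsSection.exists_eq_mk'`), and their singular points form the focal hyperplanes `⟪· - c, ν⟫ = 0`
(`isRegularPoint_iff`). The fixed points of the group are the points on all focal hyperplanes, which
are the centers (`fixedSet_eq`); so are the points common to all sections (`sectionIntersection_eq`)
and the zero-dimensional leaves (`zeroStratum_eq`).
-/

open scoped ContDiff RealInnerProductSpace
open Metric Set Filter Topology

/-! ### Tangent spaces and graph charts -/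

/-- The derivative of a smooth map into `A`, defined on an open set, takes values in the tangent
spaces of `A`. (The curves in the definition of `tangentSpaceAt` have to be defined for all times.)
-/
theorem fderiv_apply_mem_tangentSpaceAt {n : ℕ} {A : Set (Euc n)} {F : Type*}
    [NormedAddCommGroup F] [NormedSpace ℝ F] {g : F → Euc n} {O : Set F} (hO : IsOpen O)
    (hg : ContDiffOn ℝ ∞ g O) (hA : ∀ y ∈ O, g y ∈ A) {a : F} (ha : a ∈ O) (v : F) :
    fderiv ℝ g a v ∈ tangentSpaceAt A (g a) := by
  obtain ⟨ε, hε, hball⟩ := Metric.isOpen_iff.1 hO a ha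
  set δ : ℝ := ε / (2 * (‖v‖ + 1)) with hδ
  have hv : 0 < ‖v‖ + 1 := by positivity
  have hδ0 : 0 < δ := by positivity
  -- the bounded reparametrization `δ sin (t / δ)` keeps the curve inside `O` for all times
  let s : ℝ → F := fun t => a + (δ * Real.sin (t / δ)) • v
  have hs : ContDiff ℝ ∞ s := by fun_prop
  have hmem : ∀ t, s t ∈ O := by
    intro t
    apply hball
    rw [mem_ball, dist_eq_norm]
    have h1 : |δ * Real.sin (t / δ)| ≤ δ := by
      rw [abs_mul, abs_of_pos hδ0]
      exact mul_le_of_le_one_right hδ0.le (Real.abs_sin_le_one _)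
    calc ‖s t - a‖ = |δ * Real.sin (t / δ)| * ‖v‖ := by
          simp only [s, add_sub_cancel_left, norm_smul, Real.norm_eq_abs]
      _ ≤ δ * (‖v‖ + 1) := by gcongr; linarith
      _ = ε / 2 := by rw [hδ]; field_simp
      _ < ε := by linarith
  have hs0 : s 0 = a := by simp [s]
  have hds : HasDerivAt s v 0 := by
    have h1 : HasDerivAt (fun t : ℝ => δ * Real.sin (t / δ)) 1 0 := by
      have h2 : HasDerivAt (fun t : ℝ => t / δ) (1 / δ) 0 := (hasDerivAt_id (0 : ℝ)).div_const δ
      have h3 := (h2.sin).const_mul δ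
      exact h3.congr_deriv (by rw [zero_div, Real.cos_zero]; field_simp)
    have h4 := (h1.smul_const v).const_add a
    simpa [s] using h4
  refine Submodule.subset_span ⟨g ∘ s, hg.comp_contDiff hs hmem, fun t => hA _ (hmem t), ?_, ?_⟩
  · simp [hs0]
  · have hd : HasFDerivAt g (fderiv ℝ g a) (s 0) := by
      rw [hs0]
      exact ((hg.contDiffAt (hO.mem_nhds ha)).differentiableAt (by simp)).hasFDerivAt
    exact (hd.comp_hasDerivAt (0 : ℝ) hds).deriv

/-- In a straightening `φ`, the tangent space is the image of the model subspace under the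
derivative of `φ⁻¹`. -/
theorem tangentSpaceAt_eq_map_of_straightening {n : ℕ} {M : Set (Euc n)} {x : Euc n} (hx : x ∈ M)
    {φ : OpenPartialHomeomorph (Euc n) (Euc n)} {V : Submodule ℝ (Euc n)} (hxs : x ∈ φ.source)
    (hφ : ContDiffOn ℝ ∞ φ φ.source) (hψ : ContDiffOn ℝ ∞ φ.symm φ.target)
    (himg : φ '' (M ∩ φ.source) = φ.target ∩ (V : Set (Euc n))) :
    tangentSpaceAt M x = V.map (fderiv ℝ φ.symm (φ x) : Euc n →ₗ[ℝ] Euc n) ∧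
      Function.Injective (fderiv ℝ φ.symm (φ x)) := by
  have hb : φ x ∈ φ.target := φ.map_source hxs
  have hbV : φ x ∈ V := by
    have : φ x ∈ φ.target ∩ (V : Set (Euc n)) := himg ▸ ⟨x, ⟨hx, hxs⟩, rfl⟩
    exact this.2
  have hdφ : HasFDerivAt φ (fderiv ℝ φ x) x :=
    ((hφ.contDiffAt (φ.open_source.mem_nhds hxs)).differentiableAt (by simp)).hasFDerivAt
  have hdψ : HasFDerivAt φ.symm (fderiv ℝ φ.symm (φ x)) (φ x) :=
    ((hψ.contDiffAt (φ.open_target.mem_nhds hb)).differentiableAt (by simp)).hasFDerivAt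
  have hcomp1 : (fderiv ℝ φ.symm (φ x)).comp (fderiv ℝ φ x) = ContinuousLinearMap.id ℝ _ := by
    have h1 := hdψ.comp x hdφ
    refine h1.unique ((hasFDerivAt_id x).congr_of_eventuallyEq ?_)
    filter_upwards [φ.open_source.mem_nhds hxs] with y hy
    simp [φ.left_inv hy]
  have hcomp2 : (fderiv ℝ φ x).comp (fderiv ℝ φ.symm (φ x)) = ContinuousLinearMap.id ℝ _ := by
    have hdφ' : HasFDerivAt φ (fderiv ℝ φ x) (φ.symm (φ x)) := by rwa [φ.left_inv hxs]
    have h1 := hdφ'.comp (φ x) hdψ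
    refine h1.unique ((hasFDerivAt_id (φ x)).congr_of_eventuallyEq ?_)
    filter_upwards [φ.open_target.mem_nhds hb] with y hy
    simp [φ.right_inv hy]
  refine ⟨le_antisymm (Submodule.span_le.2 ?_) ?_, ?_⟩
  -- the velocity of `φ ∘ c` lies in `V`, and the derivative of `φ⁻¹` maps it back
  · rintro X ⟨c, hc, hcM, hc0, rfl⟩
    have hdc : HasDerivAt c (deriv c 0) 0 := (hc.differentiable (by simp) 0).hasDerivAt
    have hdφ' : HasFDerivAt φ (fderiv ℝ φ x) (c 0) := by rwa [hc0]
    have h1 := hdφ'.comp_hasDerivAt (0 : ℝ) hdc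
    have hev : ∀ᶠ t in 𝓝 (0 : ℝ), (φ ∘ c) t ∈ V := by
      have : ∀ᶠ t in 𝓝 (0 : ℝ), c t ∈ φ.source :=
        hc.continuous.continuousAt.eventually_mem (φ.open_source.mem_nhds (hc0 ▸ hxs))
      filter_upwards [this] with t ht
      have : φ (c t) ∈ φ.target ∩ (V : Set (Euc n)) := himg ▸ ⟨c t, ⟨hcM t, ht⟩, rfl⟩
      exact this.2
    have hmem : fderiv ℝ φ x (deriv c 0) ∈ V := by
      have hcl : IsClosed (V : Set (Euc n)) := V.closed_of_finiteDimensional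
      have h2 := hasDerivAt_iff_tendsto_slope.1 h1
      refine hcl.mem_of_tendsto h2 ?_
      have h3 := hev.filter_mono (nhdsWithin_le_nhds (s := {(0 : ℝ)}ᶜ))
      filter_upwards [h3] with t ht
      rw [slope_def_module]
      refine V.smul_mem _ (V.sub_mem ht ?_)
      simpa [hc0] using hbV
    refine ⟨_, hmem, ?_⟩
    exact DFunLike.congr_fun hcomp1 (deriv c 0)
  · rintro _ ⟨v, hv, rfl⟩
    -- the smooth parametrization `a ↦ φ⁻¹ (φ x + a)` of `M` near `x`
    let ι : V → Euc n := fun a => φ.symm (φ x + a)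
    let O : Set V := (fun a : V => φ x + (a : Euc n)) ⁻¹' φ.target
    have hcont : Continuous (fun a : V => φ x + (a : Euc n)) := by fun_prop
    have hO : IsOpen O := φ.open_target.preimage hcont
    have hsm : ContDiffOn ℝ ∞ ι O := by
      refine hψ.comp (ContDiff.contDiffOn ?_) (fun a ha => ha)
      exact contDiff_const.add V.subtypeL.contDiff
    have hιM : ∀ a ∈ O, ι a ∈ M := by
      intro a ha
      have : φ x + (a : Euc n) ∈ φ '' (M ∩ φ.source) := himg ▸ ⟨ha, V.add_mem hbV a.2⟩
      obtain ⟨y, ⟨hyM, hys⟩, hy⟩ := this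
      simp only [ι, ← hy, φ.left_inv hys, hyM]
    have h0 : (0 : V) ∈ O := by simpa [O] using hb
    have h1 := fderiv_apply_mem_tangentSpaceAt hO hsm hιM h0 ⟨v, hv⟩
    have h2 : HasFDerivAt ι ((fderiv ℝ φ.symm (φ x)).comp V.subtypeL) 0 := by
      have h3 : HasFDerivAt (fun a : V => φ x + (a : Euc n)) V.subtypeL 0 :=
        (V.subtypeL.hasFDerivAt).const_add _
      have h4 : HasFDerivAt φ.symm (fderiv ℝ φ.symm (φ x)) (φ x + ((0 : V) : Euc n)) := by
        simpa using hdψ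
      exact h4.comp (0 : V) h3
    rw [h2.fderiv] at h1
    simpa [ι, φ.left_inv hxs] using h1
  · intro a b hab
    have ha := DFunLike.congr_fun hcomp2 a
    have hb := DFunLike.congr_fun hcomp2 b
    simp only [ContinuousLinearMap.comp_apply, ContinuousLinearMap.id_apply] at ha hb
    rw [← ha, ← hb, hab]

theorem IsSmoothSubmanifold.finrank_tangentSpaceAt {n d : ℕ} {M : Set (Euc n)}
    (hM : IsSmoothSubmanifold M d) {x : Euc n} (hx : x ∈ M) :
    Module.finrank ℝ (tangentSpaceAt M x) = d := by
  obtain ⟨φ, V, hxs, hφ, hψ, hV, himg⟩ := hM x hx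
  obtain ⟨h1, h2⟩ := tangentSpaceAt_eq_map_of_straightening hx hxs hφ hψ himg
  rw [h1, ← hV]
  exact (Submodule.equivMapOfInjective _ h2 V).finrank_eq.symm

/-- Near each of its points a smooth submanifold is the graph of a smooth map over a ball in the
tangent space. -/
theorem IsSmoothSubmanifold.exists_graph {n d : ℕ} {M : Set (Euc n)}
    (hM : IsSmoothSubmanifold M d) {x : Euc n} (hx : x ∈ M) {O : Set (Euc n)} (hO : IsOpen O)
    (hxO : x ∈ O) :
    ∃ (ρ : ℝ) (U : Set (Euc n)) (g : tangentSpaceAt M x → Euc n), 0 < ρ ∧ IsOpen U ∧ U ⊆ O ∧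
      ContDiffOn ℝ ∞ g (ball 0 ρ) ∧ g 0 = x ∧ g '' ball 0 ρ = M ∩ U ∧
      ∀ t ∈ ball (0 : tangentSpaceAt M x) ρ,
        (tangentSpaceAt M x).orthogonalProjectionOnto (g t - x) = t := by
  obtain ⟨φ, V, hxs, hφ, hψ, hV, himg⟩ := hM x hx
  obtain ⟨hT, hinj⟩ := tangentSpaceAt_eq_map_of_straightening hx hxs hφ hψ himg
  set T := tangentSpaceAt M x with hTdef
  have hb : φ x ∈ φ.target := φ.map_source hxs
  have hbV : φ x ∈ V := by
    have : φ x ∈ φ.target ∩ (V : Set (Euc n)) := himg ▸ ⟨x, ⟨hx, hxs⟩, rfl⟩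
    exact this.2
  have hdψ : HasFDerivAt φ.symm (fderiv ℝ φ.symm (φ x)) (φ x) :=
    ((hψ.contDiffAt (φ.open_target.mem_nhds hb)).differentiableAt (by simp)).hasFDerivAt
  let ι : V → Euc n := fun a => φ.symm (φ x + a)
  let Ω : Set V := (fun a : V => φ x + (a : Euc n)) ⁻¹' φ.target
  have hcont : Continuous (fun a : V => φ x + (a : Euc n)) := by fun_prop
  have hΩ : IsOpen Ω := φ.open_target.preimage hcont
  have hsm : ContDiffOn ℝ ∞ ι Ω := by
    refine hψ.comp (ContDiff.contDiffOn ?_) (fun a ha => ha)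
    exact contDiff_const.add V.subtypeL.contDiff
  have hιM : ∀ a ∈ Ω, ι a ∈ M := by
    intro a ha
    have : φ x + (a : Euc n) ∈ φ '' (M ∩ φ.source) := himg ▸ ⟨ha, V.add_mem hbV a.2⟩
    obtain ⟨y, ⟨hyM, hys⟩, hy⟩ := this
    simp only [ι, ← hy, φ.left_inv hys, hyM]
  have h0 : (0 : V) ∈ Ω := by simpa [Ω] using hb
  have hι0 : ι 0 = x := by simp [ι, φ.left_inv hxs]
  have hdι : HasFDerivAt ι ((fderiv ℝ φ.symm (φ x)).comp V.subtypeL) 0 := by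
    have h3 : HasFDerivAt (fun a : V => φ x + (a : Euc n)) V.subtypeL 0 :=
      (V.subtypeL.hasFDerivAt).const_add _
    have h4 : HasFDerivAt φ.symm (fderiv ℝ φ.symm (φ x)) (φ x + ((0 : V) : Euc n)) := by
      simpa using hdψ
    exact h4.comp (0 : V) h3
  -- the tangential projection of the parametrization `ι` has invertible derivative at `0`; `g` is
  -- `ι` composed with its local inverse
  let κ : V → T := fun a => T.orthogonalProjectionOnto (ι a - x)
  have hκ : ContDiffOn ℝ ∞ κ Ω :=
    T.orthogonalProjectionOnto.contDiff.comp_contDiffOn (hsm.sub contDiffOn_const)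
  have hκ0 : κ 0 = 0 := by simp [κ, hι0]
  have hdκ : HasFDerivAt κ (T.orthogonalProjectionOnto.comp
      ((fderiv ℝ φ.symm (φ x)).comp V.subtypeL)) 0 :=
    T.orthogonalProjectionOnto.hasFDerivAt.comp (0 : V) (hdι.sub_const x)
  set L : V →L[ℝ] T := T.orthogonalProjectionOnto.comp
      ((fderiv ℝ φ.symm (φ x)).comp V.subtypeL) with hL
  have hLinj : Function.Injective L := by
    intro a b hab
    have hm : ∀ v : V, fderiv ℝ φ.symm (φ x) v ∈ T := fun v => hT ▸ ⟨v, v.2, rfl⟩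
    have h1 : ∀ v : V, ((L v : T) : Euc n) = fderiv ℝ φ.symm (φ x) v := by
      intro v
      simpa [hL] using (Submodule.starProjection_eq_self_iff.2 (hm v))
    apply Subtype.ext
    apply hinj
    rw [← h1, ← h1, hab]
  have hfin : Module.finrank ℝ V = Module.finrank ℝ T := by
    rw [hV, hTdef, hM.finrank_tangentSpaceAt hx]
  let e : V ≃L[ℝ] T :=
    (LinearEquiv.ofInjectiveOfFinrankEq (L : V →ₗ[ℝ] T) hLinj hfin).toContinuousLinearEquiv
  have he : (e : V →L[ℝ] T) = L := by
    ext a; rfl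
  have hκat : ContDiffAt ℝ ∞ κ 0 := hκ.contDiffAt (hΩ.mem_nhds h0)
  have hdκ' : HasFDerivAt κ (e : V →L[ℝ] T) 0 := by rw [he]; exact hdκ
  let K := hκat.toOpenPartialHomeomorph κ hdκ' (by simp)
  have hKcoe : (K : V → T) = κ := rfl
  have h0K : (0 : V) ∈ K.source := hκat.mem_toOpenPartialHomeomorph_source hdκ' (by simp)
  have h0K' : (0 : T) ∈ K.target := by
    have := K.map_source h0K
    rwa [hKcoe, hκ0] at this
  have hKs0 : K.symm 0 = 0 := by
    have := K.left_inv h0K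
    rwa [hKcoe, hκ0] at this
  -- the derivative stays invertible near the base point, so the inverse is smooth there
  have hinv : ∀ᶠ a in 𝓝 (0 : V), ∃ e' : V ≃L[ℝ] T, (e' : V →L[ℝ] T) = fderiv ℝ κ a := by
    have hc : ContinuousAt (fderiv ℝ κ) 0 :=
      (hκ.continuousOn_fderiv_of_isOpen hΩ (by simp)).continuousAt (hΩ.mem_nhds h0)
    have h1 : range ((↑) : (V ≃L[ℝ] T) → (V →L[ℝ] T)) ∈ 𝓝 (fderiv ℝ κ 0) := by
      rw [hdκ'.fderiv]
      exact ContinuousLinearEquiv.nhds e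
    exact hc h1
  obtain ⟨ε, hε, hεsub⟩ : ∃ ε > 0, ball (0 : V) ε ⊆ {a | (∃ e' : V ≃L[ℝ] T,
      (e' : V →L[ℝ] T) = fderiv ℝ κ a) ∧ a ∈ K.source ∧ a ∈ Ω ∧ ι a ∈ O} := by
    have h2 : ∀ᶠ a in 𝓝 (0 : V), ι a ∈ O :=
      hdι.continuousAt.eventually_mem (hO.mem_nhds (hι0 ▸ hxO))
    have := hinv.and ((K.open_source.eventually_mem h0K).and ((hΩ.eventually_mem h0).and h2))
    obtain ⟨ε, hε, h⟩ := Metric.eventually_nhds_iff_ball.1 this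
    exact ⟨ε, hε, fun a ha => h a ha⟩
  have hcontK : ContinuousAt K.symm 0 := K.symm.continuousAt h0K'
  obtain ⟨ρ, hρ, hρsub⟩ : ∃ ρ > 0, ∀ t ∈ ball (0 : T) ρ, t ∈ K.target ∧ K.symm t ∈ ball (0 : V) ε := by
    have h1 : ∀ᶠ t in 𝓝 (0 : T), K.symm t ∈ ball (0 : V) ε :=
      hcontK.eventually_mem (by rw [hKs0]; exact ball_mem_nhds _ hε)
    exact Metric.eventually_nhds_iff_ball.1
      ((K.open_target.eventually_mem h0K').and h1)
  let g : T → Euc n := fun t => ι (K.symm t)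
  let U : Set (Euc n) := {y | y ∈ φ.source ∧ y ∈ O ∧ ‖φ y - φ x‖ < ε ∧
    T.orthogonalProjectionOnto (y - x) ∈ ball (0 : T) ρ}
  have hproj : ∀ t ∈ ball (0 : T) ρ, T.orthogonalProjectionOnto (g t - x) = t := by
    intro t ht
    have := K.right_inv (hρsub t ht).1
    rwa [hKcoe] at this
  refine ⟨ρ, U, g, hρ, ?_, fun y hy => hy.2.1, ?_, ?_, ?_, hproj⟩
  · have h1 : ContinuousOn (fun y => ‖φ y - φ x‖) φ.source := by
      have := φ.continuousOn
      fun_prop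
    have h2 := h1.isOpen_inter_preimage φ.open_source (isOpen_Iio (a := ε))
    have h3 : Continuous (fun y => T.orthogonalProjectionOnto (y - x)) := by fun_prop
    have h4 := (isOpen_ball (x := (0 : T)) (ε := ρ)).preimage h3
    convert (h2.inter hO).inter h4 using 1
    ext y
    simp only [U, mem_ofPred_eq, mem_inter_iff, mem_preimage, mem_Iio]
    tauto
  · intro t ht
    obtain ⟨htK, hta⟩ := hρsub t ht
    obtain ⟨⟨e', he'⟩, haK, haΩ, -⟩ := hεsub hta
    have h1 : ContDiffAt ℝ ∞ κ (K.symm t) := hκ.contDiffAt (hΩ.mem_nhds haΩ)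
    have h2 : HasFDerivAt K (e' : V →L[ℝ] T) (K.symm t) := by
      rw [he', hKcoe]
      exact (h1.differentiableAt (by simp)).hasFDerivAt
    have h3 : ContDiffAt ℝ ∞ K.symm t := K.contDiffAt_symm htK h2 (by rw [hKcoe]; exact h1)
    exact ((hsm.contDiffAt (hΩ.mem_nhds haΩ)).comp t h3).contDiffWithinAt
  · simp [g, hKs0, hι0]
  · ext y
    constructor
    · rintro ⟨t, ht, rfl⟩
      obtain ⟨htK, hta⟩ := hρsub t ht
      obtain ⟨-, haK, haΩ, haO⟩ := hεsub hta
      refine ⟨hιM _ haΩ, ?_, haO, ?_, ?_⟩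
      · exact φ.map_target haΩ
      · have : φ (ι (K.symm t)) = φ x + (K.symm t : V) := φ.right_inv haΩ
        simp only [g, this, add_sub_cancel_left]
        simpa using hta
      · rw [hproj t ht]; exact ht
    · rintro ⟨hyM, hys, hyO, hyε, hyρ⟩
      refine ⟨_, hyρ, ?_⟩
      have hyV : φ y ∈ V := by
        have : φ y ∈ φ.target ∩ (V : Set (Euc n)) := himg ▸ ⟨y, ⟨hyM, hys⟩, rfl⟩
        exact this.2
      let a : V := ⟨φ y - φ x, V.sub_mem hyV hbV⟩
      have ha : a ∈ ball (0 : V) ε := by simpa [a] using hyε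
      have hιa : ι a = y := by simp [ι, a, φ.left_inv hys]
      have hκa : κ a = T.orthogonalProjectionOnto (y - x) := by simp only [κ, hιa]
      have := K.left_inv (hεsub ha).2.1
      rw [hKcoe, hκa] at this
      simp only [g, this, hιa]

/-! ### Parallel normal fields and flat charts -/

/-- A chart of `M` at `x` together with a parallel frame: `M ∩ U` is the graph of `g` over a ball
in `T_x M`, and `V` extends each normal vector at `x` linearly to a parallel normal field. -/
structure FlatChart {n : ℕ} (M : Set (Euc n)) (x : Euc n) where
  ρ : ℝ
  U : Set (Euc n)
  g : tangentSpaceAt M x → Euc n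
  V : normalSpaceAt M x →ₗ[ℝ] (Euc n → Euc n)
  ρ_pos : 0 < ρ
  isOpen_U : IsOpen U
  contDiffOn_g : ContDiffOn ℝ ∞ g (ball 0 ρ)
  g_zero : g 0 = x
  image_g : g '' ball 0 ρ = M ∩ U
  proj_g : ∀ t ∈ ball (0 : tangentSpaceAt M x) ρ,
    (tangentSpaceAt M x).orthogonalProjectionOnto (g t - x) = t
  parallel_V : ∀ ξ, IsParallelNormalField M U (V ξ)
  V_base : ∀ ξ, V ξ x = ξ

/-- The family `t ↦ (y t, w t)` of normal vectors of `M`, defined on the open set `Ω`, is parallel: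
the derivative of `w` is tangent to `M`. -/
structure IsParallelMap {n : ℕ} (M : Set (Euc n)) {E : Type*} [NormedAddCommGroup E]
    [NormedSpace ℝ E] (Ω : Set E) (y w : E → Euc n) : Prop where
  isOpen : IsOpen Ω
  mem : ∀ t ∈ Ω, y t ∈ M
  normal : ∀ t ∈ Ω, w t ∈ normalSpaceAt M (y t)
  diff_base : ∀ t ∈ Ω, DifferentiableAt ℝ y t
  diff_field : ∀ t ∈ Ω, DifferentiableAt ℝ w t
  parallel : ∀ t ∈ Ω, ∀ u, fderiv ℝ w t u ∈ tangentSpaceAt M (y t)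

theorem inner_eq_zero_of_mem_normalSpaceAt {n : ℕ} {M : Set (Euc n)} {x ξ X : Euc n}
    (hξ : ξ ∈ normalSpaceAt M x) (hX : X ∈ tangentSpaceAt M x) : ⟪ξ, X⟫ = 0 :=
  Submodule.inner_left_of_mem_orthogonal hX hξ

/-- The inner product of two normal families with tangential derivatives has vanishing derivative.
-/
theorem hasFDerivAt_inner_of_parallel {n : ℕ} {E : Type*} [NormedAddCommGroup E]
    [NormedSpace ℝ E] {a b : E → Euc n} {t : E} {T : Submodule ℝ (Euc n)}
    (ha : DifferentiableAt ℝ a t) (hb : DifferentiableAt ℝ b t)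
    (ha' : ∀ u, fderiv ℝ a t u ∈ T) (hb' : ∀ u, fderiv ℝ b t u ∈ T)
    (hat : a t ∈ Tᗮ) (hbt : b t ∈ Tᗮ) :
    HasFDerivAt (fun s => (⟪a s, b s⟫ : ℝ)) (0 : E →L[ℝ] ℝ) t := by
  have h := ha.hasFDerivAt.inner ℝ hb.hasFDerivAt
  refine h.congr_fderiv ?_
  ext u
  simp [Submodule.inner_left_of_mem_orthogonal (hb' u) hat,
    Submodule.inner_right_of_mem_orthogonal (ha' u) hbt]

namespace IsParallelNormalField

variable {n : ℕ} {M U : Set (Euc n)} {v w : Euc n → Euc n}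

theorem differentiableAt (hv : IsParallelNormalField M U v) {x : Euc n} (hx : x ∈ U) :
    DifferentiableAt ℝ v x :=
  (hv.2.1.contDiffAt (hv.1.mem_nhds hx)).differentiableAt (by simp)

theorem mono (hv : IsParallelNormalField M U v) {U' : Set (Euc n)} (hU' : IsOpen U')
    (h : U' ⊆ U) : IsParallelNormalField M U' v :=
  ⟨hU', hv.2.1.mono h, fun x hx => hv.2.2 x ⟨hx.1, h hx.2⟩⟩

theorem zero (hU : IsOpen U) : IsParallelNormalField M U (0 : Euc n → Euc n) := by
  refine ⟨hU, contDiffOn_const, fun x _ => ⟨Submodule.zero_mem _, fun X _ => ?_⟩⟩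
  simp

theorem add (hv : IsParallelNormalField M U v) (hw : IsParallelNormalField M U w) :
    IsParallelNormalField M U (v + w) := by
  refine ⟨hv.1, hv.2.1.add hw.2.1, fun x hx => ⟨Submodule.add_mem _ (hv.2.2 x hx).1
    (hw.2.2 x hx).1, fun X hX => ?_⟩⟩
  rw [fderiv_add (hv.differentiableAt hx.2) (hw.differentiableAt hx.2)]
  exact Submodule.add_mem _ ((hv.2.2 x hx).2 X hX) ((hw.2.2 x hx).2 X hX)

theorem smul (c : ℝ) (hv : IsParallelNormalField M U v) :
    IsParallelNormalField M U (c • v) := by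
  refine ⟨hv.1, contDiffOn_const.smul hv.2.1, fun x hx => ⟨Submodule.smul_mem _ c
    (hv.2.2 x hx).1, fun X hX => ?_⟩⟩
  rw [fderiv_const_smul (hv.differentiableAt hx.2)]
  exact Submodule.smul_mem _ c ((hv.2.2 x hx).2 X hX)

theorem sum {ι : Type*} (s : Finset ι) {f : ι → Euc n → Euc n} (hU : IsOpen U)
    (hf : ∀ i ∈ s, IsParallelNormalField M U (f i)) :
    IsParallelNormalField M U (∑ i ∈ s, f i) :=
  Finset.sum_induction f (IsParallelNormalField M U) (fun _ _ ha hb => ha.add hb) (zero hU) hf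

end IsParallelNormalField

/-- Every point has a flat chart: extend a basis of the normal space to parallel fields. -/
theorem IsIsoparametricSubmanifold.exists_flatChart {n : ℕ} {M : Set (Euc n)}
    (hM : IsIsoparametricSubmanifold M) {x : Euc n} (hx : x ∈ M) : Nonempty (FlatChart M x) := by
  obtain ⟨d, hd⟩ := hM.submanifold
  let b := Module.finBasis ℝ (normalSpaceAt M x)
  choose U v hxU hv hvx using fun i => hM.flat x hx (b i) (b i).2
  have hO : IsOpen (⋂ i, U i) := isOpen_iInter_of_finite fun i => (hv i).1
  obtain ⟨ρ, W, g, hρ, hW, hWU, hg, hg0, himg, hproj⟩ :=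
    hd.exists_graph hx hO (mem_iInter.2 hxU)
  refine ⟨⟨ρ, W, g, b.constr ℝ v, hρ, hW, hg, hg0, himg, hproj, fun ξ => ?_, fun ξ => ?_⟩⟩
  · rw [b.constr_apply_fintype ℝ v ξ]
    exact IsParallelNormalField.sum _ hW fun i _ => IsParallelNormalField.smul _
      ((hv i).mono hW (hWU.trans (iInter_subset _ i)))
  · rw [b.constr_apply_fintype ℝ v ξ]
    refine Eq.trans ?_ (congrArg Subtype.val (b.sum_equivFun ξ))
    simp only [Finset.sum_apply, Pi.smul_apply, hvx, Submodule.coe_sum, Submodule.coe_smul]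

namespace FlatChart

variable {n : ℕ} {M : Set (Euc n)} {x : Euc n} (C : FlatChart M x)

theorem g_mem {t : tangentSpaceAt M x} (ht : t ∈ ball 0 C.ρ) : C.g t ∈ M ∩ C.U :=
  C.image_g ▸ mem_image_of_mem _ ht

theorem zero_mem : (0 : tangentSpaceAt M x) ∈ ball 0 C.ρ := mem_ball_self C.ρ_pos

theorem base_mem : x ∈ M ∩ C.U := by simpa only [C.g_zero] using C.g_mem C.zero_mem

/-- On `M ∩ U` the orthogonal projection to the tangent space at `x` inverts the chart. -/
theorem g_proj {y : Euc n} (hy : y ∈ M ∩ C.U) :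
    (tangentSpaceAt M x).orthogonalProjectionOnto (y - x) ∈ ball 0 C.ρ ∧
      C.g ((tangentSpaceAt M x).orthogonalProjectionOnto (y - x)) = y := by
  rw [← C.image_g] at hy
  obtain ⟨t, ht, rfl⟩ := hy
  rw [C.proj_g t ht]
  exact ⟨ht, rfl⟩

theorem contDiffAt_g {t : tangentSpaceAt M x} (ht : t ∈ ball 0 C.ρ) : ContDiffAt ℝ ∞ C.g t :=
  C.contDiffOn_g.contDiffAt (isOpen_ball.mem_nhds ht)

theorem differentiableAt_g {t : tangentSpaceAt M x} (ht : t ∈ ball 0 C.ρ) :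
    DifferentiableAt ℝ C.g t :=
  (C.contDiffAt_g ht).differentiableAt (by simp)

theorem fderiv_g_mem {t : tangentSpaceAt M x} (ht : t ∈ ball 0 C.ρ) (u : tangentSpaceAt M x) :
    fderiv ℝ C.g t u ∈ tangentSpaceAt M (C.g t) :=
  fderiv_apply_mem_tangentSpaceAt isOpen_ball C.contDiffOn_g (fun _ hs => (C.g_mem hs).1) ht u

theorem proj_fderiv_g {t : tangentSpaceAt M x} (ht : t ∈ ball 0 C.ρ) (u : tangentSpaceAt M x) :
    (tangentSpaceAt M x).orthogonalProjectionOnto (fderiv ℝ C.g t u) = u := by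
  have h1 : HasFDerivAt (fun s => (tangentSpaceAt M x).orthogonalProjectionOnto (C.g s - x))
      ((tangentSpaceAt M x).orthogonalProjectionOnto.comp (fderiv ℝ C.g t)) t :=
    (tangentSpaceAt M x).orthogonalProjectionOnto.hasFDerivAt.comp t
      ((C.differentiableAt_g ht).hasFDerivAt.sub_const x)
  have h2 : HasFDerivAt (_root_.id : tangentSpaceAt M x → tangentSpaceAt M x) (ContinuousLinearMap.id ℝ _) t :=
    hasFDerivAt_id t
  have h3 := h1.unique (h2.congr_of_eventuallyEq (by
    filter_upwards [isOpen_ball.mem_nhds ht] with s hs using C.proj_g _ hs))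
  exact DFunLike.congr_fun h3 u

/-- Differentiable maps into `M` have their derivatives in the range of the derivative of the
chart. -/
theorem fderiv_g_proj_fderiv {E : Type*} [NormedAddCommGroup E] [NormedSpace ℝ E]
    {y : E → Euc n} {s : E} (hy : DifferentiableAt ℝ y s) (hyM : ∀ᶠ r in 𝓝 s, y r ∈ M)
    {t : tangentSpaceAt M x} (ht : t ∈ ball 0 C.ρ) (hst : y s = C.g t) (u : E) :
    fderiv ℝ C.g t ((tangentSpaceAt M x).orthogonalProjectionOnto (fderiv ℝ y s u)) =
      fderiv ℝ y s u := by
  have hts : (tangentSpaceAt M x).orthogonalProjectionOnto (y s - x) = t := by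
    rw [hst, C.proj_g t ht]
  have h1 : HasFDerivAt (fun r => (tangentSpaceAt M x).orthogonalProjectionOnto (y r - x))
      ((tangentSpaceAt M x).orthogonalProjectionOnto.comp (fderiv ℝ y s)) s :=
    (tangentSpaceAt M x).orthogonalProjectionOnto.hasFDerivAt.comp s
      (hy.hasFDerivAt.sub_const x)
  have h2 : HasFDerivAt C.g (fderiv ℝ C.g t)
      ((tangentSpaceAt M x).orthogonalProjectionOnto (y s - x)) := by
    rw [hts]; exact (C.differentiableAt_g ht).hasFDerivAt
  have h3 := h2.comp s h1
  have hU : ∀ᶠ r in 𝓝 s, y r ∈ C.U :=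
    hy.continuousAt.eventually_mem (C.isOpen_U.mem_nhds (hst ▸ (C.g_mem ht).2))
  have h4 := hy.hasFDerivAt.unique (h3.congr_of_eventuallyEq (by
    filter_upwards [hyM, hU] with r hr1 hr2
    exact (C.g_proj ⟨hr1, hr2⟩).2.symm))
  exact (DFunLike.congr_fun h4 u).symm

theorem fderiv_g_proj {t : tangentSpaceAt M x} (ht : t ∈ ball 0 C.ρ) {X : Euc n}
    (hX : X ∈ tangentSpaceAt M (C.g t)) :
    fderiv ℝ C.g t ((tangentSpaceAt M x).orthogonalProjectionOnto X) = X := by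
  let L : Euc n →ₗ[ℝ] Euc n := (fderiv ℝ C.g t : tangentSpaceAt M x →ₗ[ℝ] Euc n) ∘ₗ
    ((tangentSpaceAt M x).orthogonalProjectionOnto : Euc n →ₗ[ℝ] tangentSpaceAt M x)
  have h : tangentSpaceAt M (C.g t) ≤ LinearMap.eqLocus L LinearMap.id := by
    refine Submodule.span_le.2 ?_
    rintro _ ⟨c, hc, hcM, hc0, rfl⟩
    have := C.fderiv_g_proj_fderiv (hc.differentiable (by simp) 0)
      (Eventually.of_forall hcM) ht hc0 1
    rwa [fderiv_apply_one_eq_deriv] at this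
  exact h hX

theorem fderiv_g_zero (u : tangentSpaceAt M x) : fderiv ℝ C.g 0 u = u := by
  have h : (u : Euc n) ∈ tangentSpaceAt M (C.g 0) := by rw [C.g_zero]; exact u.2
  have := C.fderiv_g_proj C.zero_mem h
  simpa using this

theorem isPreconnected : IsPreconnected (M ∩ C.U) := by
  rw [← C.image_g]
  exact (convex_ball _ _).isPreconnected.image _ C.contDiffOn_g.continuousOn

theorem V_mem {y : Euc n} (hy : y ∈ M ∩ C.U) (ξ : normalSpaceAt M x) :
    C.V ξ y ∈ normalSpaceAt M y := ((C.parallel_V ξ).2.2 y hy).1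

theorem V_add (ξ η : normalSpaceAt M x) (y : Euc n) : C.V (ξ + η) y = C.V ξ y + C.V η y := by
  rw [map_add]; rfl

theorem V_smul (a : ℝ) (ξ : normalSpaceAt M x) (y : Euc n) : C.V (a • ξ) y = a • C.V ξ y := by
  rw [map_smul]; rfl

theorem V_sub (ξ η : normalSpaceAt M x) (y : Euc n) : C.V (ξ - η) y = C.V ξ y - C.V η y := by
  rw [map_sub]; rfl

end FlatChart

variable {n : ℕ} {M : Set (Euc n)}

/-- The derivative of a map into `M` which is only differentiable at a point is tangent to `M`.
Since the tangent space is defined by smooth curves, this uses that `M` is a graph. -/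
theorem fderiv_mem_tangentSpaceAt (hM : IsIsoparametricSubmanifold M) {E : Type*}
    [NormedAddCommGroup E] [NormedSpace ℝ E] {y : E → Euc n} {s : E}
    (hy : DifferentiableAt ℝ y s) (hyM : ∀ᶠ r in 𝓝 s, y r ∈ M) (u : E) :
    fderiv ℝ y s u ∈ tangentSpaceAt M (y s) := by
  obtain ⟨C⟩ := hM.exists_flatChart hyM.self_of_nhds
  have h := C.fderiv_g_proj_fderiv hy hyM C.zero_mem C.g_zero.symm u
  rw [C.fderiv_g_zero] at h
  rw [← h]
  exact Submodule.coe_mem _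

theorem IsParallelNormalField.fderiv_comp (hM : IsIsoparametricSubmanifold M) {U : Set (Euc n)}
    {v : Euc n → Euc n} (hv : IsParallelNormalField M U v) {E : Type*}
    [NormedAddCommGroup E] [NormedSpace ℝ E] {y : E → Euc n} {s : E}
    (hy : DifferentiableAt ℝ y s) (hyM : ∀ᶠ r in 𝓝 s, y r ∈ M) (hyU : y s ∈ U) :
    DifferentiableAt ℝ (fun r => v (y r)) s ∧
      (∀ u, fderiv ℝ (fun r => v (y r)) s u = fderiv ℝ v (y s) (fderiv ℝ y s u)) ∧
      ∀ u, fderiv ℝ (fun r => v (y r)) s u ∈ tangentSpaceAt M (y s) := by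
  have h1 := (hv.differentiableAt hyU).hasFDerivAt.comp s hy.hasFDerivAt
  have h2 : ∀ u, fderiv ℝ (fun r => v (y r)) s u = fderiv ℝ v (y s) (fderiv ℝ y s u) := fun u => by
    have : fderiv ℝ (fun r => v (y r)) s = _ := h1.fderiv
    rw [this]; rfl
  refine ⟨h1.differentiableAt, h2, fun u => ?_⟩
  rw [h2]
  exact (hv.2.2 _ ⟨hyM.self_of_nhds, hyU⟩).2 _ (fderiv_mem_tangentSpaceAt hM hy hyM u)

/-- A parallel normal field pulls back to a parallel family along any differentiable map. -/
theorem IsParallelNormalField.isParallelMap (hM : IsIsoparametricSubmanifold M) {U : Set (Euc n)}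
    {v : Euc n → Euc n} (hv : IsParallelNormalField M U v) {E : Type*}
    [NormedAddCommGroup E] [NormedSpace ℝ E] {y : E → Euc n} {Ω : Set E} (hΩ : IsOpen Ω)
    (hy : ∀ t ∈ Ω, DifferentiableAt ℝ y t) (hyM : ∀ t ∈ Ω, y t ∈ M ∩ U) :
    IsParallelMap M Ω y (fun t => v (y t)) where
  isOpen := hΩ
  mem t ht := (hyM t ht).1
  normal t ht := (hv.2.2 _ (hyM t ht)).1
  diff_base := hy
  diff_field t ht := (hv.fderiv_comp hM (hy t ht) (by
    filter_upwards [hΩ.mem_nhds ht] with s hs using (hyM s hs).1) (hyM t ht).2).1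
  parallel t ht := (hv.fderiv_comp hM (hy t ht) (by
    filter_upwards [hΩ.mem_nhds ht] with s hs using (hyM s hs).1) (hyM t ht).2).2.2

theorem FlatChart.isParallelMap (hM : IsIsoparametricSubmanifold M) {x : Euc n}
    (C : FlatChart M x) (ξ : normalSpaceAt M x) :
    IsParallelMap M (ball 0 C.ρ) C.g (fun t => C.V ξ (C.g t)) :=
  (C.parallel_V ξ).isParallelMap hM isOpen_ball (fun _ ht => C.differentiableAt_g ht)
    (fun _ ht => C.g_mem ht)

namespace IsParallelMap

variable {E : Type*} [NormedAddCommGroup E] [NormedSpace ℝ E] {Ω : Set E} {y w w' : E → Euc n}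

theorem mono (h : IsParallelMap M Ω y w) {Ω' : Set E} (hΩ' : IsOpen Ω') (hs : Ω' ⊆ Ω) :
    IsParallelMap M Ω' y w :=
  ⟨hΩ', fun t ht => h.mem t (hs ht), fun t ht => h.normal t (hs ht),
    fun t ht => h.diff_base t (hs ht), fun t ht => h.diff_field t (hs ht),
    fun t ht => h.parallel t (hs ht)⟩

theorem inner_eq (h : IsParallelMap M Ω y w) (h' : IsParallelMap M Ω y w')
    (hΩ : IsPreconnected Ω) {s t : E} (hs : s ∈ Ω) (ht : t ∈ Ω) :
    (⟪w s, w' s⟫ : ℝ) = ⟪w t, w' t⟫ := by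
  have hd : ∀ r ∈ Ω, HasFDerivAt (fun r => (⟪w r, w' r⟫ : ℝ)) (0 : E →L[ℝ] ℝ) r := fun r hr =>
    hasFDerivAt_inner_of_parallel (h.diff_field r hr) (h'.diff_field r hr) (h.parallel r hr)
      (h'.parallel r hr) (h.normal r hr) (h'.normal r hr)
  exact h.isOpen.is_const_of_fderiv_eq_zero hΩ
    (fun r hr => (hd r hr).differentiableAt.differentiableWithinAt)
    (fun r hr => (hd r hr).fderiv) hs ht

theorem sub (h : IsParallelMap M Ω y w) (h' : IsParallelMap M Ω y w') :
    IsParallelMap M Ω y (w - w') where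
  isOpen := h.isOpen
  mem := h.mem
  normal t ht := Submodule.sub_mem _ (h.normal t ht) (h'.normal t ht)
  diff_base := h.diff_base
  diff_field t ht := (h.diff_field t ht).sub (h'.diff_field t ht)
  parallel t ht u := by
    rw [fderiv_sub (h.diff_field t ht) (h'.diff_field t ht)]
    exact Submodule.sub_mem _ (h.parallel t ht u) (h'.parallel t ht u)

theorem add (h : IsParallelMap M Ω y w) (h' : IsParallelMap M Ω y w') :
    IsParallelMap M Ω y (w + w') where
  isOpen := h.isOpen
  mem := h.mem
  normal t ht := Submodule.add_mem _ (h.normal t ht) (h'.normal t ht)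
  diff_base := h.diff_base
  diff_field t ht := (h.diff_field t ht).add (h'.diff_field t ht)
  parallel t ht u := by
    rw [fderiv_add (h.diff_field t ht) (h'.diff_field t ht)]
    exact Submodule.add_mem _ (h.parallel t ht u) (h'.parallel t ht u)

/-- Normal parallel transport is unique. -/
theorem eqOn (h : IsParallelMap M Ω y w) (h' : IsParallelMap M Ω y w')
    (hΩ : IsPreconnected Ω) {s : E} (hs : s ∈ Ω) (he : w s = w' s) {t : E} (ht : t ∈ Ω) :
    w t = w' t := by
  have h1 := (h.sub h').inner_eq (h.sub h') hΩ hs ht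
  have h2 : (w - w') s = 0 := by simp [he]
  rw [h2, inner_zero_left] at h1
  exact sub_eq_zero.1 (inner_self_eq_zero.1 h1.symm)

/-- A parallel family is locally given by the parallel fields of a chart. -/
theorem eventually_eq_V (hM : IsIsoparametricSubmanifold M) (h : IsParallelMap M Ω y w) {x : Euc n}
    (C : FlatChart M x) {s : E} (hs : s ∈ Ω) (hU : y s ∈ C.U) {ξ : normalSpaceAt M x}
    (hξ : w s = C.V ξ (y s)) : ∀ᶠ t in 𝓝 s, t ∈ Ω ∧ y t ∈ C.U ∧ w t = C.V ξ (y t) := by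
  have h1 : ∀ᶠ t in 𝓝 s, t ∈ Ω ∧ y t ∈ C.U := (h.isOpen.eventually_mem hs).and
    ((h.diff_base s hs).continuousAt.eventually_mem (C.isOpen_U.mem_nhds hU))
  obtain ⟨ε, hε, hball⟩ := Metric.eventually_nhds_iff_ball.1 h1
  have h2 : IsParallelMap M (ball s ε) y w := h.mono isOpen_ball fun t ht => (hball t ht).1
  have h3 : IsParallelMap M (ball s ε) y (fun t => C.V ξ (y t)) :=
    (C.parallel_V ξ).isParallelMap hM isOpen_ball (fun t ht => h2.diff_base t ht)
      (fun t ht => ⟨h2.mem t ht, (hball t ht).2⟩)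
  filter_upwards [ball_mem_nhds s hε] with t ht
  exact ⟨(hball t ht).1, (hball t ht).2,
    h2.eqOn h3 (convex_ball _ _).isPreconnected (mem_ball_self hε) hξ ht⟩

end IsParallelMap

namespace FlatChart

variable {x : Euc n} (C : FlatChart M x)

theorem inner_V (hM : IsIsoparametricSubmanifold M) {y : Euc n} (hy : y ∈ M ∩ C.U)
    (ξ η : normalSpaceAt M x) : (⟪C.V ξ y, C.V η y⟫ : ℝ) = ⟪ξ, η⟫ := by
  obtain ⟨ht, hgt⟩ := C.g_proj hy
  have := (C.isParallelMap hM ξ).inner_eq (C.isParallelMap hM η)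
    (convex_ball _ _).isPreconnected ht C.zero_mem
  rw [hgt, C.g_zero, C.V_base, C.V_base] at this
  exact this

theorem norm_V (hM : IsIsoparametricSubmanifold M) {y : Euc n} (hy : y ∈ M ∩ C.U)
    (ξ : normalSpaceAt M x) : ‖C.V ξ y‖ = ‖ξ‖ := by
  have := C.inner_V hM hy ξ ξ
  rw [real_inner_self_eq_norm_sq, real_inner_self_eq_norm_sq] at this
  exact (sq_eq_sq₀ (norm_nonneg _) (norm_nonneg _)).1 this

theorem V_injective (hM : IsIsoparametricSubmanifold M) {y : Euc n} (hy : y ∈ M ∩ C.U)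
    {ξ η : normalSpaceAt M x} (h : C.V ξ y = C.V η y) : ξ = η := by
  have := C.norm_V hM hy (ξ - η)
  rw [C.V_sub, h, sub_self, norm_zero] at this
  exact sub_eq_zero.1 (norm_eq_zero.1 this.symm)

theorem exists_V_eq (hM : IsIsoparametricSubmanifold M) {y : Euc n} (hy : y ∈ M ∩ C.U)
    {η : Euc n} (hη : η ∈ normalSpaceAt M y) : ∃ ξ : normalSpaceAt M x, C.V ξ y = η := by
  obtain ⟨d, hd⟩ := hM.submanifold
  let L : normalSpaceAt M x →ₗ[ℝ] normalSpaceAt M y :=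
    { toFun := fun ξ => ⟨C.V ξ y, C.V_mem hy ξ⟩
      map_add' := fun a b => Subtype.ext (C.V_add a b y)
      map_smul' := fun a b => Subtype.ext (C.V_smul a b y) }
  have hinj : Function.Injective L := fun a b hab =>
    C.V_injective hM hy (congrArg Subtype.val hab)
  -- an injective linear map between normal spaces of equal dimension is onto
  have hfin : Module.finrank ℝ (normalSpaceAt M x) = Module.finrank ℝ (normalSpaceAt M y) := by
    have h1 := (tangentSpaceAt M x).finrank_add_finrank_orthogonal
    have h2 := (tangentSpaceAt M y).finrank_add_finrank_orthogonal
    rw [hd.finrank_tangentSpaceAt C.base_mem.1] at h1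
    rw [hd.finrank_tangentSpaceAt hy.1] at h2
    unfold normalSpaceAt
    omega
  obtain ⟨ξ, hξ⟩ := (LinearMap.injective_iff_surjective_of_finrank_eq_finrank hfin).1 hinj ⟨η, hη⟩
  exact ⟨ξ, congrArg Subtype.val hξ⟩

/-- A vector is tangent at a point of the chart as soon as it is orthogonal to the parallel
frame. -/
theorem mem_tangentSpaceAt_iff (hM : IsIsoparametricSubmanifold M) {y : Euc n} (hy : y ∈ M ∩ C.U)
    {X : Euc n} : X ∈ tangentSpaceAt M y ↔ ∀ ξ, (⟪C.V ξ y, X⟫ : ℝ) = 0 := by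
  refine ⟨fun hX ξ => inner_eq_zero_of_mem_normalSpaceAt (C.V_mem hy ξ) hX, fun h => ?_⟩
  rw [← (tangentSpaceAt M y).orthogonal_orthogonal]
  refine (Submodule.mem_orthogonal _ _).2 fun η hη => ?_
  obtain ⟨ξ, rfl⟩ := C.exists_V_eq hM hy hη
  exact h ξ

end FlatChart

/-- Parallel normal fields which agree at a point have the same tangential derivatives there. -/
theorem IsParallelNormalField.fderiv_eq_fderiv_V (hM : IsIsoparametricSubmanifold M)
    {U : Set (Euc n)} {v : Euc n → Euc n} (hv : IsParallelNormalField M U v) {x y : Euc n}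
    (C : FlatChart M x) (hy : y ∈ M ∩ U) (hyC : y ∈ C.U) {ξ : normalSpaceAt M x}
    (hξ : C.V ξ y = v y) {X : Euc n} (hX : X ∈ tangentSpaceAt M y) :
    fderiv ℝ v y X = fderiv ℝ (C.V ξ) y X := by
  obtain ⟨D⟩ := hM.exists_flatChart hy.1
  have h1 : ∀ᶠ t in 𝓝 (0 : tangentSpaceAt M y), t ∈ ball 0 D.ρ ∧ D.g t ∈ U :=
    (isOpen_ball.eventually_mem D.zero_mem).and
    ((D.differentiableAt_g D.zero_mem).continuousAt.eventually_mem
      (hv.1.mem_nhds (D.g_zero.symm ▸ hy.2)))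
  obtain ⟨ε, hε, hball⟩ := Metric.eventually_nhds_iff_ball.1 h1
  have h2 : IsParallelMap M (ball 0 ε) D.g (fun t => v (D.g t)) :=
    hv.isParallelMap hM isOpen_ball (fun t ht => D.differentiableAt_g (hball t ht).1)
      (fun t ht => ⟨(D.g_mem (hball t ht).1).1, (hball t ht).2⟩)
  have h3 := h2.eventually_eq_V hM C (mem_ball_self hε) (by rwa [D.g_zero])
    (ξ := ξ) (by rw [D.g_zero, hξ])
  have h4 : (fun t => v (D.g t)) =ᶠ[𝓝 0] fun t => C.V ξ (D.g t) := by
    filter_upwards [h3] with t ht using ht.2.2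
  have hM0 : ∀ᶠ r in 𝓝 (0 : tangentSpaceAt M y), D.g r ∈ M := by
    filter_upwards [isOpen_ball.mem_nhds D.zero_mem] with r hr using (D.g_mem hr).1
  have h5 := (hv.fderiv_comp hM (D.differentiableAt_g D.zero_mem) hM0
    (D.g_zero.symm ▸ hy.2)).2.1 ⟨X, hX⟩
  have h6 := ((C.parallel_V ξ).fderiv_comp hM (D.differentiableAt_g D.zero_mem) hM0
    (D.g_zero.symm ▸ hyC)).2.1 ⟨X, hX⟩
  rw [h4.fderiv_eq, h6, D.fderiv_g_zero, D.g_zero] at h5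
  exact h5.symm

/-! ### Principal curvatures and curvature normals -/

/-- A commuting linear family of symmetric operators has a common orthonormal eigenbasis, and its
eigenvalues are represented by vectors of the parameter space. -/
theorem exists_orthonormalBasis_of_commuting_family {E N : Type*} [NormedAddCommGroup E]
    [InnerProductSpace ℝ E] [FiniteDimensional ℝ E] [NormedAddCommGroup N]
    [InnerProductSpace ℝ N] [FiniteDimensional ℝ N] (A : N → E →ₗ[ℝ] E)
    (hadd : ∀ a b, A (a + b) = A a + A b) (hsmul : ∀ (c : ℝ) a, A (c • a) = c • A a)
    (hsymm : ∀ a, (A a).IsSymmetric) (hcomm : ∀ a b, Commute (A a) (A b)) :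
    ∃ (e : OrthonormalBasis (Fin (Module.finrank ℝ E)) ℝ E)
      (ν : Fin (Module.finrank ℝ E) → N), ∀ a i, A a (e i) = (⟪a, ν i⟫ : ℝ) • e i := by
  classical
  -- `V χ` is the joint eigenspace of the operators `A a` for the eigenvalues `χ a`
  let V : (N → ℝ) → Submodule ℝ E := fun χ => ⨅ a, Module.End.eigenspace (A a) (χ a)
  have hint : DirectSum.IsInternal V :=
    LinearMap.IsSymmetric.directSum_isInternal_of_pairwise_commute hsymm
      (fun a b _ => hcomm a b)
  have horth : OrthogonalFamily ℝ (fun χ => V χ) fun χ => (V χ).subtypeₗᵢ :=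
    LinearMap.IsSymmetric.orthogonalFamily_iInf_eigenspaces hsymm
  have hfin : {χ | V χ ≠ ⊥}.Finite :=
    WellFoundedGT.finite_ne_bot_of_iSupIndep hint.submodule_iSupIndep
  have : Fintype {χ // V χ ≠ ⊥} := hfin.fintype
  have hint' := DirectSum.isInternal_ne_bot_iff.2 hint
  have horth' : OrthogonalFamily ℝ (fun χ : {χ // V χ ≠ ⊥} => V χ)
      fun χ => (V χ).subtypeₗᵢ := horth.comp Subtype.val_injective
  let e := hint'.subordinateOrthonormalBasis rfl horth'
  have he : ∀ i, ∃ χ : N → ℝ, ∀ a, A a (e i) = χ a • e i := by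
    intro i
    have h := hint'.subordinateOrthonormalBasis_subordinate rfl i horth'
    exact ⟨(hint'.subordinateOrthonormalBasisIndex rfl i horth').1, fun a =>
      Module.End.mem_eigenspace_iff.1 ((Submodule.mem_iInf _).1 h a)⟩
  have hν : ∀ i, ∃ ν : N, ∀ a, A a (e i) = (⟪a, ν⟫ : ℝ) • e i := by
    intro i
    obtain ⟨χ, hχ⟩ := he i
    -- the eigenvalue on `e i` depends linearly on `a`, so it is an inner product with a fixed
    -- vector
    let L : N →ₗ[ℝ] ℝ :=
      { toFun := fun a => ⟪A a (e i), e i⟫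
        map_add' := fun a b => by simp [hadd, inner_add_left]
        map_smul' := fun c a => by simp [hsmul, inner_smul_left] }
    refine ⟨(InnerProductSpace.toDual ℝ N).symm L.toContinuousLinearMap, fun a => ?_⟩
    have h1 : (⟪a, (InnerProductSpace.toDual ℝ N).symm L.toContinuousLinearMap⟫ : ℝ) = L a := by
      rw [real_inner_comm, InnerProductSpace.toDual_symm_apply]
      rfl
    rw [h1]
    simp only [L, LinearMap.coe_mk, AddHom.coe_mk, hχ, inner_smul_left]
    simp
  choose ν hν using hν
  exact ⟨e, ν, fun a i => hν i a⟩

/-- Finitely many affine functions, none of which vanishes identically, have a common point at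
which none of them vanishes. -/
theorem exists_forall_affine_ne_zero {ι V P : Type*} [AddCommGroup V] [Module ℝ V]
    [AddTorsor V P] (s : Finset ι) (f : ι → P →ᵃ[ℝ] ℝ) (h : ∀ i ∈ s, ∃ p, f i p ≠ 0) :
    ∃ p, ∀ i ∈ s, f i p ≠ 0 := by
  classical
  induction s using Finset.induction_on with
  | empty => exact ⟨Classical.choice AddTorsor.nonempty, by simp⟩
  | insert i s his ih =>
    obtain ⟨a, ha⟩ := ih fun j hj => h j (Finset.mem_insert_of_mem hj)
    obtain ⟨b, hb⟩ := h i (Finset.mem_insert_self i s)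
    -- on the line through `a` and `b` each of the functions has at most one zero
    have key : ∀ j ∈ insert i s, {t : ℝ | f j (AffineMap.lineMap a b t) = 0}.Finite := by
      intro j hj
      apply Set.Subsingleton.finite
      intro t ht t' ht'
      simp only [mem_ofPred_eq, AffineMap.apply_lineMap, AffineMap.lineMap_apply_module,
        smul_eq_mul] at ht ht'
      by_contra hne
      have h1 : (t - t') * (f j b - f j a) = 0 := by linarith
      have h2 : f j b = f j a := by
        rcases mul_eq_zero.1 h1 with h | h
        · exact absurd (sub_eq_zero.1 h) hne
        · linarith
      have h3 : f j a = 0 := by rw [h2] at ht; linarith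
      rcases Finset.mem_insert.1 hj with rfl | hj
      · exact hb (h2.trans h3)
      · exact ha j hj h3
    have hfin : (⋃ j ∈ insert i s, {t : ℝ | f j (AffineMap.lineMap a b t) = 0}).Finite :=
      Set.Finite.biUnion (Finset.finite_toSet _) key
    obtain ⟨t, ht⟩ := hfin.infinite_compl.nonempty
    refine ⟨AffineMap.lineMap a b t, fun j hj h0 => ht ?_⟩
    exact mem_biUnion (by exact hj) h0

namespace IsParallelMap

variable {E : Type*} [NormedAddCommGroup E] [NormedSpace ℝ E] {Ω : Set E} {y w w' : E → Euc n}

/-- The Weingarten equation: the derivative of a normal field is minus the second fundamental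
form. -/
theorem inner_fderiv_fderiv_base (hM : IsIsoparametricSubmanifold M)
    (h : IsParallelMap M Ω y w) {t : E} (ht : t ∈ Ω) (hy : ContDiffAt ℝ 2 y t) (X Y : E) :
    (⟪fderiv ℝ w t X, fderiv ℝ y t Y⟫ : ℝ) = -⟪w t, fderiv ℝ (fderiv ℝ y) t X Y⟫ := by
  have hd : DifferentiableAt ℝ (fderiv ℝ y) t :=
    (hy.fderiv_right (m := 1) (by norm_num)).differentiableAt (by simp)
  have h1 := (h.diff_field t ht).hasFDerivAt.inner ℝ
    (hd.hasFDerivAt.clm_apply (hasFDerivAt_const Y t))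
  have h2 : (fun s => (⟪w s, fderiv ℝ y s Y⟫ : ℝ)) =ᶠ[𝓝 t] fun _ => 0 := by
    filter_upwards [h.isOpen.mem_nhds ht] with s hs
    exact inner_eq_zero_of_mem_normalSpaceAt (h.normal s hs)
      (fderiv_mem_tangentSpaceAt hM (h.diff_base s hs)
        (by filter_upwards [h.isOpen.mem_nhds hs] with r hr using h.mem r hr) Y)
  have h3 := h1.unique ((hasFDerivAt_const (0 : ℝ) t).congr_of_eventuallyEq h2)
  have h4 := DFunLike.congr_fun h3 X
  simp [fderivInnerCLM_apply] at h4
  linarith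

/-- The Ricci equation for parallel normal fields. -/
theorem inner_fderiv_fderiv (h : IsParallelMap M Ω y w) (h' : IsParallelMap M Ω y w')
    {t : E} (ht : t ∈ Ω) (hw : ContDiffAt ℝ 2 w t) (X Y : E) :
    (⟪fderiv ℝ w t X, fderiv ℝ w' t Y⟫ : ℝ) = -⟪fderiv ℝ (fderiv ℝ w) t Y X, w' t⟫ := by
  have hd : DifferentiableAt ℝ (fderiv ℝ w) t :=
    (hw.fderiv_right (m := 1) (by norm_num)).differentiableAt (by simp)
  have h1 := (hd.hasFDerivAt.clm_apply (hasFDerivAt_const X t)).inner ℝ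
    (h'.diff_field t ht).hasFDerivAt
  have h2 : (fun s => (⟪fderiv ℝ w s X, w' s⟫ : ℝ)) =ᶠ[𝓝 t] fun _ => 0 := by
    filter_upwards [h.isOpen.mem_nhds ht] with s hs
    rw [real_inner_comm]
    exact inner_eq_zero_of_mem_normalSpaceAt (h'.normal s hs) (h.parallel s hs X)
  have h3 := h1.unique ((hasFDerivAt_const (0 : ℝ) t).congr_of_eventuallyEq h2)
  have h4 := DFunLike.congr_fun h3 Y
  simp [fderivInnerCLM_apply] at h4
  linarith

end IsParallelMap

theorem FlatChart.contDiffAt_V_g {x : Euc n} (C : FlatChart M x) (ξ : normalSpaceAt M x)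
    {t : tangentSpaceAt M x} (ht : t ∈ ball 0 C.ρ) :
    ContDiffAt ℝ ∞ (fun t => C.V ξ (C.g t)) t :=
  ((C.parallel_V ξ).2.1.contDiffAt (C.isOpen_U.mem_nhds (C.g_mem ht).2)).comp t
    (C.contDiffAt_g ht)

theorem FlatChart.fderiv_V_g (hM : IsIsoparametricSubmanifold M) {x : Euc n} (C : FlatChart M x)
    (ξ : normalSpaceAt M x) {t : tangentSpaceAt M x} (ht : t ∈ ball 0 C.ρ)
    (u : tangentSpaceAt M x) :
    fderiv ℝ (fun t => C.V ξ (C.g t)) t u = fderiv ℝ (C.V ξ) (C.g t) (fderiv ℝ C.g t u) :=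
  ((C.parallel_V ξ).fderiv_comp hM (C.differentiableAt_g ht)
    (by filter_upwards [isOpen_ball.mem_nhds ht] with s hs using (C.g_mem hs).1)
    (C.g_mem ht).2).2.1 u

/-- An orthonormal basis of `T_x M` which diagonalizes all shape operators at `x`, with the
corresponding curvature normals (listed with multiplicities). -/
structure PrincipalFrame {n : ℕ} (M : Set (Euc n)) (x : Euc n) where
  e : OrthonormalBasis (Fin (Module.finrank ℝ (tangentSpaceAt M x))) ℝ (tangentSpaceAt M x)
  nrm : Fin (Module.finrank ℝ (tangentSpaceAt M x)) → normalSpaceAt M x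
  eigen : ∀ (U : Set (Euc n)) (v : Euc n → Euc n), IsParallelNormalField M U v → x ∈ U →
    ∀ b, fderiv ℝ v x (e b : Euc n) = -(⟪v x, nrm b⟫ : ℝ) • (e b : Euc n)

/-- The shape operators at a point are symmetric by the Weingarten equation and commute by the Ricci
equation, so they are simultaneously diagonalizable. -/
theorem IsIsoparametricSubmanifold.exists_principalFrame (hM : IsIsoparametricSubmanifold M)
    {x : Euc n} (hx : x ∈ M) : Nonempty (PrincipalFrame M x) := by
  obtain ⟨C⟩ := hM.exists_flatChart hx
  let w : normalSpaceAt M x → tangentSpaceAt M x → Euc n := fun ξ t => C.V ξ (C.g t)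
  have hw : ∀ ξ, IsParallelMap M (ball 0 C.ρ) C.g (w ξ) := fun ξ => C.isParallelMap hM ξ
  have hdw : ∀ ξ u, fderiv ℝ (w ξ) 0 u ∈ tangentSpaceAt M x := fun ξ u => by
    have := (hw ξ).parallel 0 C.zero_mem u
    rwa [C.g_zero] at this
  let A : normalSpaceAt M x → tangentSpaceAt M x →ₗ[ℝ] tangentSpaceAt M x := fun ξ =>
    -((fderiv ℝ (w ξ) 0 : tangentSpaceAt M x →ₗ[ℝ] Euc n).codRestrict _ (hdw ξ))
  have hA : ∀ ξ u, ((A ξ u : tangentSpaceAt M x) : Euc n) = -fderiv ℝ (w ξ) 0 u :=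
    fun ξ u => rfl
  have hdiff : ∀ ξ, DifferentiableAt ℝ (w ξ) 0 := fun ξ => (hw ξ).diff_field 0 C.zero_mem
  have hcd : ∀ ξ, ContDiffAt ℝ 2 (w ξ) 0 := fun ξ =>
    mod_cast contDiffAt_infty.1 (C.contDiffAt_V_g ξ C.zero_mem) 2
  have hcg : ContDiffAt ℝ 2 C.g 0 := mod_cast contDiffAt_infty.1 (C.contDiffAt_g C.zero_mem) 2
  -- symmetry of the second derivative of the chart
  have hsymm1 : ∀ ξ (X Y : tangentSpaceAt M x), (⟪A ξ X, Y⟫ : ℝ) = ⟪X, A ξ Y⟫ := by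
    intro ξ X Y
    have h1 := (hw ξ).inner_fderiv_fderiv_base hM C.zero_mem hcg X Y
    have h2 := (hw ξ).inner_fderiv_fderiv_base hM C.zero_mem hcg Y X
    rw [hcg.isSymmSndFDerivAt (by simp) X Y, ← h2, C.fderiv_g_zero, C.fderiv_g_zero] at h1
    rw [Submodule.coe_inner, Submodule.coe_inner, hA, hA, inner_neg_left, inner_neg_right, h1,
      real_inner_comm]
  -- symmetry of the second derivative of the parallel fields
  have hcomm : ∀ ξ η, Commute (A ξ) (A η) := by
    intro ξ η
    have h0 : ∀ X Y : tangentSpaceAt M x, (⟪A ξ X, A η Y⟫ : ℝ) = ⟪A ξ Y, A η X⟫ := by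
      intro X Y
      have h1 := (hw ξ).inner_fderiv_fderiv (hw η) C.zero_mem (hcd ξ) X Y
      have h2 := (hw ξ).inner_fderiv_fderiv (hw η) C.zero_mem (hcd ξ) Y X
      rw [(hcd ξ).isSymmSndFDerivAt (by simp) Y X, ← h2] at h1
      simp only [Submodule.coe_inner, hA, inner_neg_neg]
      exact h1
    refine LinearMap.ext fun X => ext_inner_right ℝ fun Y => ?_
    rw [Module.End.mul_apply, Module.End.mul_apply, hsymm1, real_inner_comm, ← h0, ← hsymm1 η]
  obtain ⟨e, ν, he⟩ := exists_orthonormalBasis_of_commuting_family A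
    (fun a b => by
      refine LinearMap.ext fun u => Subtype.ext ?_
      have : w (a + b) = w a + w b := by funext t; exact C.V_add a b _
      rw [hA, this, fderiv_add (hdiff a) (hdiff b)]
      simp [hA]
      abel)
    (fun c a => by
      refine LinearMap.ext fun u => Subtype.ext ?_
      have : w (c • a) = c • w a := by funext t; exact C.V_smul c a _
      rw [hA, this, fderiv_const_smul (hdiff a)]
      simp [hA])
    (fun a X Y => hsymm1 a X Y) hcomm
  refine ⟨⟨e, ν, fun U v hv hxU b => ?_⟩⟩
  let ξ : normalSpaceAt M x := ⟨v x, (hv.2.2 x ⟨hx, hxU⟩).1⟩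
  have h1 := hv.fderiv_eq_fderiv_V hM C ⟨hx, hxU⟩ C.base_mem.2 (ξ := ξ) (C.V_base ξ) (e b).2
  have h2 := congrArg Subtype.val (he ξ b)
  rw [hA, C.fderiv_V_g hM ξ C.zero_mem, C.fderiv_g_zero, C.g_zero] at h2
  rw [h1, ← neg_neg (fderiv ℝ (C.V ξ) x (e b : Euc n)), h2, Submodule.coe_smul, neg_smul]
  rfl

namespace PrincipalFrame

variable {x : Euc n} (F : PrincipalFrame M x)

theorem fderiv_eq_sum {U : Set (Euc n)} {v : Euc n → Euc n} (hv : IsParallelNormalField M U v)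
    (hxU : x ∈ U) (X : tangentSpaceAt M x) :
    fderiv ℝ v x X = -∑ b, ((⟪v x, F.nrm b⟫ : ℝ) * ⟪F.e b, X⟫) • (F.e b : Euc n) := by
  have h1 : (X : Euc n) = ∑ b, (⟪F.e b, X⟫ : ℝ) • (F.e b : Euc n) := by
    refine (congrArg Subtype.val (F.e.sum_repr' X)).symm.trans ?_
    simp only [Submodule.coe_sum, Submodule.coe_smul]
  conv_lhs => rw [h1]
  rw [map_sum, ← Finset.sum_neg_distrib]
  refine Finset.sum_congr rfl fun b _ => ?_
  rw [map_smul, F.eigen U v hv hxU, smul_smul, ← neg_smul]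
  congr 1
  ring

theorem shapeOperator_e {U : Set (Euc n)} {v : Euc n → Euc n}
    (hv : IsParallelNormalField M U v) (hxU : x ∈ U)
    (b : Fin (Module.finrank ℝ (tangentSpaceAt M x))) :
    shapeOperator M v x (F.e b) = (⟪v x, F.nrm b⟫ : ℝ) • F.e b := by
  have h1 : shapeOperator M v x (F.e b) =
      -(tangentSpaceAt M x).orthogonalProjectionOnto (fderiv ℝ v x (F.e b : Euc n)) := rfl
  rw [h1, F.eigen U v hv hxU, map_smul,
    Submodule.orthogonalProjectionOnto_mem_subspace_eq_self, neg_smul, neg_neg]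

theorem roots_charpoly_shapeOperator {U : Set (Euc n)} {v : Euc n → Euc n}
    (hv : IsParallelNormalField M U v) (hxU : x ∈ U) :
    (shapeOperator M v x).charpoly.roots =
      Finset.univ.val.map fun b => (⟪v x, F.nrm b⟫ : ℝ) := by
  classical
  have h1 : LinearMap.toMatrix F.e.toBasis F.e.toBasis (shapeOperator M v x) =
      Matrix.diagonal fun b => (⟪v x, F.nrm b⟫ : ℝ) := by
    ext i j
    rw [LinearMap.toMatrix_apply]
    simp only [OrthonormalBasis.coe_toBasis, F.shapeOperator_e hv hxU]
    rw [map_smul]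
    simp only [OrthonormalBasis.coe_toBasis_repr_apply, Finsupp.smul_apply, smul_eq_mul]
    by_cases h : i = j
    · subst h; simp
    · simp [h]
  rw [← LinearMap.charpoly_toMatrix _ F.e.toBasis, h1, Matrix.charpoly_diagonal,
    Polynomial.roots_prod]
  · simp
  · exact Finset.prod_ne_zero_iff.2 fun _ _ => Polynomial.X_sub_C_ne_zero _

end PrincipalFrame

/-- The principal curvatures in the direction of a parallel normal field are constant, with
multiplicities. -/
theorem PrincipalFrame.map_inner_eq (hM : IsIsoparametricSubmanifold M) {U : Set (Euc n)}
    {v : Euc n → Euc n} (hv : IsParallelNormalField M U v) (hU : IsPreconnected (M ∩ U))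
    {x y : Euc n} (F : PrincipalFrame M x) (G : PrincipalFrame M y) (hx : x ∈ M ∩ U)
    (hy : y ∈ M ∩ U) :
    (Finset.univ.val.map fun b => (⟪v x, F.nrm b⟫ : ℝ)) =
      Finset.univ.val.map fun b => (⟪v y, G.nrm b⟫ : ℝ) := by
  rw [← F.roots_charpoly_shapeOperator hv hx.2, ← G.roots_charpoly_shapeOperator hv hy.2,
    hM.const_principal_curvatures U v hv hU x hx y hy]

namespace FlatChart

variable {x : Euc n} (C : FlatChart M x)

/-- Symmetric functions of the principal curvatures in a parallel direction are constant. -/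
theorem sum_inner_nrm_eq (hM : IsIsoparametricSubmanifold M) (F : PrincipalFrame M x)
    {y : Euc n} (hy : y ∈ M ∩ C.U) (G : PrincipalFrame M y) (ξ : normalSpaceAt M x)
    (f : ℝ → ℝ) : ∑ b, f ⟪C.V ξ y, G.nrm b⟫ = ∑ b, f ⟪ξ, F.nrm b⟫ := by
  have h := F.map_inner_eq hM (C.parallel_V ξ) C.isPreconnected G C.base_mem hy
  rw [C.V_base] at h
  have h2 := congrArg (fun s => (Multiset.map f s).sum) h
  simp only [Multiset.map_map] at h2
  exact h2.symm

theorem exists_inner_nrm_eq (hM : IsIsoparametricSubmanifold M) (F : PrincipalFrame M x)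
    {y : Euc n} (hy : y ∈ M ∩ C.U) (G : PrincipalFrame M y) (ξ : normalSpaceAt M x) (b) :
    ∃ b', (⟪C.V ξ y, G.nrm b⟫ : ℝ) = ⟪ξ, F.nrm b'⟫ := by
  have h := F.map_inner_eq hM (C.parallel_V ξ) C.isPreconnected G C.base_mem hy
  rw [C.V_base] at h
  have h2 : (⟪C.V ξ y, G.nrm b⟫ : ℝ) ∈ Finset.univ.val.map fun b => (⟪C.V ξ y, G.nrm b⟫ : ℝ) :=
    Multiset.mem_map_of_mem _ (Finset.mem_univ b)
  rw [← h] at h2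
  obtain ⟨b', -, hb'⟩ := Multiset.mem_map.1 h2
  exact ⟨b', hb'.symm⟩

theorem exists_inner_nrm_eq' (hM : IsIsoparametricSubmanifold M) (F : PrincipalFrame M x)
    {y : Euc n} (hy : y ∈ M ∩ C.U) (G : PrincipalFrame M y) (ξ : normalSpaceAt M x) (b) :
    ∃ b', (⟪C.V ξ y, G.nrm b'⟫ : ℝ) = ⟪ξ, F.nrm b⟫ := by
  have h := F.map_inner_eq hM (C.parallel_V ξ) C.isPreconnected G C.base_mem hy
  rw [C.V_base] at h
  have h2 : (⟪ξ, F.nrm b⟫ : ℝ) ∈ Finset.univ.val.map fun b => (⟪(ξ : Euc n), F.nrm b⟫ : ℝ) :=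
    Multiset.mem_map_of_mem _ (Finset.mem_univ b)
  rw [h] at h2
  obtain ⟨b', -, hb'⟩ := Multiset.mem_map.1 h2
  exact ⟨b', hb'⟩

/-- Every curvature normal at `y` is the parallel translate of one at `x`. -/
theorem exists_V_nrm_eq (hM : IsIsoparametricSubmanifold M) (F : PrincipalFrame M x)
    {y : Euc n} (hy : y ∈ M ∩ C.U) (G : PrincipalFrame M y) (b) :
    ∃ b', C.V (F.nrm b') y = G.nrm b := by
  obtain ⟨η, hη⟩ := C.exists_V_eq hM hy (G.nrm b).2
  by_contra! hne
  have hne' : ∀ b' ∈ Finset.univ, ∃ ξ, ((innerSL ℝ (η - F.nrm b')).toLinearMap.toAffineMap :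
      normalSpaceAt M x →ᵃ[ℝ] ℝ) ξ ≠ 0 := by
    intro b' _
    refine ⟨η - F.nrm b', fun h => hne b' ?_⟩
    have h' : (⟪η - F.nrm b', η - F.nrm b'⟫ : ℝ) = 0 := h
    rw [← hη, sub_eq_zero.1 (inner_self_eq_zero.1 h')]
  -- choose `ξ` such that the principal curvatures along `ξ` distinguish the translates of all
  -- `F.nrm b'` from `G.nrm b`
  obtain ⟨ξ, hξ⟩ := exists_forall_affine_ne_zero Finset.univ _ hne'
  obtain ⟨b', hb'⟩ := C.exists_inner_nrm_eq hM F hy G ξ b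
  rw [← hη, C.inner_V hM hy] at hb'
  refine hξ b' (Finset.mem_univ _) ?_
  have : (⟪η - F.nrm b', ξ⟫ : ℝ) = 0 := by
    rw [real_inner_comm, inner_sub_right, hb', Submodule.coe_inner, sub_self]
  exact this

/-- Every parallel translate of a curvature normal is a curvature normal. -/
theorem exists_V_nrm_eq' (hM : IsIsoparametricSubmanifold M) (F : PrincipalFrame M x)
    {y : Euc n} (hy : y ∈ M ∩ C.U) (G : PrincipalFrame M y) (b) :
    ∃ b', C.V (F.nrm b) y = G.nrm b' := by
  by_contra! hne
  choose η hη using fun b' => C.exists_V_eq hM hy (G.nrm b').2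
  have hne' : ∀ b' ∈ Finset.univ, ∃ ξ, ((innerSL ℝ (η b' - F.nrm b)).toLinearMap.toAffineMap :
      normalSpaceAt M x →ᵃ[ℝ] ℝ) ξ ≠ 0 := by
    intro b' _
    refine ⟨η b' - F.nrm b, fun h => hne b' ?_⟩
    have h' : (⟪η b' - F.nrm b, η b' - F.nrm b⟫ : ℝ) = 0 := h
    rw [← hη, sub_eq_zero.1 (inner_self_eq_zero.1 h')]
  obtain ⟨ξ, hξ⟩ := exists_forall_affine_ne_zero Finset.univ _ hne'
  obtain ⟨b', hb'⟩ := C.exists_inner_nrm_eq' hM F hy G ξ b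
  rw [← hη, C.inner_V hM hy] at hb'
  refine hξ b' (Finset.mem_univ _) ?_
  have : (⟪η b' - F.nrm b, ξ⟫ : ℝ) = 0 := by
    rw [real_inner_comm, inner_sub_right, hb', Submodule.coe_inner, sub_self]
  exact this

end FlatChart

/-- `ν` is a curvature normal of `M` at `x`, and `e` is a unit vector in its curvature
distribution: every shape operator `A_ξ` at `x` has eigenvalue `⟪ξ, ν⟫` on `e`. -/
structure IsCurvatureNormal {n : ℕ} (M : Set (Euc n)) (x ν e : Euc n) : Prop where
  mem : x ∈ M
  normal : ν ∈ normalSpaceAt M x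
  tangent : e ∈ tangentSpaceAt M x
  unit : ‖e‖ = 1
  eigen : ∀ (U : Set (Euc n)) (v : Euc n → Euc n), IsParallelNormalField M U v → x ∈ U →
    fderiv ℝ v x e = -(⟪v x, ν⟫ : ℝ) • e

theorem PrincipalFrame.isCurvatureNormal {x : Euc n} (hx : x ∈ M) (F : PrincipalFrame M x) (b) :
    IsCurvatureNormal M x (F.nrm b) (F.e b) :=
  ⟨hx, (F.nrm b).2, (F.e b).2, F.e.orthonormal.1 b, fun U v hv hxU => F.eigen U v hv hxU b⟩

/-- Every curvature normal occurs in every principal frame: `e` has a nonzero component along some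
`F.e b`, and this forces the eigenvalue functionals to agree. -/
theorem IsCurvatureNormal.exists_nrm_eq (hM : IsIsoparametricSubmanifold M) {x ν e : Euc n}
    (h : IsCurvatureNormal M x ν e) (F : PrincipalFrame M x) : ∃ b, (F.nrm b : Euc n) = ν := by
  obtain ⟨C⟩ := hM.exists_flatChart h.mem
  obtain ⟨b, hb⟩ : ∃ b, (⟪F.e b, (⟨e, h.tangent⟩ : tangentSpaceAt M x)⟫ : ℝ) ≠ 0 := by
    by_contra! h0
    have h1 := F.e.sum_repr' ⟨e, h.tangent⟩
    simp only [h0, zero_smul, Finset.sum_const_zero] at h1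
    have h2 : e = 0 := congrArg Subtype.val h1.symm
    have := h.unit
    simp [h2] at this
  refine ⟨b, ?_⟩
  let ξ : normalSpaceAt M x := F.nrm b - ⟨ν, h.normal⟩
  have h1 := h.eigen _ _ (C.parallel_V ξ) C.base_mem.2
  have h2 := F.fderiv_eq_sum (C.parallel_V ξ) C.base_mem.2 ⟨e, h.tangent⟩
  rw [C.V_base] at h1 h2
  rw [h1] at h2
  have h3 : ∀ i, (⟪(F.e b : Euc n), F.e i⟫ : ℝ) = if b = i then 1 else 0 := fun i =>
    F.e.inner_eq_ite b i
  have h4 := congrArg (fun X => (⟪(F.e b : Euc n), X⟫ : ℝ)) h2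
  simp only [neg_smul, inner_neg_right, neg_inj, real_inner_smul_right, inner_sum, h3, mul_ite,
    mul_one, mul_zero, Finset.sum_ite_eq, Finset.mem_univ, if_true] at h4
  have h5 : (⟪(ξ : Euc n), (F.nrm b : Euc n) - ν⟫ : ℝ) = 0 := by
    rw [inner_sub_right]
    have := mul_right_cancel₀ hb h4
    linarith
  have h6 : ((F.nrm b : Euc n) - ν) = 0 := inner_self_eq_zero.1 h5
  exact sub_eq_zero.1 h6

/-- Being a curvature normal is invariant under parallel translation in a chart. -/
theorem FlatChart.exists_isCurvatureNormal (hM : IsIsoparametricSubmanifold M) {x : Euc n}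
    (C : FlatChart M x) {y z : Euc n} (hy : y ∈ M ∩ C.U) (hz : z ∈ M ∩ C.U)
    {ξ : normalSpaceAt M x} {e : Euc n} (h : IsCurvatureNormal M y (C.V ξ y) e) :
    ∃ e', IsCurvatureNormal M z (C.V ξ z) e' := by
  obtain ⟨F⟩ := hM.exists_principalFrame C.base_mem.1
  obtain ⟨G⟩ := hM.exists_principalFrame hy.1
  obtain ⟨H⟩ := hM.exists_principalFrame hz.1
  obtain ⟨b, hb⟩ := h.exists_nrm_eq hM G
  obtain ⟨b', hb'⟩ := C.exists_V_nrm_eq hM F hy G b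
  have hξ : F.nrm b' = ξ := C.V_injective hM hy (hb'.trans hb)
  obtain ⟨c, hc⟩ := C.exists_V_nrm_eq' hM F hz H b'
  rw [hξ] at hc
  exact ⟨H.e c, hc ▸ H.isCurvatureNormal hz.1 c⟩

/-! ### Parallel-invariant sets of normal vectors -/

/-- A set of normal vectors of `M` (given as pairs of a foot point and a vector) which is invariant
under parallel translation. -/
structure IsParallelInvariant {n : ℕ} (M : Set (Euc n)) (S : Set (Euc n × Euc n)) : Prop where
  mem : ∀ p ∈ S, p.1 ∈ M ∧ p.2 ∈ normalSpaceAt M p.1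
  invariant : ∀ (x : Euc n) (C : FlatChart M x) (ξ : normalSpaceAt M x), ∀ y ∈ M ∩ C.U,
    ∀ z ∈ M ∩ C.U, (y, C.V ξ y) ∈ S → (z, C.V ξ z) ∈ S

/-- Local invariance in charts implies invariance along every parallel family over a connected
domain. -/
theorem IsParallelInvariant.of_isParallelMap (hM : IsIsoparametricSubmanifold M)
    {S : Set (Euc n × Euc n)} (hS : IsParallelInvariant M S) {E : Type*} [NormedAddCommGroup E]
    [NormedSpace ℝ E] {Ω : Set E} {y w : E → Euc n} (h : IsParallelMap M Ω y w)
    (hΩ : IsPreconnected Ω) {s t : E} (hs : s ∈ Ω) (ht : t ∈ Ω) (hsS : (y s, w s) ∈ S) :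
    (y t, w t) ∈ S := by
  refine hΩ.induction₂' (fun s t => (y s, w s) ∈ S → (y t, w t) ∈ S) (fun s hs => ?_)
    (fun a b c _ _ _ hab hbc h => hbc (hab h)) hs ht hsS
  obtain ⟨C⟩ := hM.exists_flatChart (h.mem s hs)
  have h1 := h.eventually_eq_V hM C hs C.base_mem.2
    (ξ := ⟨w s, h.normal s hs⟩) (C.V_base ⟨w s, h.normal s hs⟩).symm
  refine (h1.filter_mono nhdsWithin_le_nhds).mono fun t ht => ?_
  have ht' : y t ∈ M ∩ C.U := ⟨h.mem t ht.1, ht.2.1⟩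
  have hw : w s = C.V ⟨w s, h.normal s hs⟩ (y s) :=
    (C.V_base ⟨w s, h.normal s hs⟩).symm
  constructor
  · intro hS'
    rw [hw] at hS'
    rw [ht.2.2]
    exact hS.invariant _ C _ _ C.base_mem _ ht' hS'
  · intro hS'
    rw [ht.2.2] at hS'
    rw [hw]
    exact hS.invariant _ C _ _ ht' _ C.base_mem hS'

namespace FlatChart

variable {x : Euc n} (C : FlatChart M x)

/-- The coordinates of a normal vector in the parallel frame of a chart. -/
noncomputable def coord (y η : Euc n) : normalSpaceAt M x :=
  ∑ i, (⟪C.V (stdOrthonormalBasis ℝ (normalSpaceAt M x) i) y, η⟫ : ℝ) •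
    stdOrthonormalBasis ℝ (normalSpaceAt M x) i

theorem coord_V (hM : IsIsoparametricSubmanifold M) {y : Euc n} (hy : y ∈ M ∩ C.U)
    (ξ : normalSpaceAt M x) : C.coord y (C.V ξ y) = ξ := by
  unfold coord
  simp only [C.inner_V hM hy]
  exact (stdOrthonormalBasis ℝ (normalSpaceAt M x)).sum_repr' ξ

theorem V_coord (hM : IsIsoparametricSubmanifold M) {y η : Euc n} (hy : y ∈ M ∩ C.U)
    (hη : η ∈ normalSpaceAt M y) : C.V (C.coord y η) y = η := by
  obtain ⟨ξ, rfl⟩ := C.exists_V_eq hM hy hη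
  rw [C.coord_V hM hy]

theorem continuousAt_V (ξ : normalSpaceAt M x) {y : Euc n} (hy : y ∈ C.U) :
    ContinuousAt (C.V ξ) y := ((C.parallel_V ξ).differentiableAt hy).continuousAt

theorem continuousAt_coord {y η : Euc n} (hy : y ∈ C.U) :
    ContinuousAt (fun p : Euc n × Euc n => C.coord p.1 p.2) (y, η) := by
  unfold coord
  refine tendsto_finsetSum _ fun i _ => ?_
  have h1 : ContinuousAt (fun p : Euc n × Euc n =>
      C.V (stdOrthonormalBasis ℝ (normalSpaceAt M x) i) p.1) (y, η) :=
    ContinuousAt.comp (x := (y, η)) (f := fun p : Euc n × Euc n => p.1)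
      (g := C.V (stdOrthonormalBasis ℝ (normalSpaceAt M x) i)) (C.continuousAt_V _ hy)
      continuousAt_fst
  have h2 : ContinuousAt (fun p : Euc n × Euc n => p.2) (y, η) := continuousAt_snd
  have h3 : ContinuousAt (fun p : Euc n × Euc n =>
      (⟪C.V (stdOrthonormalBasis ℝ (normalSpaceAt M x) i) p.1, p.2⟫ : ℝ)) (y, η) :=
    h1.inner h2
  exact Tendsto.smul h3 tendsto_const_nhds

theorem coord_base (hM : IsIsoparametricSubmanifold M) {η : Euc n}
    (hη : η ∈ normalSpaceAt M x) : (C.coord x η : Euc n) = η := by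
  rw [← C.V_base, C.V_coord hM C.base_mem hη]

theorem coord_base_eq (η : Euc n) :
    C.coord x η = (normalSpaceAt M x).orthogonalProjectionOnto η := by
  unfold coord
  simp only [C.V_base]
  rw [← (stdOrthonormalBasis ℝ (normalSpaceAt M x)).sum_repr'
    ((normalSpaceAt M x).orthogonalProjectionOnto η)]
  refine Finset.sum_congr rfl fun i _ => ?_
  congr 1
  rw [Submodule.coe_inner]
  exact (Submodule.inner_orthogonalProjectionOnto_eq_of_mem_left _ _).symm

end FlatChart

/-- The normal bundle is closed. The limit `η` is normal because its projection to the normal space,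
the limit of the coordinates in the parallel frame, has full length. -/
theorem mem_normalSpaceAt_of_tendsto (hM : IsIsoparametricSubmanifold M)
    {p : ℕ → Euc n × Euc n} {y η : Euc n} (hy : y ∈ M) (hp : ∀ k, (p k).1 ∈ M)
    (hp' : ∀ k, (p k).2 ∈ normalSpaceAt M (p k).1) (hlim : Tendsto p atTop (𝓝 (y, η))) :
    η ∈ normalSpaceAt M y := by
  obtain ⟨C⟩ := hM.exists_flatChart hy
  have h1 : Tendsto (fun k => C.coord (p k).1 (p k).2) atTop (𝓝 (C.coord y η)) :=
    (C.continuousAt_coord (η := η) C.base_mem.2).tendsto.comp hlim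
  have h2 : Tendsto (fun k => ‖C.coord (p k).1 (p k).2‖) atTop (𝓝 ‖C.coord y η‖) := h1.norm
  have h3 : Tendsto (fun k => ‖(p k).2‖) atTop (𝓝 ‖η‖) :=
    ((continuous_snd.tendsto _).comp hlim).norm
  have h4 : ∀ᶠ k in atTop, (p k).1 ∈ C.U :=
    ((continuous_fst.tendsto _).comp hlim).eventually_mem (C.isOpen_U.mem_nhds C.base_mem.2)
  have h5 : ‖C.coord y η‖ = ‖η‖ := by
    refine tendsto_nhds_unique (h2.congr' ?_) h3
    filter_upwards [h4] with k hk
    rw [← C.norm_V hM ⟨hp k, hk⟩, C.V_coord hM ⟨hp k, hk⟩ (hp' k)]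
  rw [C.coord_base_eq] at h5
  have h6 : ‖(normalSpaceAt M y).starProjection η‖ = ‖η‖ := h5
  exact (Submodule.mem_iff_norm_starProjection _ _).2 h6

/-- A parallel-invariant set with closed fibres is closed. -/
theorem IsParallelInvariant.isClosed (hM : IsIsoparametricSubmanifold M) (hMc : IsClosed M)
    {S : Set (Euc n × Euc n)} (hS : IsParallelInvariant M S)
    (hfib : ∀ x ∈ M, IsClosed {ξ | (x, ξ) ∈ S}) : IsClosed S := by
  refine isClosed_of_closure_subset fun q hq => ?_
  obtain ⟨p, hpS, hlim⟩ := mem_closure_iff_seq_limit.1 hq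
  obtain ⟨y, η⟩ := q
  have hy : y ∈ M := hMc.mem_of_tendsto ((continuous_fst.tendsto _).comp hlim)
    (Eventually.of_forall fun k => (hS.mem _ (hpS k)).1)
  have hη : η ∈ normalSpaceAt M y := mem_normalSpaceAt_of_tendsto hM hy
    (fun k => (hS.mem _ (hpS k)).1) (fun k => (hS.mem _ (hpS k)).2) hlim
  obtain ⟨C⟩ := hM.exists_flatChart hy
  have h1 : Tendsto (fun k => (C.coord (p k).1 (p k).2 : Euc n)) atTop (𝓝 (C.coord y η)) :=
    ((continuous_subtype_val.continuousAt.comp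
      (C.continuousAt_coord (η := η) C.base_mem.2))).tendsto.comp hlim
  rw [C.coord_base hM hη] at h1
  have h4 : ∀ᶠ k in atTop, (p k).1 ∈ C.U :=
    ((continuous_fst.tendsto _).comp hlim).eventually_mem (C.isOpen_U.mem_nhds C.base_mem.2)
  refine (hfib y hy).mem_of_tendsto h1 ?_
  filter_upwards [h4] with k hk
  have hk' : (p k).1 ∈ M ∩ C.U := ⟨(hS.mem _ (hpS k)).1, hk⟩
  have h5 := hS.invariant _ C (C.coord (p k).1 (p k).2) _ hk' _ C.base_mem (by
    rw [C.V_coord hM hk' (hS.mem _ (hpS k)).2]; exact hpS k)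
  rwa [C.V_base] at h5

/-! ### Existence of a center -/

/-- The second derivative of a function at a local maximum is nonpositive. -/
theorem deriv_nonpos_of_isLocalMax {f f' : ℝ → ℝ} {f'' a : ℝ}
    (hf : ∀ᶠ s in 𝓝 a, HasDerivAt f (f' s) s) (hf' : HasDerivAt f' f'' a)
    (hmax : IsLocalMax f a) : f'' ≤ 0 := by
  by_contra! hpos
  have h1 : deriv f =ᶠ[𝓝 a] f' := hf.mono fun s hs => hs.deriv
  have h2 : deriv (deriv f) a = f'' := by rw [h1.deriv_eq, hf'.deriv]
  have hmin : IsLocalMin f a := isLocalMin_of_deriv_deriv_pos (h2 ▸ hpos)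
    hmax.deriv_eq_zero hf.self_of_nhds.continuousAt
  have h3 : f =ᶠ[𝓝 a] fun _ => f a := by
    filter_upwards [hmax, hmin] with s h1 h2 using le_antisymm h1 h2
  have h4 : deriv (deriv f) a = 0 := by
    rw [h3.deriv.deriv_eq]
    simp
  linarith

namespace FlatChart

variable {x : Euc n} (C : FlatChart M x)

/-- The bilinear form `tr A_ξ A_η` is parallel. This is the polarization of the constancy of `tr
A_ξ²`. -/
theorem sum_inner_mul_inner_nrm_eq (hM : IsIsoparametricSubmanifold M) (F : PrincipalFrame M x)
    {y : Euc n} (hy : y ∈ M ∩ C.U) (G : PrincipalFrame M y) (ξ η : normalSpaceAt M x) :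
    ∑ b, (⟪C.V ξ y, G.nrm b⟫ : ℝ) * ⟪C.V η y, G.nrm b⟫ =
      ∑ b, (⟪ξ, F.nrm b⟫ : ℝ) * ⟪η, F.nrm b⟫ := by
  have h := fun ζ => C.sum_inner_nrm_eq hM F hy G ζ (fun t => t ^ 2)
  have h1 := h (ξ + η)
  have h2 := h ξ
  have h3 := h η
  simp only [C.V_add, inner_add_left, add_sq, Finset.sum_add_distrib] at h1 h2 h3
  rw [h2, h3] at h1
  have h4 : ∀ (m : ℕ) (a b : Fin m → ℝ), ∑ i, 2 * a i * b i = 2 * ∑ i, a i * b i := by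
    intro m a b
    rw [Finset.mul_sum]
    exact Finset.sum_congr rfl fun i _ => by ring
  rw [h4, h4] at h1
  linarith

/-- If all principal curvatures in the direction `ξ` are `1`, then the parallel translates of `ξ`
all end at the same point. -/
theorem add_V_eq (hM : IsIsoparametricSubmanifold M) (F : PrincipalFrame M x)
    {ξ : normalSpaceAt M x} (hξ : ∀ b, (⟪ξ, F.nrm b⟫ : ℝ) = 1) {y z : Euc n}
    (hy : y ∈ M ∩ C.U) (hz : z ∈ M ∩ C.U) : y + C.V ξ y = z + C.V ξ z := by
  obtain ⟨hs, hsy⟩ := C.g_proj hy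
  obtain ⟨ht, htz⟩ := C.g_proj hz
  have hd : ∀ t ∈ ball (0 : tangentSpaceAt M x) C.ρ,
      HasFDerivAt (fun t => C.g t + C.V ξ (C.g t)) (0 : tangentSpaceAt M x →L[ℝ] Euc n) t := by
    intro t ht
    have h1 := (C.differentiableAt_g ht).hasFDerivAt.add
      ((C.isParallelMap hM ξ).diff_field t ht).hasFDerivAt
    refine h1.congr_fderiv ?_
    ext1 u
    obtain ⟨G⟩ := hM.exists_principalFrame (C.g_mem ht).1
    rw [add_apply, C.fderiv_V_g hM ξ ht]
    have h2 := G.fderiv_eq_sum (C.parallel_V ξ) (C.g_mem ht).2 ⟨_, C.fderiv_g_mem ht u⟩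
    have h3 : ∀ b, (⟪C.V ξ (C.g t), G.nrm b⟫ : ℝ) = 1 := fun b => by
      obtain ⟨b', hb'⟩ := C.exists_inner_nrm_eq hM F (C.g_mem ht) G ξ b
      rw [hb']; exact hξ b'
    have h4 := congrArg Subtype.val (G.e.sum_repr' ⟨_, C.fderiv_g_mem ht u⟩)
    simp only [h3, one_mul] at h2
    simp only [Submodule.coe_sum, Submodule.coe_smul] at h4
    rw [h2, h4]
    simp
  -- the end point map `y ↦ y + V ξ y` has derivative `1 - A_ξ = 0` along `M`
  have h := isOpen_ball.is_const_of_fderiv_eq_zero (convex_ball _ _).isPreconnected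
    (fun t ht => (hd t ht).differentiableAt.differentiableWithinAt)
    (fun t ht => (hd t ht).fderiv) hs ht
  simpa only [hsy, htz] using h

end FlatChart

/-- The system of linear equations `∑ ⟪ζ, ν i⟫ (1 - ⟪ξ, ν i⟫) = 0` (for all `ζ`) has a solution
`ξ`: the functional `ζ ↦ ∑ ⟪ζ, ν i⟫` vanishes on the kernel of the form `∑ ⟪ζ, ν i⟫ ⟪ξ, ν i⟫`. -/
theorem exists_sum_inner_mul_one_sub_eq_zero {N ι : Type*} [NormedAddCommGroup N]
    [InnerProductSpace ℝ N] [FiniteDimensional ℝ N] [Fintype ι] (ν : ι → N) :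
    ∃ ξ : N, ∀ ζ : N, ∑ b, (⟪ζ, ν b⟫ : ℝ) * (1 - ⟪ξ, ν b⟫) = 0 := by
  -- `B` is the symmetric operator of the form `∑ ⟪ζ, ν i⟫ ⟪ξ, ν i⟫`; the equations say `B ξ = ∑ ν
  -- i`, and the right side is orthogonal to `ker B`
  let B : N →ₗ[ℝ] N := ∑ b, (innerSL ℝ (ν b)).toLinearMap.smulRight (ν b)
  have hB : ∀ ξ, B ξ = ∑ b, (⟪ν b, ξ⟫ : ℝ) • ν b := fun ξ => by
    simp [B, LinearMap.sum_apply]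
  have hBi : ∀ ξ ζ, (⟪B ξ, ζ⟫ : ℝ) = ∑ b, (⟪ζ, ν b⟫ : ℝ) * ⟪ξ, ν b⟫ := fun ξ ζ => by
    rw [hB, sum_inner]
    refine Finset.sum_congr rfl fun b _ => ?_
    rw [real_inner_smul_left, real_inner_comm ξ, real_inner_comm ζ, mul_comm]
  have hsymm : B.IsSymmetric := fun ξ ζ => by
    rw [hBi, real_inner_comm, hBi]
    exact Finset.sum_congr rfl fun b _ => mul_comm _ _
  have hH : ∑ b, ν b ∈ LinearMap.range B := by
    rw [← (LinearMap.range B).orthogonal_orthogonal, hsymm.orthogonal_range]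
    refine (Submodule.mem_orthogonal _ _).2 fun k hk => ?_
    have h1 := hBi k k
    rw [LinearMap.mem_ker.1 hk, inner_zero_left] at h1
    have h2 := (Finset.sum_eq_zero_iff_of_nonneg fun b _ => mul_self_nonneg _).1 h1.symm
    rw [inner_sum]
    exact Finset.sum_eq_zero fun b hb => mul_self_eq_zero.1 (h2 b hb)
  obtain ⟨ξ, hξ⟩ := hH
  refine ⟨ξ, fun ζ => ?_⟩
  simp only [mul_sub, mul_one, Finset.sum_sub_distrib]
  rw [← hBi, hξ, sum_inner, ← Finset.sum_sub_distrib]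
  exact Finset.sum_eq_zero fun b _ => by rw [real_inner_comm, sub_self]

/-- The second derivative test for `‖F‖ ^ 2` at a local maximum. -/
theorem norm_fderiv_sq_add_inner_nonpos {E H : Type*} [NormedAddCommGroup E] [NormedSpace ℝ E]
    [NormedAddCommGroup H] [InnerProductSpace ℝ H] {F : E → H} {a : E} (hF : ContDiffAt ℝ 2 F a)
    (hmax : IsLocalMax (fun t => ‖F t‖ ^ 2) a) (e : E) :
    ‖fderiv ℝ F a e‖ ^ 2 + ⟪F a, fderiv ℝ (fderiv ℝ F) a e e⟫ ≤ 0 := by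
  have hd2 : DifferentiableAt ℝ (fderiv ℝ F) a :=
    (hF.fderiv_right (m := 1) (by norm_num)).differentiableAt (by simp)
  have hev : ∀ᶠ t in 𝓝 a, DifferentiableAt ℝ F t :=
    (hF.eventually (by simp)).mono fun t ht => ht.differentiableAt (by simp)
  let ℓ : ℝ → E := fun s => a + s • e
  have hℓ : ∀ s, HasDerivAt ℓ e s := fun s => by
    simpa [ℓ] using ((hasDerivAt_id s).smul_const e).const_add a
  have hℓ0 : ℓ 0 = a := by simp [ℓ]
  have hℓev : Tendsto ℓ (𝓝 0) (𝓝 a) := by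
    have := (hℓ 0).continuousAt.tendsto
    rwa [hℓ0] at this
  have h1 : ∀ᶠ s in 𝓝 (0 : ℝ), HasDerivAt (fun s => ‖F (ℓ s)‖ ^ 2)
      (2 * ⟪F (ℓ s), fderiv ℝ F (ℓ s) e⟫) s := by
    filter_upwards [hℓev.eventually hev] with s hs
    exact (hs.hasFDerivAt.comp_hasDerivAt s (hℓ s)).norm_sq
  have h2 : HasDerivAt (fun s => 2 * (⟪F (ℓ s), fderiv ℝ F (ℓ s) e⟫ : ℝ))
      (2 * (⟪F a, fderiv ℝ (fderiv ℝ F) a e e⟫ + ⟪fderiv ℝ F a e, fderiv ℝ F a e⟫)) 0 := by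
    have ha : HasDerivAt (fun s => F (ℓ s)) (fderiv ℝ F a e) 0 := by
      have : HasFDerivAt F (fderiv ℝ F a) (ℓ 0) := by rw [hℓ0]; exact hev.self_of_nhds.hasFDerivAt
      exact this.comp_hasDerivAt (0 : ℝ) (hℓ 0)
    have hb : HasDerivAt (fun s => fderiv ℝ F (ℓ s) e) (fderiv ℝ (fderiv ℝ F) a e e) 0 := by
      have : HasFDerivAt (fderiv ℝ F) (fderiv ℝ (fderiv ℝ F) a) (ℓ 0) := by
        rw [hℓ0]; exact hd2.hasFDerivAt
      have h3 := (this.comp_hasDerivAt (0 : ℝ) (hℓ 0)).clm_apply (hasDerivAt_const (0 : ℝ) e)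
      simpa using h3
    have h4 := (ha.inner ℝ hb).const_mul 2
    simpa only [hℓ0] using h4
  have h3 : IsLocalMax (fun s => ‖F (ℓ s)‖ ^ 2) 0 := by
    have := hℓev.eventually hmax
    simpa only [IsLocalMax, IsMaxFilter, hℓ0] using this
  have := deriv_nonpos_of_isLocalMax h1 h2 h3
  rw [real_inner_self_eq_norm_sq] at this
  linarith

theorem fderiv_fderiv_add {E F : Type*} [NormedAddCommGroup E] [NormedSpace ℝ E]
    [NormedAddCommGroup F] [NormedSpace ℝ F] {f g : E → F} {a : E} (hf : ContDiffAt ℝ 2 f a)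
    (hg : ContDiffAt ℝ 2 g a) : fderiv ℝ (fderiv ℝ (fun t => f t + g t)) a =
      fderiv ℝ (fderiv ℝ f) a + fderiv ℝ (fderiv ℝ g) a := by
  have h1 : fderiv ℝ (fun t => f t + g t) =ᶠ[𝓝 a] fun t => fderiv ℝ f t + fderiv ℝ g t := by
    filter_upwards [hf.eventually (by simp), hg.eventually (by simp)] with t h1 h2
    exact fderiv_fun_add (h1.differentiableAt (by simp)) (h2.differentiableAt (by simp))
  rw [h1.fderiv_eq]
  exact fderiv_fun_add ((hf.fderiv_right (m := 1) (by norm_num)).differentiableAt (by simp))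
    ((hg.fderiv_right (m := 1) (by norm_num)).differentiableAt (by simp))

theorem inner_orthogonalProjectionOnto_right (T : Submodule ℝ (Euc n)) (u : T) (X : Euc n) :
    (⟪u, T.orthogonalProjectionOnto X⟫ : ℝ) = ⟪(u : Euc n), X⟫ :=
  Submodule.inner_orthogonalProjectionOnto_eq_of_mem_left _ _

namespace FlatChart

variable {x : Euc n} (C : FlatChart M x)

/-- The end point map `t ↦ g t + V ξ (g t)` of the parallel field of `ξ`. -/
noncomputable def endpoint (ξ : normalSpaceAt M x) (t : tangentSpaceAt M x) : Euc n :=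
  C.g t + C.V ξ (C.g t)

theorem contDiffAt_endpoint (ξ : normalSpaceAt M x) {t : tangentSpaceAt M x}
    (ht : t ∈ ball 0 C.ρ) : ContDiffAt ℝ ∞ (C.endpoint ξ) t :=
  (C.contDiffAt_g ht).add (C.contDiffAt_V_g ξ ht)

theorem fderiv_endpoint (hM : IsIsoparametricSubmanifold M) (ξ : normalSpaceAt M x)
    {t : tangentSpaceAt M x} (ht : t ∈ ball 0 C.ρ) (u : tangentSpaceAt M x) :
    fderiv ℝ (C.endpoint ξ) t u =
      fderiv ℝ C.g t u + fderiv ℝ (fun t => C.V ξ (C.g t)) t u := by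
  have h1 := (C.differentiableAt_g ht).hasFDerivAt.add
      ((C.isParallelMap hM ξ).diff_field t ht).hasFDerivAt
  have h2 : fderiv ℝ (C.endpoint ξ) t = _ := h1.fderiv
  rw [h2]; rfl

/-- The derivative of the end point map of `ξ` is `1 - A_ξ`, written in a principal frame. -/
theorem fderiv_endpoint_eq_sum (hM : IsIsoparametricSubmanifold M) (ξ : normalSpaceAt M x)
    {t : tangentSpaceAt M x} (ht : t ∈ ball 0 C.ρ) (G : PrincipalFrame M (C.g t))
    (u : tangentSpaceAt M x) :
    fderiv ℝ (C.endpoint ξ) t u =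
      ∑ b, ((1 - ⟪C.V ξ (C.g t), G.nrm b⟫ : ℝ) * ⟪(G.e b : Euc n), fderiv ℝ C.g t u⟫) •
        (G.e b : Euc n) := by
  rw [C.fderiv_endpoint hM ξ ht, C.fderiv_V_g hM ξ ht]
  have h2 := G.fderiv_eq_sum (C.parallel_V ξ) (C.g_mem ht).2 ⟨_, C.fderiv_g_mem ht u⟩
  have h4 := congrArg Subtype.val (G.e.sum_repr' ⟨_, C.fderiv_g_mem ht u⟩)
  simp only [Submodule.coe_sum, Submodule.coe_smul] at h4
  rw [h2]
  nth_rewrite 1 [← h4]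
  rw [← sub_eq_add_neg, ← Finset.sum_sub_distrib]
  refine Finset.sum_congr rfl fun b _ => ?_
  rw [← sub_smul]
  congr 1
  rw [Submodule.coe_inner]
  ring

/-- The second derivatives of a chart at the base point are normal. -/
theorem fderiv_fderiv_g_mem_normal (u w : tangentSpaceAt M x) :
    fderiv ℝ (fderiv ℝ C.g) 0 u w ∈ normalSpaceAt M x := by
  have hcg : ContDiffAt ℝ 2 C.g 0 := mod_cast contDiffAt_infty.1 (C.contDiffAt_g C.zero_mem) 2
  have hd : DifferentiableAt ℝ (fderiv ℝ C.g) 0 :=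
    (hcg.fderiv_right (m := 1) (by norm_num)).differentiableAt (by simp)
  have h1 := (tangentSpaceAt M x).orthogonalProjectionOnto.hasFDerivAt.comp
    (0 : tangentSpaceAt M x) (hd.hasFDerivAt.clm_apply (hasFDerivAt_const w 0))
  have h2 := h1.unique ((hasFDerivAt_const w (0 : tangentSpaceAt M x)).congr_of_eventuallyEq (by
    filter_upwards [isOpen_ball.mem_nhds C.zero_mem] with t ht using C.proj_fderiv_g ht w))
  have h3 := DFunLike.congr_fun h2 u
  simp at h3
  exact h3

/-- The Codazzi equation for the end point map. -/
theorem inner_fderiv_fderiv_endpoint (hM : IsIsoparametricSubmanifold M) (ξ : normalSpaceAt M x)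
    (s u w : tangentSpaceAt M x) :
    (⟪fderiv ℝ (fderiv ℝ (C.endpoint ξ)) 0 s u, (w : Euc n)⟫ : ℝ) =
      ⟪fderiv ℝ (fderiv ℝ (C.endpoint ξ)) 0 s w, (u : Euc n)⟫ := by
  have hcg : ∀ t ∈ ball (0 : tangentSpaceAt M x) C.ρ, ContDiffAt ℝ 2 C.g t := fun t ht =>
    mod_cast contDiffAt_infty.1 (C.contDiffAt_g ht) 2
  have hcF : ContDiffAt ℝ 2 (C.endpoint ξ) 0 :=
    mod_cast contDiffAt_infty.1 (C.contDiffAt_endpoint ξ C.zero_mem) 2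
  have hdg : DifferentiableAt ℝ (fderiv ℝ C.g) 0 :=
    ((hcg 0 C.zero_mem).fderiv_right (m := 1) (by norm_num)).differentiableAt (by simp)
  have hdF : DifferentiableAt ℝ (fderiv ℝ (C.endpoint ξ)) 0 :=
    (hcF.fderiv_right (m := 1) (by norm_num)).differentiableAt (by simp)
  -- the operator `1 - A_ξ` is symmetric at every point of the chart; differentiate this identity at
  -- the base point
  have hsymm : ∀ t ∈ ball (0 : tangentSpaceAt M x) C.ρ,
      (⟪fderiv ℝ (C.endpoint ξ) t u, fderiv ℝ C.g t w⟫ : ℝ) =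
        ⟪fderiv ℝ (C.endpoint ξ) t w, fderiv ℝ C.g t u⟫ := by
    intro t ht
    have h1 := (C.isParallelMap hM ξ).inner_fderiv_fderiv_base hM ht (hcg t ht) u w
    have h2 := (C.isParallelMap hM ξ).inner_fderiv_fderiv_base hM ht (hcg t ht) w u
    rw [(hcg t ht).isSymmSndFDerivAt (by simp) u w, ← h2] at h1
    rw [C.fderiv_endpoint hM ξ ht, C.fderiv_endpoint hM ξ ht, inner_add_left, inner_add_left, h1,
      real_inner_comm (fderiv ℝ C.g t w) (fderiv ℝ C.g t u)]
  have hder : ∀ u w : tangentSpaceAt M x, HasFDerivAt (fun t =>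
      (⟪fderiv ℝ (C.endpoint ξ) t u, fderiv ℝ C.g t w⟫ : ℝ)) _ 0 := fun u w =>
    (hdF.hasFDerivAt.clm_apply (hasFDerivAt_const u 0)).inner ℝ
      (hdg.hasFDerivAt.clm_apply (hasFDerivAt_const w 0))
  have h3 := (hder u w).unique ((hder w u).congr_of_eventuallyEq (by
    filter_upwards [isOpen_ball.mem_nhds C.zero_mem] with t ht using hsymm t ht))
  have h4 := DFunLike.congr_fun h3 s
  have hT : ∀ u, fderiv ℝ (C.endpoint ξ) 0 u ∈ tangentSpaceAt M x := fun u => by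
    rw [C.fderiv_endpoint hM ξ C.zero_mem]
    have h5 := (C.isParallelMap hM ξ).parallel 0 C.zero_mem u
    rw [C.g_zero] at h5
    refine Submodule.add_mem _ ?_ h5
    rw [C.fderiv_g_zero]
    exact u.2
  have h0 : ∀ u w : tangentSpaceAt M x,
      (⟪fderiv ℝ (C.endpoint ξ) 0 u, fderiv ℝ (fderiv ℝ C.g) 0 s w⟫ : ℝ) = 0 := fun u w => by
    rw [real_inner_comm]
    exact inner_eq_zero_of_mem_normalSpaceAt (C.fderiv_fderiv_g_mem_normal s w) (hT u)
  simp [fderivInnerCLM_apply, h0, C.fderiv_g_zero] at h4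
  exact h4

/-- The trace of the derivative of the end point map is constant. -/
theorem sum_inner_fderiv_endpoint (hM : IsIsoparametricSubmanifold M) (F : PrincipalFrame M x)
    (ξ : normalSpaceAt M x) {t : tangentSpaceAt M x} (ht : t ∈ ball 0 C.ρ) :
    ∑ b, (⟪fderiv ℝ (C.endpoint ξ) t (F.e b), (F.e b : Euc n)⟫ : ℝ) =
      ∑ b, (1 - ⟪ξ, F.nrm b⟫ : ℝ) := by
  obtain ⟨G⟩ := hM.exists_principalFrame (C.g_mem ht).1
  rw [← C.sum_inner_nrm_eq hM F (C.g_mem ht) G ξ fun r => 1 - r]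
  simp only [C.fderiv_endpoint_eq_sum hM ξ ht G, sum_inner]
  rw [Finset.sum_comm]
  refine Finset.sum_congr rfl fun b _ => ?_
  have h1 : ∑ i, (⟪(F.e i : Euc n), (G.e b : Euc n)⟫ : ℝ) • fderiv ℝ C.g t (F.e i) = G.e b := by
    have h2 := F.e.sum_repr' ((tangentSpaceAt M x).orthogonalProjectionOnto (G.e b : Euc n))
    have h3 := congrArg (fderiv ℝ C.g t) h2
    rw [map_sum, C.fderiv_g_proj ht (G.e b).2] at h3
    simp only [map_smul, inner_orthogonalProjectionOnto_right] at h3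
    exact h3
  have h4 : (⟪(G.e b : Euc n), (G.e b : Euc n)⟫ : ℝ) = 1 := by
    rw [real_inner_self_eq_norm_sq, ← Submodule.coe_norm, G.e.orthonormal.1 b, one_pow]
  nth_rewrite 2 [← h1] at h4
  rw [inner_sum] at h4
  calc _ = (1 - ⟪C.V ξ (C.g t), G.nrm b⟫ : ℝ) * ∑ i, ⟪(G.e b : Euc n),
        (⟪(F.e i : Euc n), (G.e b : Euc n)⟫ : ℝ) • fderiv ℝ C.g t (F.e i)⟫ := by
        rw [Finset.mul_sum]
        refine Finset.sum_congr rfl fun i _ => ?_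
        rw [real_inner_smul_left, real_inner_smul_right, real_inner_comm (F.e i : Euc n)]
        ring
    _ = _ := by rw [h4, mul_one]

/-- If the trace of `A_ζ (1 - A_ξ)` vanishes for all `ζ`, then the end point map of `ξ` has
vanishing Laplacian at the base point. -/
theorem sum_fderiv_fderiv_endpoint_eq_zero (hM : IsIsoparametricSubmanifold M)
    (F : PrincipalFrame M x) {ξ : normalSpaceAt M x}
    (hξ : ∀ ζ : normalSpaceAt M x, ∑ b, (⟪ζ, F.nrm b⟫ : ℝ) * (1 - ⟪ξ, F.nrm b⟫) = 0) :
    ∑ b, fderiv ℝ (fderiv ℝ (C.endpoint ξ)) 0 (F.e b) (F.e b) = 0 := by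
  have hcg : ContDiffAt ℝ 2 C.g 0 := mod_cast contDiffAt_infty.1 (C.contDiffAt_g C.zero_mem) 2
  have hcw : ContDiffAt ℝ 2 (fun t => C.V ξ (C.g t)) 0 :=
    mod_cast contDiffAt_infty.1 (C.contDiffAt_V_g ξ C.zero_mem) 2
  have hcF : ContDiffAt ℝ 2 (C.endpoint ξ) 0 :=
    mod_cast contDiffAt_infty.1 (C.contDiffAt_endpoint ξ C.zero_mem) 2
  have hdF : DifferentiableAt ℝ (fderiv ℝ (C.endpoint ξ)) 0 :=
    (hcF.fderiv_right (m := 1) (by norm_num)).differentiableAt (by simp)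
  have hF2 : fderiv ℝ (fderiv ℝ (C.endpoint ξ)) 0 =
      fderiv ℝ (fderiv ℝ C.g) 0 + fderiv ℝ (fderiv ℝ (fun t => C.V ξ (C.g t))) 0 :=
    fderiv_fderiv_add hcg hcw
  have hdV : ∀ (ζ : normalSpaceAt M x) b, fderiv ℝ (fun t => C.V ζ (C.g t)) 0 (F.e b) =
      -(⟪ζ, F.nrm b⟫ : ℝ) • (F.e b : Euc n) := fun ζ b => by
    rw [C.fderiv_V_g hM ζ C.zero_mem, C.fderiv_g_zero, C.g_zero,
      F.eigen _ _ (C.parallel_V ζ) C.base_mem.2, C.V_base, Submodule.coe_inner]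
  have hee : ∀ b, (⟪(F.e b : Euc n), (F.e b : Euc n)⟫ : ℝ) = 1 := fun b => by
    rw [real_inner_self_eq_norm_sq, ← Submodule.coe_norm, F.e.orthonormal.1 b, one_pow]
  -- the normal part is the trace of `A_ζ (1 - A_ξ)`
  have hnormal : ∀ ζ ∈ normalSpaceAt M x,
      (⟪∑ b, fderiv ℝ (fderiv ℝ (C.endpoint ξ)) 0 (F.e b) (F.e b), ζ⟫ : ℝ) = 0 := by
    intro ζ hζ
    rw [← hξ ⟨ζ, hζ⟩, sum_inner]
    refine Finset.sum_congr rfl fun b _ => ?_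
    have h1 := (C.isParallelMap hM ⟨ζ, hζ⟩).inner_fderiv_fderiv_base hM C.zero_mem hcg
      (F.e b) (F.e b)
    have h2 := (C.isParallelMap hM ξ).inner_fderiv_fderiv (C.isParallelMap hM ⟨ζ, hζ⟩)
      C.zero_mem hcw (F.e b) (F.e b)
    rw [hdV, C.fderiv_g_zero, C.g_zero, C.V_base, real_inner_smul_left, hee] at h1
    rw [hdV, hdV, C.g_zero, C.V_base, real_inner_smul_left, real_inner_smul_right, hee] at h2
    rw [hF2, add_apply, add_apply, inner_add_left]
    have h3 := real_inner_comm ζ (fderiv ℝ (fderiv ℝ C.g) 0 (F.e b) (F.e b))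
    linear_combination h3 + h1 + h2
  -- by the Codazzi equation the tangential part is the derivative of the trace of `1 - A_ξ`, which
  -- is constant
  have htan : ∀ Z ∈ tangentSpaceAt M x,
      (⟪∑ b, fderiv ℝ (fderiv ℝ (C.endpoint ξ)) 0 (F.e b) (F.e b), Z⟫ : ℝ) = 0 := by
    intro Z hZ
    have h1 : ∀ b, (⟪fderiv ℝ (fderiv ℝ (C.endpoint ξ)) 0 (F.e b) (F.e b), Z⟫ : ℝ) =
        ⟪fderiv ℝ (fderiv ℝ (C.endpoint ξ)) 0 ⟨Z, hZ⟩ (F.e b), F.e b⟫ := fun b => by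
      rw [C.inner_fderiv_fderiv_endpoint hM ξ (F.e b) (F.e b) ⟨Z, hZ⟩,
        hcF.isSymmSndFDerivAt (by simp) (F.e b) ⟨Z, hZ⟩]
    rw [sum_inner]
    simp only [h1]
    have h2 : HasFDerivAt (fun t => ∑ b, (⟪fderiv ℝ (C.endpoint ξ) t (F.e b),
        (F.e b : Euc n)⟫ : ℝ)) _ 0 := HasFDerivAt.fun_sum fun b (_ : b ∈ Finset.univ) =>
      (hdF.hasFDerivAt.clm_apply (hasFDerivAt_const (F.e b) 0)).inner ℝ
        (hasFDerivAt_const (F.e b : Euc n) 0)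
    have h3 := h2.unique ((hasFDerivAt_const (∑ b, (1 - ⟪ξ, F.nrm b⟫ : ℝ))
      (0 : tangentSpaceAt M x)).congr_of_eventuallyEq (by
      filter_upwards [isOpen_ball.mem_nhds C.zero_mem] with t ht
        using C.sum_inner_fderiv_endpoint hM F ξ ht))
    have h4 := DFunLike.congr_fun h3 ⟨Z, hZ⟩
    simpa [fderivInnerCLM_apply, sum_apply] using h4
  set Y := ∑ b, fderiv ℝ (fderiv ℝ (C.endpoint ξ)) 0 (F.e b) (F.e b) with hY
  have hYn : Y ∈ normalSpaceAt M x := (Submodule.mem_orthogonal' _ _).2 htan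
  exact inner_self_eq_zero.1 (hnormal Y hYn)

end FlatChart

/-- If the end point map has vanishing Laplacian and its norm has a local maximum at the base point,
then its derivative `1 - A_ξ` vanishes there. -/
theorem FlatChart.inner_nrm_eq_one_of_isLocalMax (hM : IsIsoparametricSubmanifold M) {x : Euc n}
    (C : FlatChart M x) (F : PrincipalFrame M x) {ξ : normalSpaceAt M x}
    (hξ : ∀ ζ : normalSpaceAt M x, ∑ b, (⟪ζ, F.nrm b⟫ : ℝ) * (1 - ⟪ξ, F.nrm b⟫) = 0)
    (hloc : IsLocalMax (fun t => ‖C.endpoint ξ t‖ ^ 2) 0) (b) : (⟪ξ, F.nrm b⟫ : ℝ) = 1 := by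
  have hcF : ContDiffAt ℝ 2 (C.endpoint ξ) 0 :=
    mod_cast contDiffAt_infty.1 (C.contDiffAt_endpoint ξ C.zero_mem) 2
  have h1 := fun b => norm_fderiv_sq_add_inner_nonpos hcF hloc (F.e b)
  have h2 := C.sum_fderiv_fderiv_endpoint_eq_zero hM F hξ
  have h3 : ∑ b, ‖fderiv ℝ (C.endpoint ξ) 0 (F.e b)‖ ^ 2 ≤ 0 := by
    have h4 := Finset.sum_nonpos fun b (_ : b ∈ Finset.univ) => h1 b
    rwa [Finset.sum_add_distrib, ← inner_sum, h2, inner_zero_right, add_zero] at h4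
  have h4 : fderiv ℝ (C.endpoint ξ) 0 (F.e b) = 0 := by
    have h5 := (Finset.sum_eq_zero_iff_of_nonneg fun b _ => sq_nonneg _).1
      (le_antisymm h3 (Finset.sum_nonneg fun b _ => sq_nonneg _)) b (Finset.mem_univ b)
    exact norm_eq_zero.1 (pow_eq_zero_iff two_ne_zero |>.1 h5)
  rw [C.fderiv_endpoint hM _ C.zero_mem, C.fderiv_V_g hM _ C.zero_mem, C.fderiv_g_zero, C.g_zero,
    F.eigen _ _ (C.parallel_V _) C.base_mem.2, C.V_base] at h4
  have h6 : (1 - ⟪ξ, F.nrm b⟫ : ℝ) • (F.e b : Euc n) = 0 := by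
    rw [← h4, sub_smul, one_smul, neg_smul, sub_eq_add_neg, Submodule.coe_inner]
  rcases smul_eq_zero.1 h6 with h | h
  · linarith
  · have := F.e.orthonormal.1 b
    rw [Submodule.coe_norm, h, norm_zero] at this
    exact absurd this zero_ne_one

theorem FlatChart.sum_inner_mul_one_sub_eq (hM : IsIsoparametricSubmanifold M) {x : Euc n}
    (C : FlatChart M x) (F : PrincipalFrame M x) (ξ ζ : normalSpaceAt M x) {y : Euc n}
    (hy : y ∈ M ∩ C.U) (G : PrincipalFrame M y) :
    ∑ b, (⟪C.V ζ y, (G.nrm b : Euc n)⟫ : ℝ) * (1 - ⟪C.V ξ y, (G.nrm b : Euc n)⟫) =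
      ∑ b, (⟪ζ, F.nrm b⟫ : ℝ) * (1 - ⟪ξ, F.nrm b⟫) := by
  simp only [mul_sub, mul_one, Finset.sum_sub_distrib]
  rw [C.sum_inner_mul_inner_nrm_eq hM F hy G, C.sum_inner_nrm_eq hM F hy G ζ fun r => r]

/-- The normal vectors `ξ` of `M` with `tr A_ζ (1 - A_ξ) = 0` for all normal vectors `ζ`. -/
def traceOneNormals {n : ℕ} (M : Set (Euc n)) : Set (Euc n × Euc n) :=
  {p | p.1 ∈ M ∧ p.2 ∈ normalSpaceAt M p.1 ∧
    ∀ (G : PrincipalFrame M p.1), ∀ ζ ∈ normalSpaceAt M p.1,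
      ∑ b, (⟪ζ, (G.nrm b : Euc n)⟫ : ℝ) * (1 - ⟪p.2, (G.nrm b : Euc n)⟫) = 0}

theorem isParallelInvariant_traceOneNormals (hM : IsIsoparametricSubmanifold M) :
    IsParallelInvariant M (traceOneNormals M) := by
  refine ⟨fun p hp => ⟨hp.1, hp.2.1⟩, ?_⟩
  rintro x C ξ y hy z hz ⟨hy1, hy2, hyS⟩
  refine ⟨hz.1, C.V_mem hz ξ, fun G ζ hζ => ?_⟩
  obtain ⟨ζ, rfl⟩ := C.exists_V_eq hM hz hζ
  obtain ⟨F⟩ := hM.exists_principalFrame C.base_mem.1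
  obtain ⟨H⟩ := hM.exists_principalFrame hy.1
  exact (C.sum_inner_mul_one_sub_eq hM F ξ ζ hz G).trans
    ((C.sum_inner_mul_one_sub_eq hM F ξ ζ hy H).symm.trans (hyS H _ (C.V_mem hy ζ)))

theorem isClosed_traceOneNormals (hM : IsIsoparametricSubmanifold M) (hMc : IsClosed M) :
    IsClosed (traceOneNormals M) := by
  refine (isParallelInvariant_traceOneNormals hM).isClosed hM hMc fun x hx => ?_
  have : {ξ | (x, ξ) ∈ traceOneNormals M} = (normalSpaceAt M x : Set (Euc n)) ∩
      ⋂ (G : PrincipalFrame M x) (ζ : normalSpaceAt M x),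
      {ξ | ∑ b, (⟪(ζ : Euc n), (G.nrm b : Euc n)⟫ : ℝ) *
        (1 - ⟪ξ, (G.nrm b : Euc n)⟫) = 0} := by
    ext ξ
    simp only [traceOneNormals, mem_ofPred_eq, mem_inter_iff, mem_iInter, SetLike.mem_coe]
    exact ⟨fun h => ⟨h.2.1, fun G ζ => h.2.2 G ζ ζ.2⟩,
      fun h => ⟨hx, h.1, fun G ζ hζ => h.2 G ⟨ζ, hζ⟩⟩⟩
  rw [this]
  refine (Submodule.closed_of_finiteDimensional _).inter
    (isClosed_iInter fun G => isClosed_iInter fun ζ => isClosed_eq ?_ continuous_const)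
  fun_prop

theorem exists_mem_traceOneNormals (hM : IsIsoparametricSubmanifold M) {x : Euc n} (hx : x ∈ M) :
    ∃ ξ, (x, ξ) ∈ traceOneNormals M := by
  obtain ⟨F⟩ := hM.exists_principalFrame hx
  obtain ⟨C⟩ := hM.exists_flatChart hx
  obtain ⟨ξ, hξ⟩ := exists_sum_inner_mul_one_sub_eq_zero F.nrm
  refine ⟨ξ, hx, ξ.2, fun G ζ hζ => ?_⟩
  have := C.sum_inner_mul_one_sub_eq hM F ξ ⟨ζ, hζ⟩ C.base_mem G
  rw [C.V_base, C.V_base] at this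
  exact this.trans (hξ _)

/-- Parallel translation preserves lengths, so it suffices to maximize over vectors of bounded
length. -/
theorem exists_isMax_traceOneNormals (hM : IsIsoparametricSubmanifold M) (hMc : IsCompact M) :
    ∃ y ξ, (y, ξ) ∈ traceOneNormals M ∧ ∀ z ζ, (z, ζ) ∈ traceOneNormals M → ‖ζ‖ = ‖ξ‖ →
      ‖z + ζ‖ ≤ ‖y + ξ‖ := by
  obtain ⟨x0, hx0⟩ := hM.connected.nonempty
  obtain ⟨ξ0, hξ0⟩ := exists_mem_traceOneNormals hM hx0
  have hK : IsCompact (traceOneNormals M ∩ M ×ˢ closedBall (0 : Euc n) ‖ξ0‖) :=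
    (hMc.prod (isCompact_closedBall _ _)).inter_left (isClosed_traceOneNormals hM hMc.isClosed)
  have hcont : Continuous fun p : Euc n × Euc n => ‖p.1 + p.2‖ := by fun_prop
  obtain ⟨⟨y, ξ⟩, ⟨hyS, hyM, hyb⟩, hmax⟩ := hK.exists_isMaxOn
    ⟨(x0, ξ0), hξ0, hx0, by simp⟩ hcont.continuousOn
  refine ⟨y, ξ, hyS, fun z ζ h hn => hmax (a := (z, ζ)) ⟨h, h.1, ?_⟩⟩
  rw [mem_closedBall_zero_iff] at hyb ⊢
  exact hn.le.trans hyb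

/-- A compact isoparametric submanifold has a normal vector all of whose principal curvatures
are `1`: among the normal vectors `ξ` with `tr A_ζ (1 - A_ξ) = 0` for all `ζ`, up to some length,
take one whose end point is farthest from the origin. -/
theorem exists_inner_nrm_eq_one (hM : IsIsoparametricSubmanifold M) (hMc : IsCompact M) :
    ∃ y ∈ M, ∃ ξ : normalSpaceAt M y, ∃ F : PrincipalFrame M y,
      ∀ b, (⟪ξ, F.nrm b⟫ : ℝ) = 1 := by
  obtain ⟨y, ξ, ⟨hyM, hξ, htr⟩, hmax⟩ := exists_isMax_traceOneNormals hM hMc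
  replace hyM : y ∈ M := hyM
  obtain ⟨C⟩ := hM.exists_flatChart hyM
  obtain ⟨F⟩ := hM.exists_principalFrame hyM
  obtain ⟨ξ, rfl⟩ : ∃ ξ' : normalSpaceAt M y, (ξ' : Euc n) = ξ := ⟨⟨ξ, hξ⟩, rfl⟩
  refine ⟨y, hyM, ξ, F, C.inner_nrm_eq_one_of_isLocalMax hM F (fun ζ => htr F ζ ζ.2) ?_⟩
  filter_upwards [isOpen_ball.mem_nhds C.zero_mem] with t ht
  have h1 := (isParallelInvariant_traceOneNormals hM).invariant _ C ξ _ C.base_mem _ (C.g_mem ht)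
    (by rw [C.V_base]; exact ⟨hyM, hξ, htr⟩)
  have h3 := hmax _ _ h1 (by rw [C.norm_V hM (C.g_mem ht), Submodule.coe_norm])
  simp only [FlatChart.endpoint, C.g_zero, C.V_base]
  gcongr

/-- `c` is a center of `M`: the position vectors of `M` with respect to `c` are normal. -/
def IsCenter {n : ℕ} (M : Set (Euc n)) (c : Euc n) : Prop :=
  ∀ y ∈ M, y - c ∈ normalSpaceAt M y

/-- If all principal curvatures in the direction `ξ` are `1`, then the end point of `ξ` is a
center. -/
theorem isCenter_of_inner_nrm_eq_one (hM : IsIsoparametricSubmanifold M) {y ξ : Euc n} (hy : y ∈ M)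
    (hξ : ξ ∈ normalSpaceAt M y) (F : PrincipalFrame M y)
    (hF : ∀ b, (⟪ξ, (F.nrm b : Euc n)⟫ : ℝ) = 1) : IsCenter M (y + ξ) := by
  -- `D z`: the vector from `z` to the end point is normal with all principal curvatures `1`; this
  -- is an open and closed condition on `z ∈ M`
  let D : Euc n → Prop := fun z => y + ξ - z ∈ normalSpaceAt M z ∧
    ∃ G : PrincipalFrame M z, ∀ b, (⟪y + ξ - z, (G.nrm b : Euc n)⟫ : ℝ) = 1
  have hloc : ∀ (x : Euc n) (C : FlatChart M x), ∀ z ∈ M ∩ C.U, ∀ z' ∈ M ∩ C.U,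
      D z → D z' := by
    rintro x C z hz z' hz' ⟨hzn, G, hG⟩
    obtain ⟨F⟩ := hM.exists_principalFrame C.base_mem.1
    obtain ⟨H⟩ := hM.exists_principalFrame hz'.1
    obtain ⟨η, hη⟩ := C.exists_V_eq hM hz hzn
    have h1 : ∀ b, (⟪η, F.nrm b⟫ : ℝ) = 1 := fun b => by
      obtain ⟨b', hb'⟩ := C.exists_inner_nrm_eq' hM F hz G η b
      rw [← hb', hη]; exact hG b'
    have h2 : y + ξ - z' = C.V η z' := by
      have := C.add_V_eq hM F h1 hz hz'
      rw [hη] at this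
      rw [sub_eq_iff_eq_add', ← this]; abel
    refine ⟨h2 ▸ C.V_mem hz' η, H, fun b => ?_⟩
    obtain ⟨b', hb'⟩ := C.exists_inner_nrm_eq hM F hz' H η b
    rw [h2, hb', h1]
  have hall : ∀ z ∈ M, D z := by
    intro z hz
    refine hM.connected.isPreconnected.induction₂' (fun a b => D a → D b) (fun a ha => ?_)
      (fun a b c _ _ _ hab hbc h => hbc (hab h)) hy hz ?_
    · obtain ⟨C⟩ := hM.exists_flatChart ha
      filter_upwards [self_mem_nhdsWithin, mem_nhdsWithin_of_mem_nhds
        (C.isOpen_U.mem_nhds C.base_mem.2)] with b hb hbU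
      exact ⟨hloc a C a C.base_mem b ⟨hb, hbU⟩, hloc a C b ⟨hb, hbU⟩ a C.base_mem⟩
    · exact ⟨by simpa using hξ, F, by simpa using hF⟩
  intro z hz
  rw [← neg_sub]
  exact Submodule.neg_mem _ (hall z hz).1

theorem exists_isCenter (hM : IsIsoparametricSubmanifold M) (hMc : IsCompact M) :
    ∃ c, IsCenter M c := by
  obtain ⟨y, hy, ξ, F, hF⟩ := exists_inner_nrm_eq_one hM hMc
  exact ⟨y + ξ, isCenter_of_inner_nrm_eq_one hM hy ξ.2 F hF⟩

theorem IsCenter.isParallelNormalField {c : Euc n} (hc : IsCenter M c) :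
    IsParallelNormalField M univ fun y => y - c := by
  refine ⟨isOpen_univ, by fun_prop, fun x hx => ⟨hc x hx.1, fun X hX => ?_⟩⟩
  simpa only [fderiv_sub_const, fderiv_fun_id, ContinuousLinearMap.id_apply] using hX

/-- All principal curvatures in the direction of the position vector are `-1`. -/
theorem IsCurvatureNormal.inner_sub_center {x ν e c : Euc n} (h : IsCurvatureNormal M x ν e)
    (hc : IsCenter M c) : (⟪x - c, ν⟫ : ℝ) = -1 := by
  have h1 := h.eigen _ _ hc.isParallelNormalField (mem_univ x)
  simp only [fderiv_sub_const, fderiv_fun_id, ContinuousLinearMap.id_apply] at h1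
  have h2 : (1 + ⟪x - c, ν⟫ : ℝ) • e = 0 := by
    rw [add_smul, one_smul]
    nth_rewrite 1 [h1]
    rw [neg_smul, neg_add_cancel]
  rcases smul_eq_zero.1 h2 with h3 | h3
  · linarith
  · have := h.unit
    simp [h3] at this

theorem IsCurvatureNormal.ne_zero {x ν e c : Euc n} (h : IsCurvatureNormal M x ν e)
    (hc : IsCenter M c) : ν ≠ 0 := by
  rintro rfl
  have := h.inner_sub_center hc
  simp at this

/-! ### A constant rank theorem -/

/-- A constant rank theorem: if `DF` is bounded below on its own range (after the projection `P`),
then `F` is constant along a slice `Y` modelled on the kernel of `DF(0)`, and the range of `DF` does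
not shrink along this slice. -/
theorem exists_kernel_slice {T H : Type*} [NormedAddCommGroup T] [InnerProductSpace ℝ T]
    [FiniteDimensional ℝ T] [NormedAddCommGroup H] [NormedSpace ℝ H] {F : T → H} {ρ : ℝ}
    (hρ : 0 < ρ) (hF : ContDiffOn ℝ ∞ F (ball 0 ρ)) (P : H →L[ℝ] T) (hP : ∀ h, ‖P h‖ ≤ ‖h‖)
    {c : ℝ} (hc : 0 < c)
    (hsymm : ∀ u w, (⟪P (fderiv ℝ F 0 u), w⟫ : ℝ) = ⟪u, P (fderiv ℝ F 0 w)⟫)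
    (hlow : ∀ t ∈ ball (0 : T) ρ, ∀ w, c * ‖fderiv ℝ F t w‖ ≤
      ‖fderiv ℝ F t (P (fderiv ℝ F t w))‖) :
    ∃ r > 0, ∃ Y : T → T, Y 0 = 0 ∧ ContinuousAt Y 0 ∧ ∀ u ∈ ball (0 : T) r,
      fderiv ℝ F 0 u = 0 → DifferentiableAt ℝ Y u ∧ Y u ∈ ball 0 ρ ∧
      (∀ w, fderiv ℝ F 0 w = 0 → (⟪Y u, w⟫ : ℝ) = ⟪u, w⟫) ∧
      (∀ w, fderiv ℝ F 0 w = 0 → fderiv ℝ F (Y u) (fderiv ℝ Y u w) = 0) ∧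
      ∀ w, ∃ w', fderiv ℝ F (Y u) w' = fderiv ℝ F 0 w := by
  let D : T →L[ℝ] H := fderiv ℝ F 0
  let E : Submodule ℝ T := D.ker
  have hmemE : ∀ w, w ∈ E ↔ fderiv ℝ F 0 w = 0 := fun w => LinearMap.mem_ker
  let π : T →L[ℝ] T := Eᗮ.starProjection
  let πE : T →L[ℝ] T := E.starProjection
  have h0 : (0 : T) ∈ ball (0 : T) ρ := mem_ball_self hρ
  have hFat : ∀ t ∈ ball (0 : T) ρ, ContDiffAt ℝ ∞ F t := fun t ht =>
    hF.contDiffAt (isOpen_ball.mem_nhds ht)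
  have hFd : ∀ t ∈ ball (0 : T) ρ, DifferentiableAt ℝ F t := fun t ht =>
    (hFat t ht).differentiableAt (by simp)
  -- near `0`, `Θ` is a coordinate system adapted to the splitting `Eᗮ ⊕ E`, where `E` is the kernel
  -- of `DF(0)`: the `Eᗮ`-part is the projection of `F`. The slice map `Y` is its inverse.
  let Θ : T → T := fun t => π (P (F t - F 0)) + πE t
  have hΘ : ContDiffAt ℝ ∞ Θ 0 := by
    have := hFat 0 h0
    fun_prop
  have hΘ0 : Θ 0 = 0 := by simp [Θ]
  let L : T →L[ℝ] T := π.comp (P.comp D) + πE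
  have hL : HasFDerivAt Θ L 0 :=
    (π.hasFDerivAt.comp (0 : T) (P.hasFDerivAt.comp (0 : T)
      ((hFd 0 h0).hasFDerivAt.sub_const (F 0)))).add πE.hasFDerivAt
  have hππ : ∀ u, π (π u) = π u := fun u =>
    Submodule.starProjection_eq_self_iff.2 (Submodule.starProjection_apply_mem _ u)
  have hππE : ∀ u, π (πE u) = 0 := fun u =>
    (Submodule.starProjection_apply_eq_zero_iff _).2
      (Submodule.le_orthogonal_orthogonal E (Submodule.starProjection_apply_mem _ u))
  have hπEπ : ∀ u, πE (π u) = 0 := fun u =>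
    (Submodule.starProjection_apply_eq_zero_iff _).2 (Submodule.starProjection_apply_mem _ u)
  have hπEπE : ∀ u, πE (πE u) = πE u := fun u =>
    Submodule.starProjection_eq_self_iff.2 (Submodule.starProjection_apply_mem _ u)
  have hrange : ∀ w, P (D w) ∈ Eᗮ := fun w => (Submodule.mem_orthogonal _ _).2 fun u hu => by
    rw [← hsymm, (hmemE u).1 hu, map_zero, inner_zero_left]
  -- on the kernel of `P ∘ DF(0)` the lower bound gives `DF(0) = 0`, so `L` is injective
  have hLinj : Function.Injective L := by
    refine (injective_iff_map_eq_zero L).2 fun w hw => ?_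
    have h1 : π (P (D w)) + πE w = 0 := hw
    have h2 : P (D w) = 0 := by
      have := congrArg π h1
      rw [map_add, hππ, hππE, add_zero, map_zero] at this
      rwa [show π (P (D w)) = P (D w) from Submodule.starProjection_eq_self_iff.2 (hrange w)] at this
    have h3 : D w = 0 := by
      have h4 := hlow 0 h0 w
      have h5 : fderiv ℝ F 0 (P (fderiv ℝ F 0 w)) = 0 := by
        rw [show P (fderiv ℝ F 0 w) = 0 from h2, map_zero]
      rw [h5, norm_zero] at h4
      exact norm_le_zero_iff.1 (nonpos_of_mul_nonpos_right h4 hc)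
    have h6 : πE w = w := Submodule.starProjection_eq_self_iff.2 ((hmemE w).2 h3)
    rw [h2, map_zero, zero_add, h6] at h1
    exact h1
  let Λ : T ≃L[ℝ] T := (LinearEquiv.ofInjectiveEndo (L : T →ₗ[ℝ] T) hLinj).toContinuousLinearEquiv
  have hΛ : (Λ : T →L[ℝ] T) = L := by ext u; rfl
  have hL' : HasFDerivAt Θ (Λ : T →L[ℝ] T) 0 := by rw [hΛ]; exact hL
  let Y : T → T := hΘ.localInverse hL' (by simp)
  have hY0 : Y 0 = 0 := by
    have := hΘ.localInverse_apply_image hL' (by simp)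
    rwa [hΘ0] at this
  have hYs : ContDiffAt ℝ ∞ Y 0 := by
    have := hΘ.to_localInverse hL' (by simp)
    rwa [hΘ0] at this
  have hYc : ContinuousAt Y 0 := hYs.continuousAt
  have hYd : ∀ᶠ s in 𝓝 (0 : T), DifferentiableAt ℝ Y s := by
    have h1 : ContDiffAt ℝ 1 Y 0 := mod_cast contDiffAt_infty.1 hYs 1
    exact (h1.eventually (by simp)).mono fun s hs => hs.differentiableAt (by simp)
  have hΘY : ∀ᶠ s in 𝓝 (0 : T), Θ (Y s) = s := by
    have := (hΘ.hasStrictFDerivAt' hL' (by simp)).eventually_right_inverse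
    rwa [hΘ0] at this
  have hsmall : ∀ᶠ t in 𝓝 (0 : T), t ∈ ball (0 : T) ρ ∧ ‖fderiv ℝ F t - D‖ < c / 2 := by
    refine (isOpen_ball.eventually_mem h0).and ?_
    have h1 : ContinuousAt (fderiv ℝ F) 0 :=
      (hF.continuousOn_fderiv_of_isOpen isOpen_ball (by simp)).continuousAt
        (isOpen_ball.mem_nhds h0)
    have h2 := h1.eventually (Metric.ball_mem_nhds (fderiv ℝ F 0) (half_pos hc))
    exact h2.mono fun t ht => by rwa [← dist_eq_norm]
  have hYsmall : ∀ᶠ s in 𝓝 (0 : T), Y s ∈ ball (0 : T) ρ ∧ ‖fderiv ℝ F (Y s) - D‖ < c / 2 := by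
    have h1 : Tendsto Y (𝓝 0) (𝓝 0) := by
      have := hYc.tendsto
      rwa [hY0] at this
    exact h1.eventually hsmall
  obtain ⟨r, hr, hball⟩ := Metric.eventually_nhds_iff_ball.1 (hYd.and (hΘY.and hYsmall))
  have hdFY : ∀ s ∈ ball (0 : T) r, HasFDerivAt (fun s => F (Y s))
      ((fderiv ℝ F (Y s)).comp (fderiv ℝ Y s)) s := fun s hs =>
    (hFd _ (hball s hs).2.2.1).hasFDerivAt.comp s (hball s hs).1.hasFDerivAt
  -- `F ∘ Y` does not change in the directions of `E`
  have hkey : ∀ s ∈ ball (0 : T) r, ∀ u ∈ E, fderiv ℝ F (Y s) (fderiv ℝ Y s u) = 0 := by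
    intro s hs u hu
    set Z := fderiv ℝ F (Y s) (fderiv ℝ Y s u) with hZ
    have h1 : HasFDerivAt (fun s => π (P (F (Y s) - F 0)))
        (π.comp (P.comp ((fderiv ℝ F (Y s)).comp (fderiv ℝ Y s)))) s :=
      π.hasFDerivAt.comp s (P.hasFDerivAt.comp s ((hdFY s hs).sub_const (F 0)))
    have h2 : (fun s => π (P (F (Y s) - F 0))) =ᶠ[𝓝 s] π := by
      filter_upwards [isOpen_ball.mem_nhds hs] with s' hs'
      have h3 := congrArg π (hball s' hs').2.1
      simp only [Θ, map_add, hππ, hππE, add_zero] at h3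
      exact h3
    have h3 := DFunLike.congr_fun (h1.unique (π.hasFDerivAt.congr_of_eventuallyEq h2)) u
    have h4 : π (P Z) = 0 := by
      have h5 : π u = 0 := (Submodule.starProjection_apply_eq_zero_iff _).2
        (Submodule.le_orthogonal_orthogonal E hu)
      rw [← h5]; exact h3
    -- `P Z` is killed by `DF(0)`, so `DF(Y s)`, which is close to `DF(0)`, is small on it; this
    -- contradicts the lower bound unless `Z = 0`
    have h5 : P Z ∈ E := by
      have := (Submodule.starProjection_apply_eq_zero_iff _).1 h4
      rwa [Submodule.orthogonal_orthogonal] at this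
    have h6 := hlow (Y s) (hball s hs).2.2.1 (fderiv ℝ Y s u)
    rw [← hZ] at h6
    have h7 : ‖fderiv ℝ F (Y s) (P Z)‖ ≤ c / 2 * ‖Z‖ := by
      have h8 : fderiv ℝ F (Y s) (P Z) = (fderiv ℝ F (Y s) - D) (P Z) := by
        rw [sub_apply, show D (P Z) = 0 from (hmemE _).1 h5, sub_zero]
      rw [h8]
      refine (ContinuousLinearMap.le_opNorm _ _).trans ?_
      exact mul_le_mul (hball s hs).2.2.2.le (hP Z) (norm_nonneg _) (half_pos hc).le
    have h9 : c / 2 * ‖Z‖ ≤ 0 := by linarith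
    exact norm_le_zero_iff.1 (nonpos_of_mul_nonpos_right h9 (half_pos hc))
  have hconst : ∀ u ∈ E, ∀ s ∈ ball (0 : T) r, s + u ∈ ball (0 : T) r → F (Y (s + u)) = F (Y s) := by
    intro u hu s hs hsu
    have hseg : ∀ τ ∈ Icc (0 : ℝ) 1, s + τ • u ∈ ball (0 : T) r := by
      intro τ hτ
      have := (convex_ball (0 : T) r).add_smul_sub_mem hs hsu hτ
      simpa using this
    have hder : ∀ τ ∈ Icc (0 : ℝ) 1, HasDerivAt (fun τ : ℝ => F (Y (s + τ • u))) 0 τ := by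
      intro τ hτ
      have h1 : HasDerivAt (fun τ : ℝ => s + τ • u) u τ := by
        simpa using ((hasDerivAt_id τ).smul_const u).const_add s
      have h2 := (hdFY _ (hseg τ hτ)).comp_hasDerivAt τ h1
      refine h2.congr_deriv ?_
      exact hkey _ (hseg τ hτ) u hu
    have h3 := constant_of_has_deriv_right_zero (f := fun τ : ℝ => F (Y (s + τ • u))) (a := 0)
      (b := 1) (fun τ hτ => (hder τ hτ).continuousAt.continuousWithinAt)
      (fun τ hτ => (hder τ (Ico_subset_Icc_self hτ)).hasDerivWithinAt) 1 (by simp)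
    simpa using h3
  refine ⟨r, hr, Y, hY0, hYc, fun u hu hu0 => ⟨(hball u hu).1, (hball u hu).2.2.1,
    fun w hw => ?_, fun w hw => hkey u hu w ((hmemE w).2 hw), fun w => ?_⟩⟩
  · have h1 := congrArg πE (hball u hu).2.1
    simp only [Θ, map_add, hπEπ, hπEπE, zero_add] at h1
    have h2 : ∀ v, (⟪πE v, w⟫ : ℝ) = ⟪v, w⟫ := fun v => by
      rw [Submodule.inner_starProjection_left_eq_right,
        Submodule.starProjection_eq_self_iff.2 ((hmemE w).2 hw)]
    rw [← h2, h1, h2]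
  · -- by translation invariance the derivatives of `F ∘ Y` at `0` and at `u` agree
    have h1 : HasFDerivAt (fun s => F (Y (s + u)))
        ((fderiv ℝ F (Y u)).comp (fderiv ℝ Y u)) 0 := by
      have h2 : HasFDerivAt (fun s : T => s + u) (ContinuousLinearMap.id ℝ T) 0 :=
        (hasFDerivAt_id (0 : T)).add_const u
      have h3 : HasFDerivAt (fun s => F (Y s)) ((fderiv ℝ F (Y u)).comp (fderiv ℝ Y u))
          (0 + u) := by
        rw [zero_add]; exact hdFY u hu
      exact (HasFDerivAt.comp (g := fun s => F (Y s)) (f := fun s => s + u) (0 : T) h3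
      h2).congr_fderiv (ContinuousLinearMap.comp_id _)
    have h4 : (fun s => F (Y (s + u))) =ᶠ[𝓝 0] fun s => F (Y s) := by
      have h5 : ∀ᶠ s in 𝓝 (0 : T), s + u ∈ ball (0 : T) r := by
        have : ContinuousAt (fun s : T => s + u) 0 := by fun_prop
        exact this.eventually_mem (isOpen_ball.mem_nhds (by simpa using hu))
      filter_upwards [h5, ball_mem_nhds (0 : T) hr] with s hs hs'
      exact hconst u ((hmemE u).2 hu0) s hs' hs
    have h6 := (hdFY 0 (mem_ball_self hr)).unique (h1.congr_of_eventuallyEq h4.symm)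
    have h7 : HasFDerivAt (fun s => Θ (Y s)) (L.comp (fderiv ℝ Y 0)) 0 := by
      have : HasFDerivAt Θ L (Y 0) := by rw [hY0]; exact hL
      exact this.comp (0 : T) (hball 0 (mem_ball_self hr)).1.hasFDerivAt
    have h8 := h7.unique ((hasFDerivAt_id (0 : T)).congr_of_eventuallyEq hΘY)
    have h9 : fderiv ℝ Y 0 (L w) = w := by
      apply hLinj
      exact DFunLike.congr_fun h8 (L w)
    refine ⟨fderiv ℝ Y u (L w), ?_⟩
    have h10 := DFunLike.congr_fun h6 (L w)
    simp only [ContinuousLinearMap.comp_apply, h9, hY0] at h10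
    exact h10.symm

/-! ### Curvature circles -/

section circle

variable (x ν e : Euc n)

/-- The circle through `x` with initial direction `e` and curvature vector `ν`, parametrized by the
angle. -/
noncomputable def curvCircle (θ : ℝ) : Euc n :=
  x + (‖ν‖⁻¹ * Real.sin θ) • e + ((‖ν‖ ^ 2)⁻¹ * (1 - Real.cos θ)) • ν

/-- The curvature vector of `curvCircle x ν e`. -/
noncomputable def curvCircleNormal (θ : ℝ) : Euc n :=
  Real.cos θ • ν - (‖ν‖ * Real.sin θ) • e

/-- The unit tangent vector of `curvCircle x ν e`. -/
noncomputable def curvCircleTangent (θ : ℝ) : Euc n :=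
  Real.cos θ • e + (‖ν‖⁻¹ * Real.sin θ) • ν

variable {x ν e}

theorem norm_curvCircleNormal (he : ‖e‖ = 1) (h : (⟪ν, e⟫ : ℝ) = 0) (θ : ℝ) :
    ‖curvCircleNormal ν e θ‖ = ‖ν‖ := by
  rw [← sq_eq_sq₀ (norm_nonneg _) (norm_nonneg _), curvCircleNormal, @norm_sub_sq_real]
  simp only [norm_smul, real_inner_smul_left, real_inner_smul_right, h, he, mul_pow,
    Real.norm_eq_abs, sq_abs]
  linear_combination ‖ν‖ ^ 2 * Real.sin_sq_add_cos_sq θ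

theorem norm_curvCircleTangent (hν : ν ≠ 0) (he : ‖e‖ = 1) (h : (⟪ν, e⟫ : ℝ) = 0) (θ : ℝ) :
    ‖curvCircleTangent ν e θ‖ = 1 := by
  rw [← sq_eq_sq₀ (norm_nonneg _) zero_le_one, curvCircleTangent, @norm_add_sq_real]
  have hn : ‖ν‖ ≠ 0 := norm_ne_zero_iff.2 hν
  simp only [norm_smul, real_inner_smul_left, real_inner_smul_right, real_inner_comm ν e, h, he,
    mul_pow, Real.norm_eq_abs, sq_abs]
  field_simp
  linear_combination ‖ν‖ * Real.sin_sq_add_cos_sq θ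

theorem curvCircleNormal_eq (hν : ν ≠ 0) (θ : ℝ) :
    curvCircleNormal ν e θ = ν - ‖ν‖ ^ 2 • (curvCircle x ν e θ - x) := by
  have hn : ‖ν‖ ≠ 0 := norm_ne_zero_iff.2 hν
  unfold curvCircleNormal curvCircle
  match_scalars <;> field_simp <;> ring

theorem curvCircle_add (hν : ν ≠ 0) (he : ‖e‖ = 1) (h : (⟪ν, e⟫ : ℝ) = 0) (θ φ : ℝ) :
    curvCircle (curvCircle x ν e θ) (curvCircleNormal ν e θ) (curvCircleTangent ν e θ) φ =
      curvCircle x ν e (θ + φ) := by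
  have hn : ‖ν‖ ≠ 0 := norm_ne_zero_iff.2 hν
  unfold curvCircle
  rw [norm_curvCircleNormal he h]
  unfold curvCircleNormal curvCircleTangent
  rw [Real.sin_add, Real.cos_add]
  match_scalars <;> field_simp <;> ring

theorem curvCircleNormal_add (hν : ν ≠ 0) (he : ‖e‖ = 1) (h : (⟪ν, e⟫ : ℝ) = 0) (θ φ : ℝ) :
    curvCircleNormal (curvCircleNormal ν e θ) (curvCircleTangent ν e θ) φ =
      curvCircleNormal ν e (θ + φ) := by
  have hn : ‖ν‖ ≠ 0 := norm_ne_zero_iff.2 hν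
  rw [curvCircleNormal, norm_curvCircleNormal he h]
  unfold curvCircleNormal curvCircleTangent
  rw [Real.sin_add, Real.cos_add]
  match_scalars <;> field_simp
  ring

theorem curvCircleTangent_add (hν : ν ≠ 0) (he : ‖e‖ = 1) (h : (⟪ν, e⟫ : ℝ) = 0) (θ φ : ℝ) :
    curvCircleTangent (curvCircleNormal ν e θ) (curvCircleTangent ν e θ) φ =
      curvCircleTangent ν e (θ + φ) := by
  have hn : ‖ν‖ ≠ 0 := norm_ne_zero_iff.2 hν
  rw [curvCircleTangent, norm_curvCircleNormal he h]
  unfold curvCircleNormal curvCircleTangent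
  rw [Real.sin_add, Real.cos_add]
  match_scalars <;> field_simp
  ring

theorem hasDerivAt_curvCircle (hν : ν ≠ 0) (θ : ℝ) :
    HasDerivAt (curvCircle x ν e) (‖ν‖⁻¹ • curvCircleTangent ν e θ) θ := by
  have hn : ‖ν‖ ≠ 0 := norm_ne_zero_iff.2 hν
  have h1 := ((((Real.hasDerivAt_sin θ).const_mul ‖ν‖⁻¹).smul_const e).const_add x).add
    ((((Real.hasDerivAt_cos θ).const_sub 1).const_mul (‖ν‖ ^ 2)⁻¹).smul_const ν)
  refine h1.congr_deriv ?_
  unfold curvCircleTangent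
  match_scalars <;> field_simp

end circle

theorem eq_of_hasDerivAt_zero {E : Type*} [NormedAddCommGroup E] [NormedSpace ℝ E] {f : ℝ → E}
    {r : ℝ} (h : ∀ a ∈ ball (0 : ℝ) r, HasDerivAt f 0 a) {a : ℝ} (ha : a ∈ ball (0 : ℝ) r) :
    f a = f 0 := by
  have hr : 0 < r := (norm_nonneg a).trans_lt (mem_ball_zero_iff.1 ha)
  exact isOpen_ball.is_const_of_deriv_eq_zero (convex_ball _ _).isPreconnected
    (fun a ha => (h a ha).differentiableAt.differentiableWithinAt) (fun a ha => (h a ha).deriv) ha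
    (mem_ball_self hr)

theorem exists_pos_forall_eq_zero_or_le_abs {ι : Type*} [Finite ι] (f : ι → ℝ) :
    ∃ c > 0, ∀ i, f i = 0 ∨ c ≤ |f i| := by
  classical
  have := Fintype.ofFinite ι
  rcases isEmpty_or_nonempty ι with hι | hι
  · exact ⟨1, one_pos, fun i => (hι.false i).elim⟩
  obtain ⟨i, -, hi⟩ := Finset.exists_min_image Finset.univ
    (fun i => if f i = 0 then 1 else |f i|) Finset.univ_nonempty
  refine ⟨if f i = 0 then 1 else |f i|, ?_, fun j => ?_⟩
  · split_ifs with h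
    · exact one_pos
    · exact abs_pos.2 h
  · by_cases h : f j = 0
    · exact Or.inl h
    · have := hi j (Finset.mem_univ j)
      rw [if_neg h] at this
      exact Or.inr this

theorem exists_forall_inner_ne_zero {N : Type*} [NormedAddCommGroup N] [InnerProductSpace ℝ N]
    (s : Finset N) (hs : (0 : N) ∉ s) : ∃ ζ : N, ∀ v ∈ s, (⟪ζ, v⟫ : ℝ) ≠ 0 := by
  have hne : ∀ v ∈ s, ∃ p, ((innerSL ℝ v).toLinearMap.toAffineMap : N →ᵃ[ℝ] ℝ) p ≠ 0 := by
    refine fun v hv => ⟨v, fun h => hs ?_⟩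
    have h' : (⟪v, v⟫ : ℝ) = 0 := h
    rwa [inner_self_eq_zero.1 h'] at hv
  obtain ⟨ζ, hζ⟩ := exists_forall_affine_ne_zero s _ hne
  refine ⟨ζ, fun v hv h => hζ v hv ?_⟩
  rw [real_inner_comm] at h
  exact h

/-- A direction `ζ` which separates `ν` from finitely many other vectors. -/
theorem exists_inner_eq_one_of_ne_zero {N ι : Type*} [NormedAddCommGroup N]
    [InnerProductSpace ℝ N] [Fintype ι] {ν : N} (hν : ν ≠ 0) (f : ι → N) :
    ∃ ζ : N, (⟪ζ, ν⟫ : ℝ) = 1 ∧ ∀ i, (⟪ζ, f i⟫ : ℝ) = 1 → f i = ν := by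
  classical
  obtain ⟨ζ, hζ⟩ := exists_forall_inner_ne_zero
    (insert ν ((Finset.univ.image fun i => f i - ν).erase 0)) (by simp [hν.symm])
  have h0 : (⟪ζ, ν⟫ : ℝ) ≠ 0 := hζ ν (Finset.mem_insert_self _ _)
  refine ⟨(⟪ζ, ν⟫ : ℝ)⁻¹ • ζ, by rw [real_inner_smul_left, inv_mul_cancel₀ h0], fun i hi => ?_⟩
  by_contra hne
  refine hζ (f i - ν) ?_ ?_
  · refine Finset.mem_insert_of_mem (Finset.mem_erase.2 ⟨sub_ne_zero.2 hne, ?_⟩)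
    exact Finset.mem_image_of_mem _ (Finset.mem_univ i)
  · rw [real_inner_smul_left] at hi
    rw [inner_sub_right, sub_eq_zero]
    field_simp at hi
    exact hi

namespace PrincipalFrame

variable {x : Euc n} (F : PrincipalFrame M x)

theorem inner_e_e (i j) : (⟪(F.e i : Euc n), (F.e j : Euc n)⟫ : ℝ) = if i = j then 1 else 0 :=
  F.e.inner_eq_ite i j

theorem inner_e_sum (c : Fin (Module.finrank ℝ (tangentSpaceAt M x)) → ℝ) (b) :
    (⟪(F.e b : Euc n), ∑ i, c i • (F.e i : Euc n)⟫ : ℝ) = c b := by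
  simp [inner_sum, real_inner_smul_right, F.inner_e_e]

theorem eq_sum {X : Euc n} (hX : X ∈ tangentSpaceAt M x) :
    X = ∑ b, (⟪(F.e b : Euc n), X⟫ : ℝ) • (F.e b : Euc n) := by
  have h := congrArg Subtype.val (F.e.sum_repr' ⟨X, hX⟩)
  simp only [Submodule.coe_sum, Submodule.coe_smul] at h
  exact h.symm

theorem norm_sq_eq_sum {X : Euc n} (hX : X ∈ tangentSpaceAt M x) :
    ‖X‖ ^ 2 = ∑ b, (⟪(F.e b : Euc n), X⟫ : ℝ) ^ 2 := by
  rw [← real_inner_self_eq_norm_sq]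
  nth_rewrite 1 [F.eq_sum hX]
  rw [sum_inner]
  exact Finset.sum_congr rfl fun b _ => by rw [real_inner_smul_left, sq]

theorem sum_smul_mem (c : Fin (Module.finrank ℝ (tangentSpaceAt M x)) → ℝ) :
    ∑ i, c i • (F.e i : Euc n) ∈ tangentSpaceAt M x :=
  Submodule.sum_mem _ fun i _ => Submodule.smul_mem _ _ (F.e i).2

end PrincipalFrame

namespace FlatChart

variable {x : Euc n} (C : FlatChart M x)

/-- At the base point of the chart, the derivative of the end point map of `ξ` is `1 - A_ξ`. -/
theorem fderiv_endpoint_zero (hM : IsIsoparametricSubmanifold M) (F : PrincipalFrame M x)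
    (ξ : normalSpaceAt M x) (u : tangentSpaceAt M x) :
    fderiv ℝ (C.endpoint ξ) 0 u =
      ∑ b, ((1 - ⟪ξ, F.nrm b⟫ : ℝ) * ⟪(F.e b : Euc n), (u : Euc n)⟫) • (F.e b : Euc n) := by
  have h := fun G u => C.fderiv_endpoint_eq_sum hM ξ C.zero_mem G u
  rw [C.g_zero, C.V_base] at h
  have h1 := h F u
  simp only [C.fderiv_g_zero] at h1
  exact h1

theorem fderiv_endpoint_mem (hM : IsIsoparametricSubmanifold M) (ξ : normalSpaceAt M x)
    {t : tangentSpaceAt M x} (ht : t ∈ ball 0 C.ρ) (u : tangentSpaceAt M x) :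
    fderiv ℝ (C.endpoint ξ) t u ∈ tangentSpaceAt M (C.g t) := by
  obtain ⟨G⟩ := hM.exists_principalFrame (C.g_mem ht).1
  rw [C.fderiv_endpoint_eq_sum hM ξ ht G]
  exact G.sum_smul_mem _

/-- The derivative `B (dg)` of an end point map, `B = 1 - A_ξ`, is bounded below on its own range,
uniformly on the chart, because the eigenvalues of `B` do not vary. -/
theorem exists_le_norm_fderiv_endpoint (hM : IsIsoparametricSubmanifold M)
    (ξ : normalSpaceAt M x) : ∃ c > 0, ∀ t ∈ ball (0 : tangentSpaceAt M x) C.ρ,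
      ∀ w, c * ‖fderiv ℝ (C.endpoint ξ) t w‖ ≤ ‖fderiv ℝ (C.endpoint ξ) t
        ((tangentSpaceAt M x).orthogonalProjectionOnto (fderiv ℝ (C.endpoint ξ) t w))‖ := by
  obtain ⟨F⟩ := hM.exists_principalFrame C.base_mem.1
  obtain ⟨c, hc, hcF⟩ := exists_pos_forall_eq_zero_or_le_abs fun b => (1 - ⟪ξ, F.nrm b⟫ : ℝ)
  refine ⟨c, hc, fun t ht w => ?_⟩
  obtain ⟨G⟩ := hM.exists_principalFrame (C.g_mem ht).1
  set Z := fderiv ℝ (C.endpoint ξ) t w with hZ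
  have hZT : Z ∈ tangentSpaceAt M (C.g t) := C.fderiv_endpoint_mem hM ξ ht w
  refine (sq_le_sq₀ (by positivity) (norm_nonneg _)).1 ?_
  rw [mul_pow, G.norm_sq_eq_sum hZT, G.norm_sq_eq_sum (C.fderiv_endpoint_mem hM ξ ht _),
    Finset.mul_sum]
  refine Finset.sum_le_sum fun b _ => ?_
  rw [C.fderiv_endpoint_eq_sum hM ξ ht G, G.inner_e_sum, C.fderiv_g_proj ht hZT, mul_pow]
  obtain ⟨b', hb'⟩ := C.exists_inner_nrm_eq hM F (C.g_mem ht) G ξ b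
  rcases hcF b' with h | h
  · have : (⟪(G.e b : Euc n), Z⟫ : ℝ) = 0 := by
      rw [hZ, C.fderiv_endpoint_eq_sum hM ξ ht G, G.inner_e_sum, hb', h, zero_mul]
    rw [this]; simp
  · rw [hb', ← sq_abs (1 - _ : ℝ)]
    gcongr

/-- Through the base point there is a curve in `M`, tangent to the curvature distribution of `ν`,
whose tangential part is a straight line with direction `e`. -/
theorem exists_curvature_curve (hM : IsIsoparametricSubmanifold M) {ν : normalSpaceAt M x}
    (hν : ν ≠ 0) {e : Euc n} (h : IsCurvatureNormal M x ν e) :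
    ∃ r > 0, ∃ γ X : ℝ → Euc n, γ 0 = x ∧ ∀ a ∈ ball (0 : ℝ) r,
      HasDerivAt γ (X a) a ∧ γ a ∈ M ∩ C.U ∧ X a ∈ tangentSpaceAt M (γ a) ∧
      (∀ (G : PrincipalFrame M (γ a)) (b), (G.nrm b : Euc n) = C.V ν (γ a) ∨
        (⟪(G.e b : Euc n), X a⟫ : ℝ) = 0) ∧
      ∀ w ∈ tangentSpaceAt M x, (⟪γ a - x, w⟫ : ℝ) = a * ⟪e, w⟫ := by
  obtain ⟨F⟩ := hM.exists_principalFrame C.base_mem.1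
  -- `ν` is the only curvature normal with `⟪ζ, ν⟫ = 1`, so the kernel of `1 - A_ζ` is the curvature
  -- distribution of `ν`; the slice along which the end point map of `ζ` is constant is an integral
  -- manifold
  obtain ⟨ζ, hζ1, hζ⟩ := exists_inner_eq_one_of_ne_zero hν F.nrm
  obtain ⟨c, hc, hlow⟩ := C.exists_le_norm_fderiv_endpoint hM ζ
  have hsm : ContDiffOn ℝ ∞ (C.endpoint ζ) (ball 0 C.ρ) := fun t ht =>
    (C.contDiffAt_endpoint ζ ht).contDiffWithinAt
  have hd0 := C.fderiv_endpoint_zero hM F ζ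
  have hPd0 : ∀ u w : tangentSpaceAt M x, (⟪(tangentSpaceAt M x).orthogonalProjectionOnto
      (fderiv ℝ (C.endpoint ζ) 0 u), w⟫ : ℝ) = ∑ b, (1 - ⟪ζ, F.nrm b⟫ : ℝ) *
        ⟪(F.e b : Euc n), (u : Euc n)⟫ * ⟪(F.e b : Euc n), (w : Euc n)⟫ := fun u w => by
    rw [real_inner_comm, inner_orthogonalProjectionOnto_right, real_inner_comm, hd0, sum_inner]
    exact Finset.sum_congr rfl fun b _ => by rw [real_inner_smul_left]
  obtain ⟨r, hr, Y, hY0, hYc, hY⟩ := exists_kernel_slice C.ρ_pos hsm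
    (tangentSpaceAt M x).orthogonalProjectionOnto
    (fun v => Submodule.norm_orthogonalProjectionOnto_apply_le _ _) hc
    (fun u w => by
      rw [hPd0, real_inner_comm, hPd0]
      exact Finset.sum_congr rfl fun b _ => by ring) hlow
  let e' : tangentSpaceAt M x := ⟨e, h.tangent⟩
  have he' : fderiv ℝ (C.endpoint ζ) 0 e' = 0 := by
    have h1 := h.eigen _ _ (C.parallel_V ζ) C.base_mem.2
    have h2 : (⟪(ζ : Euc n), (ν : Euc n)⟫ : ℝ) = 1 := hζ1
    rw [C.V_base, h2] at h1
    rw [C.fderiv_endpoint hM ζ C.zero_mem, C.fderiv_V_g hM ζ C.zero_mem, C.fderiv_g_zero, C.g_zero,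
      h1]
    simp [e']
  have hn' : ‖e'‖ = 1 := h.unit
  have hu : ∀ a ∈ ball (0 : ℝ) r, a • e' ∈ ball (0 : tangentSpaceAt M x) r := fun a ha => by
    rw [mem_ball_zero_iff] at ha ⊢
    rw [norm_smul, hn', mul_one]; exact ha
  have hu0 : ∀ a : ℝ, fderiv ℝ (C.endpoint ζ) 0 (a • e') = 0 := fun a => by
    rw [map_smul, he', smul_zero]
  let γ : ℝ → Euc n := fun a => C.g (Y (a • e'))
  let X : ℝ → Euc n := fun a => fderiv ℝ C.g (Y (a • e')) (fderiv ℝ Y (a • e') e')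
  have hγ0 : γ 0 = x := by simp [γ, hY0, C.g_zero]
  have hder : ∀ a ∈ ball (0 : ℝ) r, HasDerivAt γ (X a) a := by
    intro a ha
    obtain ⟨h1, h2, -⟩ := hY _ (hu a ha) (hu0 a)
    have h3 : HasDerivAt (fun a : ℝ => a • e') e' a := by
      simpa using (hasDerivAt_id a).smul_const e'
    exact (C.differentiableAt_g h2).hasFDerivAt.comp_hasDerivAt a
      (h1.hasFDerivAt.comp_hasDerivAt a h3)
  -- the end point map of `ζ` does not change along `γ`
  have hcoef : ∀ a ∈ ball (0 : ℝ) r, ∀ (G : PrincipalFrame M (γ a)) (b),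
      (1 - ⟪C.V ζ (γ a), G.nrm b⟫ : ℝ) * ⟪(G.e b : Euc n), X a⟫ = 0 := by
    intro a ha G b
    obtain ⟨-, h2, -, h4, -⟩ := hY _ (hu a ha) (hu0 a)
    have h5 := h4 e' he'
    rw [C.fderiv_endpoint_eq_sum hM ζ h2 G] at h5
    have h6 := congrArg (fun Z => (⟪(G.e b : Euc n), Z⟫ : ℝ)) h5
    exact (G.inner_e_sum _ b).symm.trans (h6.trans (inner_zero_right _))
  refine ⟨r, hr, γ, X, hγ0, fun a ha => ⟨hder a ha, ?_, ?_, fun G b => ?_, fun w hw => ?_⟩⟩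
  · exact C.g_mem (hY _ (hu a ha) (hu0 a)).2.1
  · exact C.fderiv_g_mem (hY _ (hu a ha) (hu0 a)).2.1 _
  · rcases mul_eq_zero.1 (hcoef a ha G b) with h1 | h1
    · left
      have hyU := C.g_mem (hY _ (hu a ha) (hu0 a)).2.1
      obtain ⟨b', hb'⟩ := C.exists_V_nrm_eq hM F hyU G b
      have h2 : (⟪ζ, F.nrm b'⟫ : ℝ) = 1 := by
        have h3 := C.inner_V hM hyU ζ (F.nrm b')
        rw [hb'] at h3
        rw [← h3]
        exact (sub_eq_zero.1 h1).symm
      rw [← hb', hζ b' h2]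
    · exact Or.inr h1
  -- check the tangential part of `γ` on the principal frame: in the curvature distribution this is
  -- the normalization of the slice, and the remaining `F.e b` lie in the range of `1 - A_ζ`, to
  -- which `X` stays orthogonal
  · have hb : ∀ b, (⟪γ a - x, (F.e b : Euc n)⟫ : ℝ) = a * ⟪e, (F.e b : Euc n)⟫ := by
      intro b
      by_cases hb : (⟪ζ, F.nrm b⟫ : ℝ) = 1
      · have h1 : fderiv ℝ (C.endpoint ζ) 0 (F.e b) = 0 := by
          rw [hd0]
          refine Finset.sum_eq_zero fun i _ => ?_
          rw [F.inner_e_e]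
          split_ifs with hi
          · rw [hi, hb]; simp
          · simp
        obtain ⟨-, h2, h3, -⟩ := hY _ (hu a ha) (hu0 a)
        have h4 := h3 _ h1
        rw [← C.proj_g _ h2, real_inner_comm, inner_orthogonalProjectionOnto_right,
          real_inner_comm, Submodule.coe_inner, Submodule.coe_smul, real_inner_smul_left] at h4
        exact h4
      · have hne : (1 - ⟪ζ, F.nrm b⟫ : ℝ) ≠ 0 := fun h0 => hb (sub_eq_zero.1 h0).symm
        have h1 : fderiv ℝ (C.endpoint ζ) 0 (F.e b) =
            (1 - ⟪ζ, F.nrm b⟫ : ℝ) • (F.e b : Euc n) := by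
          rw [hd0]
          simp [F.inner_e_e]
        have h2 : ∀ s ∈ ball (0 : ℝ) r, HasDerivAt
            (fun s => (⟪γ s, fderiv ℝ (C.endpoint ζ) 0 (F.e b)⟫ : ℝ)) 0 s := by
          intro s hs
          have h3 := (hder s hs).inner ℝ
            (hasDerivAt_const s (fderiv ℝ (C.endpoint ζ) 0 (F.e b)))
          refine h3.congr_deriv ?_
          obtain ⟨-, h4, -, -, h5⟩ := hY _ (hu s hs) (hu0 s)
          obtain ⟨w', hw'⟩ := h5 (F.e b)
          obtain ⟨G⟩ := hM.exists_principalFrame (C.g_mem h4).1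
          rw [inner_zero_right, zero_add, ← hw', C.fderiv_endpoint_eq_sum hM ζ h4 G, inner_sum]
          refine Finset.sum_eq_zero fun i _ => ?_
          have h6 : (1 - ⟪C.V ζ (C.g (Y (s • e'))), G.nrm i⟫ : ℝ) * ⟪(G.e i : Euc n), X s⟫ = 0 :=
            hcoef s hs G i
          rw [real_inner_smul_right, real_inner_comm (G.e i : Euc n) (X s)]
          linear_combination (⟪(G.e i : Euc n), fderiv ℝ C.g (Y (s • e')) w'⟫ : ℝ) * h6
        have h3 := eq_of_hasDerivAt_zero h2 ha
        simp only [h1, real_inner_smul_right, hγ0] at h3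
        have h4 : (⟪e, (F.e b : Euc n)⟫ : ℝ) = 0 := by
          have h5 := congrArg (fun Z => (⟪(F.e b : Euc n), Z⟫ : ℝ)) ((hd0 e').symm.trans he')
          simp only [F.inner_e_sum, inner_zero_right] at h5
          rw [real_inner_comm]
          exact (mul_eq_zero.1 h5).resolve_left hne
        rw [h4, mul_zero, inner_sub_left, mul_left_cancel₀ hne h3, sub_self]
    rw [F.eq_sum hw, inner_sum, inner_sum, Finset.mul_sum]
    refine Finset.sum_congr rfl fun b _ => ?_
    rw [real_inner_smul_right, real_inner_smul_right, hb]
    ring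

end FlatChart

/-! ### The circle theorem -/

/-- The set of curvature normals with their unit curvature directions is closed. -/
theorem IsCurvatureNormal.of_tendsto (hM : IsIsoparametricSubmanifold M) (hMc : IsClosed M)
    {x ν e : ℕ → Euc n} (h : ∀ k, IsCurvatureNormal M (x k) (ν k) (e k)) {x' ν' e' : Euc n}
    (hx : Tendsto x atTop (𝓝 x')) (hν : Tendsto ν atTop (𝓝 ν')) (he : Tendsto e atTop (𝓝 e')) :
    IsCurvatureNormal M x' ν' e' where
  mem := hMc.mem_of_tendsto hx (Eventually.of_forall fun k => (h k).mem)
  normal := mem_normalSpaceAt_of_tendsto hM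
    (hMc.mem_of_tendsto hx (Eventually.of_forall fun k => (h k).mem))
    (p := fun k => (x k, ν k)) (fun k => (h k).mem) (fun k => (h k).normal)
    (hx.prodMk_nhds hν)
  tangent := by
    obtain ⟨C⟩ := hM.exists_flatChart
      (hMc.mem_of_tendsto hx (Eventually.of_forall fun k => (h k).mem))
    refine (C.mem_tangentSpaceAt_iff hM C.base_mem).2 fun ξ => ?_
    have h1 : Tendsto (fun k => (⟪C.V ξ (x k), e k⟫ : ℝ)) atTop (𝓝 ⟪C.V ξ x', e'⟫) :=
      ((C.continuousAt_V ξ C.base_mem.2).tendsto.comp hx).inner he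
    refine tendsto_nhds_unique (h1.congr' ?_) tendsto_const_nhds
    filter_upwards [hx.eventually_mem (C.isOpen_U.mem_nhds C.base_mem.2)] with k hk
    exact inner_eq_zero_of_mem_normalSpaceAt (C.V_mem ⟨(h k).mem, hk⟩ ξ) (h k).tangent
  unit := by
    refine tendsto_nhds_unique he.norm ?_
    simp only [(h _).unit]
    exact tendsto_const_nhds
  eigen U v hv hxU := by
    have h1 : ContinuousAt (fderiv ℝ v) x' :=
      (hv.2.1.continuousOn_fderiv_of_isOpen hv.1 (by simp)).continuousAt (hv.1.mem_nhds hxU)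
    have h2 : Tendsto (fun k => fderiv ℝ v (x k) (e k)) atTop (𝓝 (fderiv ℝ v x' e')) :=
      (isBoundedBilinearMap_apply (𝕜 := ℝ).continuous.tendsto (fderiv ℝ v x', e')).comp
        ((h1.tendsto.comp hx).prodMk_nhds he)
    have h3 : Tendsto (fun k => -(⟪v (x k), ν k⟫ : ℝ) • e k) atTop
        (𝓝 (-(⟪v x', ν'⟫ : ℝ) • e')) :=
      (((hv.differentiableAt hxU).continuousAt.tendsto.comp hx).inner hν).neg.smul he
    refine tendsto_nhds_unique h2 (h3.congr' ?_)
    filter_upwards [hx.eventually_mem (hv.1.mem_nhds hxU)] with k hk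
    exact ((h k).eigen U v hv hk).symm

/-- The conclusion of the circle theorem at the angle `θ`: the curvature circle stays in `M`, its
curvature vector and its tangent are again a curvature normal with a curvature direction, and the
normal vectors at the starting point move as prescribed. -/
structure IsCurvCircleAt {n : ℕ} (M : Set (Euc n)) (x ν e : Euc n) (θ : ℝ) : Prop where
  isCurvatureNormal : IsCurvatureNormal M (curvCircle x ν e θ) (curvCircleNormal ν e θ)
    (curvCircleTangent ν e θ)
  sub_smul_mem : ∀ ξ ∈ normalSpaceAt M x,
    ξ - (⟪ξ, ν⟫ : ℝ) • (curvCircle x ν e θ - x) ∈ normalSpaceAt M (curvCircle x ν e θ)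

theorem IsCurvatureNormal.inner_eq_zero {x ν e : Euc n} (h : IsCurvatureNormal M x ν e) :
    (⟪ν, e⟫ : ℝ) = 0 := inner_eq_zero_of_mem_normalSpaceAt h.normal h.tangent

/-- The local form of the circle theorem: an integral curve of the curvature distribution whose
tangential part at `x` is straight is an arc of the curvature circle. -/
theorem IsCurvatureNormal.eventually_isCurvCircleAt (hM : IsIsoparametricSubmanifold M)
    {x ν e : Euc n} (h : IsCurvatureNormal M x ν e) (hν : ν ≠ 0) :
    ∀ᶠ θ in 𝓝 (0 : ℝ), IsCurvCircleAt M x ν e θ := by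
  obtain ⟨C⟩ := hM.exists_flatChart h.mem
  obtain ⟨ν', rfl⟩ : ∃ ν' : normalSpaceAt M x, (ν' : Euc n) = ν := ⟨⟨ν, h.normal⟩, rfl⟩
  have hν' : ν' ≠ 0 := fun h0 => hν (by rw [h0]; rfl)
  set m : ℝ := ‖(ν' : Euc n)‖ with hm
  have hm0 : 0 < m := norm_pos_iff.2 hν
  obtain ⟨r, hr, γ, X, hγ0, H⟩ := C.exists_curvature_curve hM hν' h
  -- the velocity of `γ` is a principal vector for the translate of `ν`
  have hK : ∀ a ∈ ball (0 : ℝ) r, ∀ (W : Set (Euc n)) (v : Euc n → Euc n),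
      IsParallelNormalField M W v → γ a ∈ W →
        fderiv ℝ v (γ a) (X a) = -(⟪v (γ a), C.V ν' (γ a)⟫ : ℝ) • X a := by
    intro a ha W v hv hW
    obtain ⟨-, h2, h3, h4, -⟩ := H a ha
    obtain ⟨G⟩ := hM.exists_principalFrame h2.1
    rw [G.fderiv_eq_sum hv hW ⟨X a, h3⟩, neg_smul]
    congr 1
    conv_rhs => rw [G.eq_sum h3, Finset.smul_sum]
    refine Finset.sum_congr rfl fun b _ => ?_
    rw [smul_smul]
    congr 1
    rcases h4 G b with h5 | h5
    · rw [h5, Submodule.coe_inner]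
    · rw [Submodule.coe_inner, h5, mul_zero, mul_zero]
  -- the parallel fields along `γ` are explicit: `V ξ + ⟪ξ, ν⟫ γ` is constant
  have hW : ∀ a ∈ ball (0 : ℝ) r, ∀ ξ : normalSpaceAt M x,
      C.V ξ (γ a) = ξ - (⟪ξ, ν'⟫ : ℝ) • (γ a - x) := by
    intro a ha ξ
    have h1 : ∀ s ∈ ball (0 : ℝ) r,
        HasDerivAt (fun s => C.V ξ (γ s) + (⟪ξ, ν'⟫ : ℝ) • γ s) 0 s := by
      intro s hs
      obtain ⟨h1, h2, -⟩ := H s hs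
      have h3 := (((C.parallel_V ξ).differentiableAt h2.2).hasFDerivAt.comp_hasDerivAt s h1).add
        (h1.const_smul (⟪ξ, ν'⟫ : ℝ))
      refine h3.congr_deriv ?_
      rw [hK s hs _ _ (C.parallel_V ξ) h2.2, C.inner_V hM h2, neg_smul, neg_add_cancel]
    have h2 := eq_of_hasDerivAt_zero h1 ha
    rw [hγ0, C.V_base] at h2
    rw [smul_sub, sub_sub_eq_add_sub, ← h2, add_sub_cancel_right]
  -- since the fields of `hW` are orthogonal to the velocity, the normal part of `γ - x` is known up
  -- to the length of `γ - x`
  have hN : ∀ a ∈ ball (0 : ℝ) r, ∀ ξ : normalSpaceAt M x,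
      (⟪γ a - x, (ξ : Euc n)⟫ : ℝ) = ⟪ξ, ν'⟫ * (‖γ a - x‖ ^ 2 / 2) := by
    intro a ha ξ
    have h1 : ∀ s ∈ ball (0 : ℝ) r, HasDerivAt
        (fun s => (⟪γ s - x, (ξ : Euc n)⟫ : ℝ) - ⟪ξ, ν'⟫ * (‖γ s - x‖ ^ 2 / 2)) 0 s := by
      intro s hs
      obtain ⟨h1, h2, h3, -⟩ := H s hs
      have h4 := h1.sub_const x
      have h5 := (h4.inner ℝ (hasDerivAt_const s (ξ : Euc n))).sub
        ((h4.norm_sq.div_const 2).const_mul (⟪ξ, ν'⟫ : ℝ))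
      refine h5.congr_deriv ?_
      have h6 := inner_eq_zero_of_mem_normalSpaceAt (C.V_mem h2 ξ) h3
      rw [hW s hs, inner_sub_left, real_inner_smul_left, real_inner_comm] at h6
      rw [inner_zero_right, zero_add]
      linear_combination h6
    have h2 := eq_of_hasDerivAt_zero h1 ha
    simp only [hγ0, sub_self, inner_zero_left, norm_zero] at h2
    linarith
  -- together with the straight tangential part this determines `γ`: it lies in the plane of `e` and
  -- `ν`
  have hγ : ∀ a ∈ ball (0 : ℝ) r, γ a - x = a • e + (‖γ a - x‖ ^ 2 / 2) • (ν' : Euc n) := by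
    intro a ha
    set σ := ‖γ a - x‖ ^ 2 / 2 with hσ
    have h1 : γ a - x - a • e - σ • (ν' : Euc n) ∈ normalSpaceAt M x := by
      refine (Submodule.mem_orthogonal' _ _).2 fun w hw => ?_
      rw [inner_sub_left, inner_sub_left, (H a ha).2.2.2.2 w hw, real_inner_smul_left,
        real_inner_smul_left, inner_eq_zero_of_mem_normalSpaceAt h.normal hw]
      ring
    have h2 : γ a - x - a • e - σ • (ν' : Euc n) = 0 := by
      set Z := γ a - x - a • e - σ • (ν' : Euc n) with hZ
      have h3 : (⟪Z, Z⟫ : ℝ) = 0 := by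
        have h4 : (⟪γ a - x, Z⟫ : ℝ) = ⟪Z, (ν' : Euc n)⟫ * σ := hN a ha ⟨Z, h1⟩
        have h5 := inner_eq_zero_of_mem_normalSpaceAt h1 h.tangent
        nth_rewrite 1 [hZ]
        rw [inner_sub_left, inner_sub_left, real_inner_smul_left, real_inner_smul_left, h4,
          real_inner_comm Z e, h5, real_inner_comm Z (ν' : Euc n)]
        ring
      exact inner_self_eq_zero.1 h3
    rw [sub_sub, sub_eq_zero] at h2
    exact h2
  -- the equation of the circle
  have hσ : ∀ a ∈ ball (0 : ℝ) r,
      (1 - ‖γ a - x‖ ^ 2 / 2 * m ^ 2) ^ 2 = 1 - m ^ 2 * a ^ 2 := by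
    intro a ha
    have h1 := congrArg (fun Z => ‖Z‖ ^ 2) (hγ a ha)
    simp only [@norm_add_sq_real, norm_smul, real_inner_smul_left, real_inner_smul_right,
      real_inner_comm (ν' : Euc n) e, h.inner_eq_zero, h.unit, mul_pow, Real.norm_eq_abs,
      sq_abs, ← hm] at h1
    linear_combination -m ^ 2 * h1
  have ht : Tendsto (fun θ => m⁻¹ * Real.sin θ) (𝓝 0) (𝓝 0) := by
    have : ContinuousAt (fun θ => m⁻¹ * Real.sin θ) 0 := by fun_prop
    simpa [ContinuousAt] using this
  -- in terms of the angle, the tangential component is `a = sin θ / ‖ν‖`; the sign of the root of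
  -- `hσ` is that of `cos θ` for small angles
  have hev : ∀ᶠ θ in 𝓝 (0 : ℝ), m⁻¹ * Real.sin θ ∈ ball (0 : ℝ) r ∧ 0 < Real.cos θ ∧
      γ (m⁻¹ * Real.sin θ) = curvCircle x ν' e θ := by
    have h1 : ∀ᶠ a in 𝓝 (0 : ℝ), 0 < 1 - ‖γ a - x‖ ^ 2 / 2 * m ^ 2 := by
      have h2 : ContinuousAt γ 0 := (H 0 (mem_ball_self hr)).1.continuousAt
      have h3 : ContinuousAt (fun a => 1 - ‖γ a - x‖ ^ 2 / 2 * m ^ 2) 0 := by fun_prop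
      exact h3.eventually_const_lt (by simp [hγ0])
    have h4 : ∀ᶠ θ in 𝓝 (0 : ℝ), 0 < Real.cos θ :=
      Real.continuous_cos.continuousAt.eventually_const_lt (by simp)
    filter_upwards [ht.eventually_mem (ball_mem_nhds 0 hr), h4, ht.eventually h1] with θ h5 h6 h7
    refine ⟨h5, h6, ?_⟩
    have h8 : 1 - ‖γ (m⁻¹ * Real.sin θ) - x‖ ^ 2 / 2 * m ^ 2 = Real.cos θ := by
      rw [← sq_eq_sq₀ h7.le h6.le, hσ _ h5]
      field_simp
      linear_combination -Real.sin_sq_add_cos_sq θ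
    have h9 : ‖γ (m⁻¹ * Real.sin θ) - x‖ ^ 2 / 2 = (m ^ 2)⁻¹ * (1 - Real.cos θ) := by
      rw [← h8]; field_simp; ring
    rw [← sub_add_cancel (γ (m⁻¹ * Real.sin θ)) x, hγ _ h5, h9, curvCircle, ← hm]
    abel
  filter_upwards [hev.eventually_nhds] with θ hθ
  obtain ⟨h1, h2, h3⟩ := hθ.self_of_nhds
  obtain ⟨h4, h5, h6, -, -⟩ := H _ h1
  have h7 : curvCircleNormal (ν' : Euc n) e θ = C.V ν' (curvCircle x ν' e θ) := by
    rw [curvCircleNormal_eq (x := x) hν, ← h3, hW _ h1, ← real_inner_self_eq_norm_sq,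
      Submodule.coe_inner]
  have h8 : curvCircleTangent (ν' : Euc n) e θ = Real.cos θ • X (m⁻¹ * Real.sin θ) := by
    have h9 := h4.scomp θ ((Real.hasDerivAt_sin θ).const_mul m⁻¹)
    have h10 := h9.unique ((hasDerivAt_curvCircle (x := x) (e := e) hν θ).congr_of_eventuallyEq
      (hθ.mono fun θ' h => h.2.2))
    rw [mul_smul] at h10
    exact (smul_right_injective _ (inv_ne_zero hm0.ne') h10).symm
  rw [h3] at h5 h6
  refine ⟨⟨h5.1, h7 ▸ C.V_mem h5 ν', h8 ▸ Submodule.smul_mem _ _ h6,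
    norm_curvCircleTangent hν h.unit h.inner_eq_zero θ, fun W v hv hxW => ?_⟩, fun ξ hξ => ?_⟩
  · have h9 := hK _ h1 W v hv (h3 ▸ hxW)
    rw [h3, ← h7] at h9
    rw [h8, map_smul, h9, smul_comm]
  · have h9 := hW _ h1 ⟨ξ, hξ⟩
    rw [h3] at h9
    have h10 := C.V_mem h5 ⟨ξ, hξ⟩
    rw [h9] at h10
    exact h10

/-- The leaves of the curvature distributions are round spheres: the circles of curvature stay
in `M`. -/
theorem IsCurvatureNormal.isCurvCircleAt (hM : IsIsoparametricSubmanifold M) (hMc : IsClosed M)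
    {x ν e : Euc n} (h : IsCurvatureNormal M x ν e) (hν : ν ≠ 0) (θ : ℝ) :
    IsCurvCircleAt M x ν e θ := by
  -- the set of good angles is open by the local statement and closed by passage to the limit
  let S : Set ℝ := {θ | IsCurvCircleAt M x ν e θ}
  have hm0 : ‖ν‖ ≠ 0 := norm_ne_zero_iff.2 hν
  have hopen : IsOpen S := by
    refine isOpen_iff_mem_nhds.2 fun θ₀ h₀ => ?_
    replace h₀ : IsCurvCircleAt M x ν e θ₀ := h₀
    have hn := norm_curvCircleNormal h.unit h.inner_eq_zero θ₀
    have h1 := h₀.isCurvatureNormal.eventually_isCurvCircleAt hM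
      (norm_ne_zero_iff.1 (hn ▸ hm0))
    have h2 : Tendsto (fun θ => θ - θ₀) (𝓝 θ₀) (𝓝 0) := by
      have : ContinuousAt (fun θ : ℝ => θ - θ₀) θ₀ := by fun_prop
      simpa [ContinuousAt] using this
    filter_upwards [h2.eventually h1] with θ hθ
    obtain ⟨h3, h4⟩ := hθ
    rw [curvCircle_add hν h.unit h.inner_eq_zero, curvCircleNormal_add hν h.unit h.inner_eq_zero,
      curvCircleTangent_add hν h.unit h.inner_eq_zero, add_sub_cancel] at h3
    rw [curvCircle_add hν h.unit h.inner_eq_zero, add_sub_cancel] at h4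
    refine ⟨h3, fun ξ hξ => ?_⟩
    have h5 := h4 _ (h₀.sub_smul_mem ξ hξ)
    have h6 : (⟪ξ - (⟪ξ, ν⟫ : ℝ) • (curvCircle x ν e θ₀ - x), curvCircleNormal ν e θ₀⟫ : ℝ) =
        ⟪ξ, ν⟫ := by
      have h7 := inner_eq_zero_of_mem_normalSpaceAt hξ h.tangent
      have h8 := h.inner_eq_zero
      have h9 : (⟪e, e⟫ : ℝ) = 1 := by rw [real_inner_self_eq_norm_sq, h.unit, one_pow]
      simp only [curvCircle, curvCircleNormal, inner_sub_left, inner_sub_right, inner_add_left,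
        real_inner_smul_left, real_inner_smul_right, h7, h8, h9, real_inner_comm ν e,
        real_inner_self_eq_norm_sq ν]
      field_simp
      linear_combination ‖ν‖ * (⟪ξ, ν⟫ : ℝ) * Real.sin_sq_add_cos_sq θ₀
    rw [h6, sub_sub, ← smul_add, add_comm, sub_add_sub_cancel] at h5
    exact h5
  have hcircle : Continuous fun θ => curvCircle x ν e θ := by unfold curvCircle; fun_prop
  have hclosed : IsClosed S := by
    refine isClosed_of_closure_subset fun θ hθ => ?_
    obtain ⟨p, hp, hlim⟩ := mem_closure_iff_seq_limit.1 hθ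
    replace hp : ∀ k, IsCurvCircleAt M x ν e (p k) := hp
    have hn : Continuous fun θ => curvCircleNormal ν e θ := by unfold curvCircleNormal; fun_prop
    have ht : Continuous fun θ => curvCircleTangent ν e θ := by unfold curvCircleTangent; fun_prop
    have h1 := IsCurvatureNormal.of_tendsto hM hMc (fun k => (hp k).isCurvatureNormal)
      ((hcircle.tendsto θ).comp hlim) ((hn.tendsto θ).comp hlim) ((ht.tendsto θ).comp hlim)
    refine ⟨h1, fun ξ hξ => ?_⟩
    refine mem_normalSpaceAt_of_tendsto hM h1.mem (p := fun k => (curvCircle x ν e (p k),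
      ξ - (⟪ξ, ν⟫ : ℝ) • (curvCircle x ν e (p k) - x)))
      (fun k => (hp k).isCurvatureNormal.mem) (fun k => (hp k).sub_smul_mem ξ hξ) ?_
    have h2 : Continuous fun θ => (curvCircle x ν e θ,
      ξ - (⟪ξ, ν⟫ : ℝ) • (curvCircle x ν e θ - x)) := by fun_prop
    exact (h2.tendsto θ).comp hlim
  have hne : S.Nonempty := ⟨0, (h.eventually_isCurvCircleAt hM hν).self_of_nhds⟩
  have hθ : θ ∈ S := by rw [IsClopen.eq_univ ⟨hclosed, hopen⟩ hne]; exact mem_univ θ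
  exact hθ

/-! ### A mountain pass lemma -/

section MountainPass

variable {X : Type*} [TopologicalSpace X]

/-- A relatively clopen subset of a preconnected set is everything. Closedness and openness of `A`
in `K` are expressed at once: near each point of `K` in the closure of `K ∩ A`, all of `K` is in
`A`. -/
theorem subset_of_relatively_open_closed {K A : Set X} (hK : IsPreconnected K) {x : X}
    (hxK : x ∈ K) (hxA : x ∈ A) (hA : ∀ z ∈ K, z ∈ closure (K ∩ A) → ∀ᶠ y in 𝓝 z, y ∈ K → y ∈ A) :
    K ⊆ A := by
  intro y hy
  refine hK.induction₂' (fun a b => a ∈ A ↔ b ∈ A) (fun a ha => ?_)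
    (fun a b c _ _ _ hab hbc => hab.trans hbc) hxK hy |>.1 hxA
  have key : ∀ᶠ b in 𝓝[K] a, (a ∈ A ↔ b ∈ A) := by
    by_cases h : a ∈ closure (K ∩ A)
    · have h1 := hA a ha h
      have h2 : a ∈ A := h1.self_of_nhds ha
      filter_upwards [self_mem_nhdsWithin, h1.filter_mono nhdsWithin_le_nhds] with b hb hb'
      exact ⟨fun _ => hb' hb, fun _ => h2⟩
    · have h1 : (closure (K ∩ A))ᶜ ∈ 𝓝 a := isClosed_closure.isOpen_compl.mem_nhds h
      filter_upwards [self_mem_nhdsWithin, mem_nhdsWithin_of_mem_nhds h1] with b hb hb'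
      exact ⟨fun h2 => (h (subset_closure ⟨ha, h2⟩)).elim,
        fun h2 => (hb' (subset_closure ⟨hb, h2⟩)).elim⟩
  exact key.mono fun b hb => ⟨hb, hb.symm⟩

/-- In a compact Hausdorff space, two points which can be joined by connected sets inside the
superlevel sets `{a ≤ h}` for all `a < b` can be joined inside `{b ≤ h}`. -/
theorem mem_connectedComponentIn_superlevel [CompactSpace X] [T2Space X] {h : X → ℝ}
    (hc : Continuous h) {x₀ x₁ : X} {b : ℝ} (h₀ : b ≤ h x₀) (h₁ : b ≤ h x₁)
    (H : ∀ a < b, ∃ K : Set X, IsPreconnected K ∧ x₀ ∈ K ∧ x₁ ∈ K ∧ ∀ y ∈ K, a ≤ h y) :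
    x₁ ∈ connectedComponentIn {y | b ≤ h y} x₀ := by
  let Z : Set X := {y | b ≤ h y}
  have hZ : IsClosed Z := isClosed_le continuous_const hc
  by_contra hn
  have : CompactSpace Z := isCompact_iff_compactSpace.1 hZ.isCompact
  have hx₀ : x₀ ∈ Z := h₀
  have hx₁ : x₁ ∈ Z := h₁
  -- in a compact Hausdorff space a component is the intersection of the clopen sets which contain
  -- it
  obtain ⟨s, hs, hs0, hs1⟩ : ∃ s : Set Z, IsClopen s ∧ ⟨x₀, hx₀⟩ ∈ s ∧ (⟨x₁, hx₁⟩ : Z) ∉ s := by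
    by_contra! hall
    refine hn ?_
    change x₁ ∈ connectedComponentIn Z x₀
    rw [connectedComponentIn_eq_image hx₀]
    refine ⟨⟨x₁, hx₁⟩, ?_, rfl⟩
    rw [connectedComponent_eq_iInter_isClopen]
    exact mem_iInter.2 fun s => hall s s.2.1 s.2.2
  have hA : IsCompact ((↑) '' s : Set X) := hs.1.isCompact.image continuous_subtype_val
  have hB : IsCompact ((↑) '' sᶜ : Set X) :=
    hs.2.isClosed_compl.isCompact.image continuous_subtype_val
  have hAB : Disjoint ((↑) '' s : Set X) ((↑) '' sᶜ : Set X) :=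
    (disjoint_image_iff Subtype.val_injective).2 disjoint_compl_right
  obtain ⟨U, V, hU, hV, hAU, hBV, hUV⟩ := SeparatedNhds.of_isCompact_isCompact hA hB hAB
  have hZU : Z ⊆ U ∪ V := fun z hz => by
    by_cases hzs : (⟨z, hz⟩ : Z) ∈ s
    · exact Or.inl (hAU ⟨_, hzs, rfl⟩)
    · exact Or.inr (hBV ⟨_, hzs, rfl⟩)
  -- by compactness, already a slightly lower superlevel set is contained in `U ∪ V`
  obtain ⟨a, hab, ha⟩ : ∃ a < b, ∀ y, a ≤ h y → y ∈ U ∪ V := by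
    have hW : IsCompact (U ∪ V)ᶜ := (hU.union hV).isClosed_compl.isCompact
    rcases (U ∪ V)ᶜ.eq_empty_or_nonempty with he | hne
    · exact ⟨b - 1, by linarith, fun y _ => by
        by_contra hy
        exact (he ▸ hy : y ∈ (∅ : Set X)).elim⟩
    · obtain ⟨w, hw, hmax⟩ := hW.exists_isMaxOn hne hc.continuousOn
      have hwb : h w < b := not_le.1 fun hle => hw (hZU hle)
      refine ⟨(h w + b) / 2, by linarith, fun y hy => ?_⟩
      by_contra hyU
      have : h y ≤ h w := hmax hyU
      linarith
  obtain ⟨K, hK, hK0, hK1, hKa⟩ := H a hab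
  have h1 : x₀ ∈ U := hAU ⟨_, hs0, rfl⟩
  have h2 : x₁ ∈ V := hBV ⟨⟨x₁, hx₁⟩, hs1, rfl⟩
  obtain ⟨z, -, hz⟩ := hK U V hU hV (fun y hy => ha y (hKa y hy)) ⟨x₀, hK0, h1⟩ ⟨x₁, hK1, h2⟩
  exact hUV.le_bot hz

/-- Points of a connected component of an open superlevel set are joined by connected sets on which
the function stays away from the level. -/
theorem exists_preconnected_of_mem_connectedComponentIn [LocallyConnectedSpace X] {h : X → ℝ}
    (hc : Continuous h) {x₀ x₁ : X} {b : ℝ} (h₀ : b < h x₀)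
    (hx : x₁ ∈ connectedComponentIn {y | b < h y} x₀) :
    ∃ a > b, ∃ K : Set X, IsPreconnected K ∧ x₀ ∈ K ∧ x₁ ∈ K ∧ ∀ y ∈ K, a ≤ h y := by
  refine isPreconnected_connectedComponentIn.induction₂ (x := x₀) (y := x₁)
    (s := connectedComponentIn {y | b < h y} x₀)
    (fun x y => ∃ a > b, ∃ K : Set X, IsPreconnected K ∧ x ∈ K ∧ y ∈ K ∧ ∀ y ∈ K, a ≤ h y)
    (fun x hxc => ?_) (fun x y z _ _ _ hxy hyz => ?_)
    (fun x y _ _ ⟨a, ha, K, h1, h2, h3, h4⟩ => ⟨a, ha, K, h1, h3, h2, h4⟩)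
    (mem_connectedComponentIn h₀) hx
  · have hbx : b < h x := connectedComponentIn_subset {y | b < h y} x₀ hxc
    have hO : IsOpen {y | (b + h x) / 2 < h y} := isOpen_lt continuous_const hc
    have hxO : x ∈ {y | (b + h x) / 2 < h y} := by
      simp only [mem_ofPred_eq]; linarith
    have h1 := hO.connectedComponentIn (x := x)
    filter_upwards [mem_nhdsWithin_of_mem_nhds (h1.mem_nhds (mem_connectedComponentIn hxO))]
      with y hy
    exact ⟨(b + h x) / 2, by linarith, _, isPreconnected_connectedComponentIn,
      mem_connectedComponentIn hxO, hy,
      fun z hz => le_of_lt (connectedComponentIn_subset {y | (b + h x) / 2 < h y} x hz)⟩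
  · obtain ⟨a, ha, K, hK, hxK, hyK, hKa⟩ := hxy
    obtain ⟨a', ha', K', hK', hyK', hzK', hKa'⟩ := hyz
    refine ⟨min a a', lt_min ha ha', K ∪ K', hK.union y hyK hyK' hK', Or.inl hxK, Or.inr hzK', ?_⟩
    rintro w (hw | hw)
    · exact (min_le_left _ _).trans (hKa w hw)
    · exact (min_le_right _ _).trans (hKa' w hw)

/-- Each point is either a strict local maximum, or the values larger than its own are taken
arbitrarily close to it and on a set which is locally connected to itself there. -/
def HasNoConnectingPass (h : X → ℝ) : Prop :=
  ∀ z, (∀ᶠ y in 𝓝[≠] z, h y < h z) ∨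
    (z ∈ closure {y | h z < h y} ∧ ∃ V ∈ 𝓝 z, ∃ Q : Set X, IsPreconnected Q ∧
      (∀ y ∈ Q, h z < h y) ∧ ∀ y ∈ V, h z < h y → y ∈ Q)

/-- If passing a critical level upwards never disconnects superlevel sets, then a connected
space carries only one strict local maximum. -/
theorem HasNoConnectingPass.eq_of_isStrictLocalMax [CompactSpace X] [T2Space X]
    [LocallyConnectedSpace X] {h : X → ℝ} (hc : Continuous h) (hh : HasNoConnectingPass h)
    {x₀ x₁ : X} (hx : x₁ ∈ connectedComponent x₀) (hm₀ : ∀ᶠ y in 𝓝[≠] x₀, h y < h x₀)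
    (hm₁ : ∀ᶠ y in 𝓝[≠] x₁, h y < h x₁) : x₁ = x₀ := by
  by_contra hne
  -- a strict local maximum is isolated in its superlevel set
  have hiso : ∀ z, (∀ᶠ y in 𝓝[≠] z, h y < h z) → ∀ K : Set X, IsPreconnected K → z ∈ K →
      (∀ y ∈ K, h z ≤ h y) → K ⊆ {z} := by
    intro z hz K hK hzK hKz
    refine subset_of_relatively_open_closed hK hzK rfl fun w hwK hw => ?_
    rw [inter_eq_right.2 (singleton_subset_iff.2 hzK)] at hw
    have hwz : w ∈ closure {z} := hw
    have : T1Space X := inferInstance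
    rw [closure_singleton] at hwz
    obtain rfl : w = z := hwz
    filter_upwards [eventually_nhdsWithin_iff.1 hz] with y hy hyK
    by_contra hyne
    exact absurd (hKz y hyK) (not_le.2 (hy hyne))
  -- the levels above which `x₀` and `x₁` can be joined; `b` is their supremum
  let A : Set ℝ := {a | ∃ K : Set X, IsPreconnected K ∧ x₀ ∈ K ∧ x₁ ∈ K ∧ ∀ y ∈ K, a ≤ h y}
  have hAne : A.Nonempty := by
    obtain ⟨w, -, hw⟩ := isCompact_univ.exists_isMinOn ⟨x₀, mem_univ _⟩ hc.continuousOn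
    exact ⟨h w, _, isPreconnected_connectedComponent, mem_connectedComponent, hx,
      fun y _ => hw (mem_univ y)⟩
  have hAbd : BddAbove A := ⟨h x₀, fun a ⟨K, _, h0, _, hK⟩ => hK _ h0⟩
  set b := sSup A with hb
  have hlow : ∀ a < b, ∃ K : Set X, IsPreconnected K ∧ x₀ ∈ K ∧ x₁ ∈ K ∧ ∀ y ∈ K, a ≤ h y := by
    intro a hab
    obtain ⟨a', ⟨K, hK, h0, h1, hKa⟩, haa'⟩ := exists_lt_of_lt_csSup hAne hab
    exact ⟨K, hK, h0, h1, fun y hy => haa'.le.trans (hKa y hy)⟩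
  have hb0 : b ≤ h x₀ := csSup_le hAne fun a ⟨K, _, h0, _, hK⟩ => hK _ h0
  have hb1 : b ≤ h x₁ := csSup_le hAne fun a ⟨K, _, _, h1, hK⟩ => hK _ h1
  -- `x₀` and `x₁` can be joined in `{b ≤ h}`, but not in `{b < h}`, since there they would be
  -- joined above a level larger than `b`
  have hx1K := mem_connectedComponentIn_superlevel hc hb0 hb1 hlow
  set K := connectedComponentIn {y | b ≤ h y} x₀ with hKdef
  have hK : IsPreconnected K := isPreconnected_connectedComponentIn
  have hx0K : x₀ ∈ K := mem_connectedComponentIn hb0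
  have hKb : ∀ y ∈ K, b ≤ h y := fun y hy =>
    connectedComponentIn_subset {y | b ≤ h y} x₀ hy
  have hisoK : ∀ z ∈ K, (∀ᶠ y in 𝓝[≠] z, h y < h z) → h z ≠ b := by
    intro z hz hzm hzb
    have := hiso z hzm K hK hz fun y hy => hzb ▸ hKb y hy
    exact hne ((this hx1K : x₁ = z).trans (this hx0K : x₀ = z).symm)
  have hlt0 : b < h x₀ := lt_of_le_of_ne hb0 (hisoK x₀ hx0K hm₀).symm
  have hlt1 : b < h x₁ := lt_of_le_of_ne hb1 (hisoK x₁ hx1K hm₁).symm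
  set O := connectedComponentIn {y | b < h y} x₀ with hO
  have hopen : IsOpen {y | b < h y} := isOpen_lt continuous_const hc
  have hOo : IsOpen O := hopen.connectedComponentIn
  have hx0O : x₀ ∈ O := mem_connectedComponentIn hlt0
  have hx1O : x₁ ∉ O := by
    intro h1
    obtain ⟨a, hab, K', hK'⟩ := exists_preconnected_of_mem_connectedComponentIn hc hlt0 h1
    exact absurd (le_csSup hAbd (⟨K', hK'⟩ : a ∈ A)) (not_le.2 hab)
  -- a preconnected subset of the open superlevel set which meets `O` lies in `O`
  have hOsub : ∀ Q : Set X, IsPreconnected Q → (∀ y ∈ Q, b < h y) → (Q ∩ O).Nonempty → Q ⊆ O := by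
    rintro Q hQ hQb ⟨y, hyQ, hyO⟩
    have h1 := hQ.subset_connectedComponentIn hyQ (F := {y | b < h y}) hQb
    exact h1.trans (connectedComponentIn_eq hyO).symm.subset
  have hOcl : ∀ z ∈ closure O, b < h z → z ∈ O := by
    intro z hz hbz
    have h1 : IsOpen (connectedComponentIn {y | b < h y} z) := hopen.connectedComponentIn
    have h2 : z ∈ connectedComponentIn {y | b < h y} z := mem_connectedComponentIn hbz
    obtain ⟨y, hy1, hy2⟩ := mem_closure_iff.1 hz _ h1 h2
    exact hOsub _ isPreconnected_connectedComponentIn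
      (fun y hy => connectedComponentIn_subset {y | b < h y} z hy) ⟨y, hy1, hy2⟩ h2
  -- as no pass at the level `b` connects `O` to the rest, `closure O` is relatively open in `K`
  have hKO : K ⊆ closure O := by
    refine subset_of_relatively_open_closed hK hx0K (subset_closure hx0O) fun z hzK hz => ?_
    have hzO : z ∈ closure O := by
      have := closure_mono (inter_subset_right (s := K) (t := closure O)) hz
      rwa [closure_closure] at this
    rcases (hKb z hzK).lt_or_eq with hbz | hbz
    · filter_upwards [hOo.mem_nhds (hOcl z hzO hbz)] with y hy _ using subset_closure hy
    · rcases hh z with hA | ⟨-, V, hV, Q, hQ, hQz, hVQ⟩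
      · exact absurd hbz.symm (hisoK z hzK hA)
      · rw [← hbz] at hQz hVQ
        obtain ⟨V', hV'V, hV'o, hzV'⟩ := mem_nhds_iff.1 hV
        obtain ⟨y, hyV, hyO⟩ := mem_closure_iff.1 hzO V' hV'o hzV'
        have hQO : Q ⊆ O := hOsub Q hQ hQz
          ⟨y, hVQ y (hV'V hyV) (connectedComponentIn_subset {y | b < h y} x₀ hyO), hyO⟩
        filter_upwards [hV'o.mem_nhds hzV'] with w hw hwK
        rcases (hKb w hwK).lt_or_eq with hbw | hbw
        · exact subset_closure (hQO (hVQ w (hV'V hw) hbw))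
        · rcases hh w with hA | ⟨hcl, -⟩
          · exact absurd hbw.symm (hisoK w hwK hA)
          · rw [← hbw] at hcl
            refine mem_closure_iff.2 fun W hW hwW => ?_
            obtain ⟨y', hy', hy'b⟩ := mem_closure_iff.1 hcl (W ∩ V') (hW.inter hV'o) ⟨hwW, hw⟩
            exact ⟨y', hy'.1, hQO (hVQ y' (hV'V hy'.2) hy'b)⟩
  exact hx1O (hOcl x₁ (hKO hx1K) hlt1)

end MountainPass

/-! ### Parallel normal fields with finitely many values -/

/-- The vectors which are normal to `M` everywhere. -/
def constNormals {n : ℕ} (M : Set (Euc n)) : Submodule ℝ (Euc n) where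
  carrier := {k | ∀ y ∈ M, k ∈ normalSpaceAt M y}
  add_mem' ha hb y hy := Submodule.add_mem _ (ha y hy) (hb y hy)
  zero_mem' _ _ := Submodule.zero_mem _
  smul_mem' a _ hk y hy := Submodule.smul_mem _ a (hk y hy)

theorem isParallelNormalField_const {k : Euc n} (hk : k ∈ constNormals M) :
    IsParallelNormalField M univ fun _ => k :=
  ⟨isOpen_univ, contDiffOn_const, fun x hx => ⟨hk x hx.1, fun X _ => by simp⟩⟩

/-- A normal vector which is orthogonal to all curvature normals is normal to `M` everywhere. -/
theorem mem_constNormals_of_inner_eq_zero (hM : IsIsoparametricSubmanifold M) {c : Euc n}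
    (hc : IsCenter M c) {x k : Euc n} (hx : x ∈ M) (hk : k ∈ normalSpaceAt M x)
    (h : ∀ ν e, IsCurvatureNormal M x ν e → (⟪k, ν⟫ : ℝ) = 0) : k ∈ constNormals M := by
  obtain ⟨F⟩ := hM.exists_principalFrame hx
  have h1 : IsCenter M (x + (k - (x - c))) := by
    refine isCenter_of_inner_nrm_eq_one hM hx (Submodule.sub_mem _ hk (hc x hx)) F fun b => ?_
    have hb := F.isCurvatureNormal hx b
    rw [inner_sub_left, h _ _ hb, hb.inner_sub_center hc]
    norm_num
  intro y hy
  have h2 := Submodule.sub_mem _ (hc y hy) (h1 y hy)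
  convert h2 using 1
  abel

namespace FlatChart

variable {x : Euc n} (C : FlatChart M x)

/-- On a chart, a globally parallel normal field is one of the fields of the chart. -/
theorem V_eq_of_isParallelNormalField (hM : IsIsoparametricSubmanifold M) {v : Euc n → Euc n}
    (hv : IsParallelNormalField M univ v) {y : Euc n} (hy : y ∈ M ∩ C.U) :
    C.V ⟨v x, (hv.2.2 x ⟨C.base_mem.1, mem_univ x⟩).1⟩ y = v y := by
  obtain ⟨ht, hty⟩ := C.g_proj hy
  have h1 := hv.isParallelMap hM isOpen_ball (fun _ ht => C.differentiableAt_g ht)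
    (fun _ ht => ⟨(C.g_mem ht).1, mem_univ _⟩)
  have h2 := (C.isParallelMap hM ⟨v x, (hv.2.2 x ⟨C.base_mem.1, mem_univ x⟩).1⟩).eqOn h1
    (convex_ball _ _).isPreconnected C.zero_mem (by rw [C.g_zero, C.V_base]) ht
  rwa [hty] at h2

theorem inner_V_const (hM : IsIsoparametricSubmanifold M) {k : Euc n} (hk : k ∈ constNormals M)
    {y : Euc n} (hy : y ∈ M ∩ C.U) (ξ : normalSpaceAt M x) :
    (⟪C.V ξ y, k⟫ : ℝ) = ⟪(ξ : Euc n), k⟫ := by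
  have h1 := C.V_eq_of_isParallelNormalField hM (isParallelNormalField_const hk) hy
  have h2 := C.inner_V hM hy ξ ⟨k, hk x C.base_mem.1⟩
  rw [h1] at h2
  exact h2

end FlatChart

/-- The normal vectors of `M` of the same length as `r`, with principal curvatures in `Λ` and with
the same component as `r` in the constant normal directions. For finite `Λ` this set is a finite
covering space of `M`; it contains all parallel translates of each of its elements. -/
def normalOrbit {n : ℕ} (M : Set (Euc n)) (Λ : Set ℝ) (r : Euc n) : Set (Euc n × Euc n) :=
  {p | p.1 ∈ M ∧ p.2 ∈ normalSpaceAt M p.1 ∧ ‖p.2‖ = ‖r‖ ∧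
    (∀ ν e, IsCurvatureNormal M p.1 ν e → (⟪p.2, ν⟫ : ℝ) ∈ Λ) ∧
    ∀ k ∈ constNormals M, (⟪p.2, k⟫ : ℝ) = ⟪r, k⟫}

theorem isParallelInvariant_normalOrbit (hM : IsIsoparametricSubmanifold M) (Λ : Set ℝ)
    (r : Euc n) : IsParallelInvariant M (normalOrbit M Λ r) := by
  refine ⟨fun p hp => ⟨hp.1, hp.2.1⟩, ?_⟩
  rintro x C ξ y hy z hz ⟨-, -, h3, h4, h5⟩
  refine ⟨hz.1, C.V_mem hz ξ, ?_, fun ν e hν => ?_, fun k hk => ?_⟩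
  · rw [← h3]
    simp only [C.norm_V hM hz, C.norm_V hM hy]
  · obtain ⟨η, rfl⟩ := C.exists_V_eq hM hz hν.normal
    obtain ⟨e', he'⟩ := C.exists_isCurvatureNormal hM hz hy hν
    have h6 := h4 _ _ he'
    simp only [C.inner_V hM hy] at h6
    simpa only [C.inner_V hM hz] using h6
  · rw [← h5 k hk]
    simp only [C.inner_V_const hM hk hz, C.inner_V_const hM hk hy]

/-- The inner products with the curvature normals take finitely many values, and they determine a
normal vector up to a constant normal; the constant normal part is prescribed. -/
theorem finite_fibre_normalOrbit (hM : IsIsoparametricSubmanifold M) {c : Euc n}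
    (hc : IsCenter M c) {Λ : Set ℝ} (hΛ : Λ.Finite) (r : Euc n) {x : Euc n} (hx : x ∈ M) :
    {ξ | (x, ξ) ∈ normalOrbit M Λ r}.Finite := by
  obtain ⟨F⟩ := hM.exists_principalFrame hx
  let f : Euc n → (Fin (Module.finrank ℝ (tangentSpaceAt M x)) → ℝ) :=
    fun ξ b => ⟪ξ, (F.nrm b : Euc n)⟫
  refine Set.Finite.of_finite_image (f := f) ((Set.Finite.pi' fun _ => hΛ).subset ?_) ?_
  · rintro _ ⟨ξ, hξ, rfl⟩ b
    exact hξ.2.2.2.1 _ _ (F.isCurvatureNormal hx b)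
  · intro ξ hξ η hη hf
    have h1 : ξ - η ∈ constNormals M := by
      refine mem_constNormals_of_inner_eq_zero hM hc hx
        (Submodule.sub_mem _ hξ.2.1 hη.2.1) fun ν e hν => ?_
      obtain ⟨b, rfl⟩ := hν.exists_nrm_eq hM F
      rw [inner_sub_left, sub_eq_zero]
      exact congrFun hf b
    have h2 : (⟪ξ - η, ξ - η⟫ : ℝ) = 0 := by
      rw [inner_sub_left, sub_eq_zero]
      exact (hξ.2.2.2.2 _ h1).trans (hη.2.2.2.2 _ h1).symm
    exact sub_eq_zero.1 (inner_self_eq_zero.1 h2)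

theorem isCompact_normalOrbit (hM : IsIsoparametricSubmanifold M) (hMc : IsCompact M) {c : Euc n}
    (hc : IsCenter M c) {Λ : Set ℝ} (hΛ : Λ.Finite) (r : Euc n) :
    IsCompact (normalOrbit M Λ r) := by
  have h1 : IsClosed (normalOrbit M Λ r) := (isParallelInvariant_normalOrbit hM Λ r).isClosed hM
    hMc.isClosed fun x hx => (finite_fibre_normalOrbit hM hc hΛ r hx).isClosed
  refine (hMc.prod (isCompact_closedBall (0 : Euc n) ‖r‖)).of_isClosed_subset h1 fun p hp => ?_
  exact ⟨hp.1, by rw [mem_closedBall_zero_iff, hp.2.2.1]⟩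

namespace IsParallelInvariant

variable {S : Set (Euc n × Euc n)}

/-- The sheet through `(x, ξ)` of a parallel-invariant set over a chart at `x`. -/
theorem sheet_mem (hS : IsParallelInvariant M S) {x : Euc n} (C : FlatChart M x)
    {ξ : normalSpaceAt M x} (hξ : (x, (ξ : Euc n)) ∈ S) {t : tangentSpaceAt M x}
    (ht : t ∈ ball 0 C.ρ) : (C.g t, C.V ξ (C.g t)) ∈ S :=
  hS.invariant _ C ξ _ C.base_mem _ (C.g_mem ht) (by rw [C.V_base]; exact hξ)

theorem continuousOn_sheet {x : Euc n} (C : FlatChart M x) (ξ : normalSpaceAt M x) :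
    ContinuousOn (fun t => (C.g t, C.V ξ (C.g t))) (ball 0 C.ρ) := fun _ ht =>
  ((C.contDiffAt_g ht).continuousAt.prodMk
    (C.contDiffAt_V_g ξ ht).continuousAt).continuousWithinAt

/-- If the fibres are finite, then the sheets are neighbourhoods of their points. -/
theorem eventually_mem_sheet (hM : IsIsoparametricSubmanifold M) (hS : IsParallelInvariant M S)
    (hfin : ∀ x ∈ M, {ξ | (x, ξ) ∈ S}.Finite) {x : Euc n} (C : FlatChart M x)
    (ξ : normalSpaceAt M x) {ε : ℝ} (hε : 0 < ε) :
    ∀ᶠ p in 𝓝[S] (x, (ξ : Euc n)), ∃ t ∈ ball (0 : tangentSpaceAt M x) ε, t ∈ ball 0 C.ρ ∧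
      p = (C.g t, C.V ξ (C.g t)) := by
  have hx := C.base_mem.1
  have h1 : ∀ᶠ p : Euc n × Euc n in 𝓝 (x, (ξ : Euc n)), p.1 ∈ C.U :=
    continuousAt_fst.eventually_mem (C.isOpen_U.mem_nhds C.base_mem.2)
  have h2 : ∀ᶠ p : Euc n × Euc n in 𝓝 (x, (ξ : Euc n)),
      (tangentSpaceAt M x).orthogonalProjectionOnto (p.1 - x) ∈ ball 0 ε := by
    have h3 : ContinuousAt (fun p : Euc n × Euc n =>
        (tangentSpaceAt M x).orthogonalProjectionOnto (p.1 - x)) (x, (ξ : Euc n)) := by fun_prop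
    refine h3.eventually_mem ?_
    simp only [sub_self, map_zero]
    exact ball_mem_nhds 0 hε
  -- the value at `x` of the parallel field through `p` is close to `ξ`, hence different from the
  -- finitely many other points of the fibre
  have h3 : ∀ᶠ p : Euc n × Euc n in 𝓝 (x, (ξ : Euc n)),
      (C.coord p.1 p.2 : Euc n) ∉ {η | (x, η) ∈ S} \ {(ξ : Euc n)} := by
    have h4 : ContinuousAt (fun p : Euc n × Euc n => (C.coord p.1 p.2 : Euc n))
        (x, (ξ : Euc n)) :=
      continuous_subtype_val.continuousAt.comp (C.continuousAt_coord C.base_mem.2)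
    refine h4.eventually_mem (((hfin x hx).subset sdiff_subset).isClosed.isOpen_compl.mem_nhds ?_)
    rw [C.coord_base hM ξ.2]
    simp
  filter_upwards [self_mem_nhdsWithin, h1.filter_mono nhdsWithin_le_nhds,
    h2.filter_mono nhdsWithin_le_nhds, h3.filter_mono nhdsWithin_le_nhds] with p hpS hpU hpε hpf
  obtain ⟨hpM, hpn⟩ := hS.mem p hpS
  have hp : p.1 ∈ M ∩ C.U := ⟨hpM, hpU⟩
  obtain ⟨ht, htp⟩ := C.g_proj hp
  refine ⟨_, hpε, ht, ?_⟩
  rw [htp]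
  have h5 : (C.coord p.1 p.2 : Euc n) = ξ := by
    by_contra hne
    refine hpf ⟨?_, hne⟩
    have h6 := hS.invariant _ C (C.coord p.1 p.2) _ hp _ C.base_mem
      (by rw [C.V_coord hM hp hpn]; exact hpS)
    rwa [C.V_base] at h6
  rw [← Subtype.ext h5, C.V_coord hM hp hpn]

theorem sheet_mem_nhds (hM : IsIsoparametricSubmanifold M) (hS : IsParallelInvariant M S)
    (hfin : ∀ x ∈ M, {ξ | (x, ξ) ∈ S}.Finite) {x : Euc n} (C : FlatChart M x)
    {ξ : normalSpaceAt M x} (hξ : (x, (ξ : Euc n)) ∈ S) {ε : ℝ} (hε : 0 < ε) :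
    {p : S | ∃ t ∈ ball (0 : tangentSpaceAt M x) ε, t ∈ ball 0 C.ρ ∧
      (p : Euc n × Euc n) = (C.g t, C.V ξ (C.g t))} ∈ 𝓝 (⟨(x, (ξ : Euc n)), hξ⟩ : S) := by
  have := eventually_mem_sheet hM hS hfin C ξ hε
  rw [← map_nhds_subtype_val ⟨(x, (ξ : Euc n)), hξ⟩] at this
  exact this

/-- The sheets over small balls form connected neighbourhoods. -/
theorem locallyConnectedSpace (hM : IsIsoparametricSubmanifold M) (hS : IsParallelInvariant M S)
    (hfin : ∀ x ∈ M, {ξ | (x, ξ) ∈ S}.Finite) : LocallyConnectedSpace S := by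
  rw [locallyConnectedSpace_iff_connected_subsets]
  rintro ⟨⟨x, ξ⟩, hp⟩ W hW
  obtain ⟨C⟩ := hM.exists_flatChart (hS.mem _ hp).1
  obtain ⟨ξ, rfl⟩ : ∃ ξ' : normalSpaceAt M x, (ξ' : Euc n) = ξ := ⟨⟨ξ, (hS.mem _ hp).2⟩, rfl⟩
  let Φ : ball (0 : tangentSpaceAt M x) C.ρ → S := fun t =>
    ⟨(C.g t, C.V ξ (C.g t)), hS.sheet_mem C hp t.2⟩
  have hΦ : Continuous Φ := Continuous.subtype_mk
    ((continuousOn_iff_continuous_domRestrict.1 (continuousOn_sheet C ξ))) _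
  have hΦ0 : Φ ⟨0, C.zero_mem⟩ = ⟨(x, (ξ : Euc n)), hp⟩ := by
    simp only [Φ, C.g_zero, C.V_base]
  have hWΦ : Φ ⁻¹' W ∈ 𝓝 (⟨0, C.zero_mem⟩ : ball (0 : tangentSpaceAt M x) C.ρ) :=
    hΦ.continuousAt.preimage_mem_nhds (by rw [hΦ0]; exact hW)
  rw [mem_nhds_subtype_iff_nhdsWithin, isOpen_ball.nhdsWithin_eq C.zero_mem] at hWΦ
  obtain ⟨ε, hε, hεW⟩ := Metric.mem_nhds_iff.1 (inter_mem hWΦ (ball_mem_nhds 0 C.ρ_pos))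
  have hpre : IsPreconnected (Φ '' ((↑) ⁻¹' ball (0 : tangentSpaceAt M x) ε)) := by
    refine IsPreconnected.image ?_ _ hΦ.continuousOn
    have h1 : IsPreconnected (ball (0 : tangentSpaceAt M x) ε) := (convex_ball _ _).isPreconnected
    have h2 : ball (0 : tangentSpaceAt M x) ε ⊆
        range ((↑) : ball (0 : tangentSpaceAt M x) C.ρ → tangentSpaceAt M x) := by
      rw [Subtype.range_coe]; exact fun t ht => (hεW ht).2
    refine Topology.IsInducing.subtypeVal.isPreconnected_image.1 ?_
    rwa [image_preimage_eq_of_subset h2]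
  refine ⟨_, ?_, hpre, ?_⟩
  · filter_upwards [sheet_mem_nhds hM hS hfin C hp hε] with p hp'
    obtain ⟨t, ht, htρ, h⟩ := hp'
    exact ⟨⟨t, htρ⟩, ht, Subtype.ext h.symm⟩
  · rintro _ ⟨t, ht, rfl⟩
    obtain ⟨t', ht', h⟩ := (hεW ht).1
    exact (Subtype.ext h : t' = t) ▸ ht'

end IsParallelInvariant

/-! ### Superlevel sets near regular and nondegenerate critical points -/

section Morse

variable {T : Type*} [NormedAddCommGroup T]

/-- Two points lie in a preconnected subset of `A` on which `f` is larger than `b`. -/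
def JoinedAbove {X : Type*} [TopologicalSpace X] (f : X → ℝ) (b : ℝ) (A : Set X) (x y : X) : Prop :=
  ∃ t : Set X, IsPreconnected t ∧ x ∈ t ∧ y ∈ t ∧ t ⊆ A ∧ ∀ z ∈ t, b < f z

theorem JoinedAbove.trans {X : Type*} [TopologicalSpace X] {f : X → ℝ} {b : ℝ} {A : Set X}
    {x y z : X} (h : JoinedAbove f b A x y) (h' : JoinedAbove f b A y z) : JoinedAbove f b A x z := by
  obtain ⟨t, h1, h2, h3, h4, h5⟩ := h
  obtain ⟨t', h1', h2', h3', h4', h5'⟩ := h'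
  exact ⟨t ∪ t', h1.union y h3 h2' h1', Or.inl h2, Or.inr h3', union_subset h4 h4',
    fun w hw => hw.elim (h5 w) (h5' w)⟩

theorem JoinedAbove.map {X Y : Type*} [TopologicalSpace X] [TopologicalSpace Y] {f : X → ℝ}
    {g : Y → ℝ} {b : ℝ} {A : Set X} {B : Set Y} {x y : X} (h : JoinedAbove f b A x y) {Φ : X → Y}
    (hΦ : ContinuousOn Φ A) (hAB : MapsTo Φ A B) (hg : ∀ z ∈ A, g (Φ z) = f z) :
    JoinedAbove g b B (Φ x) (Φ y) := by
  obtain ⟨t, h1, h2, h3, h4, h5⟩ := h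
  refine ⟨Φ '' t, h1.image _ (hΦ.mono h4), mem_image_of_mem _ h2, mem_image_of_mem _ h3,
    fun _ ⟨z, hz, hzw⟩ => hzw ▸ hAB (h4 hz), ?_⟩
  rintro _ ⟨z, hz, rfl⟩
  rw [hg z (h4 hz)]
  exact h5 z hz

theorem joinedAbove_of_path {X : Type*} [TopologicalSpace X] {f : X → ℝ} {b : ℝ} {A : Set X}
    {p : ℝ → X} (hp : Continuous p) {S : ℝ} (hS : 0 ≤ S) (hA : ∀ s ∈ Icc 0 S, p s ∈ A)
    (hb : ∀ s ∈ Icc 0 S, b < f (p s)) : JoinedAbove f b A (p 0) (p S) := by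
  refine ⟨p '' Icc 0 S, isPreconnected_Icc.image _ hp.continuousOn,
    ⟨0, ⟨le_rfl, hS⟩, rfl⟩, ⟨S, ⟨hS, le_rfl⟩, rfl⟩, ?_, ?_⟩
  · rintro _ ⟨s, hs, rfl⟩; exact hA s hs
  · rintro _ ⟨s, hs, rfl⟩; exact hb s hs

/-- The points which can be joined to `w` above the level `b` form a preconnected set. -/
theorem exists_isPreconnected_of_joinedAbove {X : Type*} [TopologicalSpace X] (f : X → ℝ) (b : ℝ)
    (A : Set X) (w : X) : ∃ Q : Set X, IsPreconnected Q ∧ Q ⊆ A ∧ (∀ y ∈ Q, b < f y) ∧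
      ∀ y, JoinedAbove f b A y w → y ∈ Q := by
  refine ⟨{y | JoinedAbove f b A y w}, isPreconnected_of_forall w ?_, ?_, ?_, fun _ h => h⟩
  · rintro y ⟨t, h1, h2, h3, h4, h5⟩
    exact ⟨t, fun z hz => ⟨t, h1, hz, h3, h4, h5⟩, h3, h2, h1⟩
  · rintro y ⟨t, h1, h2, h3, h4, h5⟩
    exact h4 h2
  · rintro y ⟨t, h1, h2, h3, h4, h5⟩
    exact h5 y h2

/-- A criterion for `HasNoConnectingPass` for the restriction of a function to a subset. -/
theorem hasNoConnectingPass_restrict {X : Type*} [TopologicalSpace X] {f : X → ℝ} {S : Set X}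
    (H : ∀ z ∈ S, (∀ᶠ y in 𝓝[S] z, y ≠ z → f y < f z) ∨ (z ∈ closure {y | y ∈ S ∧ f z < f y} ∧
      ∃ w, ∀ᶠ y in 𝓝[S] z, f z < f y → JoinedAbove f (f z) S y w)) :
    HasNoConnectingPass fun p : S => f p := by
  rintro ⟨z, hz⟩
  rcases H z hz with h | ⟨h, w, hw⟩
  · left
    rw [← map_nhds_subtype_val ⟨z, hz⟩] at h
    rw [eventually_nhdsWithin_iff]
    filter_upwards [h] with y hy hyz
    exact hy fun h => hyz (Subtype.ext h)
  · right
    obtain ⟨Q, hQ, hQS, hQb, hQw⟩ := exists_isPreconnected_of_joinedAbove f (f z) S w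
    refine ⟨?_, {p : S | f z < f p → JoinedAbove f (f z) S p w}, ?_, (↑) ⁻¹' Q, ?_, fun y hy => ?_, ?_⟩
    · rw [closure_subtype]
      convert h using 2
      ext y
      simp [and_comm]
    · rw [← map_nhds_subtype_val ⟨z, hz⟩] at hw
      exact hw
    · refine Topology.IsInducing.subtypeVal.isPreconnected_image.1 ?_
      rwa [Subtype.image_preimage_coe, inter_eq_right.2 hQS]
    · exact hQb y hy
    · exact fun y hy hyz => hQw _ (hy hyz)

/-- Near a regular point, all points of a superlevel set can be joined within it. -/
theorem exists_joinedAbove_of_fderiv_ne_zero [NormedSpace ℝ T] {f : T → ℝ} {ℓ : T →L[ℝ] ℝ}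
    (hf : HasStrictFDerivAt f ℓ 0) (hℓ : ℓ ≠ 0) {r : ℝ} (hr : 0 < r) :
    ∃ w ∈ ball (0 : T) r, f 0 < f w ∧ ∃ η > 0, ∀ u ∈ ball (0 : T) η, f 0 < f u →
      JoinedAbove f (f 0) (ball 0 r) u w := by
  obtain ⟨v₀, hv₀⟩ : ∃ v, ℓ v ≠ 0 := by
    by_contra! h
    exact hℓ (ContinuousLinearMap.ext h)
  obtain ⟨v, hv⟩ : ∃ v, ℓ v = 1 := ⟨(ℓ v₀)⁻¹ • v₀, by simp [hv₀]⟩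
  have hv0 : 0 < ‖v‖ := norm_pos_iff.2 fun h => by simp [h] at hv
  -- with this `ε`, `f` increases along `v` with slope at least `1 / 2` near `0`
  set ε : ℝ := 1 / (2 * ‖v‖) with hε
  have hε0 : 0 < ε := by positivity
  have hεv : ε * ‖v‖ = 1 / 2 := by rw [hε]; field_simp
  have h1 := hf.isLittleO.def hε0
  rw [nhds_prod_eq] at h1
  obtain ⟨r₀, hr₀, hest⟩ : ∃ r₀ > 0, ∀ a ∈ ball (0 : T) r₀, ∀ b ∈ ball (0 : T) r₀,
      |f a - f b - ℓ (a - b)| ≤ ε * ‖a - b‖ := by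
    obtain ⟨s, hs, h2⟩ := (Filter.eventually_prod_self_iff (la := 𝓝 (0 : T))
      (r := fun a b => ‖f a - f b - ℓ (a - b)‖ ≤ ε * ‖a - b‖)).1 h1
    obtain ⟨r₀, hr₀, h3⟩ := Metric.mem_nhds_iff.1 hs
    exact ⟨r₀, hr₀, fun a ha b hb => h2 a (h3 ha) b (h3 hb)⟩
  set r' := min r r₀ with hr'
  have hr'0 : 0 < r' := lt_min hr hr₀
  set s : ℝ := r' / (2 * ‖v‖) with hs
  have hs0 : 0 < s := by positivity
  have hsv : s * ‖v‖ = r' / 2 := by rw [hs]; field_simp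
  have hball : ∀ u ∈ ball (0 : T) (r' / 2), ∀ τ ∈ Icc (0 : ℝ) s, u + τ • v ∈ ball (0 : T) r' := by
    intro u hu τ hτ
    rw [mem_ball_zero_iff] at hu ⊢
    calc ‖u + τ • v‖ ≤ ‖u‖ + τ * ‖v‖ := by
          refine (norm_add_le _ _).trans ?_
          rw [norm_smul, Real.norm_of_nonneg hτ.1]
      _ ≤ ‖u‖ + s * ‖v‖ := by gcongr; exact hτ.2
      _ < r' := by rw [hsv]; linarith
  have hsub : ball (0 : T) r' ⊆ ball 0 r₀ := ball_subset_ball (min_le_right _ _)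
  have hsub' : ball (0 : T) r' ⊆ ball 0 r := ball_subset_ball (min_le_left _ _)
  have hinc : ∀ u ∈ ball (0 : T) (r' / 2), ∀ τ ∈ Icc (0 : ℝ) s, f u + τ / 2 ≤ f (u + τ • v) := by
    intro u hu τ hτ
    have h2 := hest _ (hsub (hball u hu τ hτ)) u
      (hsub (by simpa using hball u hu 0 ⟨le_rfl, hs0.le⟩))
    rw [add_sub_cancel_left, map_smul, hv, smul_eq_mul, mul_one, norm_smul,
      Real.norm_of_nonneg hτ.1] at h2
    have h3 := (abs_le.1 h2).1
    have h4 : ε * (τ * ‖v‖) = τ / 2 := by linear_combination τ * hεv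
    linarith
  have h0 : (0 : T) ∈ ball (0 : T) (r' / 2) := mem_ball_self (by positivity)
  refine ⟨s • v, hsub' (by simpa using hball 0 h0 s ⟨hs0.le, le_rfl⟩), ?_,
    min (r' / 2) (s / (2 * (‖ℓ‖ + ε))), ?_, fun u hu hfu => ?_⟩
  · have := hinc 0 h0 s ⟨hs0.le, le_rfl⟩
    rw [zero_add] at this
    linarith
  · have : 0 ≤ ‖ℓ‖ := norm_nonneg _
    refine lt_min (by positivity) (by positivity)
  · have hu1 : u ∈ ball (0 : T) (r' / 2) := ball_subset_ball (min_le_left _ _) hu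
    have hu2 : ‖u‖ < s / (2 * (‖ℓ‖ + ε)) :=
      (mem_ball_zero_iff.1 hu).trans_le (min_le_right _ _)
    -- move from `u` to `u + s • v`, then shrink `u`
    have hJ1 : JoinedAbove f (f 0) (ball 0 r) (u + (0 : ℝ) • v) (u + s • v) :=
      joinedAbove_of_path (p := fun τ : ℝ => u + τ • v) (by fun_prop) hs0.le
        (fun τ hτ => hsub' (hball u hu1 τ hτ))
        (fun τ hτ => by have := hinc u hu1 τ hτ; have := hτ.1; linarith)
    have hJ2 : JoinedAbove f (f 0) (ball 0 r) ((1 - (0 : ℝ)) • u + s • v)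
        ((1 - (1 : ℝ)) • u + s • v) := by
      have hmem : ∀ τ ∈ Icc (0 : ℝ) 1, (1 - τ) • u ∈ ball (0 : T) (r' / 2) := by
        intro τ hτ
        rw [mem_ball_zero_iff] at hu1 ⊢
        rw [norm_smul, Real.norm_of_nonneg (by linarith [hτ.2])]
        exact (mul_le_of_le_one_left (norm_nonneg _) (by linarith [hτ.1])).trans_lt hu1
      refine joinedAbove_of_path (p := fun τ : ℝ => (1 - τ) • u + s • v) (by fun_prop) zero_le_one
        (fun τ hτ => hsub' (hball _ (hmem τ hτ) s ⟨hs0.le, le_rfl⟩)) (fun τ hτ => ?_)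
      have h2 := hest _ (hsub (hball _ (hmem τ hτ) s ⟨hs0.le, le_rfl⟩)) 0 (mem_ball_self hr₀)
      rw [sub_zero, map_add, map_smul, map_smul, hv, smul_eq_mul, smul_eq_mul, mul_one] at h2
      have h3 := (abs_le.1 h2).1
      have h4 : ‖(1 - τ) • u + s • v‖ ≤ ‖u‖ + s * ‖v‖ := by
        refine (norm_add_le _ _).trans ?_
        rw [norm_smul, norm_smul, Real.norm_of_nonneg hs0.le,
          Real.norm_of_nonneg (by linarith [hτ.2] : (0 : ℝ) ≤ 1 - τ)]
        gcongr
        exact mul_le_of_le_one_left (norm_nonneg _) (by linarith [hτ.1])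
      have h5 : |(1 - τ) * ℓ u| ≤ ‖ℓ‖ * ‖u‖ := by
        rw [abs_mul, abs_of_nonneg (by linarith [hτ.2] : (0 : ℝ) ≤ 1 - τ)]
        exact (mul_le_of_le_one_left (abs_nonneg _) (by linarith [hτ.1])).trans (ℓ.le_opNorm u)
      have h6 := (abs_le.1 h5).1
      have h7 : ε * ‖(1 - τ) • u + s • v‖ ≤ ε * ‖u‖ + s / 2 := by
        have := mul_le_mul_of_nonneg_left h4 hε0.le
        have h8 : ε * (s * ‖v‖) = s / 2 := by linear_combination s * hεv
        linarith
      have h8 : (‖ℓ‖ + ε) * ‖u‖ < s / 2 := by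
        have h9 : 0 < ‖ℓ‖ + ε := by positivity
        rw [lt_div_iff₀ (by positivity)] at hu2
        linarith
      linarith
    simp only [sub_zero, one_smul, sub_self, zero_smul, zero_add, add_zero] at hJ1 hJ2
    exact hJ1.trans hJ2

variable [InnerProductSpace ℝ T]

/-- A quadratic Taylor estimate. -/
theorem abs_sub_sub_le_of_fderiv {f : T → ℝ} {H : T →L[ℝ] T →L[ℝ] ℝ} {r ε : ℝ} (hε : 0 ≤ ε)
    (h : ∀ u ∈ ball (0 : T) r, DifferentiableAt ℝ f u ∧
      ∀ w, |fderiv ℝ f u w - H u w| ≤ ε * ‖u‖ * ‖w‖) {u : T} (hu : u ∈ ball (0 : T) r) :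
    |f u - f 0 - H u u / 2| ≤ ε * ‖u‖ ^ 2 := by
  have hmem : ∀ s ∈ Icc (0 : ℝ) 1, s • u ∈ ball (0 : T) r := by
    intro s hs
    rw [mem_ball_zero_iff] at hu ⊢
    rw [norm_smul, Real.norm_of_nonneg hs.1]
    exact (mul_le_of_le_one_left (norm_nonneg _) hs.2).trans_lt hu
  have hd : ∀ s ∈ Icc (0 : ℝ) 1, HasDerivWithinAt (fun s : ℝ => f (s • u) - s ^ 2 * (H u u / 2))
      (fderiv ℝ f (s • u) u - s * H u u) (Icc 0 1) s := by
    intro s hs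
    have h1 : HasDerivAt (fun s : ℝ => s • u) u s := by
      simpa using (hasDerivAt_id s).smul_const u
    have h2 := (h _ (hmem s hs)).1.hasFDerivAt.comp_hasDerivAt s h1
    have h3 := (hasDerivAt_pow 2 s).mul_const (H u u / 2)
    refine ((h2.sub h3).congr_deriv ?_).hasDerivWithinAt
    simp
    ring
  have h4 := norm_image_sub_le_of_norm_deriv_le_segment_01' hd (C := ε * ‖u‖ ^ 2) fun s hs => by
    have h5 := (h _ (hmem s (Ico_subset_Icc_self hs))).2 u
    rw [map_smul, smul_apply, smul_eq_mul, norm_smul, Real.norm_of_nonneg hs.1] at h5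
    refine h5.trans ?_
    have : ε * (s * ‖u‖) * ‖u‖ = s * (ε * ‖u‖ ^ 2) := by ring
    rw [this]
    exact mul_le_of_le_one_left (by positivity) hs.2.le
  simpa [Real.norm_eq_abs, sub_right_comm] using h4

/-- At a critical point the derivative is the Hessian up to first order. -/
theorem eventually_abs_fderiv_sub_le {f : T → ℝ} (hf : ContDiffAt ℝ 2 f 0)
    (hf0 : fderiv ℝ f 0 = 0) {ε : ℝ} (hε : 0 < ε) :
    ∃ r > 0, ∀ u ∈ ball (0 : T) r, DifferentiableAt ℝ f u ∧
      ∀ w, |fderiv ℝ f u w - fderiv ℝ (fderiv ℝ f) 0 u w| ≤ ε * ‖u‖ * ‖w‖ := by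
  have hd : HasFDerivAt (fderiv ℝ f) (fderiv ℝ (fderiv ℝ f) 0) 0 :=
    ((hf.fderiv_right (m := 1) (by norm_num)).differentiableAt (by simp)).hasFDerivAt
  have h1 := hd.isLittleO.def hε
  have h2 : ∀ᶠ u in 𝓝 (0 : T), DifferentiableAt ℝ f u :=
    (hf.eventually (by simp)).mono fun u hu => hu.differentiableAt (by simp)
  obtain ⟨r, hr, h⟩ := Metric.eventually_nhds_iff_ball.1 (h2.and h1)
  refine ⟨r, hr, fun u hu => ⟨(h u hu).1, fun w => ?_⟩⟩
  have h3 := (h u hu).2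
  rw [hf0, sub_zero, sub_zero] at h3
  have h4 := ContinuousLinearMap.le_of_opNorm_le _ h3 w
  simpa [Real.norm_eq_abs] using h4

/-- The second derivative test for strict local maxima. -/
theorem eventually_lt_of_fderiv_fderiv_neg {f : T → ℝ} (hf : ContDiffAt ℝ 2 f 0)
    (hf0 : fderiv ℝ f 0 = 0) {c : ℝ} (hc : 0 < c)
    (hH : ∀ u, fderiv ℝ (fderiv ℝ f) 0 u u ≤ -c * ‖u‖ ^ 2) : ∀ᶠ u in 𝓝[≠] (0 : T), f u < f 0 := by
  obtain ⟨r, hr, h⟩ := eventually_abs_fderiv_sub_le hf hf0 (show 0 < c / 4 by positivity)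
  filter_upwards [self_mem_nhdsWithin, mem_nhdsWithin_of_mem_nhds (ball_mem_nhds 0 hr)] with u hu hur
  have h1 := (abs_le.1 (abs_sub_sub_le_of_fderiv (by positivity) h hur)).2
  have h2 := hH u
  have h3 : 0 < c * ‖u‖ ^ 2 := by
    have : 0 < ‖u‖ := norm_pos_iff.2 hu
    positivity
  linarith

set_option maxHeartbeats 1000000 in
/-- Near a nondegenerate critical point, points of the superlevel set can be joined within it to
points of a small sphere in the positive space `P` of the Hessian. -/
theorem exists_joinedAbove_sphere [FiniteDimensional ℝ T] {f : T → ℝ} (hf : ContDiffAt ℝ 2 f 0)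
    (hf0 : fderiv ℝ f 0 = 0) (P : Submodule ℝ T) {c : ℝ} (hc : 0 < c)
    (hP : ∀ a ∈ P, c * ‖a‖ ^ 2 ≤ fderiv ℝ (fderiv ℝ f) 0 a a)
    (hN : ∀ b ∈ Pᗮ, fderiv ℝ (fderiv ℝ f) 0 b b ≤ -c * ‖b‖ ^ 2)
    (hPN : ∀ a ∈ P, ∀ b ∈ Pᗮ, fderiv ℝ (fderiv ℝ f) 0 a b = 0 ∧
      fderiv ℝ (fderiv ℝ f) 0 b a = 0) {r : ℝ} (hr : 0 < r) :
    ∃ δ > 0, δ < r ∧ (∀ a ∈ P, ‖a‖ = δ → f 0 < f a) ∧ ∃ η > 0, ∀ u ∈ ball (0 : T) η, f 0 < f u →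
      ∃ a ∈ P, ‖a‖ = δ ∧ JoinedAbove f (f 0) (ball 0 r) u a := by
  set H := fderiv ℝ (fderiv ℝ f) 0 with hH
  set Λ := ‖H‖ with hΛ
  have hΛ0 : 0 ≤ Λ := by rw [hΛ]; exact norm_nonneg H
  have hHle : ∀ u, |H u u| ≤ Λ * ‖u‖ ^ 2 := fun u => by
    have := H.le_opNorm₂ u u
    rw [Real.norm_eq_abs] at this
    linarith [this, sq ‖u‖, mul_assoc ‖H‖ ‖u‖ ‖u‖]
  -- points `a + b` of the superlevel set, with `a ∈ P` and `b ∈ Pᗮ`, lie in the cone `‖b‖ ≤ C *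
  -- ‖a‖`; on this cone the error `ε` in the Taylor estimates is dominated by the Hessian in the
  -- direction `a`
  set C : ℝ := (2 * Λ + c) / c with hC
  have hC1 : 1 ≤ C := by rw [hC, le_div_iff₀ hc]; linarith
  have hCc : c * C = 2 * Λ + c := by rw [hC]; field_simp
  set ε : ℝ := c / (8 * C) with hε
  have hC0 : 0 < C := by linarith
  have hε0 : 0 < ε := by positivity
  have hεC : ε * C = c / 8 := by rw [hε]; field_simp
  have hε8 : ε ≤ c / 8 := by rw [← hεC]; exact le_mul_of_one_le_right hε0.le hC1
  obtain ⟨r₀, hr₀, h⟩ := eventually_abs_fderiv_sub_le hf hf0 hε0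
  set δ : ℝ := min r r₀ / 4 with hδ
  have hm : 0 < min r r₀ := lt_min hr hr₀
  have hδ0 : 0 < δ := by positivity
  have hδr : 4 * δ ≤ r := by rw [hδ]; linarith [min_le_left r r₀]
  have hδr₀ : 4 * δ ≤ r₀ := by rw [hδ]; linarith [min_le_right r r₀]
  set η : ℝ := δ / (2 * C) with hη
  have hη0 : 0 < η := by positivity
  have hηC : η * C = δ / 2 := by rw [hη]; field_simp
  have hηδ : η ≤ δ := by
    have : η ≤ η * C := le_mul_of_one_le_right hη0.le hC1
    linarith
  have hT : ∀ {u}, u ∈ ball (0 : T) r₀ → |f u - f 0 - H u u / 2| ≤ ε * ‖u‖ ^ 2 := fun hu =>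
    abs_sub_sub_le_of_fderiv hε0.le h hu
  -- `f` is large on points with a large component in `P` and a small component in `Pᗮ`
  have hval : ∀ a ∈ P, ∀ b ∈ Pᗮ, ‖a‖ = δ → ‖b‖ ≤ η → f 0 < f (a + b) := by
    intro a ha b hb haδ hbη
    have h1 : ‖a + b‖ ^ 2 = ‖a‖ ^ 2 + ‖b‖ ^ 2 := by
      rw [@norm_add_sq_real, (Submodule.mem_orthogonal _ _).1 hb a ha]; ring
    have h2 : a + b ∈ ball (0 : T) r₀ := by
      rw [mem_ball_zero_iff]
      linarith [norm_add_le a b]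
    have h3 : H (a + b) (a + b) = H a a + H b b := by
      simp [(hPN a ha b hb).1, (hPN a ha b hb).2]
    have h4 := (abs_le.1 (hT h2)).1
    have h5 := hP a ha
    have h6 := (abs_le.1 (hHle b)).1
    have h7 : ‖b‖ ^ 2 ≤ η ^ 2 := by gcongr
    have h8 : Λ * ‖b‖ ^ 2 ≤ Λ * η ^ 2 := by gcongr
    have h9 : ε * (‖a‖ ^ 2 + ‖b‖ ^ 2) ≤ c / 8 * (δ ^ 2 + η ^ 2) := by rw [haδ]; gcongr
    have h10 : (2 * Λ + c) * η ^ 2 ≤ c * δ ^ 2 / 2 := by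
      have : (2 * Λ + c) * η ^ 2 = c * ((η * C) * η) := by rw [← hCc]; ring
      rw [this, hηC]
      nlinarith [mul_le_mul_of_nonneg_left hηδ hδ0.le]
    have h11 : 0 < c * δ ^ 2 := by positivity
    have h12 : 0 ≤ c * η ^ 2 := by positivity
    rw [h1] at h4
    rw [h3] at h4
    rw [haδ] at h5 h9 h4
    linarith
  refine ⟨δ, hδ0, by linarith, fun a ha haδ => ?_, η, hη0, fun u hu hfu => ?_⟩
  · have := hval a ha 0 (Submodule.zero_mem _) haδ (by simpa using hη0.le)
    rwa [add_zero] at this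
  · rw [mem_ball_zero_iff] at hu
    obtain ⟨a, ha, b, hb, rfl⟩ := P.exists_add_mem_mem_orthogonal u
    have h1 : ‖a + b‖ ^ 2 = ‖a‖ ^ 2 + ‖b‖ ^ 2 := by
      rw [@norm_add_sq_real, (Submodule.mem_orthogonal _ _).1 hb a ha]; ring
    have h3 : H (a + b) (a + b) = H a a + H b b := by
      simp [(hPN a ha b hb).1, (hPN a ha b hb).2]
    have haη : ‖a‖ < η := lt_of_le_of_lt
      ((sq_le_sq₀ (norm_nonneg _) (norm_nonneg _)).1 (by rw [h1]; linarith [sq_nonneg ‖b‖])) hu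
    have hbη : ‖b‖ < η := lt_of_le_of_lt
      ((sq_le_sq₀ (norm_nonneg _) (norm_nonneg _)).1 (by rw [h1]; linarith [sq_nonneg ‖a‖])) hu
    have hcone : c * ‖b‖ ^ 2 < c * C * ‖a‖ ^ 2 := by
      have h4 := (abs_le.1 (hT (u := a + b) (by rw [mem_ball_zero_iff]; linarith))).2
      have h5 := (abs_le.1 (hHle a)).2
      have h6 := hN b hb
      have h7 : ε * (‖a‖ ^ 2 + ‖b‖ ^ 2) ≤ c / 8 * (‖a‖ ^ 2 + ‖b‖ ^ 2) := by gcongr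
      rw [h1, h3] at h4
      rw [hCc]
      linarith [sq_nonneg ‖a‖, mul_nonneg hc.le (sq_nonneg ‖b‖), mul_nonneg hc.le (sq_nonneg ‖a‖)]
    have ha0 : 0 < ‖a‖ := by
      rcases (norm_nonneg a).lt_or_eq with h4 | h4
      · exact h4
      · rw [← h4] at hcone
        linarith [mul_nonneg hc.le (sq_nonneg ‖b‖), hcone]
    have hbC : ‖b‖ ≤ C * ‖a‖ := by
      refine (sq_le_sq₀ (norm_nonneg _) (by positivity)).1 ?_
      have h4 : ‖b‖ ^ 2 < C * ‖a‖ ^ 2 := by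
        rw [mul_assoc] at hcone
        exact lt_of_mul_lt_mul_left hcone hc.le
      have h5 : C * ‖a‖ ^ 2 ≤ C ^ 2 * ‖a‖ ^ 2 := by gcongr; nlinarith
      rw [mul_pow]; linarith
    set S : ℝ := δ / ‖a‖ - 1 with hS
    have hSa : (1 + S) * ‖a‖ = δ := by rw [hS]; field_simp; ring
    have hS0 : 0 ≤ S := by
      rw [hS, sub_nonneg, one_le_div ha0]; linarith
    have hnorm : ∀ s ∈ Icc (0 : ℝ) S, ‖a + b + s • a‖ ≤ (1 + s) * ‖a‖ + ‖b‖ := by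
      intro s hs
      have h4 : a + b + s • a = (1 + s) • a + b := by module
      rw [h4]
      refine (norm_add_le _ _).trans ?_
      rw [norm_smul, Real.norm_of_nonneg (by linarith [hs.1])]
    have hδs : ∀ s ∈ Icc (0 : ℝ) S, (1 + s) * ‖a‖ ≤ δ := by
      intro s hs
      rw [← hSa]; gcongr; exact hs.2
    have hmem : ∀ s ∈ Icc (0 : ℝ) S, ‖a + b + s • a‖ < 4 * δ := by
      intro s hs
      linarith [hnorm s hs, hδs s hs]
    -- within the cone `f` increases in the direction `a`, up to the sphere of radius `δ`
    have hmono : MonotoneOn (fun s : ℝ => f (a + b + s • a)) (Icc 0 S) := by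
      have hder : ∀ s ∈ Icc (0 : ℝ) S, HasDerivAt (fun s : ℝ => f (a + b + s • a))
          (fderiv ℝ f (a + b + s • a) a) s := by
        intro s hs
        have h4 : HasDerivAt (fun s : ℝ => a + b + s • a) a s := by
          simpa using ((hasDerivAt_id s).smul_const a).const_add (a + b)
        exact (h _ (by rw [mem_ball_zero_iff]; linarith [hmem s hs])).1.hasFDerivAt.comp_hasDerivAt
          s h4
      refine monotoneOn_of_deriv_nonneg (convex_Icc _ _)
        (fun s hs => (hder s hs).continuousAt.continuousWithinAt)
        (fun s hs => (hder s (interior_subset hs)).differentiableAt.differentiableWithinAt)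
        fun s hs => ?_
      replace hs := interior_subset hs
      rw [(hder s hs).deriv]
      have h4 := (abs_le.1 ((h (a + b + s • a)
        (by rw [mem_ball_zero_iff]; linarith [hmem s hs])).2 a)).1
      have h5 : H (a + b + s • a) a = (1 + s) * H a a := by
        simp [(hPN a ha b hb).2]
        ring
      have h6 : ‖a + b + s • a‖ ≤ (1 + s) * (2 * C * ‖a‖) := by
        have h7 : ‖b‖ ≤ (1 + s) * (C * ‖a‖) := hbC.trans
          (le_mul_of_one_le_left (by positivity) (by linarith [hs.1]))
        have h8 : (1 + s) * ‖a‖ ≤ (1 + s) * (C * ‖a‖) := by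
          have := hs.1
          gcongr
          exact le_mul_of_one_le_left ha0.le hC1
        linarith [hnorm s hs]
      have h7 : ε * ‖a + b + s • a‖ * ‖a‖ ≤ (1 + s) * (c / 4 * ‖a‖ ^ 2) := by
        calc ε * ‖a + b + s • a‖ * ‖a‖ ≤ ε * ((1 + s) * (2 * C * ‖a‖)) * ‖a‖ := by gcongr
          _ = (1 + s) * (2 * (ε * C) * ‖a‖ ^ 2) := by ring
          _ = _ := by rw [hεC]; ring
      have h8 : (1 + s) * (c * ‖a‖ ^ 2) ≤ (1 + s) * H a a := by
        have := hs.1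
        have := hP a ha
        gcongr
      have h9 : 0 ≤ (1 + s) * (c * ‖a‖ ^ 2) := by have := hs.1; positivity
      rw [h5] at h4
      linarith
    have hJ1 : JoinedAbove f (f 0) (ball 0 r) (a + b + (0 : ℝ) • a) (a + b + S • a) := by
      refine joinedAbove_of_path (p := fun s : ℝ => a + b + s • a) (by fun_prop) hS0
        (fun s hs => by rw [mem_ball_zero_iff]; linarith [hmem s hs]) fun s hs => ?_
      have := hmono ⟨le_rfl, hS0⟩ hs hs.1
      simp only [zero_smul, add_zero] at this
      linarith
    have haS : ‖(1 + S) • a‖ = δ := by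
      rw [norm_smul, Real.norm_of_nonneg (by linarith), hSa]
    -- then shrink the component `b` to zero
    have hJ2 : JoinedAbove f (f 0) (ball 0 r) ((1 + S) • a + (1 - (0 : ℝ)) • b)
        ((1 + S) • a + (1 - (1 : ℝ)) • b) := by
      have hb' : ∀ τ ∈ Icc (0 : ℝ) 1, ‖(1 - τ) • b‖ ≤ η := by
        intro τ hτ
        rw [norm_smul, Real.norm_of_nonneg (by linarith [hτ.2])]
        exact (mul_le_of_le_one_left (norm_nonneg _) (by linarith [hτ.1])).trans hbη.le
      refine joinedAbove_of_path (p := fun τ : ℝ => (1 + S) • a + (1 - τ) • b) (by fun_prop)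
        zero_le_one (fun τ hτ => ?_) fun τ hτ => hval _ (P.smul_mem _ ha) _
          (Submodule.smul_mem _ _ hb) haS (hb' τ hτ)
      rw [mem_ball_zero_iff]
      have := norm_add_le ((1 + S) • a) ((1 - τ) • b)
      rw [haS] at this
      linarith [hb' τ hτ]
    refine ⟨(1 + S) • a, P.smul_mem _ ha, haS, ?_⟩
    have h4 : a + b + S • a = (1 + S) • a + b := by module
    simp only [sub_zero, one_smul, sub_self, zero_smul, add_zero, h4] at hJ1 hJ2
    exact hJ1.trans hJ2

end Morse

/-! ### Height functions on spaces of parallel normal vectors -/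

theorem fderiv_comp_fderiv {E F G : Type*} [NormedAddCommGroup E] [NormedSpace ℝ E]
    [NormedAddCommGroup F] [NormedSpace ℝ F] [NormedAddCommGroup G] [NormedSpace ℝ G]
    (L : F →L[ℝ] G) {w : E → F} {t : E} (h : DifferentiableAt ℝ (fderiv ℝ w) t) (u v : E) :
    fderiv ℝ (fun t => L ∘L fderiv ℝ w t) t u v = L (fderiv ℝ (fderiv ℝ w) t u v) := by
  rw [((hasFDerivAt_const L t).clm_comp h.hasFDerivAt).fderiv]
  simp

namespace FlatChart

variable {x : Euc n} (C : FlatChart M x)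

/-- The linear function `⟪q, ·⟫` along a parallel normal field of a chart. -/
noncomputable def height (ξ : normalSpaceAt M x) (q : Euc n) (t : tangentSpaceAt M x) : ℝ :=
  ⟪q, C.V ξ (C.g t)⟫

theorem height_zero (ξ : normalSpaceAt M x) (q : Euc n) : C.height ξ q 0 = ⟪q, (ξ : Euc n)⟫ := by
  rw [height, C.g_zero, C.V_base]

theorem contDiffAt_height (ξ : normalSpaceAt M x) (q : Euc n) {t : tangentSpaceAt M x}
    (ht : t ∈ ball 0 C.ρ) : ContDiffAt ℝ 2 (C.height ξ q) t :=
  contDiffAt_const.inner ℝ (mod_cast contDiffAt_infty.1 (C.contDiffAt_V_g ξ ht) 2)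

theorem fderiv_height (ξ : normalSpaceAt M x) (q : Euc n) {t : tangentSpaceAt M x}
    (ht : t ∈ ball 0 C.ρ) :
    fderiv ℝ (C.height ξ q) t = innerSL ℝ q ∘L fderiv ℝ (fun t => C.V ξ (C.g t)) t :=
  ((innerSL ℝ q).hasFDerivAt.comp t
    ((C.contDiffAt_V_g ξ ht).differentiableAt (by simp)).hasFDerivAt).fderiv

theorem fderiv_V_g_zero (hM : IsIsoparametricSubmanifold M) (F : PrincipalFrame M x)
    (ξ : normalSpaceAt M x) (u : tangentSpaceAt M x) :
    fderiv ℝ (fun t => C.V ξ (C.g t)) 0 u =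
      ∑ b, (-⟪(ξ : Euc n), (F.nrm b : Euc n)⟫ * ⟪(F.e b : Euc n), (u : Euc n)⟫ : ℝ) •
        (F.e b : Euc n) := by
  rw [C.fderiv_V_g hM ξ C.zero_mem, C.g_zero, C.fderiv_g_zero,
    F.fderiv_eq_sum (C.parallel_V ξ) C.base_mem.2, C.V_base, ← Finset.sum_neg_distrib]
  refine Finset.sum_congr rfl fun b _ => ?_
  rw [← neg_smul, neg_mul]
  rfl

/-- The derivative of a height function at the base point of the chart, in a principal frame. -/
theorem fderiv_height_zero (hM : IsIsoparametricSubmanifold M) (F : PrincipalFrame M x)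
    (ξ : normalSpaceAt M x) (q : Euc n) (u : tangentSpaceAt M x) :
    fderiv ℝ (C.height ξ q) 0 u = ∑ b, -⟪(ξ : Euc n), (F.nrm b : Euc n)⟫ *
      ⟪(F.e b : Euc n), (u : Euc n)⟫ * ⟪q, (F.e b : Euc n)⟫ := by
  rw [C.fderiv_height ξ q C.zero_mem]
  change (⟪q, fderiv ℝ (fun t => C.V ξ (C.g t)) 0 u⟫ : ℝ) = _
  rw [C.fderiv_V_g_zero hM F, inner_sum]
  exact Finset.sum_congr rfl fun b _ => real_inner_smul_right _ _ _

/-- A height function is critical at the base point only if its direction is normal there. -/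
theorem mem_normalSpaceAt_of_fderiv_height_eq_zero (hM : IsIsoparametricSubmanifold M)
    {ξ : normalSpaceAt M x} (hξ : ∀ ν e, IsCurvatureNormal M x ν e → (⟪(ξ : Euc n), ν⟫ : ℝ) < 0)
    {q : Euc n} (h : fderiv ℝ (C.height ξ q) 0 = 0) : q ∈ normalSpaceAt M x := by
  obtain ⟨F⟩ := hM.exists_principalFrame C.base_mem.1
  refine (Submodule.mem_orthogonal _ _).2 fun X hX => ?_
  rw [F.eq_sum hX, sum_inner]
  refine Finset.sum_eq_zero fun b _ => ?_
  have h1 := C.fderiv_height_zero hM F ξ q (F.e b)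
  rw [h, Finset.sum_eq_single b (fun i _ hi => by rw [F.inner_e_e, if_neg hi]; simp) (by simp),
    F.inner_e_e, if_pos rfl, mul_one] at h1
  have h2 := hξ _ _ (F.isCurvatureNormal C.base_mem.1 b)
  have h3 : (⟪q, (F.e b : Euc n)⟫ : ℝ) = 0 := by
    rcases mul_eq_zero.1 h1.symm with h4 | h4
    · exact absurd (neg_eq_zero.1 h4) h2.ne
    · exact h4
  rw [real_inner_smul_left, real_inner_comm q, h3, mul_zero]

/-- The height function is critical at the base point if its direction is normal there. -/
theorem fderiv_height_eq_zero (hM : IsIsoparametricSubmanifold M) (ξ η : normalSpaceAt M x) :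
    fderiv ℝ (C.height ξ η) 0 = 0 := by
  ext u
  rw [C.fderiv_height ξ η C.zero_mem]
  have h := (C.isParallelMap hM ξ).parallel 0 C.zero_mem u
  rw [C.g_zero] at h
  exact inner_eq_zero_of_mem_normalSpaceAt η.2 h

/-- At a critical point, the Hessian of the height function of `η` on the sheet of `ξ` is `-A_ξ
A_η`. -/
theorem fderiv_fderiv_height_zero (hM : IsIsoparametricSubmanifold M) (F : PrincipalFrame M x)
    (ξ η : normalSpaceAt M x) (u v : tangentSpaceAt M x) :
    fderiv ℝ (fderiv ℝ (C.height ξ η)) 0 u v =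
      ∑ b, -(⟪(ξ : Euc n), (F.nrm b : Euc n)⟫ * ⟪(η : Euc n), (F.nrm b : Euc n)⟫) *
        (⟪(F.e b : Euc n), (u : Euc n)⟫ * ⟪(F.e b : Euc n), (v : Euc n)⟫) := by
  have hw : ContDiffAt ℝ 2 (fun t => C.V ξ (C.g t)) 0 :=
    mod_cast contDiffAt_infty.1 (C.contDiffAt_V_g ξ C.zero_mem) 2
  have hd : DifferentiableAt ℝ (fderiv ℝ fun t => C.V ξ (C.g t)) 0 :=
    (hw.fderiv_right (m := 1) (by norm_num)).differentiableAt (by simp)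
  have h1 : fderiv ℝ (C.height ξ η) =ᶠ[𝓝 0]
      fun t => innerSL ℝ (η : Euc n) ∘L fderiv ℝ (fun t => C.V ξ (C.g t)) t := by
    filter_upwards [isOpen_ball.mem_nhds C.zero_mem] with t ht using C.fderiv_height ξ η ht
  have h2 : fderiv ℝ (fderiv ℝ (C.height ξ η)) 0 u v =
      ⟪(η : Euc n), fderiv ℝ (fderiv ℝ fun t => C.V ξ (C.g t)) 0 u v⟫ := by
    rw [h1.fderiv_eq]
    rw [fderiv_comp_fderiv _ hd]
    rfl
  have h3 := (C.isParallelMap hM ξ).inner_fderiv_fderiv (C.isParallelMap hM η) C.zero_mem hw v u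
  rw [C.g_zero, C.V_base, real_inner_comm, C.fderiv_V_g_zero hM F ξ, C.fderiv_V_g_zero hM F η] at h3
  rw [h2, real_inner_comm, ← neg_eq_iff_eq_neg.2 h3, sum_inner, ← Finset.sum_neg_distrib]
  refine Finset.sum_congr rfl fun b _ => ?_
  rw [real_inner_smul_left, F.inner_e_sum]
  ring

end FlatChart

/-! ### Superlevel sets of height functions -/

namespace IsCurvatureNormal

variable {x ν e : Euc n}

/-- The parallel translate of `ξ` along the curvature circle `curvCircle x ν e`. -/
noncomputable def _root_.curvCircleField (x ν e ξ : Euc n) (θ : ℝ) : Euc n :=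
  ξ - (⟪ξ, ν⟫ : ℝ) • (curvCircle x ν e θ - x)

/-- `curvCircleField` is parallel along the curvature circle: its derivative is tangent to the
circle. -/
theorem isParallelMap_curvCircle (hM : IsIsoparametricSubmanifold M) (hMc : IsClosed M)
    (h : IsCurvatureNormal M x ν e) (hν : ν ≠ 0) {ξ : Euc n} (hξ : ξ ∈ normalSpaceAt M x) :
    IsParallelMap M univ (curvCircle x ν e) (curvCircleField x ν e ξ) := by
  have h1 : ∀ θ, HasDerivAt (curvCircleField x ν e ξ)
      (-((⟪ξ, ν⟫ : ℝ) • (‖ν‖⁻¹ • curvCircleTangent ν e θ))) θ := fun θ =>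
    (((hasDerivAt_curvCircle hν θ).sub_const x).const_smul (⟪ξ, ν⟫ : ℝ)).const_sub ξ
  have h2 := fun θ => h.isCurvCircleAt hM hMc hν θ
  refine ⟨isOpen_univ, fun θ _ => (h2 θ).isCurvatureNormal.mem, fun θ _ => (h2 θ).sub_smul_mem ξ hξ,
    fun θ _ => (hasDerivAt_curvCircle hν θ).differentiableAt, fun θ _ => (h1 θ).differentiableAt,
    fun θ _ u => ?_⟩
  rw [(h1 θ).hasFDerivAt.fderiv]
  simp only [ContinuousLinearMap.toSpanSingleton_apply]
  exact Submodule.smul_mem _ _ (Submodule.neg_mem _ (Submodule.smul_mem _ _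
    (Submodule.smul_mem _ _ (h2 θ).isCurvatureNormal.tangent)))

theorem curvCircleField_zero (ξ : Euc n) : curvCircleField x ν e ξ 0 = ξ := by
  simp [curvCircleField, curvCircle]

theorem curvCircle_zero : curvCircle x ν e 0 = x := by
  simp [curvCircle]

theorem inner_curvCircleField (h : IsCurvatureNormal M x ν e) {η : Euc n}
    (hη : η ∈ normalSpaceAt M x) (ξ : Euc n) (θ : ℝ) :
    (⟪η, curvCircleField x ν e ξ θ⟫ : ℝ) =
      ⟪η, ξ⟫ - ⟪ξ, ν⟫ * ⟪η, ν⟫ * ((‖ν‖ ^ 2)⁻¹ * (1 - Real.cos θ)) := by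
  have h1 : (⟪η, e⟫ : ℝ) = 0 := inner_eq_zero_of_mem_normalSpaceAt hη h.tangent
  rw [curvCircleField, curvCircle, inner_sub_right, real_inner_smul_right, add_assoc,
    add_sub_cancel_left, inner_add_right, real_inner_smul_right, real_inner_smul_right, h1]
  ring

/-- The part of a curvature circle without its base point lies above the level of the base point, for
height functions which are increasing in the direction of the circle. -/
theorem joinedAbove_curvCircle (hM : IsIsoparametricSubmanifold M) (hMc : IsClosed M)
    (h : IsCurvatureNormal M x ν e) (hν : ν ≠ 0) {S : Set (Euc n × Euc n)}
    (hS : IsParallelInvariant M S) {ξ η : Euc n} (hξS : (x, ξ) ∈ S) (hη : η ∈ normalSpaceAt M x)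
    (hneg : ⟪ξ, ν⟫ * ⟪η, ν⟫ < 0) {θ φ : ℝ} (hθ : θ ∈ Ioo 0 (2 * Real.pi))
    (hφ : φ ∈ Ioo 0 (2 * Real.pi)) :
    JoinedAbove (fun p : Euc n × Euc n => (⟪η, p.2⟫ : ℝ)) ⟪η, ξ⟫ S
      (curvCircle x ν e θ, curvCircleField x ν e ξ θ)
      (curvCircle x ν e φ, curvCircleField x ν e ξ φ) := by
  have hp := h.isParallelMap_curvCircle hM hMc hν (hS.mem _ hξS).2
  refine ⟨(fun θ => (curvCircle x ν e θ, curvCircleField x ν e ξ θ)) '' Ioo 0 (2 * Real.pi),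
    isPreconnected_Ioo.image _ ?_, ⟨θ, hθ, rfl⟩, ⟨φ, hφ, rfl⟩, ?_, ?_⟩
  · exact fun θ _ => ((hp.diff_base θ trivial).continuousAt.prodMk
      (hp.diff_field θ trivial).continuousAt).continuousWithinAt
  · rintro _ ⟨θ, -, rfl⟩
    refine hS.of_isParallelMap hM hp isPreconnected_univ (mem_univ 0) (mem_univ θ) ?_
    rwa [curvCircle_zero, curvCircleField_zero]
  · rintro _ ⟨θ, hθ, rfl⟩
    have hcos : Real.cos θ < 1 := by
      refine lt_of_le_of_ne (Real.cos_le_one θ) fun hc => ?_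
      have := (Real.cos_eq_one_iff_of_lt_of_lt (by linarith [hθ.1, Real.pi_pos]) hθ.2).1 hc
      exact hθ.1.ne' this
    have h1 := h.inner_curvCircleField hη ξ θ
    have h2 : 0 < (‖ν‖ ^ 2)⁻¹ * (1 - Real.cos θ) := by
      have := norm_pos_iff.2 hν
      have : 0 < 1 - Real.cos θ := by linarith
      positivity
    simp only [h1]
    linarith [mul_neg_of_neg_of_pos hneg h2]

/-- Over a chart, the curvature circle is the graph over a line. -/
theorem eventually_sheet_eq_curvCircle (hM : IsIsoparametricSubmanifold M) (hMc : IsClosed M)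
    (C : FlatChart M x) (h : IsCurvatureNormal M x ν e) (hν : ν ≠ 0) (ξ : normalSpaceAt M x) :
    ∀ᶠ s in 𝓝 (0 : ℝ), |s * ‖ν‖| < 1 ∧
      (C.g (s • ⟨e, h.tangent⟩), C.V ξ (C.g (s • ⟨e, h.tangent⟩))) =
        (curvCircle x ν e (Real.arcsin (s * ‖ν‖)),
          curvCircleField x ν e ξ (Real.arcsin (s * ‖ν‖))) := by
  have hp := h.isParallelMap_curvCircle hM hMc hν ξ.2
  have h1 := hp.eventually_eq_V hM C (mem_univ 0) (ξ := ξ)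
    (by rw [curvCircle_zero]; exact C.base_mem.2)
    (by rw [curvCircle_zero, curvCircleField_zero, C.V_base])
  have h2 : Tendsto (fun s : ℝ => Real.arcsin (s * ‖ν‖)) (𝓝 0) (𝓝 0) := by
    have : Continuous fun s : ℝ => Real.arcsin (s * ‖ν‖) :=
      Real.continuous_arcsin.comp (continuous_id.mul_const _)
    simpa using this.tendsto 0
  have h3 : ∀ᶠ s in 𝓝 (0 : ℝ), |s * ‖ν‖| < 1 := by
    have : Continuous fun s : ℝ => |s * ‖ν‖| := by fun_prop
    exact this.continuousAt.eventually_lt continuousAt_const (by simp)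
  filter_upwards [h2.eventually h1, h3] with s hs hs1
  refine ⟨hs1, ?_⟩
  have h4 : curvCircle x ν e (Real.arcsin (s * ‖ν‖)) ∈ M ∩ C.U := ⟨hp.mem _ trivial, hs.2.1⟩
  have h5 : (tangentSpaceAt M x).orthogonalProjectionOnto
      (curvCircle x ν e (Real.arcsin (s * ‖ν‖)) - x) = s • ⟨e, h.tangent⟩ := by
    have hn : ‖ν‖ ≠ 0 := norm_ne_zero_iff.2 hν
    have h6 : ‖ν‖⁻¹ * (s * ‖ν‖) = s := by field_simp
    rw [curvCircle, add_assoc, add_sub_cancel_left,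
      Real.sin_arcsin (abs_le.1 hs1.le).1 (abs_le.1 hs1.le).2, h6, map_add, map_smul, map_smul,
      Submodule.orthogonalProjectionOnto_eq_zero_iff.2 h.normal, smul_zero, add_zero]
    congr 1
    exact Submodule.orthogonalProjectionOnto_mem_subspace_eq_self (⟨e, h.tangent⟩ : tangentSpaceAt M x)
  have h6 := (C.g_proj h4).2
  rw [h5] at h6
  rw [h6, hs.2.2]

end IsCurvatureNormal

theorem isPreconnected_submodule_sphere {T : Type*} [NormedAddCommGroup T] [NormedSpace ℝ T]
    {P : Submodule ℝ T} (hP : 1 < Module.rank ℝ P) (δ : ℝ) :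
    IsPreconnected {a | a ∈ P ∧ ‖a‖ = δ} := by
  convert (isPreconnected_sphere hP 0 δ).image _ continuous_subtype_val.continuousOn using 1
  ext a
  simp only [mem_image, mem_sphere_iff_norm, sub_zero, mem_ofPred_eq]
  exact ⟨fun h => ⟨⟨a, h.1⟩, h.2, rfl⟩, fun ⟨b, hb, hba⟩ => hba ▸ ⟨b.2, hb⟩⟩

/-- The span of the principal directions with a given property. -/
theorem PrincipalFrame.exists_submodule {x : Euc n} (F : PrincipalFrame M x)
    (p : Fin (Module.finrank ℝ (tangentSpaceAt M x)) → Prop) :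
    ∃ P : Submodule ℝ (tangentSpaceAt M x), (∀ b, p b → F.e b ∈ P) ∧
      (∀ a ∈ P, ∀ b, ¬ p b → (⟪(F.e b : Euc n), (a : Euc n)⟫ : ℝ) = 0) ∧
      (∀ a ∈ Pᗮ, ∀ b, p b → (⟪(F.e b : Euc n), (a : Euc n)⟫ : ℝ) = 0) ∧
      ∀ b, p b → 1 < Module.rank ℝ P ∨ ∀ a ∈ P, ∃ s : ℝ, a = s • F.e b := by
  have he : ∀ b, p b → F.e b ∈ Submodule.span ℝ (F.e '' {b | p b}) := fun b hb =>
    Submodule.subset_span ⟨b, hb, rfl⟩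
  refine ⟨Submodule.span ℝ (F.e '' {b | p b}), he, fun a ha b hb => ?_, fun a ha b hb => ?_,
    fun b hb => ?_⟩
  · induction ha using Submodule.span_induction with
    | mem a h =>
      obtain ⟨i, hi, rfl⟩ := h
      rw [F.inner_e_e, if_neg]
      rintro rfl
      exact hb hi
    | zero => simp
    | add a a' _ _ h h' => rw [Submodule.coe_add, inner_add_right, h, h', add_zero]
    | smul s a _ h => rw [Submodule.coe_smul, real_inner_smul_right, h, mul_zero]
  · exact (Submodule.mem_orthogonal _ _).1 ha _ (he b hb)
  · by_cases h : ∃ i, p i ∧ i ≠ b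
    · left
      obtain ⟨i, hi, hib⟩ := h
      have h1 : LinearIndependent ℝ ![(⟨F.e i, he i hi⟩ : Submodule.span ℝ (F.e '' {b | p b})),
          ⟨F.e b, he b hb⟩] := by
        refine LinearIndependent.of_comp (Submodule.subtype _) ?_
        have h2 : LinearIndependent ℝ (F.e ∘ ![i, b]) := F.e.orthonormal.linearIndependent.comp _ (by
          intro j k hjk
          fin_cases j <;> fin_cases k <;> simp_all)
        convert h2 using 1
        ext j
        fin_cases j <;> rfl
      have h2 := h1.cardinal_le_rank
      simp only [Cardinal.mk_fin] at h2
      exact lt_of_lt_of_le (by norm_num) h2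
    · right
      push Not at h
      intro a ha
      have h1 : F.e '' {b | p b} = {F.e b} := by
        ext v
        constructor
        · rintro ⟨i, hi, rfl⟩
          rw [h i hi]; rfl
        · rintro rfl
          exact ⟨b, hb, rfl⟩
      rw [h1, Submodule.mem_span_singleton] at ha
      obtain ⟨s, hs⟩ := ha
      exact ⟨s, hs.symm⟩

namespace IsParallelInvariant

variable {S : Set (Euc n × Euc n)} {x : Euc n} (C : FlatChart M x) {ξ : normalSpaceAt M x}
  {q : Euc n}

/-- Transfer of a strict local maximum from a chart to `S`, whose sheets are neighbourhoods. -/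
theorem eventually_lt_of_height (hM : IsIsoparametricSubmanifold M) (hS : IsParallelInvariant M S)
    (hfin : ∀ x ∈ M, {ξ | (x, ξ) ∈ S}.Finite)
    (h : ∀ᶠ t in 𝓝[≠] 0, C.height ξ q t < C.height ξ q 0) :
    ∀ᶠ p : Euc n × Euc n in 𝓝[S] (x, (ξ : Euc n)), p ≠ (x, (ξ : Euc n)) →
      (⟪q, p.2⟫ : ℝ) < ⟪q, (ξ : Euc n)⟫ := by
  rw [eventually_nhdsWithin_iff] at h
  obtain ⟨ε, hε, hball⟩ := Metric.eventually_nhds_iff_ball.1 h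
  filter_upwards [hS.eventually_mem_sheet hM hfin C ξ hε] with p hp hne
  obtain ⟨t, ht, -, rfl⟩ := hp
  have h1 := hball t ht fun h0 => hne (by rw [h0, C.g_zero, C.V_base])
  rwa [C.height_zero] at h1

/-- Transfer of the second alternative in `HasNoConnectingPass` from a chart to `S`. -/
theorem joinedAbove_of_height (hM : IsIsoparametricSubmanifold M) (hS : IsParallelInvariant M S)
    (hfin : ∀ x ∈ M, {ξ | (x, ξ) ∈ S}.Finite) (hξ : (x, (ξ : Euc n)) ∈ S)
    (h1 : ∀ r > 0, ∃ w ∈ ball 0 r, C.height ξ q 0 < C.height ξ q w)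
    {w : Euc n × Euc n} {η : ℝ} (hη : 0 < η) (h2 : ∀ u ∈ ball 0 η, u ∈ ball 0 C.ρ →
      C.height ξ q 0 < C.height ξ q u → JoinedAbove (fun p : Euc n × Euc n => (⟪q, p.2⟫ : ℝ))
        ⟪q, (ξ : Euc n)⟫ S (C.g u, C.V ξ (C.g u)) w) :
    (x, (ξ : Euc n)) ∈ closure {p | p ∈ S ∧ (⟪q, (ξ : Euc n)⟫ : ℝ) < ⟪q, p.2⟫} ∧
      ∃ w, ∀ᶠ p : Euc n × Euc n in 𝓝[S] (x, (ξ : Euc n)), (⟪q, (ξ : Euc n)⟫ : ℝ) < ⟪q, p.2⟫ →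
        JoinedAbove (fun p : Euc n × Euc n => (⟪q, p.2⟫ : ℝ)) ⟪q, (ξ : Euc n)⟫ S p w := by
  rw [C.height_zero] at h1 h2
  constructor
  · have h3 : ContinuousAt (fun t => (C.g t, C.V ξ (C.g t))) 0 :=
      (continuousOn_sheet C ξ).continuousAt (isOpen_ball.mem_nhds C.zero_mem)
    rw [mem_closure_iff_nhds]
    intro W hW
    have h4 : (fun t => (C.g t, C.V ξ (C.g t))) ⁻¹' W ∈ 𝓝 0 := by
      refine h3.preimage_mem_nhds ?_
      simp only [C.g_zero, C.V_base]
      exact hW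
    obtain ⟨r, hr, hrW⟩ := Metric.mem_nhds_iff.1 (inter_mem h4 (isOpen_ball.mem_nhds C.zero_mem))
    obtain ⟨t, ht, hlt⟩ := h1 r hr
    exact ⟨_, (hrW ht).1, hS.sheet_mem C hξ (hrW ht).2, hlt⟩
  · refine ⟨w, ?_⟩
    filter_upwards [hS.eventually_mem_sheet hM hfin C ξ hη] with p hp hlt
    obtain ⟨t, ht, htρ, rfl⟩ := hp
    exact h2 t ht htρ hlt

/-- A small sphere of dimension at least one is connected. -/
theorem joinedAbove_sphere_of_one_lt_rank (hS : IsParallelInvariant M S)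
    (hξ : (x, (ξ : Euc n)) ∈ S) {P : Submodule ℝ (tangentSpaceAt M x)}
    (hP : 1 < Module.rank ℝ P) {δ : ℝ} (hδ : δ < C.ρ)
    (h : ∀ a ∈ P, ‖a‖ = δ → C.height ξ q 0 < C.height ξ q a) {a a' : tangentSpaceAt M x}
    (ha : a ∈ P) (haδ : ‖a‖ = δ) (ha' : a' ∈ P) (haδ' : ‖a'‖ = δ) :
    JoinedAbove (fun p : Euc n × Euc n => (⟪q, p.2⟫ : ℝ)) ⟪q, (ξ : Euc n)⟫ S
      (C.g a, C.V ξ (C.g a)) (C.g a', C.V ξ (C.g a')) := by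
  rw [C.height_zero] at h
  have h2 : ∀ b ∈ {a | a ∈ P ∧ ‖a‖ = δ}, b ∈ ball 0 C.ρ :=
    fun b hb => by rw [mem_ball_zero_iff, hb.2]; exact hδ
  refine ⟨(fun t => (C.g t, C.V ξ (C.g t))) '' {a | a ∈ P ∧ ‖a‖ = δ},
    (isPreconnected_submodule_sphere hP δ).image _ ((continuousOn_sheet C ξ).mono h2),
    mem_image_of_mem _ ⟨ha, haδ⟩, mem_image_of_mem _ ⟨ha', haδ'⟩, ?_, ?_⟩
  · rintro _ ⟨b, hb, rfl⟩
    exact hS.sheet_mem C hξ (h2 b hb)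
  · rintro _ ⟨b, hb, rfl⟩
    exact h b hb.1 hb.2

/-- The two points of a small sphere of dimension zero are joined by the long arc of a curvature
circle. -/
theorem exists_joinedAbove_neg (hM : IsIsoparametricSubmanifold M) (hMc : IsClosed M)
    (hS : IsParallelInvariant M S) (hξ : (x, (ξ : Euc n)) ∈ S) (hq : q ∈ normalSpaceAt M x)
    {ν e : Euc n} (h : IsCurvatureNormal M x ν e) (hneg : ⟪(ξ : Euc n), ν⟫ * ⟪q, ν⟫ < 0) :
    ∃ r > (0 : ℝ), ∀ δ > (0 : ℝ), δ < r → JoinedAbove (fun p : Euc n × Euc n => (⟪q, p.2⟫ : ℝ))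
      ⟪q, (ξ : Euc n)⟫ S (C.g (-δ • ⟨e, h.tangent⟩), C.V ξ (C.g (-δ • ⟨e, h.tangent⟩)))
        (C.g (δ • ⟨e, h.tangent⟩), C.V ξ (C.g (δ • ⟨e, h.tangent⟩))) := by
  have hν : ν ≠ 0 := by rintro rfl; simp at hneg
  have hn : 0 < ‖ν‖ := norm_pos_iff.2 hν
  obtain ⟨r, hr, H⟩ := Metric.eventually_nhds_iff_ball.1
    (h.eventually_sheet_eq_curvCircle hM hMc C hν ξ)
  refine ⟨r, hr, fun δ hδ hδr => ?_⟩
  obtain ⟨h1, h2⟩ := H δ (by rwa [mem_ball_zero_iff, Real.norm_of_nonneg hδ.le])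
  obtain ⟨-, h3⟩ := H (-δ) (by rwa [mem_ball_zero_iff, norm_neg, Real.norm_of_nonneg hδ.le])
  rw [h2, h3, neg_mul, Real.arcsin_neg]
  set α := Real.arcsin (δ * ‖ν‖) with hα
  have hα0 : 0 < α := Real.arcsin_pos.2 (by positivity)
  have hα1 : α ≤ Real.pi / 2 := Real.arcsin_le_pi_div_two _
  have h4 : curvCircle x ν e (-α) = curvCircle x ν e (2 * Real.pi - α) := by
    simp [curvCircle, Real.sin_two_pi_sub, Real.cos_two_pi_sub]
  have h5 : curvCircleField x ν e (ξ : Euc n) (-α) =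
      curvCircleField x ν e ξ (2 * Real.pi - α) := by
    rw [curvCircleField, curvCircleField, h4]
  rw [h4, h5]
  have := Real.pi_pos
  exact h.joinedAbove_curvCircle hM hMc hν hS hξ hq hneg
    ⟨by linarith, by linarith⟩ ⟨hα0, by linarith⟩

/-- If all principal curvatures of both `ξ` and `q` are negative, then the Hessian of the height
function is negative definite. -/
theorem eventually_lt_of_height_of_neg (hM : IsIsoparametricSubmanifold M)
    (hS : IsParallelInvariant M S) (hfin : ∀ x ∈ M, {ξ | (x, ξ) ∈ S}.Finite)
    (hξ : (x, (ξ : Euc n)) ∈ S)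
    (hneg : ∀ ν e, IsCurvatureNormal M x ν e → (⟪(ξ : Euc n), ν⟫ : ℝ) < 0)
    (hqN : q ∈ normalSpaceAt M x) (hq : ∀ ν e, IsCurvatureNormal M x ν e → (⟪q, ν⟫ : ℝ) < 0) :
    ∀ᶠ p : Euc n × Euc n in 𝓝[S] (x, (ξ : Euc n)), p ≠ (x, (ξ : Euc n)) →
      (⟪q, p.2⟫ : ℝ) < ⟪q, (ξ : Euc n)⟫ := by
  have hxM : x ∈ M := (hS.mem _ hξ).1
  obtain ⟨C⟩ := hM.exists_flatChart hxM
  obtain ⟨η, rfl⟩ : ∃ η : normalSpaceAt M x, (η : Euc n) = q := ⟨⟨q, hqN⟩, rfl⟩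
  obtain ⟨F⟩ := hM.exists_principalFrame hxM
  have hF := fun b => F.isCurvatureNormal hxM b
  obtain ⟨c, hc, hcb⟩ := exists_pos_forall_eq_zero_or_le_abs fun b =>
    (⟪(ξ : Euc n), (F.nrm b : Euc n)⟫ * ⟪(η : Euc n), (F.nrm b : Euc n)⟫ : ℝ)
  refine hS.eventually_lt_of_height C hM hfin (eventually_lt_of_fderiv_fderiv_neg
    (C.contDiffAt_height ξ η C.zero_mem) (C.fderiv_height_eq_zero hM ξ η) hc fun u => ?_)
  rw [C.fderiv_fderiv_height_zero hM F, Submodule.coe_norm, F.norm_sq_eq_sum u.2, Finset.mul_sum]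
  refine Finset.sum_le_sum fun b _ => ?_
  rw [sq]
  refine mul_le_mul_of_nonneg_right (neg_le_neg ?_) (mul_self_nonneg _)
  have h1 := mul_pos_of_neg_of_neg (hneg _ _ (hF b)) (hq _ _ (hF b))
  have h2 := (hcb b).resolve_left h1.ne'
  rwa [abs_of_pos h1] at h2

/-- The local behaviour of a height function with nonfocal direction: at each point it either has a
strict local maximum or satisfies the second alternative in `HasNoConnectingPass`. Critical points
are nondegenerate, and superlevel sets are connected near a critical point with at least two
positive directions. With one positive direction their two parts are joined globally, by a curvature
circle. -/
theorem height_alternative (hM : IsIsoparametricSubmanifold M) (hMc : IsClosed M)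
    (hS : IsParallelInvariant M S) (hfin : ∀ x ∈ M, {ξ | (x, ξ) ∈ S}.Finite)
    (hξ : (x, (ξ : Euc n)) ∈ S)
    (hneg : ∀ ν e, IsCurvatureNormal M x ν e → (⟪(ξ : Euc n), ν⟫ : ℝ) < 0)
    (hq : q ∈ normalSpaceAt M x → ∀ ν e, IsCurvatureNormal M x ν e → (⟪q, ν⟫ : ℝ) ≠ 0) :
    (∀ᶠ p : Euc n × Euc n in 𝓝[S] (x, (ξ : Euc n)), p ≠ (x, (ξ : Euc n)) →
      (⟪q, p.2⟫ : ℝ) < ⟪q, (ξ : Euc n)⟫) ∨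
    (x, (ξ : Euc n)) ∈ closure {p | p ∈ S ∧ (⟪q, (ξ : Euc n)⟫ : ℝ) < ⟪q, p.2⟫} ∧
      ∃ w, ∀ᶠ p : Euc n × Euc n in 𝓝[S] (x, (ξ : Euc n)), (⟪q, (ξ : Euc n)⟫ : ℝ) < ⟪q, p.2⟫ →
        JoinedAbove (fun p : Euc n × Euc n => (⟪q, p.2⟫ : ℝ)) ⟪q, (ξ : Euc n)⟫ S p w := by
  have hxM : x ∈ M := (hS.mem _ hξ).1
  obtain ⟨C⟩ := hM.exists_flatChart hxM
  have hmap : ∀ {r : ℝ}, r ≤ C.ρ → ∀ {u w : tangentSpaceAt M x},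
      JoinedAbove (C.height ξ q) (C.height ξ q 0) (ball 0 r) u w →
      JoinedAbove (fun p : Euc n × Euc n => (⟪q, p.2⟫ : ℝ)) ⟪q, (ξ : Euc n)⟫ S
        (C.g u, C.V ξ (C.g u)) (C.g w, C.V ξ (C.g w)) := by
    intro r hr u w h
    rw [C.height_zero] at h
    exact h.map (Φ := fun t => (C.g t, C.V ξ (C.g t)))
      ((continuousOn_sheet C ξ).mono (ball_subset_ball hr))
      (fun t ht => hS.sheet_mem C hξ (ball_subset_ball hr ht)) fun _ _ => rfl
  have hcf : ContDiffAt ℝ 2 (C.height ξ q) 0 := C.contDiffAt_height ξ q C.zero_mem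
  -- at a critical point `q` is normal and the Hessian is `-A_ξ A_q`, where `A_ξ` is negative
  -- definite and `A_q` is invertible
  by_cases hd : fderiv ℝ (C.height ξ q) 0 = 0
  · have hqN := C.mem_normalSpaceAt_of_fderiv_height_eq_zero hM hneg hd
    obtain ⟨η, rfl⟩ : ∃ η : normalSpaceAt M x, (η : Euc n) = q := ⟨⟨q, hqN⟩, rfl⟩
    obtain ⟨F⟩ := hM.exists_principalFrame C.base_mem.1
    have hF := fun b => F.isCurvatureNormal C.base_mem.1 b
    have hneg' := fun b => hneg _ _ (hF b)
    have hne' := fun b => hq hqN _ _ (hF b)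
    obtain ⟨c, hc, hcb⟩ := exists_pos_forall_eq_zero_or_le_abs fun b =>
      (⟪(ξ : Euc n), (F.nrm b : Euc n)⟫ * ⟪(η : Euc n), (F.nrm b : Euc n)⟫ : ℝ)
    -- `P` is the positive space of the Hessian
    obtain ⟨P, hPe, hP1, hP2, hPr⟩ := F.exists_submodule
      fun b => 0 < (⟪(η : Euc n), (F.nrm b : Euc n)⟫ : ℝ)
    have hcb' : ∀ b, c ≤ |(⟪(ξ : Euc n), (F.nrm b : Euc n)⟫ : ℝ) *
        ⟪(η : Euc n), (F.nrm b : Euc n)⟫| := fun b =>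
      (hcb b).resolve_left (mul_ne_zero (hneg' b).ne (hne' b))
    have hH := fun u v => C.fderiv_fderiv_height_zero hM F ξ η u v
    have hHP : ∀ a ∈ P, c * ‖a‖ ^ 2 ≤ fderiv ℝ (fderiv ℝ (C.height ξ η)) 0 a a := by
      intro a ha
      have h1 := F.norm_sq_eq_sum a.2
      rw [Submodule.coe_norm] at *
      rw [hH, h1, Finset.mul_sum]
      refine Finset.sum_le_sum fun b _ => ?_
      rw [sq]
      by_cases hb : 0 < (⟪(η : Euc n), (F.nrm b : Euc n)⟫ : ℝ)
      · refine mul_le_mul_of_nonneg_right ?_ (mul_self_nonneg _)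
        have := hcb' b
        rwa [abs_of_neg (mul_neg_of_neg_of_pos (hneg' b) hb)] at this
      · rw [hP1 a ha b hb]; simp
    have hHN : ∀ a ∈ Pᗮ, fderiv ℝ (fderiv ℝ (C.height ξ η)) 0 a a ≤ -c * ‖a‖ ^ 2 := by
      intro a ha
      have h1 := F.norm_sq_eq_sum a.2
      rw [hH, Submodule.coe_norm, h1, Finset.mul_sum]
      refine Finset.sum_le_sum fun b _ => ?_
      rw [sq]
      by_cases hb : 0 < (⟪(η : Euc n), (F.nrm b : Euc n)⟫ : ℝ)
      · rw [hP2 a ha b hb]; simp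
      · refine mul_le_mul_of_nonneg_right (neg_le_neg ?_) (mul_self_nonneg _)
        have := hcb' b
        rwa [abs_of_pos (mul_pos_of_neg_of_neg (hneg' b)
          (lt_of_le_of_ne (not_lt.1 hb) (hne' b)))] at this
    by_cases hs : ∃ b, 0 < (⟪(η : Euc n), (F.nrm b : Euc n)⟫ : ℝ)
    · right
      obtain ⟨b₀, hb₀⟩ := hs
      -- all points of a small sphere in `P` can be joined above the level
      obtain ⟨r₁, hr₁, hr₁ρ, hsphere⟩ : ∃ r₁ > 0, r₁ ≤ C.ρ ∧ ∀ δ > 0, δ < r₁ →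
          (∀ a ∈ P, ‖a‖ = δ → C.height ξ η 0 < C.height ξ η a) → ∀ a ∈ P, ‖a‖ = δ →
          JoinedAbove (fun p : Euc n × Euc n => (⟪(η : Euc n), p.2⟫ : ℝ)) ⟪(η : Euc n), (ξ : Euc n)⟫ S
            (C.g a, C.V ξ (C.g a)) (C.g (δ • F.e b₀), C.V ξ (C.g (δ • F.e b₀))) := by
        have hδe : ∀ δ > (0 : ℝ), ‖δ • F.e b₀‖ = δ := fun δ hδ => by
          rw [norm_smul, F.e.orthonormal.1, mul_one, Real.norm_of_nonneg hδ.le]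
        rcases hPr b₀ hb₀ with h1 | h1
        · exact ⟨C.ρ, C.ρ_pos, le_rfl, fun δ hδ hδρ hpos a ha haδ =>
            hS.joinedAbove_sphere_of_one_lt_rank C hξ h1 hδρ hpos ha haδ
              (P.smul_mem _ (hPe b₀ hb₀)) (hδe δ hδ)⟩
        · obtain ⟨r, hr, hrJ⟩ := exists_joinedAbove_neg C hM hMc hS hξ hqN (hF b₀)
            (mul_neg_of_neg_of_pos (hneg' b₀) hb₀)
          refine ⟨min r C.ρ, lt_min hr C.ρ_pos, min_le_right _ _, fun δ hδ hδr hpos a ha haδ => ?_⟩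
          obtain ⟨s, rfl⟩ := h1 a ha
          rw [norm_smul, F.e.orthonormal.1, mul_one, Real.norm_eq_abs] at haδ
          rcases eq_or_eq_neg_of_abs_eq haδ with rfl | rfl
          · have h2 := hpos _ (P.smul_mem s (hPe b₀ hb₀)) (hδe s hδ)
            rw [C.height_zero] at h2
            refine ⟨{(C.g (s • F.e b₀), C.V ξ (C.g (s • F.e b₀)))}, isPreconnected_singleton, rfl,
              rfl, ?_, ?_⟩
            · rintro _ rfl
              refine hS.sheet_mem C hξ ?_
              rw [mem_ball_zero_iff, hδe s hδ]
              exact hδr.trans_le (min_le_right _ _)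
            · rintro _ rfl
              exact h2
          · exact hrJ δ hδ (hδr.trans_le (min_le_left _ _))
      have hkey := fun r hr => exists_joinedAbove_sphere hcf hd P hc hHP hHN (fun a ha b hb => by
        rw [hH, hH]
        constructor <;>
        · refine Finset.sum_eq_zero fun i _ => ?_
          by_cases hi : 0 < (⟪(η : Euc n), (F.nrm i : Euc n)⟫ : ℝ)
          · rw [hP2 b hb i hi]; simp
          · rw [hP1 a ha i hi]; simp) (r := r) hr
      obtain ⟨δ, hδ, hδr, hpos, η', hη', hJ⟩ := hkey r₁ hr₁
      refine hS.joinedAbove_of_height C hM hfin hξ ?_ hη'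
        (w := (C.g (δ • F.e b₀), C.V ξ (C.g (δ • F.e b₀)))) fun u hu _ hfu => ?_
      · intro r hr
        obtain ⟨δ, hδ, hδr, hpos, -⟩ := hkey r hr
        have h2 : ‖δ • F.e b₀‖ = δ := by
          rw [norm_smul, F.e.orthonormal.1, mul_one, Real.norm_of_nonneg hδ.le]
        exact ⟨δ • F.e b₀, by rwa [mem_ball_zero_iff, h2], hpos _ (P.smul_mem _ (hPe b₀ hb₀)) h2⟩
      · obtain ⟨a, ha, haδ, hJa⟩ := hJ u hu hfu
        exact (hmap hr₁ρ hJa).trans (hsphere δ hδ hδr hpos a ha haδ)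
    -- without positive directions the Hessian is negative definite
    · left
      refine hS.eventually_lt_of_height C hM hfin
        (eventually_lt_of_fderiv_fderiv_neg hcf hd hc fun u => hHN u ?_)
      refine (Submodule.mem_orthogonal _ _).2 fun a ha => ?_
      have h1 : (a : Euc n) = 0 := by
        rw [F.eq_sum a.2]
        exact Finset.sum_eq_zero fun b _ => by rw [hP1 a ha b fun hb => hs ⟨b, hb⟩, zero_smul]
      have h2 : a = 0 := Subtype.ext h1
      rw [h2, inner_zero_left]
  · right
    have hstrict : HasStrictFDerivAt (C.height ξ q) (fderiv ℝ (C.height ξ q) 0) 0 :=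
      hcf.hasStrictFDerivAt (by simp)
    obtain ⟨w, hw, hfw, η, hη, hJ⟩ := exists_joinedAbove_of_fderiv_ne_zero hstrict hd C.ρ_pos
    refine hS.joinedAbove_of_height C hM hfin hξ (fun r hr => ?_) hη fun u hu _ hfu =>
      hmap le_rfl (hJ u hu hfu)
    obtain ⟨w, hw, hfw, -⟩ := exists_joinedAbove_of_fderiv_ne_zero hstrict hd hr
    exact ⟨w, hw, hfw⟩

/-- A height function whose direction is nonfocal and lies in the chamber of `x` is bounded on the
connected component of `(x, ξ)` by its value at `(x, ξ)`. -/
theorem inner_le_of_nonfocal (hM : IsIsoparametricSubmanifold M) (hMc : IsClosed M)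
    (hS : IsParallelInvariant M S) (hfin : ∀ x ∈ M, {ξ | (x, ξ) ∈ S}.Finite) (hSc : IsCompact S)
    (hneg : ∀ p ∈ S, ∀ ν e, IsCurvatureNormal M p.1 ν e → (⟪p.2, ν⟫ : ℝ) < 0)
    (hq : ∀ y ∈ M, q ∈ normalSpaceAt M y → ∀ ν e, IsCurvatureNormal M y ν e → (⟪q, ν⟫ : ℝ) ≠ 0)
    {p₀ : S} (hqN : q ∈ normalSpaceAt M p₀.1.1)
    (hq₀ : ∀ ν e, IsCurvatureNormal M p₀.1.1 ν e → (⟪q, ν⟫ : ℝ) < 0)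
    {p : S} (hp : p ∈ connectedComponent p₀) : (⟪q, p.1.2⟫ : ℝ) ≤ ⟪q, p₀.1.2⟫ := by
  have : CompactSpace S := isCompact_iff_compactSpace.1 hSc
  have : LocallyConnectedSpace S := hS.locallyConnectedSpace hM hfin
  have hcont : Continuous fun p : S => (⟪q, p.1.2⟫ : ℝ) := by fun_prop
  have hpass : HasNoConnectingPass fun p : S => (⟪q, p.1.2⟫ : ℝ) := by
    refine hasNoConnectingPass_restrict (f := fun p : Euc n × Euc n => (⟪q, p.2⟫ : ℝ)) ?_
    rintro ⟨y, ξ⟩ hy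
    have hyM : y ∈ M := (hS.mem _ hy).1
    exact hS.height_alternative (x := y) (ξ := ⟨ξ, (hS.mem _ hy).2⟩) hM hMc hfin hy
      (hneg _ hy) (hq y hyM)
  have hmax₀ : ∀ᶠ p in 𝓝[≠] p₀, (⟪q, p.1.2⟫ : ℝ) < ⟪q, p₀.1.2⟫ := by
    obtain ⟨⟨x, ξ⟩, hx⟩ := p₀
    have hxM : x ∈ M := (hS.mem _ hx).1
    have hneg' := hneg _ hx
    have h := hS.eventually_lt_of_height_of_neg (x := x) (ξ := ⟨ξ, (hS.mem _ hx).2⟩) hM hfin hx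
      hneg' hqN hq₀
    rw [← map_nhds_subtype_val ⟨(x, ξ), hx⟩] at h
    rw [eventually_nhdsWithin_iff]
    filter_upwards [h] with y hy hyz
    exact hy fun h => hyz (Subtype.ext h)
  -- the maximum over the component is a strict local maximum by `hpass`, hence it is attained at
  -- `p₀`, the only one
  obtain ⟨p₁, hp₁, hmax⟩ := (isClosed_connectedComponent (x := p₀)).isCompact.exists_isMaxOn
    ⟨p₀, mem_connectedComponent⟩ hcont.continuousOn
  have hmax₁ : ∀ᶠ p in 𝓝[≠] p₁, (⟪q, p.1.2⟫ : ℝ) < ⟪q, p₁.1.2⟫ := by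
    refine (hpass p₁).resolve_right fun h => ?_
    obtain ⟨y, hy1, hy2⟩ := mem_closure_iff.1 h.1 _ isOpen_connectedComponent hp₁
    have h2 : (⟪q, y.1.2⟫ : ℝ) ≤ ⟪q, p₁.1.2⟫ := hmax hy1
    exact absurd h2 (not_le.2 hy2)
  have h1 := hpass.eq_of_isStrictLocalMax hcont hp₁ hmax₀ hmax₁
  rw [← h1]
  exact hmax hp

end IsParallelInvariant

/-! ### Nonfocal directions are dense -/

theorem orthogonalProjectionOnto_normalSpaceAt {x : Euc n} (t : tangentSpaceAt M x) :
    (normalSpaceAt M x).orthogonalProjectionOnto (t : Euc n) = 0 :=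
  Submodule.orthogonalProjectionOnto_eq_zero_iff.2 (Submodule.le_orthogonal_orthogonal _ t.2)

/-- The vectors which are normal to `M` at some point and orthogonal to a curvature normal there. -/
def focalDirections {n : ℕ} (M : Set (Euc n)) : Set (Euc n) :=
  {q | ∃ y ∈ M, q ∈ normalSpaceAt M y ∧ ∃ ν e, IsCurvatureNormal M y ν e ∧ (⟪q, ν⟫ : ℝ) = 0}

theorem fderiv_sum_inner_smul {ι E F T : Type*} [Fintype ι] [NormedAddCommGroup E]
    [InnerProductSpace ℝ E] [NormedAddCommGroup F] [NormedSpace ℝ F] [NormedAddCommGroup T]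
    [NormedSpace ℝ T] (b : ι → E) (w : ι → T → F) (P : E →L[ℝ] T) {a : E}
    (hw : ∀ i, DifferentiableAt ℝ (w i) (P a)) (u : E) :
    fderiv ℝ (fun a => ∑ i, (⟪b i, a⟫ : ℝ) • w i (P a)) a u =
      ∑ i, (⟪b i, u⟫ : ℝ) • w i (P a) + ∑ i, (⟪b i, a⟫ : ℝ) • fderiv ℝ (w i) (P a) (P u) := by
  have h1 : ∀ i, HasFDerivAt (fun a : E => (⟪b i, a⟫ : ℝ) • w i (P a)) _ a := fun i =>
    (innerSL ℝ (b i)).hasFDerivAt.smul ((hw i).hasFDerivAt.comp a P.hasFDerivAt)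
  rw [(HasFDerivAt.fun_sum (u := Finset.univ) fun i _ => h1 i).fderiv]
  simp [Finset.sum_add_distrib, add_comm]

theorem fderiv_sum_const_smul {ι F T : Type*} [Fintype ι] [NormedAddCommGroup F] [NormedSpace ℝ F]
    [NormedAddCommGroup T] [NormedSpace ℝ T] (c : ι → ℝ) (w : ι → T → F) {t : T}
    (hw : ∀ i, DifferentiableAt ℝ (w i) t) (v : T) :
    fderiv ℝ (fun t => ∑ i, c i • w i t) t v = ∑ i, c i • fderiv ℝ (w i) t v := by
  have h1 : ∀ i, HasFDerivAt (fun t => c i • w i t) (c i • fderiv ℝ (w i) t) t := fun i =>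
    (hw i).hasFDerivAt.const_smul (c i)
  rw [(HasFDerivAt.fun_sum (u := Finset.univ) fun i _ => h1 i).fderiv]
  simp

namespace FlatChart

variable {x : Euc n} (C : FlatChart M x)

/-- The map sending `t + ξ`, with `t` tangent and `ξ` normal to `M` at `x`, to the parallel translate
of `ξ` to the point of the chart over `t`. -/
noncomputable def normalParam (a : Euc n) : Euc n :=
  ∑ i, (⟪(stdOrthonormalBasis ℝ (normalSpaceAt M x) i : Euc n), a⟫ : ℝ) •
    C.V (stdOrthonormalBasis ℝ (normalSpaceAt M x) i)
      (C.g ((tangentSpaceAt M x).orthogonalProjectionOnto a))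

theorem sum_inner_stdOrthonormalBasis (N : Submodule ℝ (Euc n)) (a : Euc n) :
    ∑ i, (⟪(stdOrthonormalBasis ℝ N i : Euc n), a⟫ : ℝ) • stdOrthonormalBasis ℝ N i =
      N.orthogonalProjectionOnto a := by
  rw [← (stdOrthonormalBasis ℝ N).sum_repr' (N.orthogonalProjectionOnto a)]
  refine Finset.sum_congr rfl fun i _ => ?_
  congr 1
  rw [Submodule.coe_inner]
  exact (Submodule.inner_orthogonalProjectionOnto_eq_of_mem_left _ _).symm

theorem sum_smul_V (a : Euc n) (y : Euc n) :
    ∑ i, (⟪(stdOrthonormalBasis ℝ (normalSpaceAt M x) i : Euc n), a⟫ : ℝ) •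
      C.V (stdOrthonormalBasis ℝ (normalSpaceAt M x) i) y =
        C.V ((normalSpaceAt M x).orthogonalProjectionOnto a) y := by
  rw [← sum_inner_stdOrthonormalBasis, map_sum, Finset.sum_apply]
  exact Finset.sum_congr rfl fun i _ => (C.V_smul _ _ _).symm

theorem normalParam_eq (a : Euc n) : C.normalParam a =
    C.V ((normalSpaceAt M x).orthogonalProjectionOnto a)
      (C.g ((tangentSpaceAt M x).orthogonalProjectionOnto a)) := C.sum_smul_V a _

theorem contDiffAt_normalParam {a : Euc n}
    (ha : (tangentSpaceAt M x).orthogonalProjectionOnto a ∈ ball 0 C.ρ) :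
    ContDiffAt ℝ ∞ C.normalParam a := by
  unfold normalParam
  refine ContDiffAt.sum fun i _ => ContDiffAt.smul (contDiffAt_const.inner ℝ contDiffAt_id) ?_
  exact ContDiffAt.comp (g := fun t => C.V (stdOrthonormalBasis ℝ (normalSpaceAt M x) i) (C.g t)) a
    (C.contDiffAt_V_g _ ha) (tangentSpaceAt M x).orthogonalProjectionOnto.contDiff.contDiffAt

theorem fderiv_normalParam {a : Euc n}
    (ha : (tangentSpaceAt M x).orthogonalProjectionOnto a ∈ ball 0 C.ρ) (u : Euc n) :
    fderiv ℝ C.normalParam a u = C.V ((normalSpaceAt M x).orthogonalProjectionOnto u)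
        (C.g ((tangentSpaceAt M x).orthogonalProjectionOnto a)) +
      fderiv ℝ (fun t => C.V ((normalSpaceAt M x).orthogonalProjectionOnto a) (C.g t))
        ((tangentSpaceAt M x).orthogonalProjectionOnto a)
        ((tangentSpaceAt M x).orthogonalProjectionOnto u) := by
  have hd : ∀ ξ, DifferentiableAt ℝ (fun t => C.V ξ (C.g t))
      ((tangentSpaceAt M x).orthogonalProjectionOnto a) := fun ξ =>
    (C.contDiffAt_V_g ξ ha).differentiableAt (by simp)
  have h1 := fderiv_sum_inner_smul (fun i => (stdOrthonormalBasis ℝ (normalSpaceAt M x) i : Euc n))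
    (fun i t => C.V (stdOrthonormalBasis ℝ (normalSpaceAt M x) i) (C.g t))
    (tangentSpaceAt M x).orthogonalProjectionOnto (a := a) (fun i => hd _) u
  have h2 := fderiv_sum_const_smul (fun i => (⟪(stdOrthonormalBasis ℝ (normalSpaceAt M x) i :
    Euc n), a⟫ : ℝ)) (fun i t => C.V (stdOrthonormalBasis ℝ (normalSpaceAt M x) i) (C.g t))
    (fun i => hd _) ((tangentSpaceAt M x).orthogonalProjectionOnto u)
  simp only [C.sum_smul_V] at h2
  rw [h2, ← C.sum_smul_V u]
  exact h1

/-- The focal directions are critical values of the map `normalParam`, so by Sard's theorem in equal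
dimensions they form a null set. -/
theorem measure_focalDirections_inter (hM : IsIsoparametricSubmanifold M) :
    MeasureTheory.volume {q : Euc n | ∃ y ∈ M ∩ C.U, q ∈ normalSpaceAt M y ∧
      ∃ ν e, IsCurvatureNormal M y ν e ∧ (⟪q, ν⟫ : ℝ) = 0} = 0 := by
  set s : Set (Euc n) := {a | (tangentSpaceAt M x).orthogonalProjectionOnto a ∈ ball 0 C.ρ ∧
    (fderiv ℝ C.normalParam a).det = 0} with hs
  have h1 : MeasureTheory.volume (C.normalParam '' s) = 0 :=
    MeasureTheory.addHaar_image_eq_zero_of_det_fderivWithin_eq_zero _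
      (f' := fun a => fderiv ℝ C.normalParam a)
      (fun a ha => ((C.contDiffAt_normalParam ha.1).differentiableAt
        (by simp)).hasFDerivAt.hasFDerivWithinAt) fun a ha => ha.2
  refine MeasureTheory.measure_mono_null ?_ h1
  rintro q ⟨y, hy, hq, ν, e, h, hqν⟩
  obtain ⟨t, ht, rfl⟩ : ∃ t ∈ ball 0 C.ρ, C.g t = y := ⟨_, C.g_proj hy⟩
  obtain ⟨ξ, rfl⟩ := C.exists_V_eq hM hy hq
  have hPt : (tangentSpaceAt M x).orthogonalProjectionOnto ((t : Euc n) + ξ) = t := by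
    rw [map_add, Submodule.orthogonalProjectionOnto_mem_subspace_eq_self,
      Submodule.orthogonalProjectionOnto_eq_zero_iff.2 ξ.2, add_zero]
  have hPξ : (normalSpaceAt M x).orthogonalProjectionOnto ((t : Euc n) + ξ) = ξ := by
    rw [map_add, Submodule.orthogonalProjectionOnto_mem_subspace_eq_self,
      orthogonalProjectionOnto_normalSpaceAt t, zero_add]
  refine ⟨t + ξ, ⟨by rwa [hPt], ?_⟩, by rw [normalParam_eq, hPt, hPξ]⟩
  -- the derivative annihilates the tangential part of the principal direction `e`
  by_contra hdet
  set w := (tangentSpaceAt M x).orthogonalProjectionOnto e with hw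
  have h2 : fderiv ℝ C.normalParam (t + ξ) (w : Euc n) = 0 := by
    rw [C.fderiv_normalParam (by rwa [hPt]), hPt, hPξ,
      Submodule.orthogonalProjectionOnto_mem_subspace_eq_self,
      orthogonalProjectionOnto_normalSpaceAt w, map_zero, C.fderiv_V_g hM ξ ht,
        C.fderiv_g_proj ht h.tangent, h.eigen _ _ (C.parallel_V ξ) hy.2, hqν]
    simp
  have h3 : (w : Euc n) = 0 := by
    have h4 : Function.Injective (fderiv ℝ C.normalParam (t + ξ)) :=
      ((fderiv ℝ C.normalParam (t + ξ)).toLinearMap.equivOfDetNeZero hdet).injective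
    exact h4 (h2.trans (map_zero _).symm)
  have h5 := C.fderiv_g_proj ht h.tangent
  rw [← hw, show w = 0 from Subtype.ext h3, map_zero] at h5
  have h6 := h.unit
  rw [← h5, norm_zero] at h6
  exact zero_ne_one h6

end FlatChart

/-- By compactness finitely many charts suffice, so the focal directions form a null set. -/
theorem dense_compl_focalDirections (hM : IsIsoparametricSubmanifold M) (hMc : IsCompact M) :
    Dense (focalDirections M)ᶜ := by
  have h1 : MeasureTheory.volume {q : Euc n | ∃ y ∈ M, q ∈ normalSpaceAt M y ∧
      ∃ ν e, IsCurvatureNormal M y ν e ∧ (⟪q, ν⟫ : ℝ) = 0} = 0 := by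
    refine hMc.induction_on (p := fun s => MeasureTheory.volume {q : Euc n | ∃ y ∈ s,
      q ∈ normalSpaceAt M y ∧ ∃ ν e, IsCurvatureNormal M y ν e ∧ (⟪q, ν⟫ : ℝ) = 0} = 0)
      (by simp) (fun s t hst ht => MeasureTheory.measure_mono_null ?_ ht)
      (fun s t hs ht => MeasureTheory.measure_mono_null ?_
        (MeasureTheory.measure_union_null hs ht)) fun x hx => ?_
    · rintro q ⟨y, hy, h⟩
      exact ⟨y, hst hy, h⟩
    · rintro q ⟨y, hy | hy, h⟩
      · exact Or.inl ⟨y, hy, h⟩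
      · exact Or.inr ⟨y, hy, h⟩
    · obtain ⟨C⟩ := hM.exists_flatChart hx
      exact ⟨M ∩ C.U, inter_mem self_mem_nhdsWithin
        (mem_nhdsWithin_of_mem_nhds (C.isOpen_U.mem_nhds C.base_mem.2)),
        C.measure_focalDirections_inter hM⟩
  exact MeasureTheory.Measure.dense_of_ae (μ := MeasureTheory.volume)
    (MeasureTheory.measure_eq_zero_iff_ae_notMem.1 h1)

namespace IsParallelInvariant

variable {S : Set (Euc n × Euc n)}

theorem sheet_mem_connectedComponent (hS : IsParallelInvariant M S) {x : Euc n} (C : FlatChart M x)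
    {ξ : normalSpaceAt M x} (hξ : (x, (ξ : Euc n)) ∈ S) {t : tangentSpaceAt M x}
    (ht : t ∈ ball 0 C.ρ) :
    (⟨(x, (ξ : Euc n)), hξ⟩ : S) ∈
      connectedComponent (⟨(C.g t, C.V ξ (C.g t)), hS.sheet_mem C hξ ht⟩ : S) := by
  let Φ : ball (0 : tangentSpaceAt M x) C.ρ → S := fun t =>
    ⟨(C.g t, C.V ξ (C.g t)), hS.sheet_mem C hξ t.2⟩
  have hΦ : Continuous Φ := Continuous.subtype_mk
    ((continuousOn_iff_continuous_domRestrict.1 (continuousOn_sheet C ξ))) _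
  have hΦ0 : Φ ⟨0, C.zero_mem⟩ = ⟨(x, (ξ : Euc n)), hξ⟩ := by
    simp only [Φ, C.g_zero, C.V_base]
  have : PreconnectedSpace (ball (0 : tangentSpaceAt M x) C.ρ) :=
    Subtype.preconnectedSpace (convex_ball _ _).isPreconnected
  have h2 := (isPreconnected_univ.image Φ hΦ.continuousOn).subset_connectedComponent (x := Φ ⟨t, ht⟩) ⟨_, trivial, rfl⟩
  rw [← hΦ0]
  exact h2 ⟨_, trivial, rfl⟩

variable {q : Euc n}

/-- A height function whose direction lies in the open chamber of `x` is bounded on the connected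
component of `(x, ξ)` by its value at `(x, ξ)`. -/
theorem inner_le_of_neg (hM : IsIsoparametricSubmanifold M) (hMc : IsCompact M)
    (hS : IsParallelInvariant M S) (hfin : ∀ x ∈ M, {ξ | (x, ξ) ∈ S}.Finite) (hSc : IsCompact S)
    (hneg : ∀ p ∈ S, ∀ ν e, IsCurvatureNormal M p.1 ν e → (⟪p.2, ν⟫ : ℝ) < 0)
    {x ξ : Euc n} (hx : (x, ξ) ∈ S) (hqN : q ∈ normalSpaceAt M x)
    (hq₀ : ∀ ν e, IsCurvatureNormal M x ν e → (⟪q, ν⟫ : ℝ) < 0)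
    {p : S} (hp : p ∈ connectedComponent (⟨(x, ξ), hx⟩ : S)) : (⟪q, p.1.2⟫ : ℝ) ≤ ⟪q, ξ⟫ := by
  have hxM : x ∈ M := (hS.mem _ hx).1
  obtain ⟨ξ, rfl⟩ : ∃ ξ' : normalSpaceAt M x, (ξ' : Euc n) = ξ := ⟨⟨ξ, (hS.mem _ hx).2⟩, rfl⟩
  obtain ⟨C⟩ := hM.exists_flatChart hxM
  obtain ⟨F⟩ := hM.exists_principalFrame hxM
  have hPt : (tangentSpaceAt M x).orthogonalProjectionOnto q = 0 :=
    Submodule.orthogonalProjectionOnto_eq_zero_iff.2 hqN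
  have hPξ : ((normalSpaceAt M x).orthogonalProjectionOnto q : Euc n) = q :=
    Submodule.starProjection_eq_self_iff.2 hqN
  have hP0 : (tangentSpaceAt M x).orthogonalProjectionOnto q ∈ ball 0 C.ρ := by
    rw [hPt]; exact C.zero_mem
  have hΨq : C.normalParam q = q := by
    rw [C.normalParam_eq, hPt, C.g_zero, C.V_base, hPξ]
  have hstrict : HasStrictFDerivAt C.normalParam (fderiv ℝ C.normalParam q) q :=
    (C.contDiffAt_normalParam hP0).hasStrictFDerivAt (by simp)
  -- `normalParam` is a local diffeomorphism at `q` because `A_q` is invertible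
  have hsurj : (fderiv ℝ C.normalParam q).range = ⊤ := by
    refine LinearMap.range_eq_top.2 (LinearMap.injective_iff_surjective.1 ?_)
    refine (injective_iff_map_eq_zero _).2 fun u hu => ?_
    replace hu : fderiv ℝ C.normalParam q u = 0 := hu
    have hF : ∀ b, (⟪(F.e b : Euc n), u⟫ : ℝ) = 0 := fun b => by
      have h1 := congrArg (fun v => (⟪(F.e b : Euc n), v⟫ : ℝ)) hu
      simp only [C.fderiv_normalParam hP0, hPt, C.fderiv_V_g_zero hM F, inner_add_right,
        F.inner_e_sum, C.g_zero, C.V_base, inner_zero_right, hPξ] at h1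
      rw [real_inner_comm, inner_eq_zero_of_mem_normalSpaceAt
        ((normalSpaceAt M x).orthogonalProjectionOnto u).2 (F.e b).2, zero_add] at h1
      have h2 := (mul_eq_zero.1 h1).resolve_left (neg_ne_zero.2
        (hq₀ _ _ (F.isCurvatureNormal hxM b)).ne)
      exact (inner_orthogonalProjectionOnto_right _ (F.e b) u).symm.trans h2
    have huN : u ∈ normalSpaceAt M x := (Submodule.mem_orthogonal _ _).2 fun X hX => by
      rw [F.eq_sum hX, sum_inner]
      exact Finset.sum_eq_zero fun b _ => by rw [real_inner_smul_left, hF b, mul_zero]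
    rw [C.fderiv_normalParam hP0, hPt, Submodule.orthogonalProjectionOnto_eq_zero_iff.2 huN, map_zero,
      add_zero, C.g_zero, C.V_base] at hu
    exact (Submodule.starProjection_eq_self_iff.2 huN).symm.trans hu
  have hmap := hstrict.map_nhds_eq_of_surj hsurj
  rw [hΨq] at hmap
  -- nonfocal directions accumulate at `q`
  have hfreq : ∃ᶠ a in 𝓝 q, C.normalParam a ∉ focalDirections M := by
    have h1 : ∃ᶠ q' in 𝓝 q, q' ∉ focalDirections M :=
      mem_closure_iff_frequently.1 (dense_compl_focalDirections hM hMc q)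
    rw [← hmap] at h1
    exact h1
  have hev1 : ∀ᶠ a in 𝓝 q, (tangentSpaceAt M x).orthogonalProjectionOnto a ∈ ball 0 C.ρ :=
    (tangentSpaceAt M x).orthogonalProjectionOnto.continuous.continuousAt.eventually_mem
      (isOpen_ball.mem_nhds hP0)
  have hev2 : ∀ᶠ a in 𝓝 q, ∀ b, (⟪((normalSpaceAt M x).orthogonalProjectionOnto a : Euc n),
      (F.nrm b : Euc n)⟫ : ℝ) < 0 := by
    refine eventually_all.2 fun b => ?_
    have h1 : Continuous fun a : Euc n => (⟪((normalSpaceAt M x).orthogonalProjectionOnto a : Euc n),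
      (F.nrm b : Euc n)⟫ : ℝ) := by fun_prop
    refine h1.continuousAt.eventually_lt continuousAt_const ?_
    rw [hPξ]
    exact hq₀ _ _ (F.isCurvatureNormal hxM b)
  -- apply the nonfocal case at the translate of `(x, ξ)` to the point of the chart where the nearby
  -- direction is normal
  have hle : ∃ᶠ a in 𝓝 q, (⟪C.normalParam a, p.1.2⟫ : ℝ) ≤
      ⟪((normalSpaceAt M x).orthogonalProjectionOnto a : Euc n), (ξ : Euc n)⟫ := by
    refine (hfreq.and_eventually (hev1.and hev2)).mono ?_
    rintro a ⟨h1, h2, h3⟩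
    have hy := C.g_mem h2
    set t := (tangentSpaceAt M x).orthogonalProjectionOnto a with ht
    set η := (normalSpaceAt M x).orthogonalProjectionOnto a with hη
    have hΨ : C.normalParam a = C.V η (C.g t) := C.normalParam_eq a
    have h4 : p ∈ connectedComponent (⟨(C.g t, C.V ξ (C.g t)), hS.sheet_mem C hx h2⟩ : S) := by
      rwa [connectedComponent_eq (hS.sheet_mem_connectedComponent C hx h2)]
    have h5 := hS.inner_le_of_nonfocal (q := C.normalParam a) hM hMc.isClosed hfin hSc hneg
      (fun y hy hyN ν e hν h0 => h1 ⟨y, hy, hyN, ν, e, hν, h0⟩)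
      (by rw [hΨ]; exact C.V_mem hy η) (fun ν e hν => ?_) h4
    · refine h5.trans_eq ?_
      rw [hΨ]
      exact C.inner_V hM hy η ξ
    · obtain ⟨ν', rfl⟩ := C.exists_V_eq hM hy hν.normal
      obtain ⟨e', he'⟩ := C.exists_isCurvatureNormal hM hy C.base_mem hν
      rw [C.V_base] at he'
      obtain ⟨b, hb⟩ := he'.exists_nrm_eq hM F
      have h6 := C.inner_V hM hy η ν'
      rw [hΨ, h6]
      have h7 := h3 b
      rwa [hb] at h7
  have hc1 : Tendsto (fun a => (⟪((normalSpaceAt M x).orthogonalProjectionOnto a : Euc n),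
      (ξ : Euc n)⟫ : ℝ) - ⟪C.normalParam a, p.1.2⟫) (𝓝 q) (𝓝 (⟪q, (ξ : Euc n)⟫ - ⟪q, p.1.2⟫)) := by
    have h1 : ContinuousAt (fun a => (⟪((normalSpaceAt M x).orthogonalProjectionOnto a : Euc n),
      (ξ : Euc n)⟫ : ℝ)) q := by fun_prop
    have h2 : ContinuousAt (fun a => (⟪C.normalParam a, p.1.2⟫ : ℝ)) q :=
      (C.contDiffAt_normalParam hP0).continuousAt.inner continuousAt_const
    have h3 := h1.tendsto.sub h2.tendsto
    rwa [hPξ, hΨq] at h3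
  exact sub_nonneg.1 (ge_of_tendsto_of_frequently hc1 (hle.mono fun a ha => sub_nonneg.2 ha))

/-- A height function whose direction lies in the closed chamber of `x` is bounded on the connected
component of `(x, ξ)` by its value at `(x, ξ)`. -/
theorem inner_le (hM : IsIsoparametricSubmanifold M) (hMc : IsCompact M) {c : Euc n}
    (hc : IsCenter M c) (hS : IsParallelInvariant M S) (hfin : ∀ x ∈ M, {ξ | (x, ξ) ∈ S}.Finite)
    (hSc : IsCompact S)
    (hneg : ∀ p ∈ S, ∀ ν e, IsCurvatureNormal M p.1 ν e → (⟪p.2, ν⟫ : ℝ) < 0)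
    {x ξ : Euc n} (hx : (x, ξ) ∈ S) (hqN : q ∈ normalSpaceAt M x)
    (hq₀ : ∀ ν e, IsCurvatureNormal M x ν e → (⟪q, ν⟫ : ℝ) ≤ 0)
    {p : S} (hp : p ∈ connectedComponent (⟨(x, ξ), hx⟩ : S)) : (⟪q, p.1.2⟫ : ℝ) ≤ ⟪q, ξ⟫ := by
  have hxM : x ∈ M := (hS.mem _ hx).1
  -- perturb `q` by a multiple of `x - c`, all of whose principal curvatures are `-1`
  have h1 : ∀ ε > (0 : ℝ), (⟪q + ε • (x - c), p.1.2⟫ : ℝ) ≤ ⟪q + ε • (x - c), ξ⟫ := by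
    intro ε hε
    refine hS.inner_le_of_neg hM hMc hfin hSc hneg hx
      (Submodule.add_mem _ hqN (Submodule.smul_mem _ _ (hc x hxM))) (fun ν e hν => ?_) hp
    rw [inner_add_left, real_inner_smul_left, hν.inner_sub_center hc]
    linarith [hq₀ ν e hν]
  have h2 : Tendsto (fun ε : ℝ => (⟪q + ε • (x - c), ξ⟫ : ℝ) - ⟪q + ε • (x - c), p.1.2⟫) (𝓝[>] 0)
      (𝓝 (⟪q, ξ⟫ - ⟪q, p.1.2⟫)) := by
    have h3 : Continuous fun ε : ℝ => (⟪q + ε • (x - c), ξ⟫ : ℝ) - ⟪q + ε • (x - c), p.1.2⟫ := by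
      fun_prop
    have h4 := h3.tendsto 0
    simp only [zero_smul, add_zero] at h4
    exact h4.mono_left nhdsWithin_le_nhds
  exact sub_nonneg.1 (ge_of_tendsto h2 (by
    filter_upwards [self_mem_nhdsWithin] with ε hε using sub_nonneg.2 (h1 ε hε)))

end IsParallelInvariant

/-! ### Chambers -/

theorem tangentSpaceAt_eq_of_normalSpaceAt_le (hM : IsIsoparametricSubmanifold M) {x y : Euc n}
    (hx : x ∈ M) (hy : y ∈ M) (h : normalSpaceAt M x ≤ normalSpaceAt M y) :
    tangentSpaceAt M x = tangentSpaceAt M y := by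
  obtain ⟨d, hd⟩ := hM.submanifold
  have h1 : tangentSpaceAt M y ≤ tangentSpaceAt M x := by
    have h2 := Submodule.orthogonal_le h
    simpa only [normalSpaceAt, Submodule.orthogonal_orthogonal] using h2
  exact (Submodule.eq_of_le_of_finrank_eq h1
    (by rw [hd.finrank_tangentSpaceAt hx, hd.finrank_tangentSpaceAt hy])).symm

theorem isParallelInvariant_curvatureNormals (hM : IsIsoparametricSubmanifold M) :
    IsParallelInvariant M {p | ∃ e, IsCurvatureNormal M p.1 p.2 e} := by
  refine ⟨fun p ⟨e, he⟩ => ⟨he.mem, he.normal⟩, ?_⟩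
  rintro x C ξ y hy z hz ⟨e, he⟩
  exact C.exists_isCurvatureNormal hM hy hz he

theorem FlatChart.continuous_V_apply {x : Euc n} (C : FlatChart M x) (y : Euc n) :
    Continuous fun ξ => C.V ξ y :=
  (LinearMap.proj y ∘ₗ C.V : normalSpaceAt M x →ₗ[ℝ] Euc n).continuous_of_finiteDimensional

/-- The antipodal point on a curvature circle has the same normal space. -/
theorem IsCurvatureNormal.antipode (hM : IsIsoparametricSubmanifold M) (hMc : IsClosed M)
    {x ν e : Euc n} (h : IsCurvatureNormal M x ν e) (hν : ν ≠ 0) :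
    x + (2 * (‖ν‖ ^ 2)⁻¹) • ν ∈ M ∧
      normalSpaceAt M x ≤ normalSpaceAt M (x + (2 * (‖ν‖ ^ 2)⁻¹) • ν) := by
  have h1 := h.isCurvCircleAt hM hMc hν Real.pi
  have h2 : curvCircle x ν e Real.pi = x + (2 * (‖ν‖ ^ 2)⁻¹) • ν := by
    simp only [curvCircle, Real.sin_pi, Real.cos_pi]
    module
  have hn : ‖ν‖ ≠ 0 := norm_ne_zero_iff.2 hν
  have h3 := h1.isCurvatureNormal.mem
  have h4 := h1.sub_smul_mem
  rw [h2] at h3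
  simp only [h2, add_sub_cancel_left] at h4
  refine ⟨h3, fun ξ hξ => ?_⟩
  have h5 := h4 (ξ - ((⟪ξ, ν⟫ : ℝ) * (2 * (‖ν‖ ^ 2)⁻¹)) • ν)
    (Submodule.sub_mem _ hξ (Submodule.smul_mem _ _ h.normal))
  have h6 : (⟪ξ - ((⟪ξ, ν⟫ : ℝ) * (2 * (‖ν‖ ^ 2)⁻¹)) • ν, ν⟫ : ℝ) = -⟪ξ, ν⟫ := by
    rw [inner_sub_left, real_inner_smul_left, real_inner_self_eq_norm_sq]
    field_simp
    ring
  rw [h6] at h5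
  convert h5 using 1
  module

namespace FlatChart

variable {x : Euc n} (C : FlatChart M x)

/-- The normal vectors `ξ` such that `y ↦ c + V ξ y` maps the chart to points of `M` with the same
normal spaces. -/
def translations (c : Euc n) : Set (normalSpaceAt M x) :=
  {ξ | ∀ t ∈ ball (0 : tangentSpaceAt M x) C.ρ, c + C.V ξ (C.g t) ∈ M ∧
    normalSpaceAt M (C.g t) ≤ normalSpaceAt M (c + C.V ξ (C.g t))}

theorem sub_center_mem_translations (hM : IsIsoparametricSubmanifold M) {c : Euc n}
    (hc : IsCenter M c) : ⟨x - c, hc x C.base_mem.1⟩ ∈ C.translations c := by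
  intro t ht
  have h1 := C.V_eq_of_isParallelNormalField hM hc.isParallelNormalField (C.g_mem ht)
  rw [h1, add_sub_cancel]
  exact ⟨(C.g_mem ht).1, le_rfl⟩

theorem isCompact_translations (hM : IsIsoparametricSubmanifold M) (hMc : IsCompact M)
    (c : Euc n) : IsCompact (C.translations c) := by
  refine Metric.isCompact_of_isClosed_isBounded (isClosed_of_closure_subset fun ξ hξ t ht => ?_) ?_
  · obtain ⟨p, hp, hlim⟩ := mem_closure_iff_seq_limit.1 hξ
    have h1 : Tendsto (fun k => c + C.V (p k) (C.g t)) atTop (𝓝 (c + C.V ξ (C.g t))) :=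
      (((C.continuous_V_apply (C.g t)).tendsto ξ).comp hlim).const_add c
    have h2 := hMc.isClosed.mem_of_tendsto h1 (Eventually.of_forall fun k => (hp k t ht).1)
    refine ⟨h2, fun η hη => ?_⟩
    exact mem_normalSpaceAt_of_tendsto (p := fun k => (c + C.V (p k) (C.g t), η)) hM h2
      (fun k => (hp k t ht).1) (fun k => (hp k t ht).2 hη) (h1.prodMk_nhds tendsto_const_nhds)
  · obtain ⟨R, hR⟩ := hMc.isBounded.subset_closedBall c
    refine (isBounded_closedBall (x := (0 : normalSpaceAt M x)) (r := R)).subset fun ξ hξ => ?_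
    have h1 := hR (hξ 0 C.zero_mem).1
    rw [C.g_zero, C.V_base, mem_closedBall_iff_norm, add_sub_cancel_left] at h1
    rwa [mem_closedBall_zero_iff]

/-- As normal and tangent spaces correspond under a translation, it preserves parallel fields. -/
theorem isParallelMap_translation (hM : IsIsoparametricSubmanifold M) {c : Euc n}
    {ξ : normalSpaceAt M x} (hξ : ξ ∈ C.translations c) (η : normalSpaceAt M x) :
    IsParallelMap M (ball 0 C.ρ) (fun t => c + C.V ξ (C.g t)) fun t => C.V η (C.g t) := by
  have h1 := C.isParallelMap hM η
  refine ⟨isOpen_ball, fun t ht => (hξ t ht).1, fun t ht => (hξ t ht).2 (h1.normal t ht),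
    fun t ht => ((C.isParallelMap hM ξ).diff_field t ht).const_add c, h1.diff_field,
    fun t ht u => ?_⟩
  rw [← tangentSpaceAt_eq_of_normalSpaceAt_le hM (C.g_mem ht).1 (hξ t ht).1 (hξ t ht).2]
  exact h1.parallel t ht u

/-- A translation can be composed with the antipodal map of a curvature circle. -/
theorem add_smul_mem_translations (hM : IsIsoparametricSubmanifold M) (hMc : IsClosed M)
    {c : Euc n} {ξ : normalSpaceAt M x} (hξ : ξ ∈ C.translations c) {t : tangentSpaceAt M x}
    (ht : t ∈ ball 0 C.ρ) {ν : normalSpaceAt M x} (hν0 : ν ≠ 0) {e : Euc n}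
    (hν : IsCurvatureNormal M (c + C.V ξ (C.g t)) (C.V ν (C.g t)) e) :
    ξ + (2 * (‖ν‖ ^ 2)⁻¹) • ν ∈ C.translations c := by
  intro s hs
  obtain ⟨e', he'⟩ := (isParallelInvariant_curvatureNormals hM).of_isParallelMap hM
    (C.isParallelMap_translation hM hξ ν) (convex_ball _ _).isPreconnected ht hs ⟨e, hν⟩
  have hn : ‖C.V ν (C.g s)‖ = ‖ν‖ := C.norm_V hM (C.g_mem hs) ν
  have h1 := he'.antipode hM hMc (by
    rw [← norm_ne_zero_iff]
    exact hn ▸ norm_ne_zero_iff.2 hν0)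
  simp only [hn] at h1
  rw [C.V_add, C.V_smul, ← add_assoc]
  exact ⟨h1.1, (hξ s hs).2.trans h1.2⟩

/-- Every parallel normal field `V ζ` on a chart is, after a translation to another part of `M`,
in the closed chamber: its principal curvatures are nonpositive. -/
theorem exists_translation_chamber (hM : IsIsoparametricSubmanifold M) (hMc : IsCompact M)
    {c : Euc n} (hc : IsCenter M c) (ζ : normalSpaceAt M x) :
    ∃ ξ ∈ C.translations c, ∀ t ∈ ball (0 : tangentSpaceAt M x) C.ρ, ∀ ν e,
      IsCurvatureNormal M (c + C.V ξ (C.g t)) ν e → (⟪C.V ζ (C.g t), ν⟫ : ℝ) ≤ 0 := by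
  -- translate to the part of `M` on which `⟪V ζ, ·⟫` is largest
  obtain ⟨ξ, hξ, hmax⟩ := (C.isCompact_translations hM hMc c).exists_isMaxOn
    ⟨_, C.sub_center_mem_translations hM hc⟩
    (f := fun ξ => (⟪ζ, ξ⟫ : ℝ)) (by fun_prop)
  refine ⟨ξ, hξ, fun t ht ν e hν => ?_⟩
  by_contra! hpos
  have hT := tangentSpaceAt_eq_of_normalSpaceAt_le hM (C.g_mem ht).1 (hξ t ht).1 (hξ t ht).2
  have hνN : ν ∈ normalSpaceAt M (C.g t) := by
    rw [normalSpaceAt, hT]; exact hν.normal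
  obtain ⟨ν', rfl⟩ := C.exists_V_eq hM (C.g_mem ht) hνN
  have hpos' : (0 : ℝ) < ⟪ζ, ν'⟫ := by
    have h1 := C.inner_V hM (C.g_mem ht) ζ ν'
    rw [h1] at hpos
    exact hpos
  have hν0 : ν' ≠ 0 := by
    rintro rfl
    simp at hpos'
  -- otherwise passing to the antipodal points would increase `⟪ζ, ξ⟫`
  have h1 := hmax (C.add_smul_mem_translations hM hMc.isClosed hξ ht hν0 hν)
  have h2 : (⟪(ζ : Euc n), (ξ : Euc n) + (2 * (‖ν'‖ ^ 2)⁻¹) • (ν' : Euc n)⟫ : ℝ) ≤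
      ⟪(ζ : Euc n), (ξ : Euc n)⟫ := h1
  rw [inner_add_right, real_inner_smul_right] at h2
  have h3 : 0 < 2 * (‖ν'‖ ^ 2)⁻¹ * (⟪(ζ : Euc n), (ν' : Euc n)⟫ : ℝ) := by
    have hpos'' : (0 : ℝ) < ⟪(ζ : Euc n), (ν' : Euc n)⟫ := hpos'
    have := norm_pos_iff.2 hν0
    positivity
  linarith

end FlatChart

/-! ### Tangent spaces of leaves -/

namespace IsParallelInvariant

variable {S Y : Set (Euc n × Euc n)}

theorem connectedComponentIn (hS : IsParallelInvariant M S)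
    (p : Euc n × Euc n) : IsParallelInvariant M (connectedComponentIn S p) := by
  refine ⟨fun q hq => hS.mem q (connectedComponentIn_subset S p hq), ?_⟩
  intro x C ξ y hy z hz h
  obtain ⟨s, hs, rfl⟩ : ∃ s ∈ ball 0 C.ρ, C.g s = y := ⟨_, C.g_proj hy⟩
  obtain ⟨t, ht, rfl⟩ : ∃ t ∈ ball 0 C.ρ, C.g t = z := ⟨_, C.g_proj hz⟩
  have h1 : IsPreconnected ((fun t => (C.g t, C.V ξ (C.g t))) '' ball 0 C.ρ) :=
    (convex_ball _ _).isPreconnected.image _ (continuousOn_sheet C ξ)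
  have h2 := h1.subset_connectedComponentIn ⟨s, hs, rfl⟩ (F := S) (by
    rintro _ ⟨t, ht, rfl⟩
    exact hS.invariant x C ξ _ hy _ (C.g_mem ht) (connectedComponentIn_subset S p h))
  rw [connectedComponentIn_eq h]
  exact h2 ⟨t, ht, rfl⟩

/-- A nonempty parallel-invariant set has points over all of `M`, as `M` is connected. -/
theorem exists_mem (hM : IsIsoparametricSubmanifold M) (hS : IsParallelInvariant M S)
    (hne : S.Nonempty) {y : Euc n} (hy : y ∈ M) : ∃ η, (y, η) ∈ S := by
  obtain ⟨⟨x, ξ⟩, hx⟩ := hne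
  have hxM : x ∈ M := (hS.mem _ hx).1
  refine hM.connected.isPreconnected.induction₂' (fun a b => (∃ η, (a, η) ∈ S) → ∃ η, (b, η) ∈ S)
    (fun a ha => ?_) (fun a b c _ _ _ hab hbc h => hbc (hab h)) hxM hy ⟨ξ, hx⟩
  obtain ⟨C⟩ := hM.exists_flatChart ha
  have key : ∀ b ∈ M ∩ C.U, ∀ d ∈ M ∩ C.U, (∃ η, (b, η) ∈ S) → ∃ η, (d, η) ∈ S := by
    rintro b hb d hd ⟨η, hη⟩
    obtain ⟨ξ, rfl⟩ := C.exists_V_eq hM hb (hS.mem _ hη).2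
    exact ⟨_, hS.invariant _ C ξ _ hb _ hd hη⟩
  filter_upwards [self_mem_nhdsWithin,
    mem_nhdsWithin_of_mem_nhds (C.isOpen_U.mem_nhds C.base_mem.2)] with b hb hbU
  exact ⟨key _ C.base_mem _ ⟨hb, hbU⟩, key _ ⟨hb, hbU⟩ _ C.base_mem⟩

/-- A negative normal vector lies in a parallel-invariant set on which all height functions with
direction in a closed chamber attain their maximum over that chamber. -/
theorem exists_of_neg (hM : IsIsoparametricSubmanifold M) (hMc : IsCompact M)
    {c : Euc n} (hc : IsCenter M c) {x r : Euc n} (hx : x ∈ M) (hr : r ∈ normalSpaceAt M x)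
    (hneg : ∀ ν e, IsCurvatureNormal M x ν e → (⟪r, ν⟫ : ℝ) < 0) :
    ∃ Y, IsParallelInvariant M Y ∧ (x, r) ∈ Y ∧ ∀ p ∈ Y, ∀ q ∈ normalSpaceAt M p.1,
      (∀ ν e, IsCurvatureNormal M p.1 ν e → (⟪q, ν⟫ : ℝ) ≤ 0) →
        IsGreatest ((fun s : Euc n × Euc n => (⟪q, s.2⟫ : ℝ)) '' Y) ⟪q, p.2⟫ := by
  -- the required set is the connected component in the normal orbit of `r`
  set Λ : Set ℝ := {a | ∃ ν e, IsCurvatureNormal M x ν e ∧ ⟪r, ν⟫ = a} with hΛ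
  have hfinΛ : Λ.Finite := by
    obtain ⟨F⟩ := hM.exists_principalFrame hx
    refine (finite_range fun b => (⟪r, (F.nrm b : Euc n)⟫ : ℝ)).subset ?_
    rintro _ ⟨ν, e, h, rfl⟩
    obtain ⟨b, rfl⟩ := h.exists_nrm_eq hM F
    exact ⟨b, rfl⟩
  have hS := isParallelInvariant_normalOrbit hM Λ r
  have hfin := fun y (hy : y ∈ M) => finite_fibre_normalOrbit hM hc hfinΛ r hy
  have hSc := isCompact_normalOrbit hM hMc hc hfinΛ r
  have hxS : (x, r) ∈ normalOrbit M Λ r :=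
    ⟨hx, hr, rfl, fun ν e h => ⟨ν, e, h, rfl⟩, fun _ _ => rfl⟩
  refine ⟨_root_.connectedComponentIn (normalOrbit M Λ r) (x, r), hS.connectedComponentIn _,
    mem_connectedComponentIn hxS, ?_⟩
  rintro ⟨y, η⟩ hp q hq hq0
  refine ⟨⟨_, hp, rfl⟩, ?_⟩
  rintro _ ⟨p', hp', rfl⟩
  have hpS : (y, η) ∈ normalOrbit M Λ r := connectedComponentIn_subset _ _ hp
  rw [connectedComponentIn_eq hp, connectedComponentIn_eq_image hpS] at hp'
  obtain ⟨p'', hp'', rfl⟩ := hp'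
  refine hS.inner_le hM hMc hc hfin hSc (fun p hp ν e h => ?_) hpS hq hq0 hp''
  obtain ⟨ν', e', h', h0⟩ := hp.2.2.2.1 ν e h
  rw [← h0]
  exact hneg _ _ h'

/-- The maxima of height functions over a set as in `exists_of_neg` do not change under parallel
translation of the direction. -/
theorem isGreatest (hM : IsIsoparametricSubmanifold M) (hMc : IsCompact M)
    {c : Euc n} (hc : IsCenter M c) (hY : IsParallelInvariant M Y) (hne : Y.Nonempty)
    (hYle : ∀ p ∈ Y, ∀ q ∈ normalSpaceAt M p.1,
      (∀ ν e, IsCurvatureNormal M p.1 ν e → (⟪q, ν⟫ : ℝ) ≤ 0) →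
        IsGreatest ((fun s : Euc n × Euc n => (⟪q, s.2⟫ : ℝ)) '' Y) ⟪q, p.2⟫) (v : ℝ) :
    IsParallelInvariant M {p | p.1 ∈ M ∧ p.2 ∈ normalSpaceAt M p.1 ∧
      IsGreatest ((fun s : Euc n × Euc n => (⟪p.2, s.2⟫ : ℝ)) '' Y) v} := by
  refine ⟨fun p hp => ⟨hp.1, hp.2.1⟩, ?_⟩
  rintro x C ζ y hy z hz ⟨-, -, h⟩
  refine ⟨hz.1, C.V_mem hz ζ, ?_⟩
  obtain ⟨s, hs, rfl⟩ : ∃ s ∈ ball 0 C.ρ, C.g s = y := ⟨_, C.g_proj hy⟩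
  obtain ⟨t, ht, rfl⟩ : ∃ t ∈ ball 0 C.ρ, C.g t = z := ⟨_, C.g_proj hz⟩
  -- move to the part of `M` where `V ζ` lies in the closed chamber; there the maxima are known
  obtain ⟨ξ, hξ, hch⟩ := C.exists_translation_chamber hM hMc hc ζ
  obtain ⟨r, hr⟩ := hY.exists_mem hM hne (hξ s hs).1
  have hrN : r ∈ normalSpaceAt M (C.g s) := by
    rw [normalSpaceAt, tangentSpaceAt_eq_of_normalSpaceAt_le hM hy.1 (hξ s hs).1 (hξ s hs).2]
    exact (hY.mem _ hr).2
  obtain ⟨η, rfl⟩ := C.exists_V_eq hM hy hrN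
  have hrt := hY.of_isParallelMap hM (C.isParallelMap_translation hM hξ η)
    (convex_ball _ _).isPreconnected hs ht hr
  have h1 := hYle _ hr (C.V ζ (C.g s)) ((hξ s hs).2 (C.V_mem hy ζ)) (hch s hs)
  have h2 := hYle _ hrt (C.V ζ (C.g t)) ((hξ t ht).2 (C.V_mem hz ζ)) (hch t ht)
  rw [h.unique h1]
  simp only [C.inner_V hM hy, C.inner_V hM hz] at h2 ⊢
  exact h2

end IsParallelInvariant

theorem IsParallelAlong.isParallelMap {γ w : ℝ → Euc n} (h : IsParallelAlong M γ w) :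
    IsParallelMap M univ γ w :=
  ⟨isOpen_univ, fun t _ => h.mem t, fun t _ => h.normal t,
    fun t _ => h.contDiff_curve.contDiffAt.differentiableAt (by simp),
    fun t _ => h.contDiff_field.contDiffAt.differentiableAt (by simp), fun t _ u => by
      have h1 := h.parallel t
      rw [← mul_one u, ← smul_eq_mul, map_smul]
      exact Submodule.smul_mem _ _ h1⟩

/-- Parallel fields along curves stay parallel after adding the position vector. -/
theorem IsParallelAlong.isParallelMap_sub_center (hM : IsIsoparametricSubmanifold M) {c : Euc n}
    (hc : IsCenter M c) {γ w : ℝ → Euc n} (h : IsParallelAlong M γ w) :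
    IsParallelMap M univ γ fun t => γ t + w t - c := by
  have h1 := hc.isParallelNormalField.isParallelMap hM isOpen_univ h.isParallelMap.diff_base
    fun t ht => ⟨h.isParallelMap.mem t ht, mem_univ _⟩
  have h2 := h1.add h.isParallelMap
  convert h2 using 1
  funext t
  simp only [Pi.add_apply]
  abel

/-- Properties of the normal vectors `q - c` which are invariant under parallel translation are
inherited by all points of the leaf through `q`. -/
theorem IsParallelInvariant.of_mem_leafAt (hM : IsIsoparametricSubmanifold M) {c : Euc n}
    (hc : IsCenter M c) {S : Set (Euc n × Euc n)} (hS : IsParallelInvariant M S) {q a : Euc n}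
    (hq : ∀ y ∈ M, q - y ∈ normalSpaceAt M y → (y, q - c) ∈ S)
    (ha : a ∈ leafAt (isoparametricFoliation M) q) : ∃ y, (y, a - c) ∈ S := by
  obtain ⟨L, ⟨⟨x, hx, ξ, hξ, rfl⟩, γ, w, h, h0, hw, rfl⟩, γ', w', h', h0', hw', rfl⟩ := ha
  have h1 := hq (γ 1) (h.mem 1) (by rw [add_sub_cancel_left]; exact h.normal 1)
  have h2 := hS.of_isParallelMap hM (h.isParallelMap_sub_center hM hc) isPreconnected_univ
    (mem_univ 1) (mem_univ 0) h1
  rw [h0, hw, ← h0', ← hw'] at h2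
  exact ⟨_, hS.of_isParallelMap hM (h'.isParallelMap_sub_center hM hc) isPreconnected_univ
    (mem_univ 0) (mem_univ 1) h2⟩

/-- The leaf through a point `q` of `x + ν_x` is orthogonal to `x + ν_x` at `q`: the support functions
which detect the normal directions are constant along leaves. -/
theorem inner_eq_zero_of_mem_tangentSpaceAt_leafAt (hM : IsIsoparametricSubmanifold M)
    (hMc : IsCompact M) {c : Euc n} (hc : IsCenter M c) {x q : Euc n} (hx : x ∈ M)
    (hq : q - x ∈ normalSpaceAt M x) {X : Euc n}
    (hX : X ∈ tangentSpaceAt (leafAt (isoparametricFoliation M) q) q) {η : Euc n}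
    (hη : η ∈ normalSpaceAt M x) : (⟪X, η⟫ : ℝ) = 0 := by
  obtain ⟨C⟩ := hM.exists_flatChart hx
  have hqc : ∀ y ∈ M, q - y ∈ normalSpaceAt M y → q - c ∈ normalSpaceAt M y := fun y hy h => by
    have := Submodule.add_mem _ h (hc y hy)
    rwa [sub_add_sub_cancel] at this
  obtain ⟨ξ, hξ, hch⟩ := C.exists_translation_chamber hM hMc hc ⟨q - c, hqc x hx hq⟩
  obtain ⟨hyM, hle⟩ := hξ 0 C.zero_mem
  have hch0 := hch 0 C.zero_mem
  rw [C.g_zero, C.V_base] at hyM hle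
  simp only [C.g_zero, C.V_base] at hch0
  set y : Euc n := c + ξ with hy
  -- for negative `r`, the function `⟪· - c, r⟫` on the leaf is bounded by the support function,
  -- which is constant along the leaf, and attains it at `q`
  have key : ∀ r ∈ normalSpaceAt M y, (∀ ν e, IsCurvatureNormal M y ν e → (⟪r, ν⟫ : ℝ) < 0) →
      (⟪X, r⟫ : ℝ) = 0 := by
    intro r hr hneg
    obtain ⟨Y, hY, hrY, hYle⟩ := IsParallelInvariant.exists_of_neg hM hMc hc hyM hr hneg
    have hmax := hYle _ hrY (q - c) (hle (hqc x hx hq)) hch0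
    have hG := hY.isGreatest hM hMc hc ⟨_, hrY⟩ hYle ⟪q - c, r⟫
    have hleaf : ∀ a ∈ leafAt (isoparametricFoliation M) q, (⟪a - c, r⟫ : ℝ) ≤ ⟪q - c, r⟫ := by
      intro a ha
      obtain ⟨z, hz⟩ := hG.of_mem_leafAt hM hc (fun z hz hqz => ⟨hz, hqc z hz hqz, hmax⟩) ha
      exact hz.2.2.2 ⟨_, hrY, rfl⟩
    induction hX using Submodule.span_induction with
    | mem X h =>
      obtain ⟨a, ha, hmem, h0, rfl⟩ := h
      have h1 : HasDerivAt (fun t => (⟪a t - c, r⟫ : ℝ)) ⟪deriv a 0, r⟫ 0 := by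
        have h2 := ((ha.contDiffAt (x := (0 : ℝ))).differentiableAt (by simp)).hasDerivAt
        simpa using (h2.sub_const c).inner ℝ (hasDerivAt_const (0 : ℝ) r)
      refine IsLocalMax.hasDerivAt_eq_zero (Eventually.of_forall fun t => ?_) h1
      rw [h0]
      exact hleaf _ (hmem t)
    | zero => simp
    | add a b _ _ h h' => rw [inner_add_left, h, h', add_zero]
    | smul s a _ h => rw [real_inner_smul_left, h, mul_zero]
  have h0 := key (y - c) (hc y hyM) fun ν e h => by
    rw [h.inner_sub_center hc]
    norm_num
  obtain ⟨F⟩ := hM.exists_principalFrame hyM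
  -- the negative vectors are open around `y - c`, so they span the normal space
  have hev : ∀ᶠ ε in 𝓝[>] (0 : ℝ), ∀ b, (⟪(y - c) + ε • η, (F.nrm b : Euc n)⟫ : ℝ) < 0 := by
    refine eventually_all.2 fun b => ?_
    have h1 : Continuous fun ε : ℝ => (⟪(y - c) + ε • η, (F.nrm b : Euc n)⟫ : ℝ) := by fun_prop
    refine (h1.continuousAt.eventually_lt continuousAt_const ?_).filter_mono nhdsWithin_le_nhds
    rw [zero_smul, add_zero, (F.isCurvatureNormal hyM b).inner_sub_center hc]
    norm_num
  obtain ⟨ε, hε, hε0⟩ := (hev.and self_mem_nhdsWithin).exists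
  have h1 := key ((y - c) + ε • η)
    (Submodule.add_mem _ (hc y hyM) (Submodule.smul_mem _ _ (hle hη))) fun ν e h => by
      obtain ⟨b, rfl⟩ := h.exists_nrm_eq hM F
      exact hε b
  rw [inner_add_right, h0, zero_add, real_inner_smul_right] at h1
  exact (mul_eq_zero.1 h1).resolve_left (ne_of_gt hε0)

/-- At the points where a principal curvature of the parallel submanifold becomes infinite, the leaf
is orthogonal to the corresponding principal directions. -/
theorem IsCurvatureNormal.inner_eq_zero_of_mem_tangentSpaceAt_leafAt
    (hM : IsIsoparametricSubmanifold M) (hMc : IsCompact M) {c : Euc n} (hc : IsCenter M c)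
    {x q ν e : Euc n} (h : IsCurvatureNormal M x ν e) (hq : q - x ∈ normalSpaceAt M x)
    (hν : (⟪q - c, ν⟫ : ℝ) = 0) {X : Euc n}
    (hX : X ∈ tangentSpaceAt (leafAt (isoparametricFoliation M) q) q) : (⟪X, e⟫ : ℝ) = 0 := by
  have hν0 := h.ne_zero hc
  -- after a quarter of the circle the curvature normal is a multiple of `e`, while `q` is still in
  -- the affine normal space
  have h1 := h.isCurvCircleAt hM hMc.isClosed hν0 (Real.pi / 2)
  set y := curvCircle x ν e (Real.pi / 2) with hy
  have hyM : y ∈ M := h1.isCurvatureNormal.mem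
  have h2 := h1.sub_smul_mem (q - c) (by
    have := Submodule.add_mem _ hq (hc x h.mem)
    rwa [sub_add_sub_cancel] at this)
  rw [hν, zero_smul, sub_zero] at h2
  have h3 : q - y ∈ normalSpaceAt M y := by
    have := Submodule.sub_mem _ h2 (hc y hyM)
    rwa [sub_sub_sub_cancel_right] at this
  have h4 := _root_.inner_eq_zero_of_mem_tangentSpaceAt_leafAt hM hMc hc hyM h3 hX
    h1.isCurvatureNormal.normal
  simp only [curvCircleNormal, Real.cos_pi_div_two, Real.sin_pi_div_two, zero_smul, mul_one,
    zero_sub, inner_neg_right, real_inner_smul_right, neg_eq_zero] at h4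
  exact (mul_eq_zero.1 h4).resolve_left (norm_ne_zero_iff.2 hν0)

/-! ### Parallel transport along curves -/

theorem IsParallelAlong.comp {γ w : ℝ → Euc n} (h : IsParallelAlong M γ w) {β : ℝ → ℝ}
    (hβ : ContDiff ℝ ∞ β) : IsParallelAlong M (γ ∘ β) (w ∘ β) where
  contDiff_curve := h.contDiff_curve.comp hβ
  contDiff_field := h.contDiff_field.comp hβ
  mem t := h.mem _
  normal t := h.normal _
  parallel t := by
    have h1 := (h.contDiff_field.contDiffAt (x := β t)).differentiableAt (by simp)
    have h2 := (hβ.contDiffAt (x := t)).differentiableAt (by simp)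
    rw [(h1.hasDerivAt.scomp t h2.hasDerivAt).deriv]
    exact Submodule.smul_mem _ _ (h.parallel _)

theorem FlatChart.isParallelAlong (hM : IsIsoparametricSubmanifold M) {x : Euc n}
    (C : FlatChart M x) (ξ : normalSpaceAt M x) {φ : ℝ → tangentSpaceAt M x} (hφ : ContDiff ℝ ∞ φ)
    (hρ : ∀ t, φ t ∈ ball 0 C.ρ) :
    IsParallelAlong M (fun t => C.g (φ t)) fun t => C.V ξ (C.g (φ t)) where
  contDiff_curve := contDiff_iff_contDiffAt.2 fun t =>
    (C.contDiffAt_g (hρ t)).comp t hφ.contDiffAt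
  contDiff_field := contDiff_iff_contDiffAt.2 fun t =>
    ContDiffAt.comp (g := fun t => C.V ξ (C.g t)) t (C.contDiffAt_V_g ξ (hρ t)) hφ.contDiffAt
  mem t := (C.g_mem (hρ t)).1
  normal t := C.V_mem (C.g_mem (hρ t)) ξ
  parallel t := by
    have h1 := (C.contDiffAt_V_g ξ (hρ t)).differentiableAt (by simp)
    have h2 := (hφ.contDiffAt (x := t)).differentiableAt (by simp)
    have h3 := (h1.hasFDerivAt.comp_hasDerivAt t h2.hasDerivAt).deriv
    have h4 := (C.isParallelMap hM ξ).parallel _ (hρ t) (deriv φ t)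
    rw [← h3] at h4
    exact h4

/-- Parallel transport from `x` to `y`, along curves which are constant near their ends. -/
def CanTransport {n : ℕ} (M : Set (Euc n)) (x y : Euc n) : Prop :=
  ∀ ξ ∈ normalSpaceAt M x, ∃ γ w : ℝ → Euc n, IsParallelAlong M γ w ∧
    (∀ t ≤ 0, γ t = x ∧ w t = ξ) ∧ ∀ t ≥ 1, γ t = y ∧ w t = w 1

theorem CanTransport.trans {x y z : Euc n} (h : CanTransport M x y) (h' : CanTransport M y z) :
    CanTransport M x z := by
  intro ξ hξ
  obtain ⟨γ, w, hp, h0, h1⟩ := h ξ hξ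
  have hy : w 1 ∈ normalSpaceAt M y := (h1 1 le_rfl).1 ▸ hp.normal 1
  obtain ⟨γ', w', hp', h0', h1'⟩ := h' (w 1) hy
  -- as the curves are constant near their ends, the concatenation is a sum of smooth curves
  have hq : IsParallelAlong M (fun t => γ t + γ' (t - 2) - y) fun t => w t + w' (t - 2) - w 1 := by
    have hs : ContDiff ℝ ∞ fun t : ℝ => t - 2 := by fun_prop
    have hps := hp'.comp hs
    have hd : ∀ t, deriv (fun t => w t + w' (t - 2) - w 1) t = deriv w t + deriv w' (t - 2) := by
      intro t
      have h2 := ((hp.contDiff_field.contDiffAt (x := t)).differentiableAt (by simp)).hasDerivAt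
      have h3 := ((hp'.contDiff_field.contDiffAt (x := t - 2)).differentiableAt
        (by simp)).hasDerivAt.comp_sub_const t 2
      exact ((h2.add h3).sub_const _).deriv
    have hcase : ∀ t, (γ t + γ' (t - 2) - y = γ t ∧ w t + w' (t - 2) - w 1 = w t ∧
        deriv w' (t - 2) = 0) ∨ (γ t + γ' (t - 2) - y = γ' (t - 2) ∧
          w t + w' (t - 2) - w 1 = w' (t - 2) ∧ deriv w t = 0) := by
      intro t
      rcases lt_or_ge t 2 with ht | ht
      · left
        have h2 := h0' (t - 2) (by linarith)
        refine ⟨by rw [h2.1]; abel, by rw [h2.2]; abel, ?_⟩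
        have h3 : w' =ᶠ[𝓝 (t - 2)] fun _ => w 1 := by
          filter_upwards [Iio_mem_nhds (show t - 2 < 0 by linarith)] with s hs
          exact (h0' s (le_of_lt hs)).2
        rw [h3.deriv_eq, deriv_const]
      · right
        have h2 := h1 t (by linarith)
        refine ⟨by rw [h2.1]; abel, by rw [h2.2]; abel, ?_⟩
        have h3 : w =ᶠ[𝓝 t] fun _ => w 1 := by
          filter_upwards [Ioi_mem_nhds (show 1 < t by linarith)] with s hs
          exact (h1 s (le_of_lt hs)).2
        rw [h3.deriv_eq, deriv_const]
    refine ⟨(hp.contDiff_curve.add hps.contDiff_curve).sub contDiff_const,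
      (hp.contDiff_field.add hps.contDiff_field).sub contDiff_const, fun t => ?_, fun t => ?_,
      fun t => ?_⟩
    · rcases hcase t with ⟨h2, -, -⟩ | ⟨h2, -, -⟩
      · rw [h2]; exact hp.mem t
      · rw [h2]; exact hp'.mem _
    · rcases hcase t with ⟨h2, h3, -⟩ | ⟨h2, h3, -⟩
      · rw [h2, h3]; exact hp.normal t
      · rw [h2, h3]; exact hp'.normal _
    · rw [hd]
      rcases hcase t with ⟨h2, -, h3⟩ | ⟨h2, -, h3⟩
      · rw [h2, h3, add_zero]; exact hp.parallel t
      · rw [h2, h3, zero_add]; exact hp'.parallel _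
  refine ⟨_, _, hq.comp (β := fun t => 3 * t) (by fun_prop), fun t ht => ?_, fun t ht => ?_⟩
  · have h2 := h0 (3 * t) (by linarith)
    have h3 := h0' (3 * t - 2) (by linarith)
    simp [h2.1, h2.2, h3.1, h3.2]
  · have h2 := h1 (3 * t) (by linarith)
    have h3 := h1' (3 * t - 2) (by linarith)
    have h4 := h1 (3 * 1) (by norm_num)
    have h5 := h1' (3 * 1 - 2) (by norm_num)
    simp only [Function.comp_apply, h2.1, h2.2, h3.1, h3.2, h4.2, h5.2]
    exact ⟨by abel, trivial⟩

/-- `Real.smoothTransition` reparametrizes a segment in the chart so that the curve is constant near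
its ends. -/
theorem FlatChart.canTransport (hM : IsIsoparametricSubmanifold M) {x : Euc n} (C : FlatChart M x)
    {y z : Euc n} (hy : y ∈ M ∩ C.U) (hz : z ∈ M ∩ C.U) : CanTransport M y z := by
  intro η hη
  obtain ⟨ξ, rfl⟩ := C.exists_V_eq hM hy hη
  obtain ⟨s, hs, rfl⟩ : ∃ s ∈ ball 0 C.ρ, C.g s = y := ⟨_, C.g_proj hy⟩
  obtain ⟨t, ht, rfl⟩ : ∃ t ∈ ball 0 C.ρ, C.g t = z := ⟨_, C.g_proj hz⟩
  have hφ : ContDiff ℝ ∞ fun a : ℝ => s + Real.smoothTransition a • (t - s) :=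
    contDiff_const.add (Real.smoothTransition.contDiff.smul contDiff_const)
  refine ⟨_, _, C.isParallelAlong hM ξ hφ fun a => ?_, fun a ha => ?_, fun a ha => ?_⟩
  · exact (convex_ball _ _).add_smul_sub_mem hs ht
      ⟨Real.smoothTransition.nonneg a, Real.smoothTransition.le_one a⟩
  · simp [Real.smoothTransition.zero_of_nonpos ha]
  · simp [Real.smoothTransition.one_of_one_le ha]

/-- Normal parallel transport exists between any two points. -/
theorem IsIsoparametricSubmanifold.canTransport (hM : IsIsoparametricSubmanifold M) {x y : Euc n}
    (hx : x ∈ M) (hy : y ∈ M) : CanTransport M x y := by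
  refine hM.connected.isPreconnected.induction₂' (CanTransport M) (fun a ha => ?_)
    (fun a b c _ _ _ hab hbc => hab.trans hbc) hx hy
  obtain ⟨C⟩ := hM.exists_flatChart ha
  filter_upwards [self_mem_nhdsWithin,
    mem_nhdsWithin_of_mem_nhds (C.isOpen_U.mem_nhds C.base_mem.2)] with b hb hbU
  exact ⟨C.canTransport hM C.base_mem ⟨hb, hbU⟩, C.canTransport hM ⟨hb, hbU⟩ C.base_mem⟩

/-! ### Leaves and sections -/

theorem mem_parallelLeaf_of_isParallelAlong {γ w : ℝ → Euc n} (h : IsParallelAlong M γ w) (t : ℝ) :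
    γ t + w t ∈ parallelLeaf M (γ 0) (w 0) :=
  ⟨_, _, h.comp (β := fun s => t * s) (by fun_prop), by simp, by simp, by simp⟩

theorem isParallelAlong_const {x ξ : Euc n} (hx : x ∈ M) (hξ : ξ ∈ normalSpaceAt M x) :
    IsParallelAlong M (fun _ => x) fun _ => ξ :=
  ⟨contDiff_const, contDiff_const, fun _ => hx, fun _ => hξ, fun _ => by simp⟩

theorem parallelLeaf_subset_leafAt {x ξ : Euc n} (hx : x ∈ M) (hξ : ξ ∈ normalSpaceAt M x) :
    parallelLeaf M x ξ ⊆ leafAt (isoparametricFoliation M) (x + ξ) :=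
  subset_sUnion_of_mem ⟨⟨x, hx, ξ, hξ, rfl⟩,
    mem_parallelLeaf_of_isParallelAlong (isParallelAlong_const hx hξ) 0⟩

/-- A principal direction is tangent to the leaf if the corresponding principal curvature of the
parallel submanifold is finite. -/
theorem IsCurvatureNormal.mem_tangentSpaceAt_leafAt (hM : IsIsoparametricSubmanifold M)
    {x ν e ξ : Euc n} (h : IsCurvatureNormal M x ν e) (hξ : ξ ∈ normalSpaceAt M x)
    (hne : (⟪ξ, ν⟫ : ℝ) ≠ 1) :
    e ∈ tangentSpaceAt (leafAt (isoparametricFoliation M) (x + ξ)) (x + ξ) := by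
  obtain ⟨C⟩ := hM.exists_flatChart h.mem
  obtain ⟨ξ, rfl⟩ : ∃ ξ' : normalSpaceAt M x, (ξ' : Euc n) = ξ := ⟨⟨ξ, hξ⟩, rfl⟩
  set E : tangentSpaceAt M x := ⟨e, h.tangent⟩ with hE
  -- the curve over `δ * sin t • E` stays in the chart for all times
  set δ : ℝ := C.ρ / 2 with hδ
  have hδ0 : 0 < δ := half_pos C.ρ_pos
  have hEn : ‖E‖ = 1 := h.unit
  have hφ : ContDiff ℝ ∞ fun t : ℝ => (δ * Real.sin t) • E :=
    (contDiff_const.mul Real.contDiff_sin).smul contDiff_const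
  have hρ : ∀ t, (δ * Real.sin t) • E ∈ ball (0 : tangentSpaceAt M x) C.ρ := fun t => by
    rw [mem_ball_zero_iff, norm_smul, hEn, mul_one, Real.norm_eq_abs, abs_mul, abs_of_pos hδ0]
    have := mul_le_mul_of_nonneg_left (Real.abs_sin_le_one t) hδ0.le
    linarith [C.ρ_pos]
  have hpar := C.isParallelAlong hM ξ hφ hρ
  have h0 : (δ * Real.sin 0) • E = 0 := by simp
  have hdφ : HasDerivAt (fun t : ℝ => (δ * Real.sin t) • E) (δ • E) 0 := by
    simpa using ((Real.hasDerivAt_sin 0).const_mul δ).smul_const E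
  have hd1 : HasDerivAt (fun t : ℝ => C.g ((δ * Real.sin t) • E)) (δ • e) 0 := by
    have h1 := (C.differentiableAt_g C.zero_mem).hasFDerivAt
    rw [← h0] at h1
    have h2 := h1.comp_hasDerivAt (0 : ℝ) hdφ
    rw [h0, C.fderiv_g_zero] at h2
    exact h2
  have hd2 : HasDerivAt (fun t : ℝ => C.V ξ (C.g ((δ * Real.sin t) • E)))
      (δ • (-(⟪(ξ : Euc n), ν⟫ : ℝ) • e)) 0 := by
    have h1 := ((C.contDiffAt_V_g ξ C.zero_mem).differentiableAt (by simp)).hasFDerivAt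
    rw [← h0] at h1
    have h2 := h1.comp_hasDerivAt (0 : ℝ) hdφ
    rw [h0, C.fderiv_V_g hM ξ C.zero_mem, C.g_zero, C.fderiv_g_zero, Submodule.coe_smul,
      map_smul] at h2
    have h3 := h.eigen _ _ (C.parallel_V ξ) C.base_mem.2
    rw [C.V_base] at h3
    rw [← h3]
    exact h2
  have hd := hd1.add hd2
  have hmem : δ • e + δ • (-(⟪(ξ : Euc n), ν⟫ : ℝ) • e) ∈
      tangentSpaceAt (leafAt (isoparametricFoliation M) (x + ξ)) (x + ξ) := by
    refine Submodule.subset_span ⟨_, hpar.contDiff_curve.add hpar.contDiff_field, fun t => ?_, ?_,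
      hd.deriv⟩
    · refine parallelLeaf_subset_leafAt h.mem hξ ?_
      have h1 := mem_parallelLeaf_of_isParallelAlong hpar t
      simp only [h0, C.g_zero, C.V_base] at h1
      exact h1
    · simp only [h0, C.g_zero, C.V_base]
  have h1 : e = (δ * (1 - ⟪(ξ : Euc n), ν⟫))⁻¹ • (δ • e + δ • (-(⟪(ξ : Euc n), ν⟫ : ℝ) • e)) := by
    have h2 : δ * (1 - ⟪(ξ : Euc n), ν⟫) ≠ 0 := mul_ne_zero hδ0.ne' (sub_ne_zero.2 hne.symm)
    have h3 : δ • e + δ • (-(⟪(ξ : Euc n), ν⟫ : ℝ) • e) = (δ * (1 - ⟪(ξ : Euc n), ν⟫)) • e := by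
      module
    rw [h3, smul_smul, inv_mul_cancel₀ h2, one_smul]
  rw [h1]
  exact Submodule.smul_mem _ _ hmem

theorem IsCenter.leavesInSpheresAround (hM : IsIsoparametricSubmanifold M) {c : Euc n}
    (hc : IsCenter M c) : LeavesInSpheresAround (isoparametricFoliation M) c := by
  rintro L ⟨x, hx, ξ, hξ, rfl⟩
  refine ⟨‖x + ξ - c‖, ?_⟩
  rintro _ ⟨γ, w, h, h0, hw, rfl⟩
  have h1 := h.isParallelMap_sub_center hM hc
  have h2 := h1.inner_eq h1 isPreconnected_univ (mem_univ 0) (mem_univ 1)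
  rw [real_inner_self_eq_norm_sq, real_inner_self_eq_norm_sq, h0, hw,
    sq_eq_sq₀ (norm_nonneg _) (norm_nonneg _)] at h2
  rw [mem_sphere_iff_norm, h2]

/-- `M` itself is the leaf of the zero normal field. -/
theorem LeavesInSpheresAround.isCenter {c : Euc n}
    (h : LeavesInSpheresAround (isoparametricFoliation M) c) : IsCenter M c := by
  intro y hy
  refine (Submodule.mem_orthogonal _ _).2 fun X hX => ?_
  induction hX using Submodule.span_induction with
  | mem X h' =>
    obtain ⟨γ, hγ, hmem, h0, rfl⟩ := h'
    have hpar : IsParallelAlong M γ fun _ => 0 :=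
      ⟨hγ, contDiff_const, hmem, fun _ => Submodule.zero_mem _, fun _ => by simp⟩
    obtain ⟨r, hr⟩ := h (parallelLeaf M (γ 0) 0) ⟨γ 0, hmem 0, 0, Submodule.zero_mem _, rfl⟩
    have h1 : ∀ t, ‖γ t - c‖ ^ 2 = r ^ 2 := fun t => by
      have h2 := hr (mem_parallelLeaf_of_isParallelAlong hpar t)
      rw [add_zero, mem_sphere_iff_norm] at h2
      rw [h2]
    have h2 := (((hγ.contDiffAt (x := (0 : ℝ))).differentiableAt (by simp)).hasDerivAt.sub_const
      c).norm_sq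
    simp only [h1] at h2
    have h3 := h2.unique (hasDerivAt_const (0 : ℝ) (r ^ 2))
    rw [h0, real_inner_comm] at h3
    linarith
  | zero => simp
  | add a b _ _ h h' => rw [inner_add_left, h, h', add_zero]
  | smul s a _ h => rw [real_inner_smul_left, h, mul_zero]

/-- Every point lies in a normal space, that of a closest point. -/
theorem exists_sub_mem_normalSpaceAt (hMc : IsCompact M) (hne : M.Nonempty) (q : Euc n) :
    ∃ x ∈ M, q - x ∈ normalSpaceAt M x := by
  obtain ⟨x, hx, hmin⟩ := hMc.exists_isMinOn hne
    (f := fun y => ‖y - q‖ ^ 2) (by fun_prop)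
  refine ⟨x, hx, (Submodule.mem_orthogonal _ _).2 fun X hX => ?_⟩
  induction hX using Submodule.span_induction with
  | mem X h' =>
    obtain ⟨γ, hγ, hmem, rfl, rfl⟩ := h'
    have h2 := (((hγ.contDiffAt (x := (0 : ℝ))).differentiableAt (by simp)).hasDerivAt.sub_const
      q).norm_sq
    have h3 := IsLocalMin.hasDerivAt_eq_zero (Eventually.of_forall fun t => hmin (hmem t)) h2
    rw [← neg_sub, inner_neg_right, real_inner_comm]
    linarith
  | zero => simp
  | add a b _ _ h h' => rw [inner_add_left, h, h', add_zero]
  | smul s a _ h => rw [real_inner_smul_left, h, mul_zero]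

theorem tangentSpaceAt_mono {A B : Set (Euc n)} (h : A ⊆ B) (p : Euc n) :
    tangentSpaceAt A p ≤ tangentSpaceAt B p :=
  Submodule.span_mono fun _ ⟨c, h1, h2, h3⟩ => ⟨c, h1, fun t => h (h2 t), h3⟩

/-- The leaf through a point of `x + ν_x` is orthogonal to `ν_x` there. -/
theorem tangentSpaceAt_leafAt_le (hM : IsIsoparametricSubmanifold M) (hMc : IsCompact M)
    {x q : Euc n} (hx : x ∈ M) (hq : q - x ∈ normalSpaceAt M x) :
    tangentSpaceAt (leafAt (isoparametricFoliation M) q) q ≤ tangentSpaceAt M x := by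
  obtain ⟨c, hc⟩ := exists_isCenter hM hMc
  intro X hX
  rw [← Submodule.orthogonal_orthogonal (tangentSpaceAt M x)]
  refine (Submodule.mem_orthogonal _ _).2 fun η hη => ?_
  rw [real_inner_comm]
  exact inner_eq_zero_of_mem_tangentSpaceAt_leafAt hM hMc hc hx hq hX hη

/-- Away from the focal hyperplanes, all principal directions are tangent to the leaf. -/
theorem le_tangentSpaceAt_leafAt (hM : IsIsoparametricSubmanifold M)
    {x q : Euc n} (hx : x ∈ M) (hq : q - x ∈ normalSpaceAt M x)
    (h : ∀ ν e, IsCurvatureNormal M x ν e → (⟪q - x, ν⟫ : ℝ) ≠ 1) :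
    tangentSpaceAt M x ≤ tangentSpaceAt (leafAt (isoparametricFoliation M) q) q := by
  obtain ⟨F⟩ := hM.exists_principalFrame hx
  intro X hX
  rw [F.eq_sum hX]
  refine Submodule.sum_mem _ fun b _ => Submodule.smul_mem _ _ ?_
  have hb := F.isCurvatureNormal hx b
  have h1 := hb.mem_tangentSpaceAt_leafAt hM hq (h _ _ hb)
  rwa [add_sub_cancel] at h1

theorem tangentSpaceAt_leafAt_of_mem (hM : IsIsoparametricSubmanifold M) (hMc : IsCompact M)
    {x : Euc n} (hx : x ∈ M) :
    tangentSpaceAt (leafAt (isoparametricFoliation M) x) x = tangentSpaceAt M x := by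
  have h0 : x - x ∈ normalSpaceAt M x := by rw [sub_self]; exact Submodule.zero_mem _
  refine le_antisymm (tangentSpaceAt_leafAt_le hM hMc hx h0) (le_tangentSpaceAt_leafAt hM hx h0 ?_)
  intro ν e _
  simp

theorem leafDim_le (hM : IsIsoparametricSubmanifold M) (hMc : IsCompact M) {x : Euc n}
    (hx : x ∈ M) (q : Euc n) :
    leafDim (isoparametricFoliation M) q ≤ Module.finrank ℝ (tangentSpaceAt M x) := by
  obtain ⟨d, hd⟩ := hM.submanifold
  obtain ⟨y, hy, hq⟩ := exists_sub_mem_normalSpaceAt hMc ⟨x, hx⟩ q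
  rw [hd.finrank_tangentSpaceAt hx, ← hd.finrank_tangentSpaceAt hy]
  exact Submodule.finrank_mono (tangentSpaceAt_leafAt_le hM hMc hy hq)

theorem tangentSpaceAt_leafAt_eq_of_isRegularPoint (hM : IsIsoparametricSubmanifold M)
    (hMc : IsCompact M) {x q : Euc n} (hx : x ∈ M) (hq : q - x ∈ normalSpaceAt M x)
    (hr : IsRegularPoint (isoparametricFoliation M) q) :
    tangentSpaceAt (leafAt (isoparametricFoliation M) q) q = tangentSpaceAt M x := by
  refine Submodule.eq_of_le_of_finrank_le (tangentSpaceAt_leafAt_le hM hMc hx hq) ?_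
  have h1 := hr x
  rw [leafDim, tangentSpaceAt_leafAt_of_mem hM hMc hx] at h1
  exact h1

/-- In the normal space of `x`, the singular points are those on the focal hyperplanes. -/
theorem isRegularPoint_iff (hM : IsIsoparametricSubmanifold M) (hMc : IsCompact M) {c : Euc n}
    (hc : IsCenter M c) {x q : Euc n} (hx : x ∈ M) (hq : q - x ∈ normalSpaceAt M x) :
    IsRegularPoint (isoparametricFoliation M) q ↔
      ∀ ν e, IsCurvatureNormal M x ν e → (⟪q - c, ν⟫ : ℝ) ≠ 0 := by
  constructor
  · intro hr ν e h h0
    have h1 : e ∈ tangentSpaceAt (leafAt (isoparametricFoliation M) q) q := by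
      rw [tangentSpaceAt_leafAt_eq_of_isRegularPoint hM hMc hx hq hr]
      exact h.tangent
    have h2 := h.inner_eq_zero_of_mem_tangentSpaceAt_leafAt hM hMc hc hq h0 h1
    have h3 := h.unit
    rw [inner_self_eq_zero.1 h2, norm_zero] at h3
    exact zero_ne_one h3
  · intro h q'
    refine (leafDim_le hM hMc hx q').trans (Submodule.finrank_mono ?_)
    refine le_tangentSpaceAt_leafAt hM hx hq fun ν e hν h1 => h ν e hν ?_
    rw [← sub_add_sub_cancel q x c, inner_add_left, h1, hν.inner_sub_center hc]
    norm_num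

theorem isRegularPoint_of_mem (hM : IsIsoparametricSubmanifold M) (hMc : IsCompact M) {x : Euc n}
    (hx : x ∈ M) : IsRegularPoint (isoparametricFoliation M) x := by
  intro q
  refine (leafDim_le hM hMc hx q).trans_eq ?_
  rw [leafDim, tangentSpaceAt_leafAt_of_mem hM hMc hx]

/-- The affine normal spaces of `M` are sections. -/
theorem isSection_mk' (hM : IsIsoparametricSubmanifold M) (hMc : IsCompact M) {x : Euc n}
    (hx : x ∈ M) :
    IsSection (isoparametricFoliation M) (AffineSubspace.mk' x (normalSpaceAt M x)) where
  normal := by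
    refine ⟨x, AffineSubspace.self_mem_mk' _ _, isRegularPoint_of_mem hM hMc hx, ?_⟩
    rw [AffineSubspace.direction_mk', normalSpaceAt, normalSpaceAt,
      tangentSpaceAt_leafAt_of_mem hM hMc hx]
  meets := by
    rintro L ⟨y, hy, η, hη, rfl⟩
    obtain ⟨γ, w, h, h0, h1⟩ := hM.canTransport hy hx η hη
    refine ⟨γ 1 + w 1, ⟨γ, w, h, (h0 0 le_rfl).1, (h0 0 le_rfl).2, rfl⟩, ?_⟩
    rw [AffineSubspace.mem_mk', (h1 1 le_rfl).1, vsub_eq_sub, add_sub_cancel_left]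
    have h2 := h.normal 1
    rwa [(h1 1 le_rfl).1] at h2
  ortho := by
    intro L hL q hqL hq
    rw [AffineSubspace.mem_mk', vsub_eq_sub] at hq
    rw [AffineSubspace.direction_mk', Submodule.isOrtho_iff_inner_eq]
    intro η hη X hX
    have hL' : L ∈ {L | L ∈ isoparametricFoliation M ∧ q ∈ L} := ⟨hL, hqL⟩
    have h1 := tangentSpaceAt_leafAt_le hM hMc hx hq
      (tangentSpaceAt_mono (subset_sUnion_of_mem hL') q hX)
    exact inner_eq_zero_of_mem_normalSpaceAt hη h1

/-- All sections are affine normal spaces of `M`. -/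
theorem IsSection.exists_eq_mk' (hM : IsIsoparametricSubmanifold M) (hMc : IsCompact M)
    {P : AffineSubspace ℝ (Euc n)} (hP : IsSection (isoparametricFoliation M) P) :
    ∃ x ∈ M, P = AffineSubspace.mk' x (normalSpaceAt M x) := by
  obtain ⟨p, hp, hr, hdir⟩ := hP.normal
  obtain ⟨x, hx, hpx⟩ := exists_sub_mem_normalSpaceAt hMc hM.connected.nonempty p
  have hpmem : p ∈ AffineSubspace.mk' x (normalSpaceAt M x) := by
    rw [AffineSubspace.mem_mk', vsub_eq_sub]
    exact hpx
  refine ⟨x, hx, AffineSubspace.ext_of_direction_eq ?_ ⟨p, hp, hpmem⟩⟩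
  rw [hdir, AffineSubspace.direction_mk', normalSpaceAt, normalSpaceAt,
    tangentSpaceAt_leafAt_eq_of_isRegularPoint hM hMc hx hpx hr]

/-- The centers are the points on all focal hyperplanes of a normal space. -/
theorem isCenter_iff_forall_inner_eq_zero (hM : IsIsoparametricSubmanifold M) {c : Euc n}
    (hc : IsCenter M c) {x q : Euc n} (hx : x ∈ M) (hq : q - x ∈ normalSpaceAt M x) :
    IsCenter M q ↔ ∀ ν e, IsCurvatureNormal M x ν e → (⟪q - c, ν⟫ : ℝ) = 0 := by
  constructor
  · intro h ν e hν
    rw [← sub_sub_sub_cancel_left c q x, inner_sub_left, hν.inner_sub_center hc,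
      hν.inner_sub_center h, sub_self]
  · intro h
    obtain ⟨F⟩ := hM.exists_principalFrame hx
    have h1 := isCenter_of_inner_nrm_eq_one hM hx (ξ := q - x) hq F fun b => ?_
    · rwa [add_sub_cancel] at h1
    · have hb := F.isCurvatureNormal hx b
      rw [← sub_sub_sub_cancel_right q x c, inner_sub_left, h _ _ hb, hb.inner_sub_center hc]
      norm_num

/-- A zero-dimensional leaf has no principal direction in its tangent space, so it lies on all focal
hyperplanes. -/
theorem zeroStratum_eq (hM : IsIsoparametricSubmanifold M) (hMc : IsCompact M) :
    zeroStratum (isoparametricFoliation M) = {q | IsCenter M q} := by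
  ext q
  obtain ⟨x, hx, hq⟩ := exists_sub_mem_normalSpaceAt hMc hM.connected.nonempty q
  obtain ⟨c, hc⟩ := exists_isCenter hM hMc
  constructor
  · intro h
    have h1 : tangentSpaceAt (leafAt (isoparametricFoliation M) q) q = ⊥ :=
      Submodule.finrank_eq_zero.1 h
    refine (isCenter_iff_forall_inner_eq_zero hM hc hx hq).2 fun ν e hν => ?_
    by_contra hne
    have h2 := hν.mem_tangentSpaceAt_leafAt hM hq (fun h3 => hne (by
      rw [← sub_add_sub_cancel q x c, inner_add_left, h3, hν.inner_sub_center hc]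
      norm_num))
    rw [add_sub_cancel, h1, Submodule.mem_bot] at h2
    have h3 := hν.unit
    rw [h2, norm_zero] at h3
    exact zero_ne_one h3
  · intro h
    obtain ⟨F⟩ := hM.exists_principalFrame hx
    refine Submodule.finrank_eq_zero.2 ((Submodule.eq_bot_iff _).2 fun X hX => ?_)
    rw [F.eq_sum (tangentSpaceAt_leafAt_le hM hMc hx hq hX)]
    refine Finset.sum_eq_zero fun b _ => ?_
    have h1 := (F.isCurvatureNormal hx b).inner_eq_zero_of_mem_tangentSpaceAt_leafAt hM hMc
      (c := q) h hq (by rw [sub_self, inner_zero_left]) hX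
    rw [real_inner_comm, h1, zero_smul]

/-- The centers are the points which lie in all affine normal spaces, and these are the sections.
They all contain `c`. -/
theorem sectionIntersection_eq (hM : IsIsoparametricSubmanifold M) (hMc : IsCompact M) {c : Euc n}
    (hc : IsCenter M c) :
    sectionIntersection (isoparametricFoliation M) c = {q | IsCenter M q} := by
  have hmem : ∀ {q x : Euc n}, q ∈ AffineSubspace.mk' x (normalSpaceAt M x) ↔
      x - q ∈ normalSpaceAt M x := fun {q x} => by
    rw [AffineSubspace.mem_mk', vsub_eq_sub, ← neg_sub, Submodule.neg_mem_iff]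
  ext q
  constructor
  · intro h x hx
    exact hmem.1 (h _ (isSection_mk' hM hMc hx) (hmem.2 (hc x hx)))
  · intro h P hP _
    obtain ⟨x, hx, rfl⟩ := hP.exists_eq_mk' hM hMc
    exact hmem.2 (h x hx)

/-! ### The generalized Weyl group -/

section WeylGroup

variable {P : AffineSubspace ℝ (Euc n)}

/-- The linear functional `⟪·, ν⟫` on the direction of `P`. -/
noncomputable def innerOn (P : AffineSubspace ℝ (Euc n)) (ν : Euc n) : Module.Dual ℝ P.direction :=
  (innerSL ℝ ν).toLinearMap ∘ₗ P.direction.subtype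

theorem innerOn_apply (ν : Euc n) (u : P.direction) :
    innerOn P ν u = (⟪(u : Euc n), ν⟫ : ℝ) := by
  change (⟪ν, (u : Euc n)⟫ : ℝ) = _
  exact real_inner_comm _ _

theorem innerOn_ne_zero {ν : Euc n} (hν : ν ∈ P.direction) (hν0 : ν ≠ 0) : innerOn P ν ≠ 0 := by
  intro h
  have h1 := innerOn_apply (P := P) ν ⟨ν, hν⟩
  rw [h, LinearMap.zero_apply] at h1
  exact hν0 (inner_self_eq_zero.1 h1.symm)

end WeylGroup

/-- A singular hyperplane is one of the focal hyperplanes. -/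
theorem IsSingularHyperplane.exists_direction_eq (hM : IsIsoparametricSubmanifold M)
    (hMc : IsCompact M) {c : Euc n} (hc : IsCenter M c) {x : Euc n} (hx : x ∈ M)
    {P : AffineSubspace ℝ (Euc n)} [Nonempty P] (hP : P = AffineSubspace.mk' x (normalSpaceAt M x))
    {H : AffineSubspace ℝ P} (hH : IsSingularHyperplane (isoparametricFoliation M) P H) {q : P}
    (hq : q ∈ H) : ∃ ν e, IsCurvatureNormal M x ν e ∧ (⟪(q : Euc n) - c, ν⟫ : ℝ) = 0 ∧
      H.direction = LinearMap.ker (innerOn P ν) := by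
  obtain ⟨F⟩ := hM.exists_principalFrame hx
  have hF := fun b => F.isCurvatureNormal hx b
  have hdir : P.direction = normalSpaceAt M x := by rw [hP, AffineSubspace.direction_mk']
  have hmemP' : ∀ {q : Euc n}, q ∈ P ↔ q - x ∈ normalSpaceAt M x := fun {q} => by
    rw [hP, AffineSubspace.mem_mk', vsub_eq_sub]
  have hmemP : ∀ p : P, (p : Euc n) - x ∈ normalSpaceAt M x := fun p => hmemP'.1 p.2
  let f : Fin (Module.finrank ℝ (tangentSpaceAt M x)) → H.direction →ᵃ[ℝ] ℝ := fun b =>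
    (innerOn P (F.nrm b) ∘ₗ H.direction.subtype).toAffineMap +
      AffineMap.const ℝ H.direction (⟪(q : Euc n) - c, (F.nrm b : Euc n)⟫ : ℝ)
  have hf : ∀ b (u : H.direction), f b u =
      (⟪((u : P.direction) : Euc n) + ((q : Euc n) - c), (F.nrm b : Euc n)⟫ : ℝ) := fun b u => by
    rw [inner_add_left]
    change innerOn P (F.nrm b) (u : P.direction) + _ = _
    rw [innerOn_apply]
    rfl
  -- otherwise some point of `H` avoids all focal hyperplanes and is regular
  obtain ⟨b, hb⟩ : ∃ b, ∀ u, f b u = 0 := by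
    by_contra! hne
    obtain ⟨u, hu⟩ := exists_forall_affine_ne_zero Finset.univ f fun b _ => hne b
    have h1 : (u : P.direction) +ᵥ q ∈ H := AffineSubspace.vadd_mem_of_mem_direction u.2 hq
    refine hH.2 _ h1 ((isRegularPoint_iff hM hMc hc hx (hmemP _)).2 fun ν e hν => ?_)
    obtain ⟨b, rfl⟩ := hν.exists_nrm_eq hM F
    have h2 := hu b (Finset.mem_univ b)
    rw [hf, ← add_sub_assoc] at h2
    exact h2
  refine ⟨_, _, hF b, ?_, ?_⟩
  · have h1 := hb 0
    rw [hf] at h1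
    simpa using h1
  · have hle : H.direction ≤ LinearMap.ker (innerOn P (F.nrm b)) := by
      intro u hu
      have h1 := hb ⟨u, hu⟩
      have h0 := hb 0
      rw [hf] at h1 h0
      rw [LinearMap.mem_ker, innerOn_apply]
      simp only [Submodule.coe_zero, zero_add] at h0
      rw [inner_add_left, h0, add_zero] at h1
      exact h1
    have h2 := Module.Dual.finrank_ker_add_one_of_ne_zero
      (innerOn_ne_zero (P := P) (by rw [hdir]; exact (F.nrm b).2) ((hF b).ne_zero hc))
    refine Submodule.eq_of_le_of_finrank_eq hle ?_
    have h3 := hH.1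
    omega

/-- The group is generated by the reflections across the focal hyperplanes, so its fixed points are
the points on all of them. -/
theorem fixedSet_eq (hM : IsIsoparametricSubmanifold M) (hMc : IsCompact M) {c : Euc n}
    (hc : IsCenter M c) {x : Euc n} (hx : x ∈ M) {P : AffineSubspace ℝ (Euc n)} [Nonempty P]
    (hP : P = AffineSubspace.mk' x (normalSpaceAt M x)) :
    fixedSet P (generalizedWeylGroup (isoparametricFoliation M) P) = {q | IsCenter M q} := by
  have hdir : P.direction = normalSpaceAt M x := by rw [hP, AffineSubspace.direction_mk']
  have hmemP : ∀ {q : Euc n}, q ∈ P ↔ q - x ∈ normalSpaceAt M x := fun {q} => by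
    rw [hP, AffineSubspace.mem_mk', vsub_eq_sub]
  have hcenter : ∀ {q : Euc n}, IsCenter M q → q ∈ P := fun {q} h => hmemP.2 (by
    rw [← neg_sub]; exact Submodule.neg_mem _ (h x hx))
  ext q
  constructor
  · rintro ⟨hqP, hfix⟩
    refine (isCenter_iff_forall_inner_eq_zero hM hc hx (hmemP.1 hqP)).2 fun ν e hν => ?_
    -- the focal hyperplane of `ν`
    set H : AffineSubspace ℝ P :=
      AffineSubspace.mk' (⟨c, hcenter hc⟩ : P) (LinearMap.ker (innerOn P ν)) with hH
    have hHmem : ∀ {p : P}, p ∈ H → (⟪(p : Euc n) - c, ν⟫ : ℝ) = 0 := fun {p} hp => by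
      rw [hH, AffineSubspace.mem_mk', LinearMap.mem_ker, innerOn_apply] at hp
      exact hp
    have hne : Nonempty H := ⟨⟨_, AffineSubspace.self_mem_mk' _ _⟩⟩
    have hsing : IsSingularHyperplane (isoparametricFoliation M) P H := by
      refine ⟨?_, fun p hp hr => ?_⟩
      · rw [hH, AffineSubspace.direction_mk']
        exact Module.Dual.finrank_ker_add_one_of_ne_zero
          (innerOn_ne_zero (P := P) (by rw [hdir]; exact hν.normal) (hν.ne_zero hc))
      · exact (isRegularPoint_iff hM hMc hc hx (hmemP.1 p.2)).1 hr ν e hν (hHmem hp)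
    have h1 := hfix _ (Subgroup.subset_closure ⟨H, hne, hsing, rfl⟩)
    exact hHmem ((EuclideanGeometry.reflection_eq_self_iff _).1 h1)
  · intro hq
    refine ⟨hcenter hq, fun g hg => ?_⟩
    induction hg using Subgroup.closure_induction with
    | mem g h =>
      obtain ⟨H, hne, hsing, rfl⟩ := h
      obtain ⟨p, hp⟩ := id hne
      refine (EuclideanGeometry.reflection_eq_self_iff _).2 ?_
      obtain ⟨ν, e, hν, h0, hHdir⟩ := hsing.exists_direction_eq hM hMc hc hx hP hp
      have h1 : (⟨q, hcenter hq⟩ : P) -ᵥ p ∈ H.direction := by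
        rw [hHdir, LinearMap.mem_ker, innerOn_apply]
        change (⟪q - (p : Euc n), ν⟫ : ℝ) = 0
        rw [← sub_sub_sub_cancel_right q _ c, inner_sub_left, h0,
          (isCenter_iff_forall_inner_eq_zero hM hc hx (hmemP.1 (hcenter hq))).1 hq ν e hν, sub_zero]
      have h2 := AffineSubspace.vadd_mem_of_mem_direction h1 hp
      rwa [vsub_vadd] at h2
    | one => rfl
    | mul a b _ _ ha hb => rw [AffineIsometryEquiv.coe_mul, Function.comp_apply, hb, ha]
    | inv a _ ha =>
      conv_lhs => rw [← ha]
      exact a.symm_apply_apply _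

theorem mainTheorem7 {n : ℕ} (M : Set (Euc n)) (hM : IsIsoparametricSubmanifold M)
    (hcompact : IsCompact M) :
    (∃ c : Euc n, LeavesInSpheresAround (isoparametricFoliation M) c) ∧
    ∀ c : Euc n, LeavesInSpheresAround (isoparametricFoliation M) c →
      ∀ (P : AffineSubspace ℝ (Euc n)) [Nonempty P], IsSection (isoparametricFoliation M) P →
        fixedSet P (generalizedWeylGroup (isoparametricFoliation M) P) =
            sectionIntersection (isoparametricFoliation M) c ∧
          fixedSet P (generalizedWeylGroup (isoparametricFoliation M) P) =
            zeroStratum (isoparametricFoliation M) := by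
  obtain ⟨c₀, hc₀⟩ := exists_isCenter hM hcompact
  refine ⟨⟨c₀, hc₀.leavesInSpheresAround hM⟩, fun c hc P _ hP => ?_⟩
  obtain ⟨x, hx, hPx⟩ := hP.exists_eq_mk' hM hcompact
  rw [fixedSet_eq hM hcompact hc.isCenter hx hPx,
    sectionIntersection_eq hM hcompact hc.isCenter, zeroStratum_eq hM hcompact]
  exact ⟨rfl, rfl⟩
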